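/- Let $M$ be a compact smooth $m$-dimensional manifold with (smooth) boundary, $m\ge 1$, smoothly embedded in $\mathbb{R}^d$, with the induced Riemannian metric and volume measure $V$. For $h>0$ and $y\in M$ let $N_y=\{z\in M:\|z-y\|<h\}$ (distance in $\mathbb{R}^d$), and let $H^{(k)}_y$ be the orthogonal projection in $L^2(N_y,V)$ onto the polynomials of degree at most $k$ in normal coordinates at $y$ (near the boundary: in a smooth family of local coordinates $u_y(z)\in T_yM$, defined for $\|z-y\|<r$, such that $u_{\gamma(0)}(\gamma(1))=\gamma'(0)$ for every geodesic $\gamma:[0,1]\to M$ of length less than $r$). Let $$L_h f(x)=\frac{\alpha_h}{\mathrm{Vol}_h}\int_M (Q_yf)(x)\,dV(y),\qquad Q_y=I-H^{(1)}_y\ \text{(LTSA)},\qquad Q_y=H^{(2)}_y-H^{(1)}_y\ \text{(HLLE)},$$ where $Q_y f$ is taken on $N_y$ and extended by $0$, $\mathrm{Vol}_h$ is the volume of a ball of radius $h$ in $\mathbb{R}^m$, and the normalization $\alpha_h$ is of exact order $h^{-4}$, i.e. $\alpha_h=\Theta(h^{-4})$ as $h\to0^+$. (1) Let $x\in\partial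 M$, let $\eta_x$ be the inward unit normal at $x$, and let $f\in C^\infty(M)$. Then $|L^{LTSA}_hf(x)|\to\infty$ and $|L^{HLLE}_hf(x)|\to\infty$ as $h\to0^+$, unless $$\frac{\partial^2 f}{\partial\eta_x^2}(x)=\frac{1}{m+2}\,(\Delta f)(x),$$ where $\partial^2f/\partial\eta_x^2$ is the Riemannian Hessian of $f$ at $(\eta_x,\eta_x)$ and $\Delta$ is the Laplace--Beltrami operator (the trace of the Hessian). (2) Let $\varphi:M\to\mathbb{R}^m$ be a global isometric coordinate chart (smooth, injective, preserving the Riemannian metric), and let $f=c+\langle a,\varphi\rangle$ with $a\in\mathbb{R}^m$, $c\in\mathbb{R}$ be a linear function of these coordinates. Then $f$ satisfies the boundary condition of (1) at every point of $\partial M$, and it is an eigenfunction with eigenvalue $0$ of the limit of both methods: $L^{LTSA}_hf\to0$ and $L^{HLLE}_hf\to0$ uniformly on $M$ as $h\to0^+$. Moreover $L^{LTSA}_hf=L^{HLLE}_hf=0$ exactly whenever $0<h<r$ and any two points of $M$ at distance less than $h$ in $\mathbb{R}^d$ are joined by a geodesic of $M$ of length less than $r$. -/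

import Mathlib

open scoped Manifold ContDiff Topology
open MeasureTheory Set Filter Asymptotics

noncomputable section

namespace ManifoldLearning

variable {m d : ℕ} [NeZero m] {M : Type*} [TopologicalSpace M]
  [ChartedSpace (EuclideanHalfSpace m) M]

/-! ### Riemannian geometry of an embedded manifold with boundary

`ι : M → ℝᵈ` is the embedding, `M` carries the metric induced by it. Tangent vectors of `M` at `x`
are written in the coordinates of the preferred chart at `x`, as everywhere in Mathlib. -/

/-- The differential at `x` of a map from `M` to a normed space. -/
def diffAt {F : Type*} [NormedAddCommGroup F] [NormedSpace ℝ F] (g : M → F) (x : M) :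
    EuclideanSpace ℝ (Fin m) →L[ℝ] F :=
  mfderiv (𝓡∂ m) 𝓘(ℝ, F) g x

/-- The coordinate basis vector `eᵢ`. -/
def coordVec (i : Fin m) : EuclideanSpace ℝ (Fin m) := EuclideanSpace.single i (1 : ℝ)

/-- The second partial derivative `∂ᵢ∂ⱼ g` at `x`, in the preferred chart at `x`. -/
def chartSecond {F : Type*} [NormedAddCommGroup F] [NormedSpace ℝ F] (g : M → F) (x : M)
    (i j : Fin m) : F :=
  iteratedFDerivWithin ℝ 2 (g ∘ (extChartAt (𝓡∂ m) x).symm) (range (𝓡∂ m))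
    (extChartAt (𝓡∂ m) x x) ![coordVec i, coordVec j]

variable (m) in
/-- The tangent space of `M` at `x`, as a linear subspace of `ℝᵈ`. -/
def tangentSub (ι : M → EuclideanSpace ℝ (Fin d)) (x : M) :
    Submodule ℝ (EuclideanSpace ℝ (Fin d)) :=
  LinearMap.range (diffAt ι x : EuclideanSpace ℝ (Fin m) →L[ℝ] _).toLinearMap

/-- The matrix `gᵢⱼ` of the induced metric at `x`. -/
def metric (ι : M → EuclideanSpace ℝ (Fin d)) (x : M) : Matrix (Fin m) (Fin m) ℝ :=
  Matrix.of fun i j => inner ℝ (diffAt ι x (coordVec i)) (diffAt ι x (coordVec j))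

/-- The Christoffel symbols `Γᵏᵢⱼ = gᵏˡ ⟨∂ᵢ∂ⱼ ι, ∂ₗ ι⟩` of the induced metric at `x`. -/
def christoffel (ι : M → EuclideanSpace ℝ (Fin d)) (x : M) (k i j : Fin m) : ℝ :=
  ∑ l, (metric ι x)⁻¹ k l * inner ℝ (chartSecond ι x i j) (diffAt ι x (coordVec l))

/-- The components `∂ᵢ∂ⱼ f - Γᵏᵢⱼ ∂ₖ f` of the Riemannian Hessian of `f` at `x`. -/
def hess (ι : M → EuclideanSpace ℝ (Fin d)) (f : M → ℝ) (x : M) (i j : Fin m) : ℝ :=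
  chartSecond f x i j - ∑ k : Fin m, christoffel ι x k i j * diffAt f x (coordVec k)

/-- The second derivative `∂²f/∂v²` at `x`: the Hessian at `(v, v)`, that is, the second
derivative of `f` in direction `v` in normal coordinates at `x`. -/
def secondDeriv (ι : M → EuclideanSpace ℝ (Fin d)) (f : M → ℝ) (x : M)
    (v : EuclideanSpace ℝ (Fin m)) : ℝ :=
  ∑ i : Fin m, ∑ j : Fin m, v i * v j * hess ι f x i j

variable (m) in
/-- The Laplace-Beltrami operator `Δf = gⁱʲ (Hess f)ᵢⱼ`. -/
def laplaceBeltrami (ι : M → EuclideanSpace ℝ (Fin d)) (f : M → ℝ) (x : M) : ℝ :=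
  ∑ i : Fin m, ∑ j : Fin m, (metric ι x)⁻¹ i j * hess ι f x i j

/-- `η` is the inward unit normal at the boundary point `x`. In the preferred chart the vectors
tangent to the boundary are those with vanishing first coordinate, and the inward pointing ones
are those with positive first coordinate. -/
def IsInwardUnitNormal (ι : M → EuclideanSpace ℝ (Fin d)) (x : M)
    (η : EuclideanSpace ℝ (Fin m)) : Prop :=
  0 < η 0 ∧ ‖diffAt ι x η‖ = 1 ∧
    ∀ v : EuclideanSpace ℝ (Fin m), v 0 = 0 → inner ℝ (diffAt ι x v) (diffAt ι x η) = 0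

variable (m) in
/-- The volume measure of `M`: the `m`-dimensional Hausdorff measure of the image, normalized to be
Lebesgue measure on `ℝᵐ`. -/
def vol [MeasurableSpace M] (ι : M → EuclideanSpace ℝ (Fin d)) : Measure M :=
  (μHE[m] : Measure (EuclideanSpace ℝ (Fin d))).comap ι

/-- The initial velocity, in `ℝᵈ`, of a curve `γ : [0, 1] → M`. -/
def initialVelocity (ι : M → EuclideanSpace ℝ (Fin d)) (γ : ℝ → M) :
    EuclideanSpace ℝ (Fin d) :=
  derivWithin (ι ∘ γ) (Icc 0 1) 0

variable (m) in
/-- `γ : [0, 1] → M` is a (constant speed) geodesic of the induced metric: its acceleration in `ℝᵈ`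
is orthogonal to `M`. -/
def IsGeodesic (ι : M → EuclideanSpace ℝ (Fin d)) (γ : ℝ → M) : Prop :=
  ContDiffOn ℝ 2 (ι ∘ γ) (Icc 0 1) ∧
    ∀ t ∈ Icc (0 : ℝ) 1, ∀ v ∈ tangentSub m ι (γ t),
      inner ℝ (iteratedDerivWithin 2 (ι ∘ γ) (Icc 0 1) t) v = 0

variable (m) in
/-- `U y z ∈ T_y M` is the vector of normal coordinates at `y` of the point `z`, for points at
ambient distance less than `r`: it is tangent at `y`, it depends smoothly on `(y, z)`, and the
geodesics of `M` that start at `y` (and are shorter than `r`) are the rays through the origin,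
i.e. `U y (exp_y v) = v`. Orthonormal coordinates on `T_y M` play no role, as only polynomials in
`U y` are used. -/
structure IsNormalCoordinates (ι : M → EuclideanSpace ℝ (Fin d)) (r : ℝ)
    (U : M → M → EuclideanSpace ℝ (Fin d)) : Prop where
  pos : 0 < r
  smooth : ContMDiffOn ((𝓡∂ m).prod (𝓡∂ m)) 𝓘(ℝ, EuclideanSpace ℝ (Fin d)) ∞
    (fun p : M × M => U p.1 p.2) {p | dist (ι p.1) (ι p.2) < r}
  tangent : ∀ y z, dist (ι y) (ι z) < r → U y z ∈ tangentSub m ι y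
  geodesic : ∀ γ : ℝ → M, IsGeodesic m ι γ → ‖initialVelocity ι γ‖ < r →
    U (γ 0) (γ 1) = initialVelocity ι γ

/-- `φ` is a global isometric coordinate chart: a smooth injective map to `ℝᵐ` that preserves the
Riemannian metric. -/
def IsIsometricChart (ι : M → EuclideanSpace ℝ (Fin d)) (φ : M → EuclideanSpace ℝ (Fin m)) :
    Prop :=
  ContMDiff (𝓡∂ m) 𝓘(ℝ, EuclideanSpace ℝ (Fin m)) ∞ φ ∧ Function.Injective φ ∧
    ∀ x (v : EuclideanSpace ℝ (Fin m)), ‖diffAt φ x v‖ = ‖diffAt ι x v‖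

/-! ### The operators -/

/-- The neighborhood `N_y`: the points of `M` at ambient distance less than `h` from `y`. -/
def nhd (ι : M → EuclideanSpace ℝ (Fin d)) (h : ℝ) (y : M) : Set M :=
  {z | dist (ι z) (ι y) < h}

/-- The functions on `M` that are polynomials of degree at most `k` in the coordinates `U y`. -/
def localPoly (U : M → M → EuclideanSpace ℝ (Fin d)) (k : ℕ) (y : M) : Set (M → ℝ) :=
  {p | ∃ P : MvPolynomial (Fin d) ℝ, P.totalDegree ≤ k ∧
    ∀ z, p z = MvPolynomial.eval (fun i => U y z i) P}

variable (m) in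
/-- `p` is the orthogonal projection in `L²(N_y)` of `f` to the polynomials of degree at most `k`,
i.e. the local polynomial regression of `f` of order `k` in `N_y`. -/
def IsLocalFit [MeasurableSpace M] (ι : M → EuclideanSpace ℝ (Fin d))
    (U : M → M → EuclideanSpace ℝ (Fin d)) (k : ℕ) (h : ℝ) (y : M) (f p : M → ℝ) : Prop :=
  p ∈ localPoly U k y ∧
    ∀ q ∈ localPoly U k y, ∫ z in nhd ι h y, (f z - p z) * q z ∂(vol m ι) = 0

variable (m) in
/-- The hat operator `H⁽ᵏ⁾_y` of the local polynomial regression of order `k` in `N_y`. -/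
def hat [MeasurableSpace M] (ι : M → EuclideanSpace ℝ (Fin d))
    (U : M → M → EuclideanSpace ℝ (Fin d)) (k : ℕ) (h : ℝ) (y : M) (f : M → ℝ) : M → ℝ :=
  Classical.epsilon (IsLocalFit m ι U k h y f)

variable (m) in
/-- The local operator `Q_y = I - H⁽¹⁾_y` on `N_y` of LTSA, extended by zero. -/
def localLTSA [MeasurableSpace M] (ι : M → EuclideanSpace ℝ (Fin d))
    (U : M → M → EuclideanSpace ℝ (Fin d)) (h : ℝ) (y : M) (f : M → ℝ) : M → ℝ :=
  (nhd ι h y).indicator fun z => f z - hat m ι U 1 h y f z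

variable (m) in
/-- The local operator `Q_y = H⁽²⁾_y - H⁽¹⁾_y` on `N_y` of HLLE, extended by zero. -/
def localHLLE [MeasurableSpace M] (ι : M → EuclideanSpace ℝ (Fin d))
    (U : M → M → EuclideanSpace ℝ (Fin d)) (h : ℝ) (y : M) (f : M → ℝ) : M → ℝ :=
  (nhd ι h y).indicator fun z => hat m ι U 2 h y f z - hat m ι U 1 h y f z

/-- The volume of a ball of radius `h` in `ℝᵐ`. -/
def ballVol (m : ℕ) (h : ℝ) : ℝ :=
  (volume (Metric.ball (0 : EuclideanSpace ℝ (Fin m)) h)).toReal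

variable (m) in
/-- The continuous LTSA operator `L_h f = (α_h / Vol_h) ∫ Q_y f dV(y)`. -/
def opLTSA [MeasurableSpace M] (ι : M → EuclideanSpace ℝ (Fin d))
    (U : M → M → EuclideanSpace ℝ (Fin d)) (α : ℝ → ℝ) (h : ℝ) (f : M → ℝ) (x : M) : ℝ :=
  α h / ballVol m h * ∫ y, localLTSA m ι U h y f x ∂(vol m ι)

variable (m) in
/-- The continuous HLLE operator `L_h f = (α_h / Vol_h) ∫ Q_y f dV(y)`. -/
def opHLLE [MeasurableSpace M] (ι : M → EuclideanSpace ℝ (Fin d))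
    (U : M → M → EuclideanSpace ℝ (Fin d)) (α : ℝ → ℝ) (h : ℝ) (f : M → ℝ) (x : M) : ℝ :=
  α h / ballVol m h * ∫ y, localHLLE m ι U h y f x ∂(vol m ι)

end ManifoldLearning

end

open scoped Manifold ContDiff Topology
open MeasureTheory Set Filter Asymptotics

noncomputable section

/-! Boundary blow-up. Near `x` take coordinates orthonormal at `x` whose first axis is the inward
normal, and zoom in by the factor `h`. For `y = h z` the neighborhood `N_y`, centered at `y`,
becomes `cap m (z 0)`, the unit ball cut by the boundary hyperplane at height `-z 0`. The local fits
reproduce affine functions of the normal coordinates, so of `f` only the quadratic part `T`, half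
the Hessian at `x`, matters: `Q_y f(x)` is `h ^ 2` times the residual at `-z` of the affine fit of
`T` on the cap, up to `o(h ^ 2)`. A quadratic fit leaves only `o(h ^ 2)`, so LTSA and HLLE have the
same leading term. Integration over `y` gives `h ^ (m + 2)` times `capIntegral T`, up to lower
order, and `α_h / Vol_h` has order `h ^ (-4 - m)`. The operators therefore grow like `h ^ (-2)`
unless `capIntegral T = 0`.

The functional `capIntegral` is computed by symmetry (`capIntegral_bilinear`). Reflections kill the
mixed terms. A slice of the cap at height `s` is an `(m - 1)`-ball of squared radius `1 - s ^ 2`, on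
which `u_b ^ 2` has mean `(1 - s ^ 2) / (m + 1)`. Hence `u_b ^ 2 + u_0 ^ 2 / (m + 1)` has a constant
affine fit and contributes nothing. What remains is `((m + 2) T_00 - tr T) / (m + 1)` times the
value at `u_0 ^ 2`, which is positive because the residual of the affine fit of `u_0 ^ 2` is
positive at the bottom of the cap (`capFit_sq_lt`).

Isometric charts. The tangential part of the second derivative of a map is determined by the metric
it induces, so an isometric chart has vanishing Hessian and is affine along geodesics. Thus `f`
agrees with an affine function of the normal coordinates to every order, and the residuals are `O(h
^ 5)`, uniformly by compactness. If geodesics join all nearby points, the agreement is exact and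
both fits return `f`.

Two estimates make this uniform up to the boundary. The normal coordinates are prescribed only along
geodesics, which are available in all directions from interior points;
`exists_norm_le_pow_of_curves` turns vanishing jets there into Taylor bounds for all base points.
`exists_isFitSystem` bounds the Gram matrices of the scaled polynomials from below, so that the fits
are stable, and `tendsto_scaled_integral` is the change of variables and dominated convergence
behind the zoom. -/

namespace ManifoldLearning

/-! ### Taylor estimates from vanishing along curves -/

section Taylor

variable {X G : Type*} [NormedAddCommGroup X] [NormedSpace ℝ X]
  [NormedAddCommGroup G] [NormedSpace ℝ G]

lemma iteratedDerivWithin_comp_lineMap {f : X → G} {S : Set X} (hS : UniqueDiffOn ℝ S)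
    {n : ℕ} (hf : ContDiffOn ℝ n f S) {a v : X} (hseg : ∀ s ∈ Icc (0 : ℝ) 1, a + s • v ∈ S) :
    ∀ k ≤ n, ∀ s ∈ Icc (0 : ℝ) 1,
      iteratedDerivWithin k (fun s : ℝ => f (a + s • v)) (Icc 0 1) s
        = iteratedFDerivWithin ℝ k f S (a + s • v) (fun _ => v) := by
  intro k
  induction k with
  | zero => intro _ s _; simp
  | succ k ih =>
    intro hk s hs
    rw [iteratedDerivWithin_succ]
    have hcongr : EqOn (iteratedDerivWithin k (fun s : ℝ => f (a + s • v)) (Icc 0 1))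
        (fun s => iteratedFDerivWithin ℝ k f S (a + s • v) (fun _ => v)) (Icc 0 1) :=
      fun t ht => ih (by omega) t ht
    rw [derivWithin_congr hcongr (hcongr hs)]
    have hd : HasFDerivWithinAt (iteratedFDerivWithin ℝ k f S)
        (fderivWithin ℝ (iteratedFDerivWithin ℝ k f S) S (a + s • v)) S (a + s • v) :=
      ((hf.differentiableOn_iteratedFDerivWithin (by exact_mod_cast Nat.lt_of_succ_le hk) hS) _
        (hseg s hs)).hasFDerivWithinAt
    have hl : HasDerivWithinAt (fun s : ℝ => a + s • v) v (Icc 0 1) s := by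
      simpa using ((hasDerivAt_id s).smul_const v).const_add a |>.hasDerivWithinAt
    have h1 := hd.comp_hasDerivWithinAt s hl (fun t ht => hseg t ht)
    have h2 : HasDerivWithinAt
        (fun s : ℝ => iteratedFDerivWithin ℝ k f S (a + s • v) (fun _ => v))
        ((fderivWithin ℝ (iteratedFDerivWithin ℝ k f S) S (a + s • v) v) (fun _ => v))
        (Icc 0 1) s :=
      (ContinuousMultilinearMap.apply ℝ (fun _ : Fin k => X) G
        (fun _ => v)).hasFDerivAt.comp_hasDerivWithinAt s h1
    rw [h2.derivWithin (uniqueDiffOn_Icc zero_lt_one s hs), iteratedFDerivWithin_succ_apply_left]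
    rfl

/-- Restriction to the segment reduces this to one variable; the factor `1 / n!` of the remainder is
discarded. -/
lemma norm_sub_taylor_le_of_segment {f : X → G} {S : Set X} (hS : UniqueDiffOn ℝ S)
    {n : ℕ} (hf : ContDiffOn ℝ (n + 1 : ℕ) f S) {a v : X}
    (hseg : ∀ s ∈ Icc (0 : ℝ) 1, a + s • v ∈ S) {C : ℝ}
    (hC : ∀ s ∈ Icc (0 : ℝ) 1, ‖iteratedFDerivWithin ℝ (n + 1) f S (a + s • v)‖ ≤ C) :
    ‖f (a + v) - ∑ k ∈ Finset.range (n + 1),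
      ((k.factorial : ℝ)⁻¹) • iteratedFDerivWithin ℝ k f S a (fun _ => v)‖
      ≤ C * ‖v‖ ^ (n + 1) := by
  have hg : ContDiffOn ℝ (n + 1 : ℕ) (fun s : ℝ => f (a + s • v)) (Icc 0 1) := by
    refine hf.comp (ContDiff.contDiffOn (by fun_prop)) hseg
  have hder := iteratedDerivWithin_comp_lineMap hS hf hseg
  have hC0 : 0 ≤ C := (norm_nonneg _).trans (hC 0 (by simp))
  have := taylor_mean_remainder_bound (f := fun s : ℝ => f (a + s • v)) (a := 0) (b := 1)
    (C := C * ‖v‖ ^ (n + 1)) (x := 1) (n := n) zero_le_one (by exact_mod_cast hg) (by simp) (by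
      intro s hs
      rw [hder (n + 1) le_rfl s hs]
      refine (ContinuousMultilinearMap.le_opNorm _ _).trans ?_
      simp only [Finset.prod_const, Finset.card_univ, Fintype.card_fin]
      gcongr
      exact hC s hs)
  rw [taylor_within_apply] at this
  simp only [one_smul, sub_zero, one_pow, mul_one] at this
  refine le_trans (le_of_eq ?_) (this.trans ?_)
  · congr 2
    refine Finset.sum_congr rfl fun k hk => ?_
    rw [hder k (by simp at hk; omega) 0 (by simp)]
    simp
  · refine div_le_self (by positivity) ?_
    exact_mod_cast Nat.one_le_iff_ne_zero.mpr (Nat.factorial_ne_zero n)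

/-- The homogeneous terms are separated by their degree: after division by `s ^ k` the lower terms
vanish by induction, the higher ones tend to zero, and the `k`-th tends to its value at `v`. -/
lemma eq_zero_of_sum_isLittleO {n : ℕ}
    (p : ∀ k : ℕ, ContinuousMultilinearMap ℝ (fun _ : Fin k => X) G)
    (h : ∀ v : X, ∃ w : ℝ → X, Tendsto (fun s => s⁻¹ • w s) (𝓝[>] 0) (𝓝 v) ∧
      (fun s => ∑ k ∈ Finset.range (n + 1), p k (fun _ => w s)) =o[𝓝[>] 0] fun s : ℝ => s ^ n) :
    ∀ k ≤ n, ∀ v, p k (fun _ => v) = 0 := by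
  intro k
  induction k using Nat.strong_induction_on with
  | _ k ih =>
  intro hk v
  obtain ⟨w, hw, ho⟩ := h v
  have hpos : ∀ᶠ s : ℝ in 𝓝[>] 0, 0 < s := eventually_mem_nhdsWithin
  have hs0 : Tendsto (fun s : ℝ => s) (𝓝[>] 0) (𝓝 0) := nhdsWithin_le_nhds
  have hlim : Tendsto (fun s : ℝ => ∑ j ∈ Finset.range (n + 1 - k),
      s ^ j • p (k + j) (fun _ => s⁻¹ • w s)) (𝓝[>] 0)
      (𝓝 (∑ j ∈ Finset.range (n + 1 - k), (0 : ℝ) ^ j • p (k + j) (fun _ => v))) := by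
    refine tendsto_finsetSum _ fun j _ => (hs0.pow j).smul ?_
    exact ((p (k + j)).cont.tendsto _).comp (tendsto_pi_nhds.2 fun _ => hw)
  have hsum0 : (∑ j ∈ Finset.range (n + 1 - k), (0 : ℝ) ^ j • p (k + j) (fun _ => v))
      = p k (fun _ => v) := by
    rw [Finset.sum_eq_single_of_mem 0 (by simp; omega)]
    · simp
    · intro j _ hj; simp [hj]
  rw [hsum0] at hlim
  have hz : Tendsto (fun s : ℝ => (s ^ k)⁻¹ • ∑ k ∈ Finset.range (n + 1), p k (fun _ => w s))
      (𝓝[>] 0) (𝓝 0) := by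
    have h1 : (fun s => ∑ k ∈ Finset.range (n + 1), p k (fun _ => w s)) =o[𝓝[>] 0]
        fun s : ℝ => s ^ k := by
      refine ho.trans_isBigO ?_
      refine IsBigO.of_bound 1 ?_
      have : ∀ᶠ s : ℝ in 𝓝[>] 0, s < 1 :=
        hs0.eventually (gt_mem_nhds zero_lt_one)
      filter_upwards [hpos, this] with s h0 h1
      rw [one_mul, norm_pow, norm_pow]
      refine pow_le_pow_of_le_one (norm_nonneg _) ?_ hk
      rw [Real.norm_of_nonneg h0.le]; exact h1.le
    have h2 := (isBigO_refl (fun s : ℝ => (s ^ k)⁻¹) (𝓝[>] 0)).smul_isLittleO h1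
    refine (isLittleO_one_iff ℝ).1 (h2.congr' EventuallyEq.rfl ?_)
    filter_upwards [hpos] with s h0
    rw [smul_eq_mul, inv_mul_cancel₀ (by positivity)]
  refine tendsto_nhds_unique (hlim.congr' ?_) hz
  filter_upwards [hpos] with s h0
  rw [← Finset.sum_range_add_sum_Ico _ (show k ≤ n + 1 by omega),
    Finset.sum_eq_zero (s := Finset.range k), zero_add, Finset.sum_Ico_eq_sum_range,
    Finset.smul_sum]
  · refine Finset.sum_congr rfl fun j _ => ?_
    rw [(p (k + j)).map_smul_univ (fun _ => s⁻¹) (fun _ => w s), smul_smul]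
    congr 1
    simp [pow_add]
    field_simp
  · intro j hj
    simp at hj
    exact ih j hj (by omega) _

/-- If `R(y, ·)` vanishes to order `n` along curves that leave `y` in all directions, for all `y` in
the interior, then `R(y, z) = O(|z - y|ⁿ⁺¹)` uniformly. -/
lemma exists_norm_le_pow_of_curves {B : Set X} (hB : Convex ℝ B) (hBi : (interior B).Nonempty)
    (h0 : (0 : X) ∈ B) {n : ℕ} {R : X × X → G} (hR : ContDiffOn ℝ ∞ R (B ×ˢ B))
    (hc : ∀ y ∈ interior B, ∀ v : X, ∃ c : ℝ → X,
      Tendsto (fun s => s⁻¹ • (c s - y)) (𝓝[>] 0) (𝓝 v) ∧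
      (fun s => R (y, c s)) =o[𝓝[>] 0] fun s : ℝ => s ^ n) :
    ∃ C > 0, ∃ δ > 0, ∀ y ∈ B, ∀ z ∈ B, ‖y‖ < δ → ‖z‖ < δ →
      ‖R (y, z)‖ ≤ C * ‖z - y‖ ^ (n + 1) := by
  have hS : UniqueDiffOn ℝ (B ×ˢ B) := by
    have : UniqueDiffOn ℝ B := uniqueDiffOn_convex hB hBi
    exact this.prod this
  have hR' : ContDiffOn ℝ (n + 1 : ℕ) R (B ×ˢ B) := hR.of_le (by exact_mod_cast le_top)
  have hcont : ContinuousOn (iteratedFDerivWithin ℝ (n + 1) R (B ×ˢ B)) (B ×ˢ B) :=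
    hR'.continuousOn_iteratedFDerivWithin le_rfl hS
  set A := ‖iteratedFDerivWithin ℝ (n + 1) R (B ×ˢ B) (0, 0)‖ + 1 with hA
  obtain ⟨δ, hδ, hbd⟩ : ∃ δ > 0, ∀ p ∈ B ×ˢ B, ‖p‖ < δ →
      ‖iteratedFDerivWithin ℝ (n + 1) R (B ×ˢ B) p‖ < A := by
    have h1 : ∀ᶠ p in 𝓝[B ×ˢ B] ((0 : X), (0 : X)),
        ‖iteratedFDerivWithin ℝ (n + 1) R (B ×ˢ B) p‖ < A :=
      ((hcont (0, 0) ⟨h0, h0⟩).norm).eventually (gt_mem_nhds (by simp [hA]))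
    rw [eventually_nhdsWithin_iff, Metric.eventually_nhds_iff] at h1
    obtain ⟨δ, hδ, h⟩ := h1
    exact ⟨δ, hδ, fun p hp hpn => h (by rwa [show ((0 : X), (0 : X)) = 0 from rfl, dist_zero_right]) hp⟩
  -- Taylor expansion at the diagonal point `(y, y)` in the second variable only; the whole segment
  -- stays in the convex set `B ×ˢ B`.
  have hTaylor : ∀ y ∈ B, ∀ z ∈ B, ‖y‖ < δ → ‖z‖ < δ → ‖R (y, z) -
      ∑ k ∈ Finset.range (n + 1), ((k.factorial : ℝ)⁻¹) •
        iteratedFDerivWithin ℝ k R (B ×ˢ B) (y, y) (fun _ => ((0 : X), z - y))‖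
        ≤ A * ‖z - y‖ ^ (n + 1) := by
    intro y hy z hz hy' hz'
    have hmem : ∀ s ∈ Icc (0 : ℝ) 1, (y, y) + s • ((0 : X), z - y) ∈ B ×ˢ B ∧
        ‖(y, y) + s • ((0 : X), z - y)‖ < δ := by
      intro s hs
      have e : (y, y) + s • ((0 : X), z - y) = (y, y + s • (z - y)) := by simp
      rw [e]
      refine ⟨⟨hy, hB.add_smul_sub_mem hy hz hs⟩, ?_⟩
      rw [Prod.norm_def]
      refine max_lt hy' ?_
      have := (convex_ball (0 : X) δ).add_smul_sub_mem (x := y) (y := z) (by simpa) (by simpa) hs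
      simpa using this
    have := norm_sub_taylor_le_of_segment hS hR' (a := (y, y)) (v := ((0 : X), z - y))
      (fun s hs => (hmem s hs).1) (C := A) (fun s hs => (hbd _ (hmem s hs).1 (hmem s hs).2).le)
    simpa [Prod.norm_def] using this
  have hint : ∀ y ∈ interior B, ‖y‖ < δ → ∀ z ∈ B, ‖z‖ < δ →
      ‖R (y, z)‖ ≤ A * ‖z - y‖ ^ (n + 1) := by
    intro y hy hyδ z hz hzδ
    have hyB := interior_subset hy
    -- For interior `y` the Taylor polynomial of `R (y, ·)` at `y` is `o(s ^ n)` along the given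
    -- curves, which leave in all directions, so each of its terms is zero.
    have hvan := eq_zero_of_sum_isLittleO (n := n) (fun k => ((k.factorial : ℝ)⁻¹) •
      (iteratedFDerivWithin ℝ k R (B ×ˢ B) (y, y)).compContinuousLinearMap
        (fun _ => ContinuousLinearMap.inr ℝ X X)) (by
        intro v
        obtain ⟨c, hcv, hco⟩ := hc y hy v
        refine ⟨fun s => c s - y, hcv, ?_⟩
        have hcy : Tendsto (fun s => c s - y) (𝓝[>] 0) (𝓝 0) := by
          have hs0 : Tendsto (fun s : ℝ => s) (𝓝[>] 0) (𝓝 0) := nhdsWithin_le_nhds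
          have := hs0.smul hcv
          rw [zero_smul] at this
          refine this.congr' ?_
          filter_upwards [eventually_mem_nhdsWithin] with s hs
          rw [smul_smul, mul_inv_cancel₀ (ne_of_gt hs), one_smul]
        have hcy' : Tendsto c (𝓝[>] 0) (𝓝 y) := by simpa using hcy.add_const y
        have hbig : (fun s => c s - y) =O[𝓝[>] 0] fun s : ℝ => s := by
          have h1 : (fun s => s⁻¹ • (c s - y)) =O[𝓝[>] 0] fun _ : ℝ => (1 : ℝ) :=
            hcv.isBigO_one ℝ
          have h2 := (isBigO_refl (fun s : ℝ => s) (𝓝[>] 0)).smul h1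
          simp only [smul_eq_mul, mul_one] at h2
          refine h2.congr' ?_ EventuallyEq.rfl
          filter_upwards [eventually_mem_nhdsWithin] with s hs
          rw [smul_smul, mul_inv_cancel₀ (ne_of_gt hs), one_smul]
        have hrem : (fun s => R (y, c s) - ∑ k ∈ Finset.range (n + 1), ((k.factorial : ℝ)⁻¹) •
            iteratedFDerivWithin ℝ k R (B ×ˢ B) (y, y) (fun _ => ((0 : X), c s - y)))
              =o[𝓝[>] 0] fun s : ℝ => s ^ n := by
          have hO : (fun s => R (y, c s) - ∑ k ∈ Finset.range (n + 1), ((k.factorial : ℝ)⁻¹) •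
            iteratedFDerivWithin ℝ k R (B ×ˢ B) (y, y) (fun _ => ((0 : X), c s - y)))
              =O[𝓝[>] 0] fun s => ‖c s - y‖ ^ (n + 1) := by
            refine IsBigO.of_bound A ?_
            have e1 : ∀ᶠ s in 𝓝[>] 0, c s ∈ B :=
              hcy'.eventually (mem_interior_iff_mem_nhds.1 hy)
            have e2 : ∀ᶠ s in 𝓝[>] 0, ‖c s‖ < δ := hcy'.norm.eventually (gt_mem_nhds hyδ)
            filter_upwards [e1, e2] with s h1 h2
            rw [Real.norm_of_nonneg (by positivity)]
            exact hTaylor y hyB _ h1 hyδ h2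
          refine (hO.trans (hbig.norm_left.pow (n + 1))).trans_isLittleO ?_
          simp_rw [pow_succ]
          have : (fun s : ℝ => s) =o[𝓝[>] 0] fun _ => (1 : ℝ) :=
            (isLittleO_one_iff ℝ).2 nhdsWithin_le_nhds
          simpa using (isBigO_refl (fun s : ℝ => s ^ n) (𝓝[>] 0)).mul_isLittleO this
        refine (hco.sub hrem).congr' (Eventually.of_forall fun s => ?_) EventuallyEq.rfl
        simp [ContinuousMultilinearMap.compContinuousLinearMap_apply])
    have hvan0 : ∑ k ∈ Finset.range (n + 1), ((k.factorial : ℝ)⁻¹) •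
        iteratedFDerivWithin ℝ k R (B ×ˢ B) (y, y) (fun _ => ((0 : X), z - y)) = 0 := by
      refine Finset.sum_eq_zero fun k hk => ?_
      have := hvan k (by simp at hk; omega) (z - y)
      simpa [ContinuousMultilinearMap.compContinuousLinearMap_apply] using this
    have := hTaylor y hyB z hz hyδ hzδ
    rwa [hvan0, sub_zero] at this
  refine ⟨A, by positivity, δ, hδ, fun y hy z hz hyδ hzδ => ?_⟩
  -- A base point on the boundary of `B` is a limit of interior ones, and both sides of the bound
  -- are continuous in the base point.
  have hcl : y ∈ closure (interior B ∩ {y | ‖y‖ < δ}) := by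
    have h1 : y ∈ closure (interior B) := by
      rw [hB.closure_interior_eq_closure_of_nonempty_interior hBi]
      exact subset_closure hy
    rw [mem_closure_iff_nhdsWithin_neBot] at h1 ⊢
    rw [nhdsWithin_inter_of_mem']
    · exact h1
    · exact mem_nhdsWithin_of_mem_nhds ((isOpen_lt continuous_norm continuous_const).mem_nhds hyδ)
  have hne := mem_closure_iff_nhdsWithin_neBot.1 hcl
  have hle : 𝓝[interior B ∩ {y | ‖y‖ < δ}] y ≤ 𝓝[B] y :=
    nhdsWithin_mono _ (inter_subset_left.trans interior_subset)
  have hRc : Tendsto (fun w => ‖R (w, z)‖) (𝓝[B] y) (𝓝 ‖R (y, z)‖) := by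
    have h1 : ContinuousWithinAt (fun w => R (w, z)) B y :=
      (hR.continuousOn (y, z) ⟨hy, hz⟩).comp (f := fun w => (w, z))
        (by fun_prop) (fun w hw => ⟨hw, hz⟩)
    exact h1.norm
  have hrc : Tendsto (fun w => A * ‖z - w‖ ^ (n + 1)) (𝓝[B] y) (𝓝 (A * ‖z - y‖ ^ (n + 1))) := by
    have : Continuous fun w => A * ‖z - w‖ ^ (n + 1) := by fun_prop
    exact this.continuousWithinAt
  refine le_of_tendsto_of_tendsto (hRc.mono_left hle) (hrc.mono_left hle) ?_
  filter_upwards [self_mem_nhdsWithin] with w hw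
  exact hint w hw.1 hw.2 z hz hzδ

end Taylor

/-- The Euclidean space of dimension `n`. -/
abbrev Euc (n : ℕ) := EuclideanSpace ℝ (Fin n)

/-! ### Injectivity of the differential of the embedding -/

section Immersion

variable {m d : ℕ} [NeZero m] {M : Type*} [TopologicalSpace M]
  [ChartedSpace (EuclideanHalfSpace m) M] [IsManifold (𝓡∂ m) ∞ M]

/-- In the normal form of an immersion the domain chart factors through `ι` by the projection `rr`.
The differential of the domain chart is injective, hence so is that of `ι`. -/
lemma diffAt_injective {ι : M → Euc d}
    (hι : Manifold.IsSmoothEmbedding (𝓡∂ m) 𝓘(ℝ, Euc d) ∞ ι) (x : M) :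
    Function.Injective (diffAt (m := m) ι x) := by
  have h := hι.isImmersion.isImmersionAt x
  have hle : (1 : WithTop ℕ∞) ≤ ∞ := by exact_mod_cast le_top
  have : IsManifold (𝓡∂ m) 1 M := IsManifold.of_le hle
  have hxs : x ∈ h.domChart.source := h.mem_domChart_source
  have hdm := IsManifold.maximalAtlas_subset_of_le hle h.domChart_mem_maximalAtlas
  have hcm := IsManifold.maximalAtlas_subset_of_le hle h.codChart_mem_maximalAtlas
  have hιd : MDifferentiableAt (𝓡∂ m) 𝓘(ℝ, Euc d) ι x :=
    (hι.contMDiff x).mdifferentiableAt (by simp)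
  have hdom : h.domChart.MDifferentiable (𝓡∂ m) (𝓡∂ m) :=
    ⟨fun y hy => (mdifferentiableAt_of_mem_maximalAtlas hdm hy).mdifferentiableWithinAt,
      fun y hy => (mdifferentiableAt_symm_of_mem_maximalAtlas hdm hy).mdifferentiableWithinAt⟩
  let rr : Euc d → Euc m := fun q => (h.equiv.symm (h.codChart.extend 𝓘(ℝ, Euc d) q)).1
  have hrr : MDifferentiableAt 𝓘(ℝ, Euc d) 𝓘(ℝ, Euc m) rr (ι x) := by
    have h1 : MDifferentiableAt 𝓘(ℝ, Euc d) 𝓘(ℝ, Euc d) (h.codChart.extend 𝓘(ℝ, Euc d)) (ι x) :=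
      (h.codChart.contMDiffAt_extend hcm h.mem_codChart_source).mdifferentiableAt (by simp)
    have h2 : Differentiable ℝ (fun q : Euc d => (h.equiv.symm q).1) := by fun_prop
    exact (h2.differentiableAt.mdifferentiableAt).comp (ι x) h1
  have heq : (fun q => (𝓡∂ m) (h.domChart q)) =ᶠ[𝓝 x] rr ∘ ι := by
    filter_upwards [h.domChart.open_source.mem_nhds hxs] with q hq
    have hq' : h.domChart.extend (𝓡∂ m) q ∈ (h.domChart.extend (𝓡∂ m)).target :=
      (h.domChart.extend (𝓡∂ m)).map_source (by simpa using hq)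
    have := h.writtenInCharts hq'
    simp only [Function.comp_apply] at this
    rw [h.domChart.extend_left_inv hq] at this
    simp only [rr, Function.comp_apply, this]
    simp
  have hI : MDifferentiableAt (𝓡∂ m) 𝓘(ℝ, Euc m) (𝓡∂ m) (h.domChart x) :=
    (𝓡∂ m).mdifferentiableAt
  have hdx := hdom.mdifferentiableAt hxs
  have e1 : mfderiv (𝓡∂ m) 𝓘(ℝ, Euc m) (fun q => (𝓡∂ m) (h.domChart q)) x
      = (mfderiv 𝓘(ℝ, Euc d) 𝓘(ℝ, Euc m) rr (ι x)).comp (mfderiv (𝓡∂ m) 𝓘(ℝ, Euc d) ι x) := by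
    rw [heq.mfderiv_eq]
    exact mfderiv_comp x hrr hιd
  have e2 : mfderiv (𝓡∂ m) 𝓘(ℝ, Euc m) (fun q => (𝓡∂ m) (h.domChart q)) x
      = (mfderiv (𝓡∂ m) 𝓘(ℝ, Euc m) (𝓡∂ m) (h.domChart x)).comp
        (mfderiv (𝓡∂ m) (𝓡∂ m) h.domChart x) :=
    mfderiv_comp x hI hdx
  rw [(𝓡∂ m).hasMFDerivAt.mfderiv] at e2
  rw [injective_iff_map_eq_zero]
  intro v hv
  have hv' : mfderiv (𝓡∂ m) 𝓘(ℝ, Euc d) ι x v = 0 := hv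
  have h3 : mfderiv (𝓡∂ m) (𝓡∂ m) h.domChart x v
      = mfderiv 𝓘(ℝ, Euc d) 𝓘(ℝ, Euc m) rr (ι x) (mfderiv (𝓡∂ m) 𝓘(ℝ, Euc d) ι x v) :=
    congrArg (fun T => T v) (e2.symm.trans e1)
  rw [hv', map_zero] at h3
  exact (injective_iff_map_eq_zero _).1 (hdom.mfderiv_injective hxs) v h3

end Immersion

/-! ### Coordinates that are orthonormal at a base point -/

section Patch

variable {m d : ℕ} [NeZero m] {M : Type*} [TopologicalSpace M]
  [ChartedSpace (EuclideanHalfSpace m) M]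

variable (m) in
/-- Linear coordinates in the preferred chart at `x`, orthonormal at `x`. -/
structure Patch (ι : M → Euc d) (x : M) where
  L : Euc m ≃L[ℝ] Euc m
  J : Euc m →ₗᵢ[ℝ] Euc d
  δ : ℝ
  δ_pos : 0 < δ
  diff_comp : ∀ v, diffAt (m := m) ι x (L v) = J v
  mem_target : ∀ z : Euc m, 0 ≤ (extChartAt (𝓡∂ m) x x + L z) 0 → ‖z‖ < δ →
    extChartAt (𝓡∂ m) x x + L z ∈ (extChartAt (𝓡∂ m) x).target

namespace Patch

variable {ι : M → Euc d} {x : M} (P : Patch m ι x)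

/-- The affine map from the coordinates of the patch to those of the preferred chart. -/
def aff (z : Euc m) : Euc m := extChartAt (𝓡∂ m) x x + P.L z

/-- The coordinate domain. -/
def B : Set (Euc m) := {z | 0 ≤ P.aff z 0 ∧ ‖z‖ < P.δ}

/-- The parametrization. -/
def Ψ (z : Euc m) : M := (extChartAt (𝓡∂ m) x).symm (P.aff z)

/-- The coordinates of the patch. -/
def ξ (q : M) : Euc m := P.L.symm (extChartAt (𝓡∂ m) x q - extChartAt (𝓡∂ m) x x)

/-- The parametrization, as a map to the ambient space. -/
def F (z : Euc m) : Euc d := ι (P.Ψ z)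

lemma aff_zero : P.aff 0 = extChartAt (𝓡∂ m) x x := by simp [aff]

lemma Ψ_zero : P.Ψ 0 = x := by
  rw [Ψ, aff_zero, extChartAt_to_inv]

lemma range_eq : range (𝓡∂ m) = {y : Euc m | 0 ≤ y 0} :=
  range_modelWithCornersEuclideanHalfSpace m

lemma aff_mem_target {z : Euc m} (hz : z ∈ P.B) :
    P.aff z ∈ (extChartAt (𝓡∂ m) x).target := P.mem_target z hz.1 hz.2

lemma contDiff_aff : ContDiff ℝ ∞ P.aff := by
  unfold aff; exact contDiff_const.add P.L.contDiff

lemma base_nonneg (x : M) : 0 ≤ (extChartAt (𝓡∂ m) x x : Euc m) 0 := by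
  have : extChartAt (𝓡∂ m) x x ∈ range (𝓡∂ m) :=
    extChartAt_target_subset_range x (mem_extChartAt_target x)
  rwa [range_eq] at this

lemma zero_mem : (0 : Euc m) ∈ P.B :=
  ⟨by rw [aff_zero]; exact base_nonneg x, by simpa using P.δ_pos⟩

/-- The linear functional that defines the half space. -/
def ell : Euc m →L[ℝ] ℝ := (EuclideanSpace.proj (0 : Fin m) : Euc m →L[ℝ] ℝ) ∘L
  (P.L : Euc m →L[ℝ] Euc m)

lemma aff_apply_zero (z : Euc m) : P.aff z 0 = (extChartAt (𝓡∂ m) x x) 0 + P.ell z := by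
  simp [aff, ell]

lemma convex_B : Convex ℝ P.B := by
  have h1 : Convex ℝ {z : Euc m | 0 ≤ P.aff z 0} := by
    have : {z : Euc m | 0 ≤ P.aff z 0} = {z | -(extChartAt (𝓡∂ m) x x) 0 ≤ P.ell z} := by
      ext z; simp only [mem_ofPred_eq, aff_apply_zero]; constructor <;> intro h <;> linarith
    rw [this]
    exact convex_halfSpace_ge (f := P.ell) P.ell.isLinear _
  have h2 : P.B = {z : Euc m | 0 ≤ P.aff z 0} ∩ Metric.ball 0 P.δ := by
    ext z; simp [B]
  rw [h2]; exact h1.inter (convex_ball _ _)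

/-- A direction that points into the half space. -/
def inward : Euc m := P.L.symm (coordVec 0)

lemma ell_inward : P.ell P.inward = 1 := by
  simp [ell, inward, coordVec]

lemma inward_ne_zero : P.inward ≠ 0 := fun h => by
  have := P.ell_inward; rw [h] at this; simp at this

lemma add_mem_B {y v : Euc m} (hy : y ∈ P.B) (hv : 0 ≤ P.ell v) (hn : ‖y + v‖ < P.δ) :
    y + v ∈ P.B := by
  refine ⟨?_, hn⟩
  have := hy.1
  rw [aff_apply_zero] at this ⊢
  rw [map_add]; linarith

lemma isOpen_pos : IsOpen {z : Euc m | 0 < P.aff z 0 ∧ ‖z‖ < P.δ} := by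
  have h := P.contDiff_aff.continuous
  have h' : Continuous fun z => P.aff z 0 := by
    simp_rw [aff_apply_zero]; fun_prop
  exact (isOpen_lt continuous_const h').inter (isOpen_lt continuous_norm continuous_const)

lemma interior_B_nonempty : (interior P.B).Nonempty := by
  have hsub : {z : Euc m | 0 < P.aff z 0 ∧ ‖z‖ < P.δ} ⊆ interior P.B :=
    interior_maximal (fun z hz => ⟨hz.1.le, hz.2⟩) P.isOpen_pos
  refine ⟨(P.δ / (2 * ‖P.inward‖)) • P.inward, hsub ⟨?_, ?_⟩⟩
  · rw [aff_apply_zero, map_smul, ell_inward]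
    have := base_nonneg (m := m) x
    have h1 := P.δ_pos
    have h2 := norm_pos_iff.2 P.inward_ne_zero
    simp only [smul_eq_mul, mul_one]; positivity
  · have h1 := P.δ_pos
    have h2 := norm_pos_iff.2 P.inward_ne_zero
    rw [norm_smul, Real.norm_of_nonneg (by positivity)]
    have : P.δ / (2 * ‖P.inward‖) * ‖P.inward‖ = P.δ / 2 := by field_simp
    rw [this]; linarith

lemma uniqueDiffOn_B : UniqueDiffOn ℝ P.B := uniqueDiffOn_convex P.convex_B P.interior_B_nonempty

lemma measurableSet_B : MeasurableSet P.B := by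
  have h' : Continuous fun z => P.aff z 0 := by
    simp_rw [aff_apply_zero]; fun_prop
  exact (isClosed_le continuous_const h').measurableSet.inter
    (isOpen_lt continuous_norm continuous_const).measurableSet

lemma ξ_Ψ {z : Euc m} (hz : z ∈ P.B) : P.ξ (P.Ψ z) = z := by
  unfold ξ Ψ
  rw [(extChartAt (𝓡∂ m) x).right_inv (P.aff_mem_target hz)]
  simp [aff]

/-- The right side is visibly open, since `ξ` is continuous on the chart domain; this is how patches
are seen to be neighborhoods even at boundary points. -/
lemma image_eq : P.Ψ '' P.B = (extChartAt (𝓡∂ m) x).source ∩ P.ξ ⁻¹' Metric.ball 0 P.δ := by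
  ext q
  constructor
  · rintro ⟨z, hz, rfl⟩
    refine ⟨(extChartAt (𝓡∂ m) x).map_target (P.aff_mem_target hz), ?_⟩
    rw [mem_preimage, P.ξ_Ψ hz]; simpa using hz.2
  · rintro ⟨hq, hξ⟩
    have ha : P.aff (P.ξ q) = extChartAt (𝓡∂ m) x q := by simp [aff, ξ]
    refine ⟨P.ξ q, ⟨?_, by simpa using hξ⟩, ?_⟩
    · rw [ha]
      have : extChartAt (𝓡∂ m) x q ∈ range (𝓡∂ m) :=
        extChartAt_target_subset_range x ((extChartAt (𝓡∂ m) x).map_source hq)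
      rwa [range_eq] at this
    · rw [Ψ, ha, (extChartAt (𝓡∂ m) x).left_inv hq]

lemma continuousOn_ξ : ContinuousOn P.ξ (extChartAt (𝓡∂ m) x).source :=
  P.L.symm.continuous.comp_continuousOn ((continuousOn_extChartAt x).sub continuousOn_const)

lemma isOpen_image : IsOpen (P.Ψ '' P.B) := by
  rw [image_eq]
  exact P.continuousOn_ξ.isOpen_inter_preimage (isOpen_extChartAt_source x) Metric.isOpen_ball

lemma continuousOn_ξ_image : ContinuousOn P.ξ (P.Ψ '' P.B) :=
  P.continuousOn_ξ.mono (by rw [image_eq]; exact inter_subset_left)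

lemma Ψ_ξ {q : M} (hq : q ∈ P.Ψ '' P.B) : P.Ψ (P.ξ q) = q := by
  obtain ⟨z, hz, rfl⟩ := hq; rw [P.ξ_Ψ hz]

lemma ξ_mem {q : M} (hq : q ∈ P.Ψ '' P.B) : P.ξ q ∈ P.B := by
  obtain ⟨z, hz, rfl⟩ := hq; rwa [P.ξ_Ψ hz]

lemma ξ_base : P.ξ x = 0 := by simpa [Ψ_zero] using P.ξ_Ψ P.zero_mem

lemma image_mem_nhds : P.Ψ '' P.B ∈ 𝓝 x :=
  P.isOpen_image.mem_nhds ⟨0, P.zero_mem, P.Ψ_zero⟩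

lemma image_ball_mem_nhds {ρ : ℝ} (hρ : 0 < ρ) : P.Ψ '' (P.B ∩ {z | ‖z‖ < ρ}) ∈ 𝓝 x := by
  have hc : ContinuousAt P.ξ x := P.continuousOn_ξ_image.continuousAt P.image_mem_nhds
  have h1 : ∀ᶠ q in 𝓝 x, ‖P.ξ q‖ < ρ := by
    refine hc.norm.eventually (gt_mem_nhds ?_)
    simpa [ξ_base] using hρ
  filter_upwards [h1, P.image_mem_nhds] with q h1 h2
  exact ⟨P.ξ q, ⟨P.ξ_mem h2, h1⟩, P.Ψ_ξ h2⟩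

/-- The same coordinates on a smaller domain. -/
def shrink (ρ : ℝ) (h0 : 0 < ρ) (hρ : ρ ≤ P.δ) : Patch m ι x where
  L := P.L
  J := P.J
  δ := ρ
  δ_pos := h0
  diff_comp := P.diff_comp
  mem_target z hz hn := P.mem_target z hz (hn.trans_le hρ)

section Smooth

variable [IsManifold (𝓡∂ m) ∞ M] {G : Type*} [NormedAddCommGroup G] [NormedSpace ℝ G]

lemma contMDiffOn_Ψ : ContMDiffOn 𝓘(ℝ, Euc m) (𝓡∂ m) ∞ P.Ψ P.B :=
  (contMDiffOn_extChartAt_symm x).comp P.contDiff_aff.contMDiff.contMDiffOn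
    (fun _ hz => P.aff_mem_target hz)

lemma continuousOn_Ψ : ContinuousOn P.Ψ P.B := P.contMDiffOn_Ψ.continuousOn

lemma contDiffOn_comp {g : M → G} (hg : ContMDiff (𝓡∂ m) 𝓘(ℝ, G) ∞ g) :
    ContDiffOn ℝ ∞ (fun z => g (P.Ψ z)) P.B :=
  (hg.comp_contMDiffOn P.contMDiffOn_Ψ).contDiffOn

/-- The derivative of the parametrization. -/
def dΨ (z : Euc m) : Euc m →L[ℝ] Euc m := mfderivWithin 𝓘(ℝ, Euc m) (𝓡∂ m) P.Ψ P.B z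

lemma dΨ_eq {z : Euc m} (hz : z ∈ P.B) : P.dΨ z =
    (mfderivWithin 𝓘(ℝ, Euc m) (𝓡∂ m) (extChartAt (𝓡∂ m) x).symm (range (𝓡∂ m)) (P.aff z)).comp
      (P.L : Euc m →L[ℝ] Euc m) := by
  have : IsManifold (𝓡∂ m) 1 M := IsManifold.of_le (by exact_mod_cast le_top : (1 : WithTop ℕ∞) ≤ ∞)
  have h1 := mdifferentiableWithinAt_extChartAt_symm (I := 𝓡∂ m) (P.aff_mem_target hz)
  have h2 : HasFDerivAt P.aff (P.L : Euc m →L[ℝ] Euc m) z := by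
    unfold aff; exact P.L.hasFDerivAt.const_add _
  have h3 := h1.hasMFDerivWithinAt.comp z (h2.hasMFDerivAt.hasMFDerivWithinAt (s := P.B))
    (fun w hw => by rw [mem_preimage, range_eq]; exact hw.1)
  exact h3.mfderivWithin (uniqueMDiffWithinAt_iff_uniqueDiffWithinAt.2 (P.uniqueDiffOn_B z hz))

lemma dΨ_bijective {z : Euc m} (hz : z ∈ P.B) : Function.Bijective (P.dΨ z) := by
  have : IsManifold (𝓡∂ m) 1 M := IsManifold.of_le (by exact_mod_cast le_top : (1 : WithTop ℕ∞) ≤ ∞)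
  rw [P.dΨ_eq hz]
  have := isInvertible_mfderivWithin_extChartAt_symm (I := 𝓡∂ m) (P.aff_mem_target hz)
  obtain ⟨A, hA⟩ := this
  rw [← hA]
  exact (A.bijective.comp P.L.bijective)

lemma dΨ_zero : P.dΨ 0 = (P.L : Euc m →L[ℝ] Euc m) := by
  have : IsManifold (𝓡∂ m) 1 M := IsManifold.of_le (by exact_mod_cast le_top : (1 : WithTop ℕ∞) ≤ ∞)
  rw [P.dΨ_eq P.zero_mem, aff_zero, mfderivWithin_range_extChartAt_symm]
  rfl

lemma fderivWithin_comp_Ψ {g : M → G} (hg : ContMDiff (𝓡∂ m) 𝓘(ℝ, G) ∞ g) {z : Euc m}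
    (hz : z ∈ P.B) :
    fderivWithin ℝ (fun z => g (P.Ψ z)) P.B z = (diffAt (m := m) g (P.Ψ z)).comp (P.dΨ z) := by
  have h1 : MDifferentiableAt (𝓡∂ m) 𝓘(ℝ, G) g (P.Ψ z) := (hg _).mdifferentiableAt (by simp)
  have h2 : MDifferentiableWithinAt 𝓘(ℝ, Euc m) (𝓡∂ m) P.Ψ P.B z :=
    (P.contMDiffOn_Ψ z hz).mdifferentiableWithinAt (by simp)
  have h3 := h1.hasMFDerivAt.comp_hasMFDerivWithinAt z h2.hasMFDerivWithinAt
  have h4 : HasFDerivWithinAt (g ∘ P.Ψ) ((diffAt (m := m) g (P.Ψ z)).comp (P.dΨ z)) P.B z :=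
    hasMFDerivWithinAt_iff_hasFDerivWithinAt.1 h3
  exact h4.fderivWithin (P.uniqueDiffOn_B z hz)

/-- The tangent space depends only on the range of the differential, and `dΨ` is onto. -/
lemma tangentSub_eq {z : Euc m} (hz : z ∈ P.B) (hι : ContMDiff (𝓡∂ m) 𝓘(ℝ, Euc d) ∞ ι) :
    tangentSub m ι (P.Ψ z) = LinearMap.range (fderivWithin ℝ P.F P.B z).toLinearMap := by
  have h : fderivWithin ℝ P.F P.B z = (diffAt (m := m) ι (P.Ψ z)).comp (P.dΨ z) :=
    P.fderivWithin_comp_Ψ hι hz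
  rw [h, tangentSub]
  have hr : LinearMap.range (P.dΨ z).toLinearMap = ⊤ :=
    LinearMap.range_eq_top.2 (P.dΨ_bijective hz).2
  rw [ContinuousLinearMap.toLinearMap_comp, LinearMap.range_comp, hr, Submodule.map_top]

lemma contDiffOn_F (hι : ContMDiff (𝓡∂ m) 𝓘(ℝ, Euc d) ∞ ι) : ContDiffOn ℝ ∞ P.F P.B :=
  P.contDiffOn_comp hι

lemma fderivWithin_F_zero (hι : ContMDiff (𝓡∂ m) 𝓘(ℝ, Euc d) ∞ ι) :
    fderivWithin ℝ P.F P.B 0 = P.J.toContinuousLinearMap := by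
  ext1 v
  have h : fderivWithin ℝ P.F P.B 0 = (diffAt (m := m) ι (P.Ψ 0)).comp (P.dΨ 0) :=
    P.fderivWithin_comp_Ψ hι P.zero_mem
  rw [h, dΨ_zero, Ψ_zero]
  exact P.diff_comp v

lemma contDiffOn_pair {U : M → M → G} {r : ℝ}
    (hU : ContMDiffOn ((𝓡∂ m).prod (𝓡∂ m)) 𝓘(ℝ, G) ∞
      (fun p : M × M => U p.1 p.2) {p | dist (ι p.1) (ι p.2) < r})
    (hd : ∀ y ∈ P.B, ∀ z ∈ P.B, dist (P.F y) (P.F z) < r) :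
    ContDiffOn ℝ ∞ (fun p : Euc m × Euc m => U (P.Ψ p.1) (P.Ψ p.2)) (P.B ×ˢ P.B) := by
  have h1 : ContMDiffOn (𝓘(ℝ, Euc m).prod 𝓘(ℝ, Euc m)) ((𝓡∂ m).prod (𝓡∂ m)) ∞
      (Prod.map P.Ψ P.Ψ) (P.B ×ˢ P.B) := P.contMDiffOn_Ψ.prodMap P.contMDiffOn_Ψ
  have h2 := hU.comp h1 (fun p hp => hd _ hp.1 _ hp.2)
  rw [← contMDiffOn_iff_contDiffOn, modelWithCornersSelf_prod, ← chartedSpaceSelf_prod]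
  exact h2

/-- Near the base point the derivative of the parametrization is close to an isometry. -/
lemma exists_fderivWithin_approx (hι : ContMDiff (𝓡∂ m) 𝓘(ℝ, Euc d) ∞ ι) {ε : ℝ} (hε : 0 < ε) :
    ∃ ρ > 0, ∀ z ∈ P.B, ‖z‖ < ρ →
      ‖fderivWithin ℝ P.F P.B z - P.J.toContinuousLinearMap‖ < ε := by
  have hc : ContinuousOn (fderivWithin ℝ P.F P.B) P.B :=
    (P.contDiffOn_F hι).continuousOn_fderivWithin P.uniqueDiffOn_B (by exact_mod_cast le_top)
  have h1 : ∀ᶠ z in 𝓝[P.B] 0, ‖fderivWithin ℝ P.F P.B z - P.J.toContinuousLinearMap‖ < ε := by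
    have := ((hc 0 P.zero_mem).sub
      (continuousWithinAt_const (b := P.J.toContinuousLinearMap))).norm
    refine this.eventually (gt_mem_nhds ?_)
    simpa [P.fderivWithin_F_zero hι] using hε
  rw [eventually_nhdsWithin_iff, Metric.eventually_nhds_iff] at h1
  obtain ⟨ρ, hρ, h⟩ := h1
  exact ⟨ρ, hρ, fun z hz hzρ => h (by simpa using hzρ) hz⟩

lemma norm_sub_le_of_fderivWithin (hι : ContMDiff (𝓡∂ m) 𝓘(ℝ, Euc d) ∞ ι) {ε ρ : ℝ}
    (h : ∀ z ∈ P.B, ‖z‖ < ρ → ‖fderivWithin ℝ P.F P.B z - P.J.toContinuousLinearMap‖ ≤ ε)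
    {y z : Euc m} (hy : y ∈ P.B) (hz : z ∈ P.B) (hyρ : ‖y‖ < ρ) (hzρ : ‖z‖ < ρ) :
    ‖P.F z - P.F y - P.J (z - y)‖ ≤ ε * ‖z - y‖ := by
  have hconv : Convex ℝ (P.B ∩ Metric.ball 0 ρ) := P.convex_B.inter (convex_ball _ _)
  refine hconv.norm_image_sub_le_of_norm_hasFDerivWithin_le' (φ := P.J.toContinuousLinearMap)
    (f' := fderivWithin ℝ P.F P.B) (fun w hw => ?_) (fun w hw => ?_)
    ⟨hy, by simpa using hyρ⟩ ⟨hz, by simpa using hzρ⟩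
  · exact (((P.contDiffOn_F hι).differentiableOn (by simp)) w hw.1).hasFDerivWithinAt.mono
      inter_subset_left
  · exact h w hw.1 (by simpa using hw.2)

/-- Near the base point the parametrization is arbitrarily close to an isometry. -/
lemma exists_approx (hι : ContMDiff (𝓡∂ m) 𝓘(ℝ, Euc d) ∞ ι) {ε : ℝ} (hε : 0 < ε) :
    ∃ ρ > 0, ∀ y ∈ P.B, ∀ z ∈ P.B, ‖y‖ < ρ → ‖z‖ < ρ →
      ‖P.F z - P.F y - P.J (z - y)‖ ≤ ε * ‖z - y‖ := by
  obtain ⟨ρ, hρ, h⟩ := P.exists_fderivWithin_approx hι hε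
  exact ⟨ρ, hρ, fun y hy z hz hyρ hzρ =>
    P.norm_sub_le_of_fderivWithin hι (fun w hw hwρ => (h w hw hwρ).le) hy hz hyρ hzρ⟩

end Smooth

end Patch

end Patch

/-! ### Adjoints, second derivatives and the Hessian in a patch -/

section Transpose

variable {m d : ℕ}

/-- The adjoint, as a linear map. -/
def transposeL : (Euc m →L[ℝ] Euc d) →L[ℝ] (Euc d →L[ℝ] Euc m) :=
  -- Bundled as an `ℝ`-linear map, so that smooth families of operators have smooth adjoints by
  -- composition.
  LinearMap.mkContinuous
    { toFun := fun A => ContinuousLinearMap.adjoint A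
      map_add' := fun A B => map_add _ A B
      map_smul' := fun c A => by simp } 1 (fun A => by simp)

lemma transposeL_inner (A : Euc m →L[ℝ] Euc d) (u : Euc d) (v : Euc m) :
    inner ℝ (transposeL A u) v = inner ℝ u (A v) :=
  ContinuousLinearMap.adjoint_inner_left A v u

lemma transposeL_isometry_apply (J : Euc m →ₗᵢ[ℝ] Euc d) (v : Euc m) :
    transposeL J.toContinuousLinearMap (J v) = v := by
  refine ext_inner_right ℝ fun w => ?_
  rw [transposeL_inner]
  exact J.inner_map_map v w

lemma norm_transposeL_isometry_le (J : Euc m →ₗᵢ[ℝ] Euc d) (v : Euc d) :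
    ‖transposeL J.toContinuousLinearMap v‖ ≤ ‖v‖ := by
  have h : ‖transposeL J.toContinuousLinearMap‖ ≤ 1 := by
    change ‖ContinuousLinearMap.adjoint J.toContinuousLinearMap‖ ≤ 1
    rw [LinearIsometryEquiv.norm_map]
    exact J.norm_toContinuousLinearMap_le
  simpa using ContinuousLinearMap.le_of_opNorm_le _ h v

end Transpose

lemma euc_eq_sum {m : ℕ} (v : Euc m) : v = ∑ i, v i • (coordVec i : Euc m) := by
  have := (EuclideanSpace.basisFun (Fin m) ℝ).sum_repr v
  simpa [coordVec] using this.symm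

section Second

variable {m : ℕ} {G : Type*} [NormedAddCommGroup G] [NormedSpace ℝ G]

/-- The second derivative within `B`. -/
def D2 (B : Set (Euc m)) (g : Euc m → G) (z : Euc m) : Euc m →L[ℝ] Euc m →L[ℝ] G :=
  fderivWithin ℝ (fderivWithin ℝ g B) B z

end Second

namespace Patch

variable {m d : ℕ} [NeZero m] {M : Type*} [TopologicalSpace M]
  [ChartedSpace (EuclideanHalfSpace m) M] {ι : M → Euc d} {x : M} (P : Patch m ι x)

/-- The patch is small: the parametrization is close to an isometry, and the normal coordinates are
defined on it. -/
structure IsGood (r : ℝ) : Prop where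
  fderiv_le : ∀ z ∈ P.B, ‖fderivWithin ℝ P.F P.B z - P.J.toContinuousLinearMap‖ ≤ 1 / 2
  approx : ∀ y ∈ P.B, ∀ z ∈ P.B, ‖P.F z - P.F y - P.J (z - y)‖ ≤ 1 / 2 * ‖z - y‖
  small : ∀ y ∈ P.B, ∀ z ∈ P.B, dist (P.F y) (P.F z) < r

lemma B_shrink_subset {ρ : ℝ} (h0 : 0 < ρ) (hρ : ρ ≤ P.δ) : (P.shrink ρ h0 hρ).B ⊆ P.B :=
  fun _ hz => ⟨hz.1, lt_of_lt_of_le hz.2 hρ⟩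

lemma B_shrink_eq {ρ : ℝ} (h0 : 0 < ρ) (hρ : ρ ≤ P.δ) :
    (P.shrink ρ h0 hρ).B = P.B ∩ Metric.ball 0 ρ := by
  ext z
  constructor
  · intro hz
    exact ⟨P.B_shrink_subset h0 hρ hz, mem_ball_zero_iff.2 hz.2⟩
  · intro hz
    exact ⟨hz.1.1, mem_ball_zero_iff.1 hz.2⟩

lemma exists_isGood [IsManifold (𝓡∂ m) ∞ M] (hι : ContMDiff (𝓡∂ m) 𝓘(ℝ, Euc d) ∞ ι)
    {r : ℝ} (hr : 0 < r) : ∃ P' : Patch m ι x, P'.J = P.J ∧ P'.L = P.L ∧ P'.IsGood r := by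
  obtain ⟨ρ, hρ, h⟩ := P.exists_fderivWithin_approx hι (ε := 1 / 2) (by norm_num)
  -- With radius `r / 4` two points of the patch differ by less than `r / 2`, and `F` expands
  -- distances by at most `3 / 2`, so images are closer than `r`.
  have h0 : 0 < min (min ρ P.δ) (r / 4) := lt_min (lt_min hρ P.δ_pos) (by positivity)
  have hδ : min (min ρ P.δ) (r / 4) ≤ P.δ := (min_le_left _ _).trans (min_le_right _ _)
  have key : ∀ y ∈ (P.shrink _ h0 hδ).B, ∀ z ∈ (P.shrink _ h0 hδ).B,
      ‖P.F z - P.F y - P.J (z - y)‖ ≤ 1 / 2 * ‖z - y‖ := by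
    intro y hy z hz
    have h1 := (P.B_shrink_subset h0 hδ) hy
    have h2 := (P.B_shrink_subset h0 hδ) hz
    exact P.norm_sub_le_of_fderivWithin hι (fun w hw hwρ => (h w hw hwρ).le) h1 h2
      (hy.2.trans_le ((min_le_left _ _).trans (min_le_left _ _))) (hz.2.trans_le ((min_le_left _ _).trans (min_le_left _ _)))
  refine ⟨P.shrink _ h0 hδ, rfl, rfl, ?_, key, ?_⟩
  · intro z hz
    have h1 := (P.B_shrink_subset h0 hδ) hz
    have h2 : fderivWithin ℝ P.F (P.shrink _ h0 hδ).B z = fderivWithin ℝ P.F P.B z := by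
      rw [B_shrink_eq]
      exact fderivWithin_inter (Metric.isOpen_ball.mem_nhds (mem_ball_zero_iff.2 hz.2))
    change ‖fderivWithin ℝ P.F (P.shrink _ h0 hδ).B z - _‖ ≤ 1 / 2
    rw [h2]
    exact (h z h1 (hz.2.trans_le ((min_le_left _ _).trans (min_le_left _ _)))).le
  intro y hy z hz
  have h1 := key z hz y hy
  have hy' : ‖y‖ < r / 4 := hy.2.trans_le (min_le_right _ _)
  have hz' : ‖z‖ < r / 4 := hz.2.trans_le (min_le_right _ _)
  have h2 : ‖y - z‖ ≤ ‖y‖ + ‖z‖ := norm_sub_le _ _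
  have h3 : ‖P.F y - P.F z‖ ≤ ‖P.F y - P.F z - P.J (y - z)‖ + ‖P.J (y - z)‖ := by
    simpa using norm_add_le (P.F y - P.F z - P.J (y - z)) (P.J (y - z))
  rw [P.J.norm_map] at h3
  change dist (P.F y) (P.F z) < r
  rw [dist_eq_norm]
  linarith

lemma aff_mapsTo : MapsTo P.aff P.B (range (𝓡∂ m)) := fun z hz => by
  rw [range_eq]; exact hz.1

lemma hasFDerivAt_aff (z : Euc m) : HasFDerivAt P.aff (P.L : Euc m →L[ℝ] Euc m) z := by
  unfold aff; exact P.L.hasFDerivAt.const_add _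

lemma finrank_tangentSub {x : M} (hinj : Function.Injective (diffAt (m := m) ι x)) :
    Module.finrank ℝ (tangentSub m ι x) = m := by
  rw [tangentSub, LinearMap.finrank_range_of_inj hinj]; simp

/-- Every point has a patch whose first coordinate direction is a given unit tangent vector. -/
lemma exists_patch {x : M} (hinj : Function.Injective (diffAt (m := m) ι x)) {u : Euc d}
    (hu : u ∈ tangentSub m ι x) (hu1 : ‖u‖ = 1) :
    ∃ P : Patch m ι x, P.J (coordVec 0) = u := by
  classical
  -- An orthonormal basis of the tangent space with `u` as its vector of index `0`. `J` is the
  -- resulting isometry, and `L` expresses it in the coordinates of the chart.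
  obtain ⟨b, hb⟩ := Orthonormal.exists_orthonormalBasis_extension_of_card_eq (ι := Fin m) (𝕜 := ℝ)
    (E := tangentSub m ι x) (by rw [finrank_tangentSub hinj]; simp)
    (v := fun _ => (⟨u, hu⟩ : tangentSub m ι x)) (s := {0}) (by
      refine ⟨fun _ => hu1, fun i j hij => absurd (Subsingleton.elim i j) hij⟩)
  have hb0 : b 0 = ⟨u, hu⟩ := hb 0 rfl
  let D : Euc m ≃ₗ[ℝ] tangentSub m ι x :=
    LinearEquiv.ofInjective (diffAt (m := m) ι x).toLinearMap hinj
  let L : Euc m ≃L[ℝ] Euc m := (b.repr.symm.toLinearEquiv.trans D.symm).toContinuousLinearEquiv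
  let J : Euc m →ₗᵢ[ℝ] Euc d := (tangentSub m ι x).subtypeₗᵢ.comp b.repr.symm.toLinearIsometry
  have hLJ : ∀ v, diffAt (m := m) ι x (L v) = J v := by
    intro v
    have h1 : D (L v) = b.repr.symm v := D.apply_symm_apply _
    have h2 : ((D (L v) : tangentSub m ι x) : Euc d) = diffAt (m := m) ι x (L v) := rfl
    rw [← h2, h1]; rfl
  have ht := extChartAt_target_mem_nhdsWithin (I := 𝓡∂ m) x
  rw [mem_nhdsWithin] at ht
  obtain ⟨O, hO, hxO, hsub⟩ := ht
  have hc : Continuous fun z : Euc m => extChartAt (𝓡∂ m) x x + L z := by fun_prop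
  have h0 : ∀ᶠ z in 𝓝 (0 : Euc m), extChartAt (𝓡∂ m) x x + L z ∈ O := by
    refine hc.continuousAt.eventually (hO.mem_nhds ?_)
    simpa using hxO
  obtain ⟨δ, hδ, hball⟩ := Metric.eventually_nhds_iff.1 h0
  refine ⟨⟨L, J, δ, hδ, hLJ, fun z hz hn => hsub ⟨hball (by simpa using hn), ?_⟩⟩, ?_⟩
  · rw [range_eq]; exact hz
  · change ((b.repr.symm (EuclideanSpace.single 0 1) : tangentSub m ι x) : Euc d) = u
    rw [b.repr_symm_single, hb0]

lemma exists_isGood_patch [IsManifold (𝓡∂ m) ∞ M]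
    (hι : Manifold.IsSmoothEmbedding (𝓡∂ m) 𝓘(ℝ, Euc d) ∞ ι) {r : ℝ} (hr : 0 < r) (x : M) :
    ∃ P : Patch m ι x, P.IsGood r := by
  have hinj := diffAt_injective hι x
  have hne : diffAt (m := m) ι x (coordVec 0) ≠ 0 := by
    intro h
    have := (injective_iff_map_eq_zero _).1 hinj _ h
    simp [coordVec] at this
  obtain ⟨P, -⟩ := exists_patch hinj
    (u := ‖diffAt (m := m) ι x (coordVec 0)‖⁻¹ • diffAt (m := m) ι x (coordVec 0))
    (Submodule.smul_mem _ _ ⟨coordVec 0, rfl⟩) (by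
      rw [norm_smul, norm_inv, norm_norm, inv_mul_cancel₀ (norm_ne_zero_iff.2 hne)])
  obtain ⟨P', -, -, h⟩ := P.exists_isGood hι.contMDiff hr
  exact ⟨P', h⟩

section

variable {G : Type*} [NormedAddCommGroup G] [NormedSpace ℝ G]

/-- The Gram operator of the metric. -/
def N (y : Euc m) : Euc m →L[ℝ] Euc m :=
  transposeL (fderivWithin ℝ P.F P.B y) ∘L fderivWithin ℝ P.F P.B y

/-- The left inverse of the derivative of the parametrization that vanishes on normal vectors. -/
def Λ (y : Euc m) : Euc d →L[ℝ] Euc m :=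
  (P.N y).inverse ∘L transposeL (fderivWithin ℝ P.F P.B y)

/-- The Riemannian Hessian, in the coordinates of the patch. -/
def Hess (g : Euc m → G) (y : Euc m) : Euc m →L[ℝ] Euc m →L[ℝ] G :=
  -- `Λ` extracts the tangential part of the second derivative of `F`, which is the vector of
  -- Christoffel symbols.
  D2 P.B g y - (ContinuousLinearMap.compL ℝ (Euc m) (Euc d) G
    (fderivWithin ℝ g P.B y ∘L P.Λ y)) ∘L (D2 P.B P.F y)

lemma Hess_apply (g : Euc m → G) (y u v : Euc m) :
    P.Hess g y u v = D2 P.B g y u v - fderivWithin ℝ g P.B y (P.Λ y (D2 P.B P.F y u v)) := rfl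

variable [IsManifold (𝓡∂ m) ∞ M]

lemma N_zero (hι : ContMDiff (𝓡∂ m) 𝓘(ℝ, Euc d) ∞ ι) : P.N 0 = ContinuousLinearMap.id ℝ _ := by
  ext1 v
  rw [N, P.fderivWithin_F_zero hι]
  exact transposeL_isometry_apply P.J v

lemma Λ_zero (hι : ContMDiff (𝓡∂ m) 𝓘(ℝ, Euc d) ∞ ι) :
    P.Λ 0 = transposeL P.J.toContinuousLinearMap := by
  rw [Λ, P.N_zero hι, P.fderivWithin_F_zero hι, ContinuousLinearMap.inverse_id,
    ContinuousLinearMap.id_comp]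

lemma contDiffOn_chart {g : M → G} (hg : ContMDiff (𝓡∂ m) 𝓘(ℝ, G) ∞ g) (x : M) :
    ContDiffOn ℝ ∞ (g ∘ (extChartAt (𝓡∂ m) x).symm) (extChartAt (𝓡∂ m) x).target :=
  (hg.comp_contMDiffOn (contMDiffOn_extChartAt_symm x)).contDiffOn

lemma contDiffWithinAt_chart {g : M → G} (hg : ContMDiff (𝓡∂ m) 𝓘(ℝ, G) ∞ g) (x : M) {y : Euc m}
    (hy : y ∈ (extChartAt (𝓡∂ m) x).target) :
    ContDiffWithinAt ℝ ∞ (g ∘ (extChartAt (𝓡∂ m) x).symm) (range (𝓡∂ m)) y :=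
  (contDiffOn_chart hg x y hy).mono_of_mem_nhdsWithin
    (extChartAt_target_mem_nhdsWithin_of_mem hy)

lemma fderivWithin_comp_aff {g : M → G} (hg : ContMDiff (𝓡∂ m) 𝓘(ℝ, G) ∞ g) {z : Euc m}
    (hz : z ∈ P.B) : fderivWithin ℝ (fun z => g (P.Ψ z)) P.B z =
      (fderivWithin ℝ (g ∘ (extChartAt (𝓡∂ m) x).symm) (range (𝓡∂ m)) (P.aff z)).comp
        (P.L : Euc m →L[ℝ] Euc m) := by
  have h1 := ((contDiffWithinAt_chart hg x (P.aff_mem_target hz)).differentiableWithinAt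
    (by simp)).hasFDerivWithinAt
  exact (h1.comp z (P.hasFDerivAt_aff z).hasFDerivWithinAt P.aff_mapsTo).fderivWithin
    (P.uniqueDiffOn_B z hz)

/-- The change of coordinates `aff` is affine, so second derivatives transform without a first order
term. -/
lemma D2_zero_eq {g : M → G} (hg : ContMDiff (𝓡∂ m) 𝓘(ℝ, G) ∞ g) (u v : Euc m) :
    D2 P.B (fun z => g (P.Ψ z)) 0 u v =
      D2 (range (𝓡∂ m)) (g ∘ (extChartAt (𝓡∂ m) x).symm) (extChartAt (𝓡∂ m) x x)
        (P.L u) (P.L v) := by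
  have hx := mem_extChartAt_target (I := 𝓡∂ m) x
  have h1 : DifferentiableWithinAt ℝ
      (fderivWithin ℝ (g ∘ (extChartAt (𝓡∂ m) x).symm) (range (𝓡∂ m))) (range (𝓡∂ m))
      (extChartAt (𝓡∂ m) x x) :=
    ((contDiffWithinAt_chart hg x hx).fderivWithin_right (m := 1) (𝓡∂ m).uniqueDiffOn
      (by norm_cast) (extChartAt_target_subset_range x hx)).differentiableWithinAt (by simp)
  have h2 := h1.hasFDerivWithinAt
  rw [← P.aff_zero] at h2
  have h3 := h2.comp 0 (P.hasFDerivAt_aff 0).hasFDerivWithinAt P.aff_mapsTo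
  have h4 := (((ContinuousLinearMap.compL ℝ (Euc m) (Euc m) G).flip
    (P.L : Euc m →L[ℝ] Euc m)).hasFDerivAt).comp_hasFDerivWithinAt 0 h3
  have h5 := h4.congr (f₁ := fderivWithin ℝ (fun z => g (P.Ψ z)) P.B)
    (fun z hz => P.fderivWithin_comp_aff hg hz) (P.fderivWithin_comp_aff hg P.zero_mem)
  rw [D2, h5.fderivWithin (P.uniqueDiffOn_B 0 P.zero_mem), D2, P.aff_zero]
  rfl

lemma chartSecond_eq {g : M → G} (hg : ContMDiff (𝓡∂ m) 𝓘(ℝ, G) ∞ g) (i j : Fin m) :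
    chartSecond g x i j =
      D2 P.B (fun z => g (P.Ψ z)) 0 (P.L.symm (coordVec i)) (P.L.symm (coordVec j)) := by
  rw [P.D2_zero_eq hg, chartSecond, iteratedFDerivWithin_two_apply' _ (𝓡∂ m).uniqueDiffOn
    (extChartAt_target_subset_range x (mem_extChartAt_target x))]
  simp [D2]

lemma diffAt_base {g : M → G} (hg : ContMDiff (𝓡∂ m) 𝓘(ℝ, G) ∞ g) (v : Euc m) :
    diffAt g x (P.L v) = fderivWithin ℝ (fun z => g (P.Ψ z)) P.B 0 v := by
  rw [P.fderivWithin_comp_Ψ hg P.zero_mem, P.dΨ_zero, P.Ψ_zero]; rfl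

/-- The matrix of the linear part of the patch. -/
def Lcoeff : Matrix (Fin m) (Fin m) ℝ := Matrix.of fun i a => P.L (coordVec a) i

/-- The columns of `Lcoeff` are orthonormal for the metric `g` at `x`, so `Lᵀ g L = 1`, which
rearranges to `g⁻¹ = L Lᵀ`. -/
lemma metric_inv_eq : (metric (m := m) ι x)⁻¹ = P.Lcoeff * P.Lcoeff.transpose := by
  refine Matrix.inv_eq_right_inv ?_
  rw [← Matrix.mul_assoc]
  refine mul_eq_one_comm.1 ?_
  ext a b
  simp only [Matrix.mul_apply, Matrix.transpose_apply]
  have h1 : ∀ b, P.J (coordVec b) = ∑ j, P.Lcoeff j b • diffAt (m := m) ι x (coordVec j) := by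
    intro b
    rw [← P.diff_comp]
    conv_lhs => rw [euc_eq_sum (P.L (coordVec b))]
    simp [Lcoeff]
  have h2 : inner ℝ (P.J (coordVec a)) (P.J (coordVec b)) = (1 : Matrix (Fin m) (Fin m) ℝ) a b := by
    rw [P.J.inner_map_map]
    simp [coordVec, Matrix.one_apply, EuclideanSpace.inner_single_left]
  rw [← h2, h1 a, h1 b, sum_inner]
  refine Finset.sum_congr rfl fun i _ => ?_
  rw [inner_sum, Finset.mul_sum]
  simp only [inner_smul_left, inner_smul_right]
  refine Finset.sum_congr rfl fun j _ => ?_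
  simp [metric]; ring

/-- With `g⁻¹ = L Lᵀ` the Christoffel sum becomes the differential of `f` applied to the tangential
part of `w`, which ties the index formula to the coordinate-free `Hess`. -/
lemma sum_christoffel {f : M → ℝ} (i j : Fin m) (w : Euc d)
    (hw : chartSecond (m := m) ι x i j = w) :
    ∑ k : Fin m, christoffel ι x k i j * diffAt f x (coordVec k)
      = diffAt f x (P.L (transposeL P.J.toContinuousLinearMap w)) := by
  have h1 : transposeL P.J.toContinuousLinearMap w
      = ∑ a, (∑ l, P.Lcoeff l a * inner ℝ w (diffAt (m := m) ι x (coordVec l))) •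
        (coordVec a : Euc m) := by
    conv_lhs => rw [euc_eq_sum (transposeL P.J.toContinuousLinearMap w)]
    refine Finset.sum_congr rfl fun a _ => ?_
    congr 1
    have h2 : (transposeL P.J.toContinuousLinearMap w) a
        = inner ℝ (transposeL P.J.toContinuousLinearMap w) (coordVec a) := by
      simp [coordVec, EuclideanSpace.inner_single_right]
    rw [h2, transposeL_inner]
    change inner ℝ w (P.J (coordVec a)) = _
    rw [← P.diff_comp]
    conv_lhs => rw [euc_eq_sum (P.L (coordVec a))]
    simp [Lcoeff, inner_sum, inner_smul_right]
  have h3 : ∀ a, P.L (coordVec a) = ∑ k, P.Lcoeff k a • (coordVec k : Euc m) := fun a =>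
    euc_eq_sum (P.L (coordVec a))
  rw [h1]
  simp only [map_sum, map_smul, h3, christoffel, P.metric_inv_eq, hw, Matrix.mul_apply,
    Matrix.transpose_apply, smul_eq_mul, Finset.sum_mul, Finset.mul_sum]
  rw [Finset.sum_comm_cycle]
  refine Finset.sum_congr rfl fun a _ => ?_
  refine Finset.sum_congr rfl fun k _ => Finset.sum_congr rfl fun l _ => ?_
  ring

lemma hess_eq (hι : ContMDiff (𝓡∂ m) 𝓘(ℝ, Euc d) ∞ ι) {f : M → ℝ}
    (hf : ContMDiff (𝓡∂ m) 𝓘(ℝ, ℝ) ∞ f) (i j : Fin m) :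
    hess ι f x i j = P.Hess (fun z => f (P.Ψ z)) 0 (P.L.symm (coordVec i))
      (P.L.symm (coordVec j)) := by
  rw [hess, P.sum_christoffel i j _ (P.chartSecond_eq hι i j), P.diffAt_base hf,
    P.chartSecond_eq hf, Hess_apply, P.Λ_zero hι]
  rfl

lemma secondDeriv_eq (hι : ContMDiff (𝓡∂ m) 𝓘(ℝ, Euc d) ∞ ι) {f : M → ℝ}
    (hf : ContMDiff (𝓡∂ m) 𝓘(ℝ, ℝ) ∞ f) (v : Euc m) :
    secondDeriv ι f x (P.L v) = P.Hess (fun z => f (P.Ψ z)) 0 v v := by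
  have h : v = ∑ i, (P.L v) i • P.L.symm (coordVec i) := by
    apply P.L.injective
    simpa using euc_eq_sum (P.L v)
  conv_rhs => rw [h]
  simp only [secondDeriv, P.hess_eq hι hf, map_sum, map_smul, _root_.sum_apply,
    _root_.smul_apply, smul_eq_mul, Finset.mul_sum, mul_assoc]
  rw [Finset.sum_comm]
  refine Finset.sum_congr rfl fun i _ => Finset.sum_congr rfl fun j _ => ?_
  ring

/-- In coordinates orthonormal at the base point, contraction with the inverse metric is the plain
trace. -/
lemma laplaceBeltrami_eq (hι : ContMDiff (𝓡∂ m) 𝓘(ℝ, Euc d) ∞ ι) {f : M → ℝ}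
    (hf : ContMDiff (𝓡∂ m) 𝓘(ℝ, ℝ) ∞ f) :
    laplaceBeltrami m ι f x
      = ∑ a, P.Hess (fun z => f (P.Ψ z)) 0 (coordVec a) (coordVec a) := by
  have h : ∀ a, (coordVec a : Euc m) = ∑ i, P.Lcoeff i a • P.L.symm (coordVec i) := by
    intro a
    apply P.L.injective
    simpa [Lcoeff] using euc_eq_sum (P.L (coordVec a))
  have h2 : ∀ a, P.Hess (fun z => f (P.Ψ z)) 0 (coordVec a) (coordVec a)
      = ∑ i, ∑ j, P.Lcoeff i a * P.Lcoeff j a * hess ι f x i j := by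
    intro a
    conv_lhs => rw [h a]
    simp only [P.hess_eq hι hf, map_sum, map_smul, _root_.sum_apply,
      _root_.smul_apply, smul_eq_mul, Finset.mul_sum, mul_assoc]
    rw [Finset.sum_comm]
    refine Finset.sum_congr rfl fun i _ => Finset.sum_congr rfl fun j _ => ?_
    ring
  simp only [h2, laplaceBeltrami, P.metric_inv_eq, Matrix.mul_apply, Matrix.transpose_apply,
    Finset.sum_mul]
  rw [Finset.sum_comm_cycle]

end

end Patch

/-! ### Derivatives along curves and the Koszul formula -/

section Curves

lemma two_le_infty : (2 : WithTop ℕ∞) ≤ ∞ := WithTop.coe_le_coe.2 le_top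

variable {m : ℕ} {G : Type*} [NormedAddCommGroup G] [NormedSpace ℝ G]
  {B : Set (Euc m)} {g : Euc m → G} {S : Set ℝ} {t : ℝ} {c c1 : ℝ → Euc m}

lemma hasDerivWithinAt_comp_curve (hg : ContDiffOn ℝ ∞ g B) (hc : HasDerivWithinAt c (c1 t) S t)
    (hm : MapsTo c S B) (ht : t ∈ S) :
    HasDerivWithinAt (fun τ => g (c τ)) (fderivWithin ℝ g B (c t) (c1 t)) S t :=
  (((hg.differentiableOn (by simp)) _ (hm ht)).hasFDerivWithinAt).comp_hasDerivWithinAt t hc hm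

lemma contDiffOn_fderivWithin_infty (hB : UniqueDiffOn ℝ B) (hg : ContDiffOn ℝ ∞ g B) :
    ContDiffOn ℝ ∞ (fderivWithin ℝ g B) B := hg.fderivWithin hB (by exact_mod_cast le_top)

lemma contDiffOn_D2 (hB : UniqueDiffOn ℝ B) (hg : ContDiffOn ℝ ∞ g B) :
    ContDiffOn ℝ ∞ (D2 B g) B :=
  contDiffOn_fderivWithin_infty hB (contDiffOn_fderivWithin_infty hB hg)

lemma hasDerivWithinAt_fderivWithin_curve (hB : UniqueDiffOn ℝ B) (hg : ContDiffOn ℝ ∞ g B)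
    (hc : HasDerivWithinAt c (c1 t) S t) {c2 : Euc m} (hc1 : HasDerivWithinAt c1 c2 S t)
    (hm : MapsTo c S B) (ht : t ∈ S) :
    HasDerivWithinAt (fun τ => fderivWithin ℝ g B (c τ) (c1 τ))
      (D2 B g (c t) (c1 t) (c1 t) + fderivWithin ℝ g B (c t) c2) S t := by
  have h1 := hasDerivWithinAt_comp_curve (contDiffOn_fderivWithin_infty hB hg) hc hm ht
  exact h1.clm_apply hc1

lemma D2_symm (hB : Convex ℝ B) (hBi : (interior B).Nonempty) (hg : ContDiffOn ℝ ∞ g B)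
    {z : Euc m} (hz : z ∈ B) (u v : Euc m) : D2 B g z u v = D2 B g z v u := by
  refine (hg z hz).isSymmSndFDerivWithinAt (by simp; exact two_le_infty)
    (uniqueDiffOn_convex hB hBi) ?_ hz u v
  rw [hB.closure_interior_eq_closure_of_nonempty_interior hBi]
  exact subset_closure hz

/-- The second derivative of a map is determined tangentially by the induced metric. -/
lemma inner_D2_eq_of_inner_eq {G' : Type*} [NormedAddCommGroup G'] [InnerProductSpace ℝ G']
    {G : Type*} [NormedAddCommGroup G] [InnerProductSpace ℝ G] {g : Euc m → G} {g' : Euc m → G'}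
    (hB : Convex ℝ B) (hBi : (interior B).Nonempty) (hg : ContDiffOn ℝ ∞ g B)
    (hg' : ContDiffOn ℝ ∞ g' B)
    (h : ∀ z ∈ B, ∀ u v, inner ℝ (fderivWithin ℝ g B z u) (fderivWithin ℝ g B z v)
      = inner ℝ (fderivWithin ℝ g' B z u) (fderivWithin ℝ g' B z v)) {z : Euc m} (hz : z ∈ B)
    (u v w : Euc m) : inner ℝ (D2 B g z u v) (fderivWithin ℝ g B z w)
      = inner ℝ (D2 B g' z u v) (fderivWithin ℝ g' B z w) := by
  have hu := uniqueDiffOn_convex hB hBi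
  -- The derivative in direction `a` of the metric identity for the pair `(b, e)`.
  have key : ∀ a b e, inner ℝ (D2 B g z a b) (fderivWithin ℝ g B z e)
      + inner ℝ (fderivWithin ℝ g B z b) (D2 B g z a e)
      = inner ℝ (D2 B g' z a b) (fderivWithin ℝ g' B z e)
      + inner ℝ (fderivWithin ℝ g' B z b) (D2 B g' z a e) := by
    intro a b e
    have d1 := (((contDiffOn_fderivWithin_infty hu hg).differentiableOn (by simp)) z
      hz).hasFDerivWithinAt
    have d2 := (((contDiffOn_fderivWithin_infty hu hg').differentiableOn (by simp)) z
      hz).hasFDerivWithinAt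
    have e1 := (d1.clm_apply (hasFDerivWithinAt_const b z B)).inner ℝ
      (d1.clm_apply (hasFDerivWithinAt_const e z B))
    have e2 := (d2.clm_apply (hasFDerivWithinAt_const b z B)).inner ℝ
      (d2.clm_apply (hasFDerivWithinAt_const e z B))
    have e3 := e2.congr (fun y hy => h y hy b e) (h z hz b e)
    have e4 := congrArg (fun T => T a) ((hu z hz).eq e1 e3)
    simpa [D2, add_comm] using e4
  have s1 := D2_symm hB hBi hg hz
  have s2 := D2_symm hB hBi hg' hz
  -- Koszul's combination `k1 + k2 - k3`: by symmetry of second derivatives all terms cancel except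
  -- twice the wanted one.
  have k1 := key u v w
  have k2 := key v w u
  have k3 := key w u v
  rw [s1 v u, s1 v w, s2 v u, s2 v w, real_inner_comm _ (fderivWithin ℝ g B z w),
    real_inner_comm _ (fderivWithin ℝ g' B z w)] at k2
  rw [s1 w u, s2 w u, real_inner_comm _ (fderivWithin ℝ g B z u),
    real_inner_comm _ (fderivWithin ℝ g' B z u)] at k3
  rw [real_inner_comm _ (fderivWithin ℝ g B z v), real_inner_comm _ (fderivWithin ℝ g' B z v)] at k1
  linarith

end Curves

/-! ### Geodesics in the coordinates of a patch -/

namespace Patch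

variable {m d : ℕ} [NeZero m] {M : Type*} [TopologicalSpace M]
  [ChartedSpace (EuclideanHalfSpace m) M] {ι : M → Euc d} {x : M} (P : Patch m ι x)
  {r : ℝ}

section Good

variable {P} [IsManifold (𝓡∂ m) ∞ M] (hG : P.IsGood r)
  (hι : ContMDiff (𝓡∂ m) 𝓘(ℝ, Euc d) ∞ ι)
include hG hι

lemma IsGood.norm_fderivWithin_sub_le {z : Euc m} (hz : z ∈ P.B) (v : Euc m) :
    ‖fderivWithin ℝ P.F P.B z v - P.J v‖ ≤ 1 / 2 * ‖v‖ :=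
  ContinuousLinearMap.le_of_opNorm_le _ (hG.fderiv_le z hz) v

lemma IsGood.le_norm_fderivWithin {z : Euc m} (hz : z ∈ P.B) (v : Euc m) :
    1 / 2 * ‖v‖ ≤ ‖fderivWithin ℝ P.F P.B z v‖ := by
  have h1 := hG.norm_fderivWithin_sub_le hι hz v
  have h2 := norm_sub_norm_le (P.J v) (P.J v - fderivWithin ℝ P.F P.B z v)
  rw [sub_sub_cancel, P.J.norm_map, norm_sub_rev] at h2
  linarith

lemma IsGood.exists_N_eq {z : Euc m} (hz : z ∈ P.B) :
    ∃ e : Euc m ≃L[ℝ] Euc m, P.N z = e := by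
  have hinj : Function.Injective (P.N z).toLinearMap := by
    rw [injective_iff_map_eq_zero]
    intro v hv
    have h1 : inner ℝ (P.N z v) v = ‖fderivWithin ℝ P.F P.B z v‖ ^ 2 := by
      rw [N, ContinuousLinearMap.comp_apply, transposeL_inner, real_inner_self_eq_norm_sq]
    have hv' : P.N z v = 0 := hv
    rw [hv', inner_zero_left] at h1
    have h2 := hG.le_norm_fderivWithin hι hz v
    have h3 : ‖fderivWithin ℝ P.F P.B z v‖ = 0 := by
      have := h1.symm; simpa using this
    rw [h3] at h2
    exact norm_eq_zero.1 (le_antisymm (by linarith) (norm_nonneg _))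
  refine ⟨(LinearEquiv.ofInjectiveEndo _ hinj).toContinuousLinearEquiv, ?_⟩
  ext1 v
  rfl

lemma IsGood.Λ_fderivWithin {z : Euc m} (hz : z ∈ P.B) (v : Euc m) :
    P.Λ z (fderivWithin ℝ P.F P.B z v) = v := by
  obtain ⟨e, he⟩ := hG.exists_N_eq hι hz
  have h1 : P.Λ z (fderivWithin ℝ P.F P.B z v) = (P.N z).inverse (P.N z v) := rfl
  rw [h1, he, ContinuousLinearMap.inverse_equiv]
  simp

/-- These are the normal equations: `fderivWithin F ∘ Λ` is the orthogonal projection to the tangent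
space. -/
lemma IsGood.inner_sub_Λ {z : Euc m} (hz : z ∈ P.B) (w : Euc d) (v : Euc m) :
    inner ℝ (w - fderivWithin ℝ P.F P.B z (P.Λ z w)) (fderivWithin ℝ P.F P.B z v) = 0 := by
  obtain ⟨e, he⟩ := hG.exists_N_eq hι hz
  rw [← transposeL_inner, map_sub]
  have h1 : transposeL (fderivWithin ℝ P.F P.B z) (fderivWithin ℝ P.F P.B z (P.Λ z w))
      = P.N z ((P.N z).inverse (transposeL (fderivWithin ℝ P.F P.B z) w)) := rfl
  rw [h1, he, ContinuousLinearMap.inverse_equiv]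
  simp

lemma IsGood.Λ_eq_zero {z : Euc m} {w : Euc d}
    (h : ∀ v, inner ℝ w (fderivWithin ℝ P.F P.B z v) = 0) : P.Λ z w = 0 := by
  have : transposeL (fderivWithin ℝ P.F P.B z) w = 0 := by
    refine ext_inner_right ℝ fun v => ?_
    rw [transposeL_inner, h, inner_zero_left]
  rw [Λ, ContinuousLinearMap.comp_apply, this, map_zero]

lemma IsGood.contDiffOn_Λ : ContDiffOn ℝ ∞ P.Λ P.B := by
  have h1 := contDiffOn_fderivWithin_infty P.uniqueDiffOn_B (P.contDiffOn_F hι)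
  have h2 : ContDiffOn ℝ ∞ (fun z => transposeL (fderivWithin ℝ P.F P.B z)) P.B :=
    transposeL.contDiff.comp_contDiffOn h1
  have h3 : ContDiffOn ℝ ∞ P.N P.B := h2.clm_comp h1
  have h4 : ContDiffOn ℝ ∞ (fun z => (P.N z).inverse) P.B := by
    intro z hz
    obtain ⟨e, he⟩ := hG.exists_N_eq hι hz
    have h5 : ContDiffAt ℝ ∞ ContinuousLinearMap.inverse (P.N z) := by
      rw [he]; exact contDiffAt_map_inverse e
    exact h5.comp_contDiffWithinAt z (h3 z hz)
  exact h4.clm_comp h2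

lemma IsGood.contDiffOn_Hess {G : Type*} [NormedAddCommGroup G] [NormedSpace ℝ G] {g : Euc m → G}
    (hg : ContDiffOn ℝ ∞ g P.B) : ContDiffOn ℝ ∞ (P.Hess g) P.B := by
  have h1 := contDiffOn_fderivWithin_infty P.uniqueDiffOn_B hg
  have h2 := contDiffOn_D2 P.uniqueDiffOn_B hg
  have h3 := contDiffOn_D2 P.uniqueDiffOn_B (P.contDiffOn_F hι)
  have h4 : ContDiffOn ℝ ∞ (fun y => fderivWithin ℝ g P.B y ∘L P.Λ y) P.B :=
    h1.clm_comp (hG.contDiffOn_Λ hι)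
  have h5 : ContDiffOn ℝ ∞ (fun y => ContinuousLinearMap.compL ℝ (Euc m) (Euc d) G
      (fderivWithin ℝ g P.B y ∘L P.Λ y)) P.B :=
    ContDiffOn.clm_apply contDiffOn_const h4
  have h6 : ContDiffOn ℝ ∞ (fun y => (ContinuousLinearMap.compL ℝ (Euc m) (Euc d) G
      (fderivWithin ℝ g P.B y ∘L P.Λ y)) ∘L (D2 P.B P.F y)) P.B := h5.clm_comp h3
  exact h2.sub h6

end Good

/-- `c` is a geodesic in the coordinates of the patch, with velocity `c1`. -/
structure IsCoordGeodesic (c c1 : ℝ → Euc m) (s0 : ℝ) : Prop where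
  pos : 0 < s0
  mem : ∀ t ∈ Icc 0 s0, c t ∈ P.B
  smooth : ContDiffOn ℝ 2 c (Icc 0 s0)
  d1 : ∀ t ∈ Icc 0 s0, HasDerivWithinAt c (c1 t) (Icc 0 s0) t
  d2 : ∀ t ∈ Icc 0 s0,
    HasDerivWithinAt c1 (-(P.Λ (c t) (D2 P.B P.F (c t) (c1 t) (c1 t)))) (Icc 0 s0) t

section Good

variable {P} [IsManifold (𝓡∂ m) ∞ M] (hG : P.IsGood r)
  (hι : ContMDiff (𝓡∂ m) 𝓘(ℝ, Euc d) ∞ ι)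

include hG hι

/-- Picard-Lindelöf for the geodesic equation, written as a first order system in position and
velocity. The base point is interior so that the vector field is smooth on a full neighborhood of
the initial value. -/
lemma IsGood.exists_isCoordGeodesic {y : Euc m} (hy : y ∈ interior P.B) (v : Euc m) :
    ∃ (c c1 : ℝ → Euc m) (s0 : ℝ), P.IsCoordGeodesic c c1 s0 ∧ c 0 = y ∧ c1 0 = v := by
  let X : Euc m × Euc m → Euc m × Euc m :=
    fun p => (p.2, -(P.Λ p.1 (D2 P.B P.F p.1 p.2 p.2)))
  have hX : ContDiffOn ℝ ∞ X (P.B ×ˢ univ) := by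
    have h1 : ContDiffOn ℝ ∞ (fun p : Euc m × Euc m => P.Λ p.1) (P.B ×ˢ univ) :=
      (hG.contDiffOn_Λ hι).comp contDiffOn_fst (fun p hp => hp.1)
    have h2 : ContDiffOn ℝ ∞ (fun p : Euc m × Euc m => D2 P.B P.F p.1) (P.B ×ˢ univ) :=
      (contDiffOn_D2 P.uniqueDiffOn_B (P.contDiffOn_F hι)).comp contDiffOn_fst (fun p hp => hp.1)
    exact contDiffOn_snd.prodMk
      (h1.clm_apply ((h2.clm_apply contDiffOn_snd).clm_apply contDiffOn_snd)).neg
  have hnhds : P.B ×ˢ (univ : Set (Euc m)) ∈ 𝓝 (y, v) :=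
    prod_mem_nhds (mem_interior_iff_mem_nhds.1 hy) univ_mem
  obtain ⟨α, hα0, ε, hε, hα⟩ :=
    ContDiffAt.exists_forall_mem_closedBall_exists_eq_forall_mem_Ioo_hasDerivAt₀
      (((hX (y, v) ⟨interior_subset hy, mem_univ _⟩).contDiffAt hnhds).of_le
        (by exact_mod_cast le_top : (1 : WithTop ℕ∞) ≤ ∞)) 0
  have hcont : ContinuousAt α 0 := (hα 0 ⟨by linarith, by linarith⟩).continuousAt
  have hmem : ∀ᶠ t in 𝓝 (0 : ℝ), α t ∈ P.B ×ˢ (univ : Set (Euc m)) :=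
    hcont.eventually (by rw [hα0]; exact hnhds)
  obtain ⟨ρ, hρ, hmem⟩ := Metric.eventually_nhds_iff.1 hmem
  -- Halving both radii keeps the closed interval inside the interval of existence and the curve
  -- inside the patch.
  set s0 := min (ε / 2) (ρ / 2) with hs0
  have hs0pos : 0 < s0 := by positivity
  have hsub : ∀ t ∈ Icc 0 s0, t ∈ Ioo (0 - ε) (0 + ε) ∧ α t ∈ P.B ×ˢ (univ : Set (Euc m)) := by
    intro t ht
    have h1 : t ≤ ε / 2 := ht.2.trans (min_le_left _ _)
    have h2 : t ≤ ρ / 2 := ht.2.trans (min_le_right _ _)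
    refine ⟨⟨by linarith [ht.1], by linarith⟩, hmem ?_⟩
    rw [Real.dist_eq, sub_zero, abs_of_nonneg ht.1]; linarith
  have hd : ∀ t ∈ Icc 0 s0, HasDerivWithinAt α (X (α t)) (Icc 0 s0) t :=
    fun t ht => (hα t (hsub t ht).1).hasDerivWithinAt
  have hsm : ContDiffOn ℝ 2 α (Icc 0 s0) := by
    refine ODE.contDiffOn_enat_Icc_of_hasDerivWithinAt (n := 2) (f := fun _ => X)
      (u := P.B ×ˢ univ) ?_ hd (fun t ht => (hsub t ht).2)
    have : ContDiffOn ℝ ∞ (fun p : ℝ × (Euc m × Euc m) => X p.2)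
        (Icc 0 s0 ×ˢ (P.B ×ˢ univ)) := hX.comp contDiffOn_snd (fun p hp => hp.2)
    exact this.of_le (by exact_mod_cast le_top)
  refine ⟨fun t => (α t).1, fun t => (α t).2, s0, ⟨hs0pos, fun t ht => (hsub t ht).2.1,
    contDiff_fst.comp_contDiffOn hsm, fun t ht => ?_, fun t ht => ?_⟩, by simp [hα0], by simp [hα0]⟩
  · exact (hd t ht).fst
  · exact (hd t ht).snd

variable {c c1 : ℝ → Euc m} {s0 : ℝ} (hc : P.IsCoordGeodesic c c1 s0)
include hc

/-- The geodesic equation is homogeneous of degree two in the velocity. This brings short geodesics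
to the parameter interval `[0, 1]` required by `IsGeodesic`. -/
lemma IsCoordGeodesic.rescale {s : ℝ} (hs : 0 < s) (hs0 : s ≤ s0) :
    P.IsCoordGeodesic (fun t => c (s * t)) (fun t => s • c1 (s * t)) 1 := by
  have hmaps : MapsTo (fun t : ℝ => s * t) (Icc 0 1) (Icc 0 s0) := fun t ht =>
    ⟨mul_nonneg hs.le ht.1, by nlinarith [ht.2, ht.1]⟩
  have hlin : ∀ t, HasDerivWithinAt (fun t : ℝ => s * t) s (Icc 0 1) t := fun t => by
    simpa using ((hasDerivAt_id t).const_mul s).hasDerivWithinAt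
  refine ⟨one_pos, fun t ht => hc.mem _ (hmaps ht), ?_, fun t ht => ?_, fun t ht => ?_⟩
  · exact hc.smooth.comp (by fun_prop) hmaps
  · exact (hc.d1 _ (hmaps ht)).scomp t (hlin t) hmaps
  · have := ((hc.d2 _ (hmaps ht)).scomp t (hlin t) hmaps).const_smul s
    exact this.congr_deriv (by simp)

lemma IsCoordGeodesic.isGeodesic_one (h1 : s0 = 1) :
    IsGeodesic m ι (fun t => P.Ψ (c t)) ∧
    initialVelocity ι (fun t => P.Ψ (c t)) = fderivWithin ℝ P.F P.B (c 0) (c1 0) := by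
  subst h1
  have hF := P.contDiffOn_F hι
  have hmaps : MapsTo c (Icc 0 1) P.B := hc.mem
  have hu : UniqueDiffOn ℝ (Icc (0 : ℝ) 1) := uniqueDiffOn_Icc one_pos
  have e1 : ∀ t ∈ Icc (0 : ℝ) 1, derivWithin (ι ∘ fun t => P.Ψ (c t)) (Icc 0 1) t
      = fderivWithin ℝ P.F P.B (c t) (c1 t) := fun t ht =>
    (hasDerivWithinAt_comp_curve hF (hc.d1 t ht) hmaps ht).derivWithin (hu t ht)
  refine ⟨⟨(hF.of_le two_le_infty).comp hc.smooth hmaps, ?_⟩, e1 0 (by simp)⟩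
  intro t ht v hv
  rw [P.tangentSub_eq (hc.mem t ht) hι] at hv
  obtain ⟨w, rfl⟩ := hv
  -- The coordinate equation subtracts exactly the tangential part of the acceleration in `ℝᵈ`, so a
  -- normal vector is left.
  have e2 : iteratedDerivWithin 2 (ι ∘ fun t => P.Ψ (c t)) (Icc 0 1) t
      = D2 P.B P.F (c t) (c1 t) (c1 t)
        + fderivWithin ℝ P.F P.B (c t) (-(P.Λ (c t) (D2 P.B P.F (c t) (c1 t) (c1 t)))) := by
    rw [iteratedDerivWithin_succ, iteratedDerivWithin_one, derivWithin_congr e1 (e1 t ht)]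
    exact (hasDerivWithinAt_fderivWithin_curve P.uniqueDiffOn_B hF (hc.d1 t ht) (hc.d2 t ht)
      hmaps ht).derivWithin (hu t ht)
  rw [e2, map_neg, ← sub_eq_add_neg]
  exact hG.inner_sub_Λ hι (hc.mem t ht) _ w

lemma IsCoordGeodesic.isGeodesic {s : ℝ} (hs : 0 < s) (hs0 : s ≤ s0) :
    IsGeodesic m ι (fun t => P.Ψ (c (s * t))) ∧
    initialVelocity ι (fun t => P.Ψ (c (s * t))) = s • fderivWithin ℝ P.F P.B (c 0) (c1 0) := by
  have := (hc.rescale hG hι hs hs0).isGeodesic_one hG hι rfl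
  refine ⟨this.1, this.2.trans ?_⟩
  simp

/-- The acceleration of a geodesic supplies the Christoffel term of the Hessian, so no first order
term remains. -/
lemma IsCoordGeodesic.hasDerivWithinAt_comp {G : Type*} [NormedAddCommGroup G] [NormedSpace ℝ G]
    {g : Euc m → G} (hg : ContDiffOn ℝ ∞ g P.B) {t : ℝ} (ht : t ∈ Icc 0 s0) :
    HasDerivWithinAt (fun τ => fderivWithin ℝ g P.B (c τ) (c1 τ))
      (P.Hess g (c t) (c1 t) (c1 t)) (Icc 0 s0) t := by
  have := hasDerivWithinAt_fderivWithin_curve P.uniqueDiffOn_B hg (hc.d1 t ht) (hc.d2 t ht)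
      hc.mem ht
  rw [map_neg, ← sub_eq_add_neg] at this
  exact this

lemma IsCoordGeodesic.taylor {G : Type*} [NormedAddCommGroup G] [NormedSpace ℝ G]
    {g : Euc m → G} (hg : ContDiffOn ℝ ∞ g P.B) :
    (fun s => g (c s) - g (c 0) - s • fderivWithin ℝ g P.B (c 0) (c1 0)
      - (s ^ 2 / 2) • P.Hess g (c 0) (c1 0) (c1 0)) =o[𝓝[>] 0] fun s : ℝ => s ^ 2 := by
  have hu : UniqueDiffOn ℝ (Icc (0 : ℝ) s0) := uniqueDiffOn_Icc hc.pos
  have h0 : (0 : ℝ) ∈ Icc 0 s0 := ⟨le_rfl, hc.pos.le⟩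
  have hsm : ContDiffOn ℝ (2 : ℕ) (fun s => g (c s)) (Icc 0 s0) :=
    (hg.of_le two_le_infty).comp hc.smooth hc.mem
  have e1 : ∀ t ∈ Icc (0 : ℝ) s0, derivWithin (fun s => g (c s)) (Icc 0 s0) t
      = fderivWithin ℝ g P.B (c t) (c1 t) := fun t ht =>
    (hasDerivWithinAt_comp_curve hg (hc.d1 t ht) hc.mem ht).derivWithin (hu t ht)
  have e2 : iteratedDerivWithin 2 (fun s => g (c s)) (Icc 0 s0) 0
      = P.Hess g (c 0) (c1 0) (c1 0) := by
    rw [iteratedDerivWithin_succ, iteratedDerivWithin_one, derivWithin_congr e1 (e1 0 h0)]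
    exact (hc.hasDerivWithinAt_comp hG hι hg h0).derivWithin (hu 0 h0)
  have h := taylor_isLittleO (convex_Icc 0 s0) h0 hsm
  have hle : 𝓝[>] (0 : ℝ) ≤ 𝓝[Icc 0 s0] 0 :=
    nhdsWithin_le_of_mem (mem_of_superset (Ioc_mem_nhdsGT hc.pos) Ioc_subset_Icc_self)
  refine ((h.mono hle).congr_left fun s => ?_).congr_right fun s => ?_
  · rw [taylor_within_apply]
    simp only [Finset.sum_range_succ, Finset.sum_range_zero, iteratedDerivWithin_zero,
      iteratedDerivWithin_one, e1 0 h0, e2]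
    simp only [Nat.factorial, sub_zero]
    norm_num
    rw [sub_sub, sub_sub, add_assoc, one_div, div_eq_inv_mul]
  · simp

end Good

end Patch

/-! ### Expansions in normal coordinates -/

namespace Patch

variable {m d : ℕ} [NeZero m] {M : Type*} [TopologicalSpace M]
  [ChartedSpace (EuclideanHalfSpace m) M] {ι : M → Euc d} {x : M} {P : Patch m ι x}
  {r : ℝ} [IsManifold (𝓡∂ m) ∞ M] {U : M → M → Euc d}

section Jets

variable (hG : P.IsGood r) (hι : ContMDiff (𝓡∂ m) 𝓘(ℝ, Euc d) ∞ ι)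

lemma IsCoordGeodesic.tendsto_slope {c c1 : ℝ → Euc m} {s0 : ℝ}
    (hc : P.IsCoordGeodesic c c1 s0) :
    Tendsto (fun s => s⁻¹ • (c s - c 0)) (𝓝[>] 0) (𝓝 (c1 0)) := by
  have h := (hc.d1 0 ⟨le_rfl, hc.pos.le⟩)
  rw [hasDerivWithinAt_iff_tendsto_slope] at h
  have hle : 𝓝[>] (0 : ℝ) ≤ 𝓝[Icc 0 s0 \ {0}] 0 :=
    nhdsWithin_le_of_mem (mem_of_superset (Ioc_mem_nhdsGT hc.pos)
      fun s hs => ⟨Ioc_subset_Icc_self hs, fun h => hs.1.ne' h⟩)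
  refine (h.mono_left hle).congr fun s => ?_
  simp [slope_def_module]

lemma IsCoordGeodesic.isLittleO_sub {c c1 : ℝ → Euc m} {s0 : ℝ}
    (hc : P.IsCoordGeodesic c c1 s0) :
    (fun s => c s - c 0 - s • c1 0) =o[𝓝[>] 0] fun s : ℝ => s := by
  have h := (hc.d1 0 ⟨le_rfl, hc.pos.le⟩)
  rw [hasDerivWithinAt_iff_isLittleO] at h
  have hle : 𝓝[>] (0 : ℝ) ≤ 𝓝[Icc 0 s0] 0 :=
    nhdsWithin_le_of_mem (mem_of_superset (Ioc_mem_nhdsGT hc.pos) Ioc_subset_Icc_self)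
  simpa using h.mono hle

include hG hι

/-- For small `s` the rescaled geodesic has velocity shorter than `r`, so the defining property of
the normal coordinates applies to its endpoint. -/
lemma eventually_normalCoordinates_curve (hU : IsNormalCoordinates m ι r U) {c c1 : ℝ → Euc m}
    {s0 : ℝ} (hc : P.IsCoordGeodesic c c1 s0) :
    ∀ᶠ s in 𝓝[>] (0 : ℝ), U (P.Ψ (c 0)) (P.Ψ (c s)) = s • fderivWithin ℝ P.F P.B (c 0) (c1 0) := by
  have h1 : ∀ᶠ s in 𝓝[>] (0 : ℝ), ‖s • fderivWithin ℝ P.F P.B (c 0) (c1 0)‖ < r := by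
    have : Tendsto (fun s : ℝ => ‖s • fderivWithin ℝ P.F P.B (c 0) (c1 0)‖) (𝓝[>] 0) (𝓝 0) := by
      have : Continuous fun s : ℝ => ‖s • fderivWithin ℝ P.F P.B (c 0) (c1 0)‖ := by fun_prop
      simpa using (this.tendsto 0).mono_left nhdsWithin_le_nhds
    exact this.eventually (gt_mem_nhds hU.pos)
  filter_upwards [h1, Ioc_mem_nhdsGT hc.pos] with s hs hs0
  obtain ⟨g1, g2⟩ := hc.isGeodesic hG hι hs0.1 hs0.2
  have := hU.geodesic _ g1 (by rw [g2]; exact hs)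
  rw [g2] at this
  simpa using this

lemma contDiffOn_normalCoordinates (hU : IsNormalCoordinates m ι r U) :
    ContDiffOn ℝ ∞ (fun p : Euc m × Euc m => U (P.Ψ p.1) (P.Ψ p.2)) (P.B ×ˢ P.B) :=
  P.contDiffOn_pair hU.smooth hG.small

/-- Normal coordinates agree with the coordinates of the patch to first order. -/
lemma exists_normalCoordinates_sub_le (hU : IsNormalCoordinates m ι r U) :
    ∃ C > 0, ∃ δ > 0, ∀ y ∈ P.B, ∀ z ∈ P.B, ‖y‖ < δ → ‖z‖ < δ →
      ‖U (P.Ψ y) (P.Ψ z) - fderivWithin ℝ P.F P.B y (z - y)‖ ≤ C * ‖z - y‖ ^ 2 := by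
  have hR : ContDiffOn ℝ ∞ (fun p : Euc m × Euc m => U (P.Ψ p.1) (P.Ψ p.2)
      - fderivWithin ℝ P.F P.B p.1 (p.2 - p.1)) (P.B ×ˢ P.B) := by
    refine (contDiffOn_normalCoordinates hG hι hU).sub (ContDiffOn.clm_apply ?_ (by fun_prop))
    exact (contDiffOn_fderivWithin_infty P.uniqueDiffOn_B (P.contDiffOn_F hι)).comp
      contDiffOn_fst (fun p hp => hp.1)
  -- By the jet lemma it suffices to look along geodesics from interior points. There the normal
  -- coordinates are exactly linear in `s`, and `c s` is linear up to `o(s)`.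
  refine exists_norm_le_pow_of_curves P.convex_B P.interior_B_nonempty P.zero_mem (n := 1) hR ?_
  intro y hy v
  obtain ⟨c, c1, s0, hc, rfl, rfl⟩ := hG.exists_isCoordGeodesic hι hy v
  refine ⟨c, hc.tendsto_slope, ?_⟩
  have h1 := ((fderivWithin ℝ P.F P.B (c 0)).isBigO_comp (fun s => c s - c 0 - s • c1 0)
    (𝓝[>] 0)).trans_isLittleO hc.isLittleO_sub
  refine (h1.neg_left.congr' ?_ (by simp [EventuallyEq.rfl]))
  filter_upwards [eventually_normalCoordinates_curve hG hι hU hc] with s hs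
  rw [hs, map_sub, map_smul, neg_sub]

/-- Second order expansion of a function in normal coordinates. -/
lemma exists_expansion_le (hU : IsNormalCoordinates m ι r U) {G : Type*} [NormedAddCommGroup G]
    [NormedSpace ℝ G] {g : Euc m → G} (hg : ContDiffOn ℝ ∞ g P.B) :
    ∃ C > 0, ∃ δ > 0, ∀ y ∈ P.B, ∀ z ∈ P.B, ‖y‖ < δ → ‖z‖ < δ →
      ‖g z - g y - fderivWithin ℝ g P.B y (P.Λ y (U (P.Ψ y) (P.Ψ z)))
        - (1 / 2 : ℝ) • P.Hess g y (z - y) (z - y)‖ ≤ C * ‖z - y‖ ^ 3 := by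
  have hfst : MapsTo Prod.fst (P.B ×ˢ P.B) P.B := fun p hp => hp.1
  have hR : ContDiffOn ℝ ∞ (fun p : Euc m × Euc m => g p.2 - g p.1
      - fderivWithin ℝ g P.B p.1 (P.Λ p.1 (U (P.Ψ p.1) (P.Ψ p.2)))
      - (1 / 2 : ℝ) • P.Hess g p.1 (p.2 - p.1) (p.2 - p.1)) (P.B ×ˢ P.B) := by
    have h1 := hg.comp contDiffOn_fst hfst
    have h2 := hg.comp (contDiffOn_snd (s := P.B ×ˢ P.B)) (fun p hp => hp.2)
    have h3 := (contDiffOn_fderivWithin_infty P.uniqueDiffOn_B hg).comp contDiffOn_fst hfst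
    have h4 := (hG.contDiffOn_Λ hι).comp contDiffOn_fst hfst
    have h5 := (hG.contDiffOn_Hess hι hg).comp contDiffOn_fst hfst
    have h6 : ContDiffOn ℝ ∞ (fun p : Euc m × Euc m => p.2 - p.1) (P.B ×ˢ P.B) := by fun_prop
    exact ((h2.sub h1).sub (h3.clm_apply (h4.clm_apply
      (contDiffOn_normalCoordinates hG hι hU)))).sub (((h5.clm_apply h6).clm_apply h6).const_smul _)
  -- Along a geodesic `Λ` turns the normal coordinates into `s • c1 0`, so the first order terms
  -- cancel exactly, and the Hessian term matches the second order Taylor term up to `o(s ^ 2)`.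
  refine exists_norm_le_pow_of_curves P.convex_B P.interior_B_nonempty P.zero_mem (n := 2) hR ?_
  intro y hy v
  obtain ⟨c, c1, s0, hc, rfl, rfl⟩ := hG.exists_isCoordGeodesic hι hy v
  refine ⟨c, hc.tendsto_slope, ?_⟩
  have hyB := interior_subset hy
  have h1 := hc.taylor hG hι hg
  have h2 : (fun s => P.Hess g (c 0) (c s - c 0) (c s - c 0)
      - s ^ 2 • P.Hess g (c 0) (c1 0) (c1 0)) =o[𝓝[>] 0] fun s : ℝ => s ^ 2 := by
    have e1 : Tendsto (fun s => P.Hess g (c 0) (s⁻¹ • (c s - c 0)) (s⁻¹ • (c s - c 0))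
        - P.Hess g (c 0) (c1 0) (c1 0)) (𝓝[>] 0) (𝓝 0) := by
      have hcont : Continuous fun w : Euc m => P.Hess g (c 0) w w := by fun_prop
      have := ((hcont.tendsto _).comp hc.tendsto_slope).sub
        (tendsto_const_nhds (x := P.Hess g (c 0) (c1 0) (c1 0)))
      simpa using this
    have e2 := (isBigO_refl (fun s : ℝ => s ^ 2) (𝓝[>] 0)).smul_isLittleO
      ((isLittleO_one_iff ℝ).2 e1)
    refine e2.congr' ?_ (by simp)
    filter_upwards [self_mem_nhdsWithin] with s hs
    have hs' : s ≠ 0 := ne_of_gt hs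
    rw [smul_sub, map_smul, map_smul, _root_.smul_apply, smul_smul, smul_smul]
    rw [show s ^ 2 * s⁻¹ * s⁻¹ = 1 by field_simp, one_smul]
  refine ((h1.sub (h2.const_smul_left (1 / 2 : ℝ))).congr' ?_ EventuallyEq.rfl)
  filter_upwards [eventually_normalCoordinates_curve hG hι hU hc] with s hs
  rw [hs, map_smul, map_smul, hG.Λ_fderivWithin hι hyB]
  rw [Pi.smul_apply, smul_sub, smul_smul, show (1 / 2 : ℝ) * s ^ 2 = s ^ 2 / 2 by ring]
  abel

end Jets

/-! ### Isometric charts are affine in normal coordinates -/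

section Isometric

variable (hι : ContMDiff (𝓡∂ m) 𝓘(ℝ, Euc d) ∞ ι) (hG : P.IsGood r)
  {φ : M → Euc m} (hφ : IsIsometricChart ι φ)
include hι hφ

lemma norm_fderivWithin_chart {z : Euc m} (hz : z ∈ P.B) (v : Euc m) :
    ‖fderivWithin ℝ (fun z => φ (P.Ψ z)) P.B z v‖ = ‖fderivWithin ℝ P.F P.B z v‖ := by
  rw [P.fderivWithin_comp_Ψ hφ.1 hz]
  have : fderivWithin ℝ P.F P.B z = _ := P.fderivWithin_comp_Ψ hι hz
  rw [this]
  exact hφ.2.2 _ _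

include hG

/-- The Hessian of an isometric chart vanishes. -/
lemma Hess_chart_eq_zero {z : Euc m} (hz : z ∈ P.B) (u v : Euc m) :
    P.Hess (fun z => φ (P.Ψ z)) z u v = 0 := by
  set g : Euc m → Euc m := fun z => φ (P.Ψ z) with hg
  have hgs : ContDiffOn ℝ ∞ g P.B := P.contDiffOn_comp hφ.1
  have hF := P.contDiffOn_F hι
  have hin : ∀ z ∈ P.B, ∀ u v, inner ℝ (fderivWithin ℝ g P.B z u) (fderivWithin ℝ g P.B z v)
      = inner ℝ (fderivWithin ℝ P.F P.B z u) (fderivWithin ℝ P.F P.B z v) := by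
    intro z hz u v
    rw [real_inner_eq_norm_mul_self_add_norm_mul_self_sub_norm_sub_mul_self_div_two,
      real_inner_eq_norm_mul_self_add_norm_mul_self_sub_norm_sub_mul_self_div_two,
      ← map_sub, ← map_sub, norm_fderivWithin_chart hι hφ hz, norm_fderivWithin_chart hι hφ hz,
      norm_fderivWithin_chart hι hφ hz]
  have hinj : Function.Injective (fderivWithin ℝ g P.B z).toLinearMap := by
    rw [injective_iff_map_eq_zero]
    intro w hw
    have h1 := hG.le_norm_fderivWithin hι hz w
    rw [← norm_fderivWithin_chart hι hφ hz] at h1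
    have hw' : fderivWithin ℝ g P.B z w = 0 := hw
    rw [hw', norm_zero] at h1
    exact norm_eq_zero.1 (le_antisymm (by linarith) (norm_nonneg _))
  have hsurj := LinearMap.injective_iff_surjective.1 hinj
  -- The vectors to test against are all of the form `dg w`. By the Koszul formula the pairing of
  -- the Hessian with `dg w` is that of the normal part of `D2 F` with the tangent vector `dF w`.
  refine ext_inner_right ℝ fun w => ?_
  obtain ⟨w, rfl⟩ := hsurj w
  change inner ℝ (P.Hess g z u v) (fderivWithin ℝ g P.B z w) = _
  rw [Hess_apply, inner_sub_left, hin z hz, inner_zero_left,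
    inner_D2_eq_of_inner_eq P.convex_B P.interior_B_nonempty hgs hF hin hz, ← inner_sub_left]
  exact hG.inner_sub_Λ hι hz _ w

/-- The second derivative of the chart along the geodesic is its Hessian at the velocity, which is
zero; so its velocity is constant. -/
lemma IsCoordGeodesic.chart_eq {c c1 : ℝ → Euc m} {s0 : ℝ} (hc : P.IsCoordGeodesic c c1 s0) :
    ∀ s ∈ Icc 0 s0, φ (P.Ψ (c s)) = φ (P.Ψ (c 0))
      + s • fderivWithin ℝ (fun z => φ (P.Ψ z)) P.B (c 0) (c1 0) := by
  have hgs : ContDiffOn ℝ ∞ (fun z => φ (P.Ψ z)) P.B := P.contDiffOn_comp hφ.1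
  have hu : UniqueDiffOn ℝ (Icc (0 : ℝ) s0) := uniqueDiffOn_Icc hc.pos
  have h1 : ∀ t ∈ Icc 0 s0, HasDerivWithinAt
      (fun τ => fderivWithin ℝ (fun z => φ (P.Ψ z)) P.B (c τ) (c1 τ)) 0 (Icc 0 s0) t := by
    intro t ht
    have := hc.hasDerivWithinAt_comp hG hι hgs ht
    rwa [Hess_chart_eq_zero hι hG hφ (hc.mem t ht)] at this
  have h2 := constant_of_derivWithin_zero (fun t ht => (h1 t ht).differentiableWithinAt)
    (fun t ht => (h1 t (Ico_subset_Icc_self ht)).derivWithin (hu t (Ico_subset_Icc_self ht)))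
  have h3 : ∀ t ∈ Icc 0 s0, HasDerivWithinAt (fun τ => φ (P.Ψ (c τ))
      - τ • fderivWithin ℝ (fun z => φ (P.Ψ z)) P.B (c 0) (c1 0)) 0 (Icc 0 s0) t := by
    intro t ht
    have e1 := hasDerivWithinAt_comp_curve hgs (hc.d1 t ht) hc.mem ht
    rw [h2 t ht] at e1
    have e2 := ((hasDerivAt_id t).smul_const
      (fderivWithin ℝ (fun z => φ (P.Ψ z)) P.B (c 0) (c1 0))).hasDerivWithinAt (s := Icc 0 s0)
    exact (e1.sub e2).congr_deriv (by simp)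
  have h4 := constant_of_derivWithin_zero (fun t ht => (h3 t ht).differentiableWithinAt)
    (fun t ht => (h3 t (Ico_subset_Icc_self ht)).derivWithin (hu t (Ico_subset_Icc_self ht)))
  intro s hs
  have := h4 s hs
  simp only [zero_smul, sub_zero] at this
  rw [← this]; abel

/-- An isometric chart is an affine function of normal coordinates, to high order. -/
lemma exists_chart_expansion_le (hU : IsNormalCoordinates m ι r U) (n : ℕ) :
    ∃ C > 0, ∃ δ > 0, ∀ y ∈ P.B, ∀ z ∈ P.B, ‖y‖ < δ → ‖z‖ < δ →
      ‖φ (P.Ψ z) - φ (P.Ψ y) - fderivWithin ℝ (fun z => φ (P.Ψ z)) P.B y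
        (P.Λ y (U (P.Ψ y) (P.Ψ z)))‖ ≤ C * ‖z - y‖ ^ (n + 1) := by
  have hgs : ContDiffOn ℝ ∞ (fun z => φ (P.Ψ z)) P.B := P.contDiffOn_comp hφ.1
  have hfst : MapsTo Prod.fst (P.B ×ˢ P.B) P.B := fun p hp => hp.1
  have hR : ContDiffOn ℝ ∞ (fun p : Euc m × Euc m => φ (P.Ψ p.2) - φ (P.Ψ p.1)
      - fderivWithin ℝ (fun z => φ (P.Ψ z)) P.B p.1 (P.Λ p.1 (U (P.Ψ p.1) (P.Ψ p.2))))
      (P.B ×ˢ P.B) := by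
    have h1 := hgs.comp contDiffOn_fst hfst
    have h2 := hgs.comp (contDiffOn_snd (s := P.B ×ˢ P.B)) (fun p hp => hp.2)
    have h3 := (contDiffOn_fderivWithin_infty P.uniqueDiffOn_B hgs).comp contDiffOn_fst hfst
    have h4 := (hG.contDiffOn_Λ hι).comp contDiffOn_fst hfst
    exact (h2.sub h1).sub (h3.clm_apply (h4.clm_apply (contDiffOn_normalCoordinates hG hι hU)))
  refine exists_norm_le_pow_of_curves P.convex_B P.interior_B_nonempty P.zero_mem (n := n) hR ?_
  intro y hy v
  obtain ⟨c, c1, s0, hc, rfl, rfl⟩ := hG.exists_isCoordGeodesic hι hy v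
  refine ⟨c, hc.tendsto_slope, ?_⟩
  -- Along short geodesics the remainder is identically zero, so the jet lemma applies with any
  -- order `n`.
  refine (isLittleO_zero _ _).congr' ?_ EventuallyEq.rfl
  filter_upwards [eventually_normalCoordinates_curve hG hι hU hc, Ioc_mem_nhdsGT hc.pos]
    with s hs hs0
  rw [hs, map_smul, map_smul, hG.Λ_fderivWithin hι (interior_subset hy),
    hc.chart_eq hι hG hφ s (Ioc_subset_Icc_self hs0)]
  abel

omit hι hφ in
/-- A geodesic in the coordinates of a patch. -/
lemma hasDerivWithinAt_geodesic (hι : ContMDiff (𝓡∂ m) 𝓘(ℝ, Euc d) ∞ ι) {S : Set ℝ}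
    (hS : UniqueDiffOn ℝ S) {γ : ℝ → M} (hγ : MapsTo γ S (P.Ψ '' P.B)) (hγc : ContinuousOn γ S)
    {b1 b2 : ℝ → Euc d} (h1 : ∀ t ∈ S, HasDerivWithinAt (ι ∘ γ) (b1 t) S t)
    (h2 : ∀ t ∈ S, HasDerivWithinAt b1 (b2 t) S t)
    (ho : ∀ t ∈ S, ∀ v ∈ tangentSub m ι (γ t), inner ℝ (b2 t) v = 0)
    {G : Type*} [NormedAddCommGroup G] [NormedSpace ℝ G] {g : Euc m → G}
    (hg : ContDiffOn ℝ ∞ g P.B) {t : ℝ} (ht : t ∈ S) :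
    HasDerivWithinAt (fun τ => g (P.ξ (γ τ)))
      (fderivWithin ℝ g P.B (P.ξ (γ t)) (P.Λ (P.ξ (γ t)) (b1 t))) S t ∧
    HasDerivWithinAt (fun τ => fderivWithin ℝ g P.B (P.ξ (γ τ)) (P.Λ (P.ξ (γ τ)) (b1 τ)))
      (P.Hess g (P.ξ (γ t)) (P.Λ (P.ξ (γ t)) (b1 t)) (P.Λ (P.ξ (γ t)) (b1 t))) S t := by
  have hF := P.contDiffOn_F hι
  set c : ℝ → Euc m := fun τ => P.ξ (γ τ) with hcdef
  have hcm : MapsTo c S P.B := fun τ hτ => P.ξ_mem (hγ hτ)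
  have hcc : ContinuousOn c S := P.continuousOn_ξ_image.comp hγc hγ
  have hFc : ∀ τ ∈ S, P.F (c τ) = ι (γ τ) := fun τ hτ => by
    rw [F, hcdef]; simp only [P.Ψ_ξ (hγ hτ)]
  -- `Λ` is a left inverse of the derivative of `F`, so differentiability of the curve in `ℝᵈ`
  -- passes to its coordinates, even where it touches the boundary.
  have hc1 : ∀ τ ∈ S, HasDerivWithinAt c (P.Λ (c τ) (b1 τ)) S τ := by
    intro τ hτ
    have e1 : HasFDerivWithinAt P.F (fderivWithin ℝ P.F P.B (c τ)) P.B (c τ) :=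
      ((hF.differentiableOn (by simp)) _ (hcm hτ)).hasFDerivWithinAt
    have e2 := HasFDerivWithinAt.of_comp_of_leftInverse (f'symm := P.Λ (c τ))
      ((hcc τ hτ).tendsto_nhdsWithin hcm) e1 (h1 τ hτ).hasFDerivWithinAt
      (by filter_upwards [self_mem_nhdsWithin] with σ hσ using hFc σ hσ)
      (hG.Λ_fderivWithin hι (hcm hτ)) hτ
    exact e2.hasDerivWithinAt.congr_deriv (by simp)
  let c1 : ℝ → Euc m := fun τ => P.Λ (c τ) (b1 τ)
  have hb1 : ∀ τ ∈ S, b1 τ = fderivWithin ℝ P.F P.B (c τ) (P.Λ (c τ) (b1 τ)) := by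
    intro τ hτ
    have e1 := hasDerivWithinAt_comp_curve (c1 := c1) hF (hc1 τ hτ) hcm hτ
    exact (hS τ hτ).eq_deriv _ (h1 τ hτ) (e1.congr (fun σ hσ => (hFc σ hσ).symm) (hFc τ hτ).symm)
  refine ⟨hasDerivWithinAt_comp_curve (c1 := c1) hg (hc1 t ht) hcm ht, ?_⟩
  have hΛ := ((hG.contDiffOn_Λ hι).differentiableOn (by simp) _ (hcm ht)).hasFDerivWithinAt
  have e3 := (hΛ.comp_hasDerivWithinAt t (hc1 t ht) hcm).clm_apply (h2 t ht)
  -- The acceleration is normal, and `Λ` vanishes on normal vectors.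
  have hΛ0 : P.Λ (c t) (b2 t) = 0 := hG.Λ_eq_zero hι fun v => by
    refine ho t ht _ ?_
    have := P.tangentSub_eq (hcm ht) hι
    simp only [hcdef, P.Ψ_ξ (hγ ht)] at this
    rw [this]; exact ⟨v, rfl⟩
  rw [Function.comp_apply, hΛ0, add_zero] at e3
  set c2 := fderivWithin ℝ P.Λ P.B (c t) (P.Λ (c t) (b1 t)) (b1 t)
  have e3' : HasDerivWithinAt (fun τ => P.Λ (c τ) (b1 τ)) c2 S t := e3
  have e4 := hasDerivWithinAt_fderivWithin_curve (c1 := c1) P.uniqueDiffOn_B hF (hc1 t ht) e3' hcm ht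
  have e5 := (hS t ht).eq_deriv _ (h2 t ht) (e4.congr hb1 (hb1 t ht))
  -- Applying `Λ` to the two expressions of the acceleration yields the geodesic equation in
  -- coordinates.
  have e6 : c2 = -P.Λ (c t) (D2 P.B P.F (c t) (P.Λ (c t) (b1 t)) (P.Λ (c t) (b1 t))) := by
    have := congrArg (P.Λ (c t)) e5
    rw [hΛ0, map_add, hG.Λ_fderivWithin hι (hcm ht)] at this
    exact eq_neg_of_add_eq_zero_right this.symm
  have e7 := hasDerivWithinAt_fderivWithin_curve (c1 := c1) P.uniqueDiffOn_B hg (hc1 t ht) e3' hcm ht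
  rw [e6, map_neg, ← sub_eq_add_neg] at e7
  exact e7

end Isometric

section Geodesic

variable (hι : Manifold.IsSmoothEmbedding (𝓡∂ m) 𝓘(ℝ, Euc d) ∞ ι) {φ : M → Euc m}
  (hφ : IsIsometricChart ι φ)
include hι hφ

/-- An isometric chart is affine along geodesics. -/
lemma chart_geodesic {γ : ℝ → M} (hγ : IsGeodesic m ι γ) {Q : Patch m ι (γ 0)} (hQ : Q.IsGood r)
    (hr : 0 < r) :
    φ (γ 1) = φ (γ 0) + fderivWithin ℝ (fun z => φ (Q.Ψ z)) Q.B 0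
      (Q.Λ 0 (initialVelocity ι γ)) := by
  have hιc := hι.contMDiff
  have hu : UniqueDiffOn ℝ (Icc (0 : ℝ) 1) := uniqueDiffOn_Icc one_pos
  have hγc : ContinuousOn γ (Icc 0 1) := by
    rw [hι.isEmbedding.continuousOn_iff]
    exact hγ.1.continuousOn
  set b1 := derivWithin (ι ∘ γ) (Icc 0 1) with hb1
  set b2 := iteratedDerivWithin 2 (ι ∘ γ) (Icc 0 1) with hb2
  have h1 : ∀ t ∈ Icc (0 : ℝ) 1, HasDerivWithinAt (ι ∘ γ) (b1 t) (Icc 0 1) t := fun t ht =>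
    (hγ.1.differentiableOn (by simp) t ht).hasDerivWithinAt
  have h2 : ∀ t ∈ Icc (0 : ℝ) 1, HasDerivWithinAt b1 (b2 t) (Icc 0 1) t := by
    intro t ht
    have e1 : DifferentiableOn ℝ b1 (Icc 0 1) :=
      (ContDiffOn.derivWithin (m := 1) hγ.1 hu (by norm_num)).differentiableOn (by simp)
    have e3 := (e1 t ht).hasDerivWithinAt
    rw [hb2, iteratedDerivWithin_succ]
    have e2 : iteratedDerivWithin 1 (ι ∘ γ) (Icc 0 1) = b1 := by
      rw [iteratedDerivWithin_one]
    rw [e2]; exact e3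
  -- A geodesic may leave any single patch, so the vanishing of the second derivative of `φ ∘ γ` at
  -- `t` is read off in a patch centered at `γ t`.
  have key : ∀ t ∈ Icc (0 : ℝ) 1, ∀ Q : Patch m ι (γ t), Q.IsGood r →
      HasDerivWithinAt (φ ∘ γ) (fderivWithin ℝ (fun z => φ (Q.Ψ z)) Q.B 0 (Q.Λ 0 (b1 t)))
        (Icc 0 1) t ∧ HasDerivWithinAt (derivWithin (φ ∘ γ) (Icc 0 1)) 0 (Icc 0 1) t := by
    intro t ht Q hQ
    set S := Icc (0 : ℝ) 1 ∩ γ ⁻¹' (Q.Ψ '' Q.B) with hS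
    -- `S` is relatively open in `[0, 1]`, so derivatives within `S` and within `[0, 1]` agree at
    -- its points.
    have hSn : ∀ τ ∈ S, S ∈ 𝓝[Icc 0 1] τ := fun τ hτ =>
      inter_mem self_mem_nhdsWithin ((hγc τ hτ.1) (Q.isOpen_image.mem_nhds hτ.2))
    have hSu : UniqueDiffOn ℝ S := fun τ hτ => by
      rw [uniqueDiffWithinAt_congr (t := Icc 0 1)]
      · exact hu τ hτ.1
      · exact le_antisymm (nhdsWithin_mono _ inter_subset_left) (nhdsWithin_le_of_mem (hSn τ hτ))
    have htS : t ∈ S := ⟨ht, mem_preimage.2 (mem_of_mem_nhds Q.image_mem_nhds)⟩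
    have hgs : ContDiffOn ℝ ∞ (fun z => φ (Q.Ψ z)) Q.B := Q.contDiffOn_comp hφ.1
    have hloc := fun τ (hτ : τ ∈ S) => hasDerivWithinAt_geodesic hQ hιc hSu (γ := γ)
      (fun τ hτ => hτ.2) (hγc.mono inter_subset_left)
      (fun τ hτ => (h1 τ hτ.1).mono inter_subset_left)
      (fun τ hτ => (h2 τ hτ.1).mono inter_subset_left) (fun τ hτ => hγ.2 τ hτ.1) hgs hτ
    have d1 : ∀ τ ∈ S, HasDerivWithinAt (φ ∘ γ) (fderivWithin ℝ (fun z => φ (Q.Ψ z)) Q.B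
        (Q.ξ (γ τ)) (Q.Λ (Q.ξ (γ τ)) (b1 τ))) (Icc 0 1) τ := fun τ hτ =>
      (((hloc τ hτ).1.congr (fun σ hσ => by simp [Q.Ψ_ξ hσ.2]) (by simp [Q.Ψ_ξ hτ.2]))
        ).mono_of_mem_nhdsWithin (hSn τ hτ)
    have d2 := (hloc t htS).2
    rw [Hess_chart_eq_zero hιc hQ hφ (Q.ξ_mem htS.2)] at d2
    refine ⟨by simpa [Q.ξ_base] using d1 t htS, ?_⟩
    exact (d2.congr (fun τ hτ => (d1 τ hτ).derivWithin (hu τ hτ.1))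
      ((d1 t htS).derivWithin (hu t ht))).mono_of_mem_nhdsWithin (hSn t htS)
  have key2 : ∀ t ∈ Icc (0 : ℝ) 1, DifferentiableWithinAt ℝ (φ ∘ γ) (Icc 0 1) t ∧
      HasDerivWithinAt (derivWithin (φ ∘ γ) (Icc 0 1)) 0 (Icc 0 1) t := by
    intro t ht
    obtain ⟨Q, hQ⟩ := exists_isGood_patch hι hr (γ t)
    exact ⟨(key t ht Q hQ).1.differentiableWithinAt, (key t ht Q hQ).2⟩
  have h3 := constant_of_derivWithin_zero (fun t ht => (key2 t ht).2.differentiableWithinAt)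
    (fun t ht => (key2 t (Ico_subset_Icc_self ht)).2.derivWithin (hu t (Ico_subset_Icc_self ht)))
  set w := derivWithin (φ ∘ γ) (Icc 0 1) 0 with hw
  have h4 : ∀ t ∈ Icc (0 : ℝ) 1, HasDerivWithinAt (fun τ => φ (γ τ) - τ • w) 0 (Icc 0 1) t := by
    intro t ht
    have e1 := (key2 t ht).1.hasDerivWithinAt
    rw [h3 t ht] at e1
    exact (e1.sub ((hasDerivAt_id t).smul_const w).hasDerivWithinAt).congr_deriv (by simp)
  have h5 := constant_of_derivWithin_zero (fun t ht => (h4 t ht).differentiableWithinAt)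
    (fun t ht => (h4 t (Ico_subset_Icc_self ht)).derivWithin (hu t (Ico_subset_Icc_self ht)))
    1 (by simp)
  have h6 : w = _ := (key 0 (by simp) Q hQ).1.derivWithin (hu 0 (by simp))
  simp only [one_smul, zero_smul, sub_zero] at h5
  rw [← h5, h6]
  simp [initialVelocity, hb1]

end Geodesic

/-! ### The boundary condition for affine functions of an isometric chart -/

section Condition

variable (hι : Manifold.IsSmoothEmbedding (𝓡∂ m) 𝓘(ℝ, Euc d) ∞ ι) {φ : M → Euc m}
  (hφ : IsIsometricChart ι φ) {f : M → ℝ} {a : Euc m} {b : ℝ} (hf : ∀ z, f z = b + inner ℝ a (φ z))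
include hφ hf

lemma contMDiff_affine_chart : ContMDiff (𝓡∂ m) 𝓘(ℝ, ℝ) ∞ f := by
  have h1 : ContDiff ℝ ∞ (fun v : Euc m => b + inner ℝ a v) :=
    contDiff_const.add (contDiff_const.inner ℝ contDiff_id)
  have : f = (fun v : Euc m => b + inner ℝ a v) ∘ φ := funext hf
  rw [this]
  exact h1.contMDiff.comp hφ.1

include hι

lemma Hess_affine_chart_eq_zero {x : M} {Q : Patch m ι x} (hQ : Q.IsGood r) (u v : Euc m) :
    Q.Hess (fun z => f (Q.Ψ z)) 0 u v = 0 := by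
  have hgs : ContDiffOn ℝ ∞ (fun z => φ (Q.Ψ z)) Q.B := Q.contDiffOn_comp hφ.1
  have h1 : ∀ z ∈ Q.B, fderivWithin ℝ (fun z => f (Q.Ψ z)) Q.B z
      = (innerSL ℝ a).comp (fderivWithin ℝ (fun z => φ (Q.Ψ z)) Q.B z) := by
    intro z hz
    have e1 := ((hgs.differentiableOn (by simp)) z hz).hasFDerivWithinAt
    have e2 := ((innerSL ℝ a).hasFDerivAt.comp_hasFDerivWithinAt z e1).const_add b
    refine HasFDerivWithinAt.fderivWithin (e2.congr (fun y _ => ?_) ?_) (Q.uniqueDiffOn_B z hz)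
    · simp [hf]
    · simp [hf]
  have h2 : D2 Q.B (fun z => f (Q.Ψ z)) 0 u v
      = inner ℝ a (D2 Q.B (fun z => φ (Q.Ψ z)) 0 u v) := by
    have e1 := ((contDiffOn_fderivWithin_infty Q.uniqueDiffOn_B hgs).differentiableOn (by simp) 0
      Q.zero_mem).hasFDerivWithinAt
    have e2 := (e1.clm_apply (hasFDerivWithinAt_const v 0 Q.B))
    have e3 := (innerSL ℝ a).hasFDerivAt.comp_hasFDerivWithinAt 0 e2
    have e4 := (((contDiffOn_fderivWithin_infty Q.uniqueDiffOn_B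
      (Q.contDiffOn_comp (contMDiff_affine_chart hφ hf))).differentiableOn (by simp) 0
      Q.zero_mem).hasFDerivWithinAt).clm_apply (hasFDerivWithinAt_const v 0 Q.B)
    have e5 := (Q.uniqueDiffOn_B 0 Q.zero_mem).eq e4 (e3.congr (fun y hy => by simp [h1 y hy])
      (by simp [h1 0 Q.zero_mem]))
    simpa [D2] using congrArg (fun T => T u) e5
  rw [Hess_apply, h2, h1 0 Q.zero_mem]
  have := Hess_chart_eq_zero hι.contMDiff hQ hφ Q.zero_mem u v
  rw [Hess_apply] at this
  change inner ℝ a _ - inner ℝ a _ = 0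
  rw [← inner_sub_right]
  exact (congrArg (fun w => inner ℝ a w) this).trans (inner_zero_right a)

lemma secondDeriv_affine_chart (hr : 0 < r) (x : M) (v : Euc m) : secondDeriv ι f x v = 0 := by
  obtain ⟨Q, hQ⟩ := exists_isGood_patch hι hr x
  have := Q.secondDeriv_eq hι.contMDiff (contMDiff_affine_chart hφ hf) (Q.L.symm v)
  rw [Hess_affine_chart_eq_zero hι hφ hf hQ] at this
  simpa using this

lemma laplaceBeltrami_affine_chart (hr : 0 < r) (x : M) : laplaceBeltrami m ι f x = 0 := by
  obtain ⟨Q, hQ⟩ := exists_isGood_patch hι hr x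
  rw [Q.laplaceBeltrami_eq hι.contMDiff (contMDiff_affine_chart hφ hf)]
  exact Finset.sum_eq_zero fun a _ => Hess_affine_chart_eq_zero hι hφ hf hQ _ _

end Condition

end Patch

open scoped NNReal ENNReal

/-! ### Volume in the coordinates of a patch -/

section Hausdorff

variable {X Y : Type*} [EMetricSpace X] [MeasurableSpace X] [BorelSpace X]
  [EMetricSpace Y] [MeasurableSpace Y] [BorelSpace Y]

lemma euclideanHausdorffMeasure_image_le {f : X → Y} {s : Set X} {K : ℝ≥0}
    (h : LipschitzOnWith K f s) (m : ℕ) :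
    (μHE[m] : Measure Y) (f '' s) ≤ (K : ℝ≥0∞) ^ m * (μHE[m] : Measure X) s := by
  have := h.hausdorffMeasure_image_le (d := m) (by positivity)
  rw [Measure.euclideanHausdorffMeasure_def, Measure.euclideanHausdorffMeasure_def,
    Measure.smul_apply, Measure.smul_apply, mul_smul_comm]
  rw [ENNReal.rpow_natCast] at this
  gcongr

end Hausdorff

section Sandwich

variable {Ω : Type*} [MeasurableSpace Ω] {μ ν : Measure Ω} {θ K : ℝ} {A : Set Ω} {Φ : Ω → ℝ}

/-- Integrals against two measures that are close to each other. -/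
lemma setIntegral_sub_le_of_measure_le (hA : MeasurableSet A) (hθ : 0 ≤ θ) (hθ1 : θ ≤ 1)
    (h1 : ν.restrict A ≤ ENNReal.ofReal (1 + θ) • μ.restrict A)
    (h2 : ENNReal.ofReal (1 - θ) * μ A ≤ ν A) (hμ : μ A ≠ ⊤)
    (hΦ : StronglyMeasurable Φ) (hK : ∀ z ∈ A, |Φ z| ≤ K) :
    ∫ z in A, Φ z ∂ν - ∫ z in A, Φ z ∂μ ≤ 3 * θ * K * μ.real A := by
  rcases A.eq_empty_or_nonempty with rfl | ⟨a, ha⟩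
  · simp
  have hK0 : 0 ≤ K := (abs_nonneg _).trans (hK a ha)
  have hνA : ν A ≤ ENNReal.ofReal (1 + θ) * μ A := by
    have := h1 A
    simpa using this
  have hν : ν A ≠ ⊤ := ne_top_of_le_ne_top (ENNReal.mul_ne_top ENNReal.ofReal_ne_top hμ) hνA
  have hIμ : IntegrableOn Φ A μ := Measure.integrableOn_of_bounded hμ hΦ.aestronglyMeasurable
    (M := K) (by filter_upwards [ae_restrict_mem hA] with z hz using hK z hz)
  have hIν : IntegrableOn Φ A ν := Measure.integrableOn_of_bounded hν hΦ.aestronglyMeasurable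
    (M := K) (by filter_upwards [ae_restrict_mem hA] with z hz using hK z hz)
  have hcμ : IntegrableOn (fun _ => K) A μ := integrableOn_const hμ
  have hcν : IntegrableOn (fun _ => K) A ν := integrableOn_const hν
  -- Adding `K` makes the integrand nonnegative, so the inequality of measures can be integrated. In
  -- the final constant `3 θ` one `θ` comes from the integral of `Φ` and two from the masses.
  have key : ∫ z in A, (Φ z + K) ∂ν ≤ (1 + θ) * ∫ z in A, (Φ z + K) ∂μ := by
    have e1 := integral_mono_measure (f := fun z => Φ z + K) h1
      (by filter_upwards [Measure.ae_smul_measure (ae_restrict_mem hA) _] with z hz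
          have := abs_le.1 (hK z hz); simp; linarith)
      ((hIμ.add hcμ).smul_measure ENNReal.ofReal_ne_top)
    rwa [integral_smul_measure, ENNReal.toReal_ofReal (by linarith)] at e1
  rw [integral_add hIν hcν, integral_add hIμ hcμ] at key
  simp only [setIntegral_const, smul_eq_mul] at key
  have h2' : (1 - θ) * μ.real A ≤ ν.real A := by
    have := ENNReal.toReal_mono hν h2
    rwa [ENNReal.toReal_mul, ENNReal.toReal_ofReal (by linarith)] at this
  have h3 : ∫ z in A, Φ z ∂μ ≤ K * μ.real A := by
    have := norm_setIntegral_le_of_norm_le_const (f := Φ) hμ.lt_top hK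
    exact (le_abs_self _).trans this
  have hμ0 : 0 ≤ μ.real A := measureReal_nonneg
  nlinarith [mul_le_mul_of_nonneg_left h3 hθ, mul_le_mul_of_nonneg_left h2' hK0]

lemma abs_setIntegral_sub_le_of_measure_le (hA : MeasurableSet A) (hθ : 0 ≤ θ) (hθ1 : θ ≤ 1)
    (h1 : ν.restrict A ≤ ENNReal.ofReal (1 + θ) • μ.restrict A)
    (h2 : ENNReal.ofReal (1 - θ) * μ A ≤ ν A) (hμ : μ A ≠ ⊤)
    (hΦ : StronglyMeasurable Φ) (hK : ∀ z ∈ A, |Φ z| ≤ K) :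
    |∫ z in A, Φ z ∂ν - ∫ z in A, Φ z ∂μ| ≤ 3 * θ * K * μ.real A := by
  rw [abs_le']
  refine ⟨setIntegral_sub_le_of_measure_le hA hθ hθ1 h1 h2 hμ hΦ hK, ?_⟩
  have := setIntegral_sub_le_of_measure_le hA hθ hθ1 h1 h2 hμ hΦ.neg (K := K)
    (fun z hz => by simpa using hK z hz)
  simp only [Pi.neg_apply, integral_neg] at this
  linarith

end Sandwich

section Volume

variable {m d : ℕ} [NeZero m] {M : Type*} [TopologicalSpace M]
  [ChartedSpace (EuclideanHalfSpace m) M] {ι : M → Euc d} [IsManifold (𝓡∂ m) ∞ M]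
  [CompactSpace M] [MeasurableSpace M] [BorelSpace M]
  (hι : Manifold.IsSmoothEmbedding (𝓡∂ m) 𝓘(ℝ, Euc d) ∞ ι)
include hι

lemma isClosedEmbedding_of_isSmoothEmbedding 
    : Topology.IsClosedEmbedding ι :=
  ⟨hι.isEmbedding, (isCompact_range hι.isEmbedding.continuous).isClosed⟩

lemma vol_apply (s : Set M) : vol m ι s = (μHE[m] : Measure (Euc d)) (ι '' s) :=
  (isClosedEmbedding_of_isSmoothEmbedding hι).measurableEmbedding.comap_apply _ s

namespace Patch

variable {x : M} {P : Patch m ι x} {r : ℝ}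

/-- `F` is `(1 + ε)`-Lipschitz on `A`, and on `ℝᵐ` the normalized Hausdorff measure is Lebesgue
measure. -/
lemma vol_image_le {A : Set (Euc m)} {ε : ℝ} (hε : 0 ≤ ε)
    (h : ∀ y ∈ A, ∀ z ∈ A, ‖P.F z - P.F y - P.J (z - y)‖ ≤ ε * ‖z - y‖) :
    vol m ι (P.Ψ '' A) ≤ ENNReal.ofReal (1 + ε) ^ m * volume A := by
  have h1 : LipschitzOnWith (1 + ε).toNNReal P.F A := by
    refine LipschitzOnWith.of_dist_le_mul fun z hz y hy => ?_
    rw [Real.coe_toNNReal _ (by linarith), dist_eq_norm, dist_eq_norm]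
    have := norm_add_le (P.F z - P.F y - P.J (z - y)) (P.J (z - y))
    rw [sub_add_cancel, P.J.norm_map] at this
    linarith [h y hy z hz]
  rw [vol_apply hι, image_image, ← EuclideanSpace.euclideanHausdorffMeasure_eq_volume]
  exact euclideanHausdorffMeasure_image_le h1 m

/-- The inverse of `F` on the image of `A` is Lipschitz with constant `(1 - ε)⁻¹`. -/
lemma le_vol_image {A : Set (Euc m)} {ε : ℝ} (hε : ε < 1)
    (h : ∀ y ∈ A, ∀ z ∈ A, ‖P.F z - P.F y - P.J (z - y)‖ ≤ ε * ‖z - y‖) :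
    volume A ≤ ENNReal.ofReal (1 - ε)⁻¹ ^ m * vol m ι (P.Ψ '' A) := by
  have hlow : ∀ y ∈ A, ∀ z ∈ A, (1 - ε) * ‖z - y‖ ≤ ‖P.F z - P.F y‖ := by
    intro y hy z hz
    have := norm_sub_norm_le (P.J (z - y)) (P.J (z - y) - (P.F z - P.F y))
    rw [sub_sub_cancel, P.J.norm_map, norm_sub_rev (P.J (z - y))] at this
    linarith [h y hy z hz]
  have h0 : (0 : ℝ) < 1 - ε := by linarith
  have hinj : InjOn P.F A := by
    intro z hz y hy hzy
    have := hlow y hy z hz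
    rw [hzy, sub_self, norm_zero] at this
    have h2 : ‖z - y‖ ≤ 0 := by nlinarith [norm_nonneg (z - y)]
    exact sub_eq_zero.1 (norm_le_zero_iff.1 h2)
  have h1 : LipschitzOnWith (1 - ε)⁻¹.toNNReal (Function.invFunOn P.F A) (P.F '' A) := by
    refine LipschitzOnWith.of_dist_le_mul ?_
    rintro _ ⟨z, hz, rfl⟩ _ ⟨y, hy, rfl⟩
    rw [hinj.leftInvOn_invFunOn hz, hinj.leftInvOn_invFunOn hy,
      Real.coe_toNNReal _ (by positivity), dist_eq_norm, dist_eq_norm, inv_mul_eq_div,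
      le_div_iff₀ h0, mul_comm]
    exact hlow y hy z hz
  have h2 := euclideanHausdorffMeasure_image_le h1 m
  rw [hinj.leftInvOn_invFunOn.image_image, EuclideanSpace.euclideanHausdorffMeasure_eq_volume] at h2
  rw [vol_apply hι, image_image]
  exact h2

/-- The volume measure in the coordinates of a patch. -/
def ν (P : Patch m ι x) : Measure (Euc m) := ((vol m ι).restrict (P.Ψ '' P.B)).map P.ξ

omit hι [CompactSpace M] in
lemma aemeasurable_ξ : AEMeasurable P.ξ ((vol m ι).restrict (P.Ψ '' P.B)) :=
  P.continuousOn_ξ_image.aemeasurable P.isOpen_image.measurableSet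

omit hι [CompactSpace M] in
lemma ν_apply {A : Set (Euc m)} (hA : MeasurableSet A) (hAB : A ⊆ P.B) :
    P.ν A = vol m ι (P.Ψ '' A) := by
  rw [ν, Measure.map_apply_of_aemeasurable aemeasurable_ξ hA,
    Measure.restrict_apply₀' P.isOpen_image.measurableSet.nullMeasurableSet]
  congr 1
  ext q
  constructor
  · rintro ⟨h1, h2⟩; exact ⟨P.ξ q, h1, P.Ψ_ξ h2⟩
  · rintro ⟨z, hz, rfl⟩; exact ⟨by rw [mem_preimage, P.ξ_Ψ (hAB hz)]; exact hz, z, hAB hz, rfl⟩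

omit hι [CompactSpace M] in
lemma ν_restrict_B : P.ν.restrict P.B = P.ν := by
  refine Measure.restrict_eq_self_of_ae_mem ?_
  refine (ae_map_iff (p := (· ∈ P.B)) aemeasurable_ξ P.measurableSet_B).2 ?_
  filter_upwards [ae_restrict_mem P.isOpen_image.measurableSet] with q hq using P.ξ_mem hq

omit hι [CompactSpace M] in
lemma aemeasurable_Ψ : AEMeasurable P.Ψ P.ν := by
  rw [← ν_restrict_B]
  exact P.continuousOn_Ψ.aemeasurable P.measurableSet_B

omit hι [CompactSpace M] in
/-- Change of variables. -/
lemma setIntegral_image_eq {g : M → ℝ} (hg : StronglyMeasurable g) {A : Set (Euc m)}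
    (hA : MeasurableSet A) (hAB : A ⊆ P.B) :
    ∫ q in P.Ψ '' A, g q ∂(vol m ι) = ∫ z in A, g (P.Ψ z) ∂P.ν := by
  have h1 : AEStronglyMeasurable (fun z => g (P.Ψ z)) P.ν :=
    (hg.measurable.comp_aemeasurable aemeasurable_Ψ).aestronglyMeasurable
  have h2 : P.Ψ '' A = P.ξ ⁻¹' A ∩ P.Ψ '' P.B := by
    ext q
    constructor
    · rintro ⟨z, hz, rfl⟩
      exact ⟨by rw [mem_preimage, P.ξ_Ψ (hAB hz)]; exact hz, z, hAB hz, rfl⟩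
    · rintro ⟨h1, h2⟩; exact ⟨P.ξ q, h1, P.Ψ_ξ h2⟩
  have h3 : NullMeasurableSet (P.ξ ⁻¹' A) ((vol m ι).restrict (P.Ψ '' P.B)) :=
    aemeasurable_ξ.nullMeasurable hA
  have h1' := h1
  rw [ν] at h1' ⊢
  rw [setIntegral_map hA h1' aemeasurable_ξ, Measure.restrict_restrict₀ h3, ← h2]
  have h4 : ∀ᵐ q ∂((vol m ι).restrict (P.Ψ '' P.B)), P.Ψ (P.ξ q) = q := by
    filter_upwards [ae_restrict_mem P.isOpen_image.measurableSet] with q hq using P.Ψ_ξ hq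
  refine integral_congr_ae ?_
  filter_upwards [ae_restrict_of_ae_restrict_of_subset (image_mono hAB) h4] with q hq
  rw [hq]

/-- Near the base point the volume measure is close to Lebesgue measure. -/
lemma exists_ν_bounds {θ : ℝ} (hθ : 0 < θ) : ∃ ρ > 0, ∀ A : Set (Euc m), MeasurableSet A →
    A ⊆ P.B → (∀ z ∈ A, ‖z‖ < ρ) →
    P.ν A ≤ ENNReal.ofReal (1 + θ) * volume A ∧ ENNReal.ofReal (1 - θ) * volume A ≤ P.ν A := by
  -- A metric distortion `1 ± ε` distorts volume by its `m`-th power, so `ε` is taken small in terms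
  -- of `θ`.
  have h1 : ∀ᶠ ε in 𝓝[>] (0 : ℝ), (1 + ε) ^ m < 1 + θ := by
    have : Continuous fun ε : ℝ => (1 + ε) ^ m := by fun_prop
    refine ((this.tendsto 0).mono_left nhdsWithin_le_nhds).eventually (gt_mem_nhds ?_)
    simpa using hθ
  have h2 : ∀ᶠ ε in 𝓝[>] (0 : ℝ), 1 - θ < (1 - ε) ^ m := by
    have : Continuous fun ε : ℝ => (1 - ε) ^ m := by fun_prop
    refine ((this.tendsto 0).mono_left nhdsWithin_le_nhds).eventually (lt_mem_nhds ?_)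
    simpa using hθ
  obtain ⟨ε, ⟨hε1, hε2⟩, hε0, hε⟩ := ((h1.and h2).and (Ioo_mem_nhdsGT one_pos)).exists
  obtain ⟨ρ, hρ, h⟩ := P.exists_approx hι.contMDiff hε0
  refine ⟨ρ, hρ, fun A hA hAB hAρ => ?_⟩
  have hF : ∀ y ∈ A, ∀ z ∈ A, ‖P.F z - P.F y - P.J (z - y)‖ ≤ ε * ‖z - y‖ := fun y hy z hz =>
    h y (hAB hy) z (hAB hz) (hAρ y hy) (hAρ z hz)
  rw [ν_apply hA hAB]
  constructor
  · refine (vol_image_le hι hε0.le hF).trans ?_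
    gcongr
    rw [← ENNReal.ofReal_pow (by linarith)]
    exact ENNReal.ofReal_le_ofReal hε1.le
  · have h3 := le_vol_image hι hε hF
    have h4 : (0 : ℝ) < 1 - ε := by linarith
    calc ENNReal.ofReal (1 - θ) * volume A
        ≤ ENNReal.ofReal ((1 - ε) ^ m) *
          (ENNReal.ofReal (1 - ε)⁻¹ ^ m * vol m ι (P.Ψ '' A)) := by gcongr
      _ = vol m ι (P.Ψ '' A) := by
          rw [← mul_assoc, ← ENNReal.ofReal_pow (by positivity), ← ENNReal.ofReal_mul (by positivity),
            ← mul_pow, mul_inv_cancel₀ h4.ne']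
          simp

lemma IsGood.ν_le (hG : P.IsGood r) {A : Set (Euc m)} (hA : MeasurableSet A) (hAB : A ⊆ P.B) :
    P.ν A ≤ 2 ^ m * volume A := by
  rw [ν_apply hA hAB]
  refine (vol_image_le hι (by norm_num) fun y hy z hz => hG.approx y (hAB hy) z (hAB hz)).trans ?_
  gcongr
  rw [← ENNReal.ofReal_ofNat]
  exact ENNReal.ofReal_le_ofReal (by norm_num)

lemma IsGood.le_ν (hG : P.IsGood r) {A : Set (Euc m)} (hA : MeasurableSet A) (hAB : A ⊆ P.B) :
    volume A ≤ 2 ^ m * P.ν A := by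
  rw [ν_apply hA hAB]
  refine (le_vol_image hι (ε := 1 / 2) (by norm_num) fun y hy z hz =>
    hG.approx y (hAB hy) z (hAB hz)).trans ?_
  gcongr
  rw [← ENNReal.ofReal_ofNat]
  exact ENNReal.ofReal_le_ofReal (by norm_num)

lemma IsGood.vol_image_lt_top (hG : P.IsGood r) : vol m ι (P.Ψ '' P.B) < ⊤ := by
  rw [← ν_apply P.measurableSet_B subset_rfl]
  refine (hG.ν_le hι P.measurableSet_B subset_rfl).trans_lt ?_
  refine ENNReal.mul_lt_top (by simp) ?_
  refine (measure_mono (t := Metric.ball 0 P.δ) fun z hz => ?_).trans_lt measure_ball_lt_top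
  exact mem_ball_zero_iff.2 hz.2

end Patch

namespace Patch

variable {x : M} {P : Patch m ι x}

/-- The half space. -/
def _root_.ManifoldLearning.halfSpace (m : ℕ) [NeZero m] : Set (Euc m) := {z | 0 < z 0}

omit [TopologicalSpace M] [ChartedSpace (EuclideanHalfSpace m) M] [IsManifold (𝓡∂ m) ∞ M]
  [CompactSpace M] [MeasurableSpace M] [BorelSpace M] hι in
lemma _root_.ManifoldLearning.ae_apply_zero_ne : ∀ᵐ z : Euc m, z 0 ≠ 0 := by
  let p : Euc m →ₗ[ℝ] ℝ := (EuclideanSpace.proj (0 : Fin m) : Euc m →L[ℝ] ℝ).toLinearMap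
  have hp : LinearMap.ker p ≠ ⊤ := by
    rw [Ne, LinearMap.ker_eq_top]
    intro h
    have : p (coordVec 0) = 0 := by rw [h]; rfl
    simp [p, coordVec] at this
  have := Measure.addHaar_submodule volume (LinearMap.ker p) hp
  rw [ae_iff]
  refine measure_mono_null (fun z hz => ?_) this
  simpa [p] using hz

/-- The limit of an integral that concentrates at a boundary point. -/
lemma tendsto_scaled_integral (hB : ∀ z, z ∈ P.B ↔ 0 ≤ z 0 ∧ ‖z‖ < P.δ) {Φ : ℝ → M → ℝ}
    {Φ0 : Euc m → ℝ} {C K : ℝ} (hm : ∀ᶠ h in 𝓝[>] (0 : ℝ), StronglyMeasurable (Φ h))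
    (hK : ∀ᶠ h in 𝓝[>] (0 : ℝ), ∀ q, |Φ h q| ≤ K)
    (hs : ∀ᶠ h in 𝓝[>] (0 : ℝ), ∀ q, Φ h q ≠ 0 → q ∈ P.Ψ '' P.B ∧ ‖P.ξ q‖ ≤ C * h)
    (hl : ∀ᵐ z : Euc m, 0 < z 0 → Tendsto (fun h : ℝ => Φ h (P.Ψ (h • z))) (𝓝[>] 0) (𝓝 (Φ0 z))) :
    Tendsto (fun h => (h ^ m)⁻¹ * ∫ q, Φ h q ∂(vol m ι)) (𝓝[>] 0)
      (𝓝 (∫ z in halfSpace m, Φ0 z)) := by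
  classical
  obtain ⟨C', hC', hCC⟩ : ∃ C' > 0, C ≤ C' := ⟨max C 1, by positivity, le_max_left _ _⟩
  let A : ℝ → Set (Euc m) := fun h => P.B ∩ Metric.closedBall 0 (C' * h)
  have hAm : ∀ h, MeasurableSet (A h) := fun h =>
    P.measurableSet_B.inter Metric.isClosed_closedBall.measurableSet
  have hAB : ∀ h, A h ⊆ P.B := fun h => inter_subset_left
  have hAv : ∀ h, volume (A h) ≠ ⊤ := fun h =>
    ne_top_of_le_ne_top (measure_closedBall_lt_top (x := (0 : Euc m)) (r := C' * h)).ne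
      (measure_mono inter_subset_right)
  have hmh : MeasurableSet (halfSpace m) :=
    (isOpen_lt continuous_const (by fun_prop : Continuous fun z : Euc m => z 0)).measurableSet
  have hpos : ∀ᶠ h in 𝓝[>] (0 : ℝ), 0 < h := self_mem_nhdsWithin
  set κ : ℝ := volume.real (Metric.closedBall (0 : Euc m) C') with hκ
  have hAle : ∀ h, 0 < h → volume.real (A h) ≤ h ^ m * κ := by
    intro h hh
    have e1 : volume.real (A h) ≤ volume.real (Metric.closedBall (0 : Euc m) (C' * h)) :=
      measureReal_mono inter_subset_right measure_closedBall_lt_top.ne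
    refine e1.trans (le_of_eq ?_)
    rw [hκ, mul_comm C' h, measureReal_def, measureReal_def,
      Measure.addHaar_closedBall_mul volume (0 : Euc m) hh.le hC'.le, ENNReal.toReal_mul,
      ENNReal.toReal_ofReal (by positivity)]
    simp
  have h1 : ∀ᶠ h in 𝓝[>] (0 : ℝ), ∫ q, Φ h q ∂(vol m ι) = ∫ z in A h, Φ h (P.Ψ z) ∂P.ν := by
    filter_upwards [hm, hs, hpos] with h hm hs hh
    rw [← setIntegral_image_eq hm (hAm h) (hAB h)]
    refine (setIntegral_eq_integral_of_forall_compl_eq_zero fun q hq => ?_).symm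
    by_contra hne
    obtain ⟨hq1, hq2⟩ := hs q hne
    exact hq ⟨P.ξ q, ⟨P.ξ_mem hq1, mem_closedBall_zero_iff.2 (hq2.trans (by gcongr))⟩, P.Ψ_ξ hq1⟩
  -- The integrand after the substitution `z ↦ h • z`, whose Jacobian is the factor `h ^ m`.
  let G : ℝ → Euc m → ℝ := fun h z => if h • z ∈ A h then Φ h (P.Ψ (h • z)) else 0
  have hind : ∀ h, StronglyMeasurable (Φ h) →
      StronglyMeasurable ((A h).indicator fun z => Φ h (P.Ψ z)) := by
    intro h hm
    have e1 : Measurable ((A h).domRestrict P.Ψ) :=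
      (continuousOn_iff_continuous_domRestrict.1 (P.continuousOn_Ψ.mono (hAB h))).measurable
    refine (measurable_of_restrict_of_restrict_compl (hAm h) ?_ ?_).stronglyMeasurable
    · have : (A h).domRestrict ((A h).indicator fun z => Φ h (P.Ψ z)) = fun z =>
          Φ h ((A h).domRestrict P.Ψ z) := by
        ext z; simp [Set.domRestrict_apply, z.2]
      rw [this]; exact hm.measurable.comp e1
    · have : (A h)ᶜ.domRestrict ((A h).indicator fun z => Φ h (P.Ψ z)) = fun _ => 0 := by
        ext z
        have := z.2
        rw [Set.domRestrict_apply, Set.indicator_of_notMem this]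
      rw [this]; exact measurable_const
  have h2 : ∀ h, 0 < h → (h ^ m)⁻¹ * ∫ z in A h, Φ h (P.Ψ z) = ∫ z, G h z := by
    intro h hh
    rw [← integral_indicator (hAm h)]
    have := Measure.integral_comp_smul volume ((A h).indicator fun z => Φ h (P.Ψ z)) h
    rw [finrank_euclideanSpace_fin, abs_of_pos (by positivity), smul_eq_mul] at this
    rw [← this]
    exact integral_congr_ae (Eventually.of_forall fun z => by simp [G, Set.indicator])
  -- Dominated convergence: all `G h` live on the ball of radius `C'` and are bounded by `K`.
  have h3 : Tendsto (fun h => ∫ z, G h z) (𝓝[>] 0) (𝓝 (∫ z in halfSpace m, Φ0 z)) := by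
    rw [← integral_indicator hmh]
    refine tendsto_integral_filter_of_dominated_convergence
      ((Metric.closedBall (0 : Euc m) C').indicator fun _ => K) ?_ ?_ ?_ ?_
    · filter_upwards [hm] with h hm
      have : G h = ((A h).indicator fun z => Φ h (P.Ψ z)) ∘ fun z => h • z := by
        ext z; simp [G, Set.indicator]
      rw [this]
      exact ((hind h hm).comp_measurable (measurable_const_smul h)).aestronglyMeasurable
    · filter_upwards [hK, hpos] with h hK hh
      refine Eventually.of_forall fun z => ?_
      simp only [G]
      split_ifs with hz
      · have : z ∈ Metric.closedBall (0 : Euc m) C' := by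
          have := mem_closedBall_zero_iff.1 hz.2
          rw [norm_smul, Real.norm_of_nonneg hh.le, mul_comm] at this
          exact mem_closedBall_zero_iff.2 (le_of_mul_le_mul_right this hh)
        rw [Set.indicator_of_mem this]
        exact hK _
      · rw [norm_zero]
        exact Set.indicator_nonneg (fun _ _ => (abs_nonneg _).trans (hK x)) _
    · exact (integrable_indicator_iff Metric.isClosed_closedBall.measurableSet).2
        (integrableOn_const measure_closedBall_lt_top.ne)
    -- The hyperplane `z 0 = 0` is null. Above it `h • z` lies in the patch for small `h`; below it
    -- never does, and the integrand is zero.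
    · filter_upwards [hl, ae_apply_zero_ne] with z hz hz0
      by_cases hp : 0 < z 0
      · rw [Set.indicator_of_mem (show z ∈ halfSpace m from hp)]
        refine (hz hp).congr' ?_
        have hsmall : ∀ᶠ h in 𝓝[>] (0 : ℝ), ‖h • z‖ < P.δ := by
          have : Continuous fun h : ℝ => ‖h • z‖ := by fun_prop
          refine ((this.tendsto 0).mono_left nhdsWithin_le_nhds).eventually (gt_mem_nhds ?_)
          simpa using P.δ_pos
        filter_upwards [hs, hpos, hsmall] with h hs hh hsm
        simp only [G]
        split_ifs with hA
        · rfl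
        · by_contra hne
          refine hA ⟨(hB _).2 ⟨?_, hsm⟩, ?_⟩
          · simpa using (mul_pos hh hp).le
          · have hmem : h • z ∈ P.B := (hB _).2 ⟨by simpa using (mul_pos hh hp).le, hsm⟩
            have := (hs _ hne).2
            rw [P.ξ_Ψ hmem] at this
            exact mem_closedBall_zero_iff.2 (this.trans (by gcongr))
      · rw [Set.indicator_of_notMem (show z ∉ halfSpace m from hp)]
        refine tendsto_const_nhds.congr' ?_
        filter_upwards [hpos] with h hh
        have : h • z ∉ A h := by
          intro hA
          have := ((hB _).1 hA.1).1
          have h3 : z 0 < 0 := lt_of_le_of_ne (not_lt.1 hp) hz0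
          simp only [PiLp.smul_apply, smul_eq_mul] at this
          nlinarith
        simp [G, this]
  -- Replacing `ν` by Lebesgue measure costs at most `3 θ K κ`, where `θ` is arbitrary because the
  -- sets `A h` shrink to the base point.
  have h4 : Tendsto (fun h => (h ^ m)⁻¹ * ((∫ z in A h, Φ h (P.Ψ z) ∂P.ν)
      - ∫ z in A h, Φ h (P.Ψ z))) (𝓝[>] 0) (𝓝 0) := by
    rw [Metric.tendsto_nhds]
    intro ε hε
    have hK0 : 0 ≤ K := by
      obtain ⟨h, hh⟩ := hK.exists
      exact (abs_nonneg _).trans (hh x)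
    obtain ⟨θ, hθ, hθ1, hθε⟩ : ∃ θ : ℝ, 0 < θ ∧ θ ≤ 1 ∧ 3 * θ * K * κ < ε := by
      have hκ0 : 0 ≤ κ := measureReal_nonneg
      refine ⟨min 1 (ε / (3 * K * κ + 1) / 2), by positivity, min_le_left _ _, ?_⟩
      have h1 : min 1 (ε / (3 * K * κ + 1) / 2) ≤ ε / (3 * K * κ + 1) / 2 := min_le_right _ _
      have h2 : ε / (3 * K * κ + 1) / 2 * (3 * K * κ + 1) = ε / 2 := by field_simp
      have h3 : 0 ≤ 3 * K * κ := by positivity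
      have h4 := mul_le_mul_of_nonneg_right h1 h3
      have h5 : 0 < ε / (3 * K * κ + 1) / 2 := by positivity
      nlinarith
    obtain ⟨ρ, hρ, hν⟩ := exists_ν_bounds hι (P := P) hθ
    have hsmall : ∀ᶠ h in 𝓝[>] (0 : ℝ), C' * h < ρ := by
      have : Continuous fun h : ℝ => C' * h := by fun_prop
      refine ((this.tendsto 0).mono_left nhdsWithin_le_nhds).eventually (gt_mem_nhds ?_)
      simpa using hρ
    filter_upwards [hm, hK, hpos, hsmall] with h hm hK hh hsm
    have hAρ : ∀ z ∈ A h, ‖z‖ < ρ := fun z hz => (mem_closedBall_zero_iff.1 hz.2).trans_lt hsm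
    have e0 : ∀ μ : Measure (Euc m), ∫ z in A h, Φ h (P.Ψ z) ∂μ
        = ∫ z in A h, ((A h).indicator fun z => Φ h (P.Ψ z)) z ∂μ := fun μ =>
      setIntegral_congr_fun (hAm h) fun z hz => by rw [Set.indicator_of_mem hz]
    have e1 := abs_setIntegral_sub_le_of_measure_le (μ := volume) (ν := P.ν) (K := K) (hAm h) hθ.le
      hθ1 (Measure.le_iff.2 fun S hS => by
        rw [Measure.restrict_apply hS, Measure.smul_apply, Measure.restrict_apply hS]
        exact (hν _ (hS.inter (hAm h)) (inter_subset_right.trans (hAB h))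
          (fun z hz => hAρ z hz.2)).1) (hν _ (hAm h) (hAB h) hAρ).2 (hAv h) (hind h hm)
      (fun z hz => by rw [Set.indicator_of_mem hz]; exact hK _)
    rw [← e0, ← e0] at e1
    rw [Real.dist_eq, sub_zero, abs_mul, abs_of_pos (by positivity : 0 < (h ^ m)⁻¹)]
    calc (h ^ m)⁻¹ * _ ≤ (h ^ m)⁻¹ * (3 * θ * K * (h ^ m * κ)) := by
          refine mul_le_mul_of_nonneg_left (e1.trans ?_) (by positivity)
          exact mul_le_mul_of_nonneg_left (hAle h hh) (by positivity)
      _ = 3 * θ * K * κ := by field_simp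
      _ < ε := hθε
  have h5 := h4.add h3
  rw [zero_add] at h5
  refine h5.congr' ?_
  filter_upwards [h1, hpos] with h e1 hh
  rw [e1, ← h2 h hh]
  ring

end Patch

lemma isFiniteMeasure_vol : IsFiniteMeasure (vol m ι) := by
  choose P hP using fun x : M => Patch.exists_isGood_patch (r := 1) hι one_pos x
  obtain ⟨t, ht⟩ := isCompact_univ.elim_nhds_subcover (fun x => (P x).Ψ '' (P x).B)
    (fun x _ => (P x).image_mem_nhds)
  refine ⟨(measure_mono ht.2).trans_lt ?_⟩
  exact (measure_biUnion_finset_le _ _).trans_lt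
    (ENNReal.sum_lt_top.2 fun x _ => (hP x).vol_image_lt_top hι)

/-- The interior of a patch is dense in it, so a nonempty open set contains the image of a nonempty
open coordinate set, whose Lebesgue measure is at most `2 ^ m` times its volume. -/
lemma isOpenPosMeasure_vol : (vol m ι).IsOpenPosMeasure := by
  refine ⟨fun O hO ⟨x, hx⟩ h0 => ?_⟩
  obtain ⟨P, hP⟩ := Patch.exists_isGood_patch (r := 1) hι one_pos x
  have h1 : ContinuousOn P.Ψ (interior P.B) := P.continuousOn_Ψ.mono interior_subset
  have hA : IsOpen (interior P.B ∩ P.Ψ ⁻¹' O) := h1.isOpen_inter_preimage isOpen_interior hO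
  have hAB : interior P.B ∩ P.Ψ ⁻¹' O ⊆ P.B := inter_subset_left.trans interior_subset
  have h2 : (interior P.B ∩ P.Ψ ⁻¹' O).Nonempty := by
    have h3 : ∀ᶠ z in 𝓝[P.B] 0, P.Ψ z ∈ O := by
      have := P.continuousOn_Ψ 0 P.zero_mem
      rw [ContinuousWithinAt, P.Ψ_zero] at this
      exact this (hO.mem_nhds hx)
    have h4 : (0 : Euc m) ∈ closure (interior P.B) := by
      rw [P.convex_B.closure_interior_eq_closure_of_nonempty_interior P.interior_B_nonempty]
      exact subset_closure P.zero_mem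
    have h5 := mem_closure_iff_nhdsWithin_neBot.1 h4
    obtain ⟨z, hz1, hz2⟩ := ((h3.filter_mono (nhdsWithin_mono _ interior_subset)).and
      self_mem_nhdsWithin).exists
    exact ⟨z, hz2, hz1⟩
  have h3 := hA.measure_pos volume h2
  have h4 := hP.le_ν hι hA.measurableSet hAB
  rw [Patch.ν_apply hA.measurableSet hAB] at h4
  have h5 : vol m ι (P.Ψ '' (interior P.B ∩ P.Ψ ⁻¹' O)) = 0 := by
    refine measure_mono_null ?_ h0
    rintro _ ⟨z, hz, rfl⟩; exact hz.2
  rw [h5, mul_zero] at h4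
  exact h3.not_ge h4

end Volume

/-! ### Polynomial functions of bounded degree -/

section PolyFun

/-- Evaluation of polynomials, as a linear map. -/
def polyEval (n : ℕ) : MvPolynomial (Fin n) ℝ →ₗ[ℝ] (Euc n → ℝ) where
  toFun P u := MvPolynomial.eval (fun i => u i) P
  map_add' P Q := by ext u; simp
  map_smul' c P := by ext u; simp [MvPolynomial.smul_eval]

/-- The polynomial functions of degree at most `k`. -/
def polyFun (n k : ℕ) : Submodule ℝ (Euc n → ℝ) :=
  (MvPolynomial.restrictTotalDegree (Fin n) ℝ k).map (polyEval n)

variable {n k : ℕ}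

instance : FiniteDimensional ℝ (polyFun n k) := by unfold polyFun; infer_instance

lemma mem_polyFun {f : Euc n → ℝ} : f ∈ polyFun n k ↔ ∃ P : MvPolynomial (Fin n) ℝ,
    P.totalDegree ≤ k ∧ ∀ u, f u = MvPolynomial.eval (fun i => u i) P := by
  constructor
  · rintro ⟨P, hP, rfl⟩
    exact ⟨P, (MvPolynomial.mem_restrictTotalDegree _ _ _).1 hP, fun u => rfl⟩
  · rintro ⟨P, hP, h⟩
    exact ⟨P, (MvPolynomial.mem_restrictTotalDegree _ _ _).2 hP, (funext h).symm⟩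

lemma continuous_of_mem_polyFun {f : Euc n → ℝ} (hf : f ∈ polyFun n k) : Continuous f := by
  obtain ⟨P, -, h⟩ := mem_polyFun.1 hf
  rw [funext h]
  exact (MvPolynomial.continuous_eval P).comp (by fun_prop)

lemma const_mem_polyFun (c : ℝ) : (fun _ : Euc n => c) ∈ polyFun n k :=
  mem_polyFun.2 ⟨MvPolynomial.C c, by simp, fun u => by simp⟩

lemma apply_mem_polyFun (i : Fin n) : (fun u : Euc n => u i) ∈ polyFun n 1 :=
  mem_polyFun.2 ⟨MvPolynomial.X i, (MvPolynomial.totalDegree_X i).le, fun u => by simp⟩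

lemma mul_apply_mem_polyFun (i j : Fin n) : (fun u : Euc n => u i * u j) ∈ polyFun n 2 :=
  mem_polyFun.2 ⟨MvPolynomial.X i * MvPolynomial.X j,
    (MvPolynomial.totalDegree_mul _ _).trans
      (by rw [MvPolynomial.totalDegree_X, MvPolynomial.totalDegree_X]), fun u => by simp⟩

lemma linear_mem_polyFun (T : Euc n →L[ℝ] ℝ) : (fun u => T u) ∈ polyFun n 1 := by
  have : (fun u => T u) = ∑ i, T (coordVec i) • fun u : Euc n => u i := by
    ext u
    conv_lhs => rw [euc_eq_sum u]
    simp [mul_comm]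
  rw [this]
  exact Submodule.sum_mem _ fun i _ => Submodule.smul_mem _ _ (apply_mem_polyFun i)

lemma bilinear_mem_polyFun (T : Euc n →L[ℝ] Euc n →L[ℝ] ℝ) : (fun u => T u u) ∈ polyFun n 2 := by
  have : (fun u => T u u) = ∑ i, ∑ j, T (coordVec i) (coordVec j) •
      fun u : Euc n => u i * u j := by
    ext u
    conv_lhs => rw [euc_eq_sum u]
    simp only [map_sum, map_smul, _root_.sum_apply, _root_.smul_apply, smul_eq_mul,
      Finset.sum_apply, Pi.smul_apply, Finset.mul_sum]
    rw [Finset.sum_comm]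
    refine Finset.sum_congr rfl fun i _ => Finset.sum_congr rfl fun j _ => ?_
    ring
  rw [this]
  exact Submodule.sum_mem _ fun i _ => Submodule.sum_mem _ fun j _ =>
    Submodule.smul_mem _ _ (mul_apply_mem_polyFun i j)

lemma comp_linear_mem_polyFun {l : ℕ} {f : Euc n → ℝ} (hf : f ∈ polyFun n k)
    (T : Euc l →L[ℝ] Euc n) : (fun u => f (T u)) ∈ polyFun l k := by
  obtain ⟨P, hP, hf⟩ := mem_polyFun.1 hf
  have h1 : ∀ i, ∃ Q : MvPolynomial (Fin l) ℝ, Q.totalDegree ≤ 1 ∧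
      ∀ u : Euc l, (T u) i = MvPolynomial.eval (fun j => u j) Q := fun i =>
    mem_polyFun.1 (linear_mem_polyFun ((EuclideanSpace.proj i : Euc n →L[ℝ] ℝ) ∘L T))
  choose Q hQ hQe using h1
  refine mem_polyFun.2 ⟨∑ s ∈ P.support, MvPolynomial.C (P.coeff s) * ∏ i, Q i ^ s i, ?_,
    fun u => ?_⟩
  · refine MvPolynomial.totalDegree_finsetSum_le fun s hs => ?_
    refine (MvPolynomial.totalDegree_mul _ _).trans ?_
    rw [MvPolynomial.totalDegree_C, zero_add]
    refine (MvPolynomial.totalDegree_finsetProd _ _).trans ?_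
    have h2 : ∑ i, s i ≤ P.totalDegree := by
      have := MvPolynomial.le_totalDegree hs
      rwa [Finsupp.sum_fintype _ _ (fun _ => rfl)] at this
    refine le_trans (Finset.sum_le_sum fun i _ => ?_) (h2.trans hP)
    refine (MvPolynomial.totalDegree_pow _ _).trans ?_
    simpa using Nat.mul_le_mul_left (s i) (hQ i)
  · rw [hf, MvPolynomial.eval_eq']
    simp [hQe]

lemma exists_affine_of_mem_polyFun {f : Euc n → ℝ} (hf : f ∈ polyFun n 1) :
    ∃ (a : ℝ) (b : Fin n → ℝ), ∀ u, f u = a + ∑ i, b i * u i := by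
  obtain ⟨P, hP, hf⟩ := mem_polyFun.1 hf
  have h1 : ∀ s ∈ P.support, ∃ (a : ℝ) (b : Fin n → ℝ), ∀ u : Euc n,
      P.coeff s * ∏ i, u i ^ s i = a + ∑ i, b i * u i := by
    intro s hs
    have h2 := (MvPolynomial.le_totalDegree hs).trans hP
    rw [Finsupp.sum_fintype _ _ (fun _ => rfl)] at h2
    by_cases h0 : ∀ i, s i = 0
    · exact ⟨P.coeff s, 0, fun u => by simp [h0]⟩
    · push Not at h0
      obtain ⟨i, hi⟩ := h0
      have h3 : ∀ j, s j = if j = i then 1 else 0 := by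
        intro j
        have h4 := Finset.add_sum_erase Finset.univ s (Finset.mem_univ i)
        split_ifs with hj
        · subst hj; omega
        · have := Finset.single_le_sum (f := s) (fun _ _ => Nat.zero_le _)
            (Finset.mem_erase.2 ⟨hj, Finset.mem_univ j⟩)
          omega
      refine ⟨0, fun j => if j = i then P.coeff s else 0, fun u => ?_⟩
      simp [h3, Finset.prod_ite_eq]
  choose! a b hab using h1
  refine ⟨∑ s ∈ P.support, a s, fun i => ∑ s ∈ P.support, b s i, fun u => ?_⟩
  rw [hf, MvPolynomial.eval_eq', Finset.sum_congr rfl fun s hs => hab s hs u,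
    Finset.sum_add_distrib, Finset.sum_comm]
  simp [Finset.sum_mul]

/-- An open set contains a product of infinite sets of reals, and a polynomial vanishing on such a
product is zero. -/
lemma eq_zero_of_mem_polyFun {f : Euc n → ℝ} (hf : f ∈ polyFun n k) {O : Set (Euc n)}
    (hO : IsOpen O) (hne : O.Nonempty) (h0 : ∀ u ∈ O, f u = 0) : f = 0 := by
  obtain ⟨P, -, hf⟩ := mem_polyFun.1 hf
  obtain ⟨u0, hu0⟩ := hne
  have hO' : IsOpen ((fun v : Fin n → ℝ => (WithLp.toLp 2 v : Euc n)) ⁻¹' O) :=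
    hO.preimage (PiLp.continuous_toLp 2 _)
  obtain ⟨s, hs, hsub⟩ := (isOpen_pi_iff'.1 hO') u0.ofLp hu0
  have : P = 0 := by
    refine MvPolynomial.funext_set (fun i => s i) (fun i => ?_) fun v hv => ?_
    · exact infinite_of_mem_nhds _ ((hs i).1.mem_nhds (hs i).2)
    · have := h0 _ (hsub hv)
      rw [hf] at this
      simpa using this
  ext u
  simp [hf, this]

end PolyFun

/-! ### Least squares through Gram matrices -/

section Fit

open scoped Matrix

variable {Ω : Type*} [MeasurableSpace Ω] {I : Type*} [Fintype I] [DecidableEq I]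
  {μ : Measure Ω} {ψ : I → Ω → ℝ} {κ K V : ℝ}

/-- The Gram matrix of a finite family of functions. -/
def gram (μ : Measure Ω) (ψ : I → Ω → ℝ) : Matrix I I ℝ :=
  Matrix.of fun i j => ∫ z, ψ i z * ψ j z ∂μ

/-- The inner products of a function with the functions of a family. -/
def moments (μ : Measure Ω) (ψ : I → Ω → ℝ) (g : Ω → ℝ) : I → ℝ := fun i => ∫ z, g z * ψ i z ∂μ

/-- The coefficients of the orthogonal projection to the span of a finite family of functions. -/
def fitCoeff (μ : Measure Ω) (ψ : I → Ω → ℝ) (g : Ω → ℝ) : I → ℝ :=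
  (gram μ ψ)⁻¹ *ᵥ moments μ ψ g

/-- A finite family of bounded functions that is quantitatively linearly independent. -/
structure IsFitSystem (μ : Measure Ω) (ψ : I → Ω → ℝ) (κ K V : ℝ) : Prop where
  finite : IsFiniteMeasure μ
  mass : μ.real univ ≤ V
  meas : ∀ i, AEStronglyMeasurable (ψ i) μ
  bound : ∀ i, ∀ᵐ z ∂μ, |ψ i z| ≤ K
  K_nonneg : 0 ≤ K
  pos : 0 < κ
  lower : ∀ c : I → ℝ, κ * ∑ i, c i ^ 2 ≤ ∫ z, (∑ i, c i * ψ i z) ^ 2 ∂μ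

/-- Bounded measurable functions. -/
structure IsBdd (μ : Measure Ω) (g : Ω → ℝ) (L : ℝ) : Prop where
  meas : AEStronglyMeasurable g μ
  bound : ∀ᵐ z ∂μ, |g z| ≤ L

lemma IsBdd.integrable [IsFiniteMeasure μ] {g : Ω → ℝ} {L : ℝ} (hg : IsBdd μ g L) :
    Integrable g μ := Integrable.of_bound hg.meas L hg.bound

lemma IsBdd.mul {g f : Ω → ℝ} {L L' : ℝ} (hg : IsBdd μ g L) (hf : IsBdd μ f L') :
    IsBdd μ (fun z => g z * f z) (L * L') := by
  refine ⟨hg.meas.mul hf.meas, ?_⟩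
  filter_upwards [hg.bound, hf.bound] with z h1 h2
  rw [abs_mul]
  exact mul_le_mul h1 h2 (abs_nonneg _) ((abs_nonneg _).trans h1)

lemma IsBdd.sub {g f : Ω → ℝ} {L L' : ℝ} (hg : IsBdd μ g L) (hf : IsBdd μ f L') :
    IsBdd μ (fun z => g z - f z) (L + L') := by
  refine ⟨hg.meas.sub hf.meas, ?_⟩
  filter_upwards [hg.bound, hf.bound] with z h1 h2
  exact (abs_sub _ _).trans (add_le_add h1 h2)

namespace IsFitSystem

variable (hψ : IsFitSystem μ ψ κ K V)
include hψ

lemma isBdd (i : I) : IsBdd μ (ψ i) K := ⟨hψ.meas i, hψ.bound i⟩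

lemma isBdd_sum (c : I → ℝ) : IsBdd μ (fun z => ∑ i, c i * ψ i z) ((∑ i, |c i|) * K) := by
  refine ⟨?_, ?_⟩
  · have := Finset.aestronglyMeasurable_fun_sum (μ := μ) Finset.univ
      (f := fun i z => c i * ψ i z) (fun i _ => (hψ.meas i).const_mul (c i))
    exact this
  · filter_upwards [ae_all_iff.2 hψ.bound] with z hz
    refine (Finset.abs_sum_le_sum_abs _ _).trans ?_
    rw [Finset.sum_mul]
    refine Finset.sum_le_sum fun i _ => ?_
    rw [abs_mul]
    exact mul_le_mul_of_nonneg_left (hz i) (abs_nonneg _)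

lemma gram_mulVec (c : I → ℝ) (j : I) :
    (gram μ ψ *ᵥ c) j = ∫ z, (∑ i, c i * ψ i z) * ψ j z ∂μ := by
  have := hψ.finite
  simp only [Matrix.mulVec, dotProduct, gram, Matrix.of_apply, Finset.sum_mul]
  rw [integral_finsetSum _ fun i _ => ((((hψ.isBdd i).mul (hψ.isBdd j)).integrable).const_mul
    (c i)).congr (Eventually.of_forall fun z => by ring)]
  refine Finset.sum_congr rfl fun i _ => ?_
  rw [mul_comm, ← integral_const_mul]
  exact integral_congr_ae (Eventually.of_forall fun z => by ring_nf)

lemma dotProduct_gram (c : I → ℝ) :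
    c ⬝ᵥ (gram μ ψ *ᵥ c) = ∫ z, (∑ i, c i * ψ i z) ^ 2 ∂μ := by
  have := hψ.finite
  simp only [dotProduct, hψ.gram_mulVec]
  simp_rw [← integral_const_mul]
  rw [← integral_finsetSum _ fun i _ =>
    (((hψ.isBdd_sum c).mul (hψ.isBdd i)).integrable).const_mul (c i)]
  refine integral_congr_ae (Eventually.of_forall fun z => ?_)
  simp only [sq]
  conv_rhs => rw [Finset.mul_sum]
  exact Finset.sum_congr rfl fun i _ => by ring

lemma isUnit_gram : IsUnit (gram μ ψ) := by
  rw [← Matrix.mulVec_injective_iff_isUnit]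
  intro c c' h
  have h0 : gram μ ψ *ᵥ (c - c') = 0 := by rw [Matrix.mulVec_sub]; exact sub_eq_zero.2 h
  have h1 := hψ.lower (c - c')
  rw [← hψ.dotProduct_gram, h0, dotProduct_zero] at h1
  have h2 : ∑ i, (c - c') i ^ 2 ≤ 0 := by
    by_contra hlt
    push Not at hlt
    have := mul_pos hψ.pos hlt
    linarith
  have h3 := (Finset.sum_eq_zero_iff_of_nonneg fun i _ => sq_nonneg ((c - c') i)).1
    (le_antisymm h2 (Finset.sum_nonneg fun i _ => sq_nonneg _))
  ext i
  have := h3 i (Finset.mem_univ i)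
  exact sub_eq_zero.1 (pow_eq_zero_iff two_ne_zero |>.1 this)

lemma gram_mulVec_fitCoeff (g : Ω → ℝ) : gram μ ψ *ᵥ fitCoeff μ ψ g = moments μ ψ g := by
  rw [fitCoeff, Matrix.mulVec_mulVec, Matrix.mul_nonsing_inv _
    ((Matrix.isUnit_iff_isUnit_det _).1 hψ.isUnit_gram), Matrix.one_mulVec]

lemma moments_sub_sum {g : Ω → ℝ} {L : ℝ} (hg : IsBdd μ g L) (c : I → ℝ) (j : I) :
    ∫ z, (g z - ∑ i, c i * ψ i z) * ψ j z ∂μ = moments μ ψ g j - (gram μ ψ *ᵥ c) j := by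
  have := hψ.finite
  rw [hψ.gram_mulVec, moments, ← integral_sub ((hg.mul (hψ.isBdd j)).integrable)
    (((hψ.isBdd_sum c).mul (hψ.isBdd j)).integrable)]
  exact integral_congr_ae (Eventually.of_forall fun z => by ring_nf)

lemma orthogonal {g : Ω → ℝ} {L : ℝ} (hg : IsBdd μ g L) (j : I) :
    ∫ z, (g z - ∑ i, fitCoeff μ ψ g i * ψ i z) * ψ j z ∂μ = 0 := by
  rw [hψ.moments_sub_sum hg, hψ.gram_mulVec_fitCoeff, sub_self]

lemma eq_fitCoeff {g : Ω → ℝ} {L : ℝ} (hg : IsBdd μ g L) {c : I → ℝ}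
    (hc : ∀ j, ∫ z, (g z - ∑ i, c i * ψ i z) * ψ j z ∂μ = 0) : c = fitCoeff μ ψ g := by
  apply Matrix.mulVec_injective_iff_isUnit.2 hψ.isUnit_gram
  change gram μ ψ *ᵥ c = gram μ ψ *ᵥ _
  rw [hψ.gram_mulVec_fitCoeff]
  ext j
  have := hc j
  rw [hψ.moments_sub_sum hg] at this
  linarith

/-- A projection fixes the span, so adding an element of it only shifts the coefficients. -/
lemma fitCoeff_sum_add {g : Ω → ℝ} {L : ℝ} (hg : IsBdd μ g L) (c : I → ℝ) :
    fitCoeff μ ψ (fun z => g z + ∑ i, c i * ψ i z) = fitCoeff μ ψ g + c := by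
  have hb : IsBdd μ (fun z => g z + ∑ i, c i * ψ i z) (L + (∑ i, |c i|) * K) := by
    refine ⟨hg.meas.add (hψ.isBdd_sum c).meas, ?_⟩
    filter_upwards [hg.bound, (hψ.isBdd_sum c).bound] with z h1 h2
    exact (abs_add_le _ _).trans (add_le_add h1 h2)
  refine (hψ.eq_fitCoeff hb fun j => ?_).symm
  rw [← hψ.orthogonal hg j]
  refine integral_congr_ae (Eventually.of_forall fun z => ?_)
  simp only [Pi.add_apply, add_mul, Finset.sum_add_distrib]
  ring

/-- With `G` the Gram matrix and `S` the sum of the `|c i|`, `κ * ∑ c i ^ 2 ≤ c ⬝ G c = c ⬝ moments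
≤ S * (L * K * V)`. Cauchy-Schwarz bounds `S ^ 2` by the number of functions times `∑ c i ^ 2`, and
one factor `S` cancels. The bound depends on the system only through `κ`, `K`, `V`, which gives
uniformity in `y` and `h`. -/
lemma sum_abs_fitCoeff_le {g : Ω → ℝ} {L : ℝ} (hg : IsBdd μ g L) (hL : 0 ≤ L) :
    ∑ i, |fitCoeff μ ψ g i| ≤ Fintype.card I * K * V / κ * L := by
  have := hψ.finite
  set c := fitCoeff μ ψ g
  set S := ∑ i, |c i|
  have hS : 0 ≤ S := Finset.sum_nonneg fun i _ => abs_nonneg _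
  have hV : 0 ≤ V := measureReal_nonneg.trans hψ.mass
  have hb : ∀ i, |moments μ ψ g i| ≤ L * K * V := by
    intro i
    have h1 := norm_integral_le_of_norm_le_const (f := fun z => g z * ψ i z) (hg.mul (hψ.isBdd i)).bound
    refine h1.trans ?_
    exact mul_le_mul_of_nonneg_left hψ.mass (mul_nonneg hL hψ.K_nonneg)
  have h1 : κ * ∑ i, c i ^ 2 ≤ S * (L * K * V) := by
    refine (hψ.lower c).trans ?_
    rw [← hψ.dotProduct_gram, hψ.gram_mulVec_fitCoeff]
    refine (le_abs_self _).trans ((Finset.abs_sum_le_sum_abs _ _).trans ?_)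
    rw [Finset.sum_mul]
    refine Finset.sum_le_sum fun i _ => ?_
    rw [abs_mul]
    exact mul_le_mul_of_nonneg_left (hb i) (abs_nonneg _)
  have h2 : S ^ 2 ≤ Fintype.card I * ∑ i, c i ^ 2 := by
    have := sq_sum_le_card_mul_sum_sq (s := (Finset.univ : Finset I)) (f := fun i => |c i|)
    simpa using this
  have h3 : κ * S ^ 2 ≤ Fintype.card I * (S * (L * K * V)) := by
    have h4 : (0 : ℝ) ≤ Fintype.card I := by positivity
    nlinarith [mul_le_mul_of_nonneg_left h1 h4, mul_le_mul_of_nonneg_left h2 hψ.pos.le]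
  have hκ := hψ.pos
  rcases hS.eq_or_lt with h0 | h0
  · rw [← h0]
    have := hψ.K_nonneg
    positivity
  · have h5 : κ * S ≤ Fintype.card I * (L * K * V) := by
      refine le_of_mul_le_mul_right ?_ h0
      nlinarith
    rw [div_mul_eq_mul_div, le_div_iff₀ hκ]
    nlinarith

end IsFitSystem

end Fit

lemma stronglyMeasurable_indicator_of_continuousOn {X : Type*} [TopologicalSpace X]
    [MeasurableSpace X] [BorelSpace X] {S : Set X} (hS : MeasurableSet S) {f : X → ℝ}
    (hf : ContinuousOn f S) : StronglyMeasurable (S.indicator f) := by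
  classical
  rw [← Set.piecewise_eq_indicator]
  exact (hf.measurable_piecewise continuousOn_const hS).stronglyMeasurable

lemma isOpen_nhd {M : Type*} [TopologicalSpace M] {d : ℕ} {ι : M → Euc d} (hι : Continuous ι)
    (h : ℝ) (y : M) : IsOpen (nhd ι h y) :=
  isOpen_lt (hι.dist continuous_const) continuous_const

/-! ### Quantitative independence of polynomials -/

section Basis

variable (m k : ℕ)

/-- The index type of a basis of the polynomial functions. -/
abbrev PolyIdx := Fin (Module.finrank ℝ (polyFun m k))

/-- A basis of the polynomial functions. -/
def polyBasis (i : PolyIdx m k) : Euc m → ℝ := (Module.finBasis ℝ (polyFun m k) i : polyFun m k)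

variable {m k}

lemma polyBasis_mem (i : PolyIdx m k) : polyBasis m k i ∈ polyFun m k :=
  (Module.finBasis ℝ (polyFun m k) i).2

lemma continuous_polyBasis (i : PolyIdx m k) : Continuous (polyBasis m k i) :=
  continuous_of_mem_polyFun (polyBasis_mem i)

lemma exists_sum_polyBasis {f : Euc m → ℝ} (hf : f ∈ polyFun m k) :
    ∃ c : PolyIdx m k → ℝ, ∀ u, f u = ∑ i, c i * polyBasis m k i u := by
  refine ⟨(Module.finBasis ℝ (polyFun m k)).repr ⟨f, hf⟩, fun u => ?_⟩
  have := congrArg (fun g : polyFun m k => (g : Euc m → ℝ) u)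
    ((Module.finBasis ℝ (polyFun m k)).sum_repr ⟨f, hf⟩)
  simp only [Submodule.coe_sum, Submodule.coe_smul, Finset.sum_apply, Pi.smul_apply,
    smul_eq_mul] at this
  exact this.symm

lemma sum_polyBasis_mem (c : PolyIdx m k → ℝ) :
    (fun u => ∑ i, c i * polyBasis m k i u) ∈ polyFun m k := by
  have : (fun u => ∑ i, c i * polyBasis m k i u) = ∑ i, c i • polyBasis m k i := by
    ext u; simp
  rw [this]
  exact Submodule.sum_mem _ fun i _ => Submodule.smul_mem _ _ (polyBasis_mem i)

lemma eq_zero_of_sum_polyBasis {c : PolyIdx m k → ℝ}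
    (h : ∀ u, ∑ i, c i * polyBasis m k i u = 0) : c = 0 := by
  have h1 : ∑ i, c i • Module.finBasis ℝ (polyFun m k) i = 0 := by
    ext u
    have := h u
    simpa [polyBasis] using this
  ext i
  exact Fintype.linearIndependent_iff.1 (Module.finBasis ℝ (polyFun m k)).linearIndependent c h1 i

lemma exists_polyBasis_bound (R : ℝ) : ∃ K > 0, ∀ i, ∀ u : Euc m, ‖u‖ ≤ R →
    |polyBasis m k i u| ≤ K := by
  have h : ∀ i, ∃ K, ∀ u ∈ Metric.closedBall (0 : Euc m) R, ‖polyBasis m k i u‖ ≤ K := fun i =>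
    (isCompact_closedBall _ _).exists_bound_of_continuousOn (continuous_polyBasis i).continuousOn
  choose K hK using h
  have h0 : 0 ≤ ∑ i, |K i| := Finset.sum_nonneg fun i _ => abs_nonneg _
  refine ⟨∑ i, |K i| + 1, by positivity, fun i u hu => ?_⟩
  have h1 := hK i u (mem_closedBall_zero_iff.2 hu)
  have h2 : |K i| ≤ ∑ i, |K i| := Finset.single_le_sum (f := fun i => |K i|)
    (fun _ _ => abs_nonneg _) (Finset.mem_univ i)
  rw [Real.norm_eq_abs] at h1
  have := le_abs_self (K i)
  linarith

/-- The basis is quantitatively linearly independent on open sets. -/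
lemma exists_polyBasis_lower {D : Set (Euc m)} (hD : IsOpen D) (hne : D.Nonempty) {R : ℝ}
    (hR : ∀ u ∈ D, ‖u‖ ≤ R) : ∃ κ > 0, ∀ c : PolyIdx m k → ℝ,
      κ * ∑ i, c i ^ 2 ≤ ∫ u in D, (∑ i, c i * polyBasis m k i u) ^ 2 := by
  classical
  have hDv : volume D ≠ ⊤ := ne_top_of_le_ne_top
    (measure_closedBall_lt_top (x := (0 : Euc m)) (r := R)).ne
    (measure_mono fun u hu => mem_closedBall_zero_iff.2 (hR u hu))
  have : IsFiniteMeasure (volume.restrict D) := isFiniteMeasure_restrict.2 hDv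
  obtain ⟨K, hK0, hK⟩ := exists_polyBasis_bound (m := m) (k := k) R
  have hb : ∀ i, IsBdd (volume.restrict D) (polyBasis m k i) K := fun i =>
    ⟨(continuous_polyBasis i).aestronglyMeasurable, by
      filter_upwards [ae_restrict_mem hD.measurableSet] with u hu using hK i u (hR u hu)⟩
  let q : EuclideanSpace ℝ (PolyIdx m k) → ℝ := fun c => ∫ u in D, (∑ i, c i * polyBasis m k i u) ^ 2
  have hq : ∀ c : EuclideanSpace ℝ (PolyIdx m k), q c = ∑ i, ∑ j, c i * c j *
      ∫ u in D, polyBasis m k i u * polyBasis m k j u := by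
    intro c
    simp only [q]
    have e1 : ∀ u, (∑ i, c i * polyBasis m k i u) ^ 2
        = ∑ i, ∑ j, c i * c j * (polyBasis m k i u * polyBasis m k j u) := fun u => by
      rw [sq, Finset.sum_mul_sum]
      exact Finset.sum_congr rfl fun i _ => Finset.sum_congr rfl fun j _ => by ring
    simp_rw [e1]
    rw [integral_finsetSum _ fun i _ => integrable_finsetSum _ fun j _ =>
      ((hb i).mul (hb j)).integrable.const_mul _]
    refine Finset.sum_congr rfl fun i _ => ?_
    rw [integral_finsetSum _ fun j _ => ((hb i).mul (hb j)).integrable.const_mul _]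
    exact Finset.sum_congr rfl fun j _ => integral_const_mul _ _
  have hqc : Continuous q := by
    rw [funext hq]; fun_prop
  -- A polynomial whose square has integral zero over an open set vanishes there, hence everywhere.
  have hqpos : ∀ c : EuclideanSpace ℝ (PolyIdx m k), c ≠ 0 → 0 < q c := by
    intro c hc
    refine lt_of_le_of_ne (integral_nonneg fun u => sq_nonneg _) fun h0 => hc ?_
    have hcont : Continuous fun u => (∑ i, c i * polyBasis m k i u) ^ 2 := by
      have := fun i => continuous_polyBasis (m := m) (k := k) i
      fun_prop
    have hint : Integrable (fun u => (∑ i, c i * polyBasis m k i u) ^ 2) (volume.restrict D) := by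
      have : IntegrableOn (fun u => (∑ i, c i * polyBasis m k i u) ^ 2)
          (Metric.closedBall 0 R) volume :=
        hcont.continuousOn.integrableOn_compact (isCompact_closedBall _ _)
      exact this.mono_set fun u hu => mem_closedBall_zero_iff.2 (hR u hu)
    have h1 := (integral_eq_zero_iff_of_nonneg (fun u => sq_nonneg _) hint).1 h0.symm
    have h2 : EqOn (fun u => (∑ i, c i * polyBasis m k i u) ^ 2) 0 D :=
      Measure.eqOn_open_of_ae_eq h1 hD hcont.continuousOn continuousOn_const
    have h3 := eq_zero_of_mem_polyFun (sum_polyBasis_mem c.ofLp) hD hne fun u hu =>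
      pow_eq_zero_iff two_ne_zero |>.1 (h2 hu)
    have h4 := eq_zero_of_sum_polyBasis fun u => congrFun h3 u
    ext i; exact congrFun h4 i
  have hsum : ∀ c : EuclideanSpace ℝ (PolyIdx m k), ∑ i, c i ^ 2 = ‖c‖ ^ 2 := fun c => by
    rw [EuclideanSpace.norm_sq_eq]; simp
  -- `κ` is the minimum of the quadratic form on the unit sphere. If the sphere is empty, every
  -- coefficient vector is zero.
  rcases (Metric.sphere (0 : EuclideanSpace ℝ (PolyIdx m k)) 1).eq_empty_or_nonempty with he | hne'
  · refine ⟨1, one_pos, fun c => ?_⟩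
    have : (WithLp.toLp 2 c : EuclideanSpace ℝ (PolyIdx m k)) = 0 := by
      by_contra hne
      have : ‖(WithLp.toLp 2 c : EuclideanSpace ℝ (PolyIdx m k))‖⁻¹ • (WithLp.toLp 2 c : EuclideanSpace ℝ (PolyIdx m k)) ∈ Metric.sphere (0 : EuclideanSpace ℝ (PolyIdx m k)) 1 := by
        rw [mem_sphere_zero_iff_norm, norm_smul, norm_inv, norm_norm,
          inv_mul_cancel₀ (norm_ne_zero_iff.2 hne)]
      rw [he] at this; exact this
    have hc := hsum (WithLp.toLp 2 c)
    rw [this, norm_zero] at hc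
    have h5 : ∑ i, c i ^ 2 = 0 := by
      have : ∀ i, c i = 0 := fun i => congrFun (congrArg WithLp.ofLp this) i
      simp [this]
    rw [h5, mul_zero]
    exact integral_nonneg fun u => sq_nonneg _
  · obtain ⟨c0, hc0, hmin⟩ := (isCompact_sphere (0 : EuclideanSpace ℝ (PolyIdx m k)) 1).exists_isMinOn hne' hqc.continuousOn
    have hc0n : c0 ≠ 0 := by
      rintro rfl; simp at hc0
    refine ⟨q c0, hqpos c0 hc0n, fun c => ?_⟩
    set v : EuclideanSpace ℝ (PolyIdx m k) := WithLp.toLp 2 c with hv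
    by_cases hv0 : v = 0
    · have h5 : ∑ i, c i ^ 2 = 0 := by
        have : ∀ i, c i = 0 := fun i => congrFun (congrArg WithLp.ofLp hv0) i
        simp [this]
      rw [h5, mul_zero]
      exact integral_nonneg fun u => sq_nonneg _
    · have hn := norm_ne_zero_iff.2 hv0
      have h6 : ‖v‖⁻¹ • v ∈ Metric.sphere (0 : EuclideanSpace ℝ (PolyIdx m k)) 1 := by
        rw [mem_sphere_zero_iff_norm, norm_smul, norm_inv, norm_norm, inv_mul_cancel₀ hn]
      have h7 : q c0 ≤ q (‖v‖⁻¹ • v) := hmin h6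
      have h8 : q (‖v‖⁻¹ • v) = (‖v‖ ^ 2)⁻¹ * q v := by
        rw [hq, hq, Finset.mul_sum]
        refine Finset.sum_congr rfl fun i _ => ?_
        rw [Finset.mul_sum]
        refine Finset.sum_congr rfl fun j _ => ?_
        simp only [PiLp.smul_apply, smul_eq_mul]
        ring
      have h9 : ∑ i, c i ^ 2 = ‖v‖ ^ 2 := hsum v
      rw [h9]
      rw [h8] at h7
      calc q c0 * ‖v‖ ^ 2 ≤ (‖v‖ ^ 2)⁻¹ * q v * ‖v‖ ^ 2 := by gcongr
        _ = q v := by field_simp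

/-- The basis stays quantitatively linearly independent under small perturbations. -/
lemma exists_polyBasis_lower_perturb {D : Set (Euc m)} (hD : IsOpen D) (hne : D.Nonempty) {R : ℝ}
    (hR : ∀ u ∈ D, ‖u‖ ≤ R) : ∃ κ > 0, ∃ ε > 0, ∀ θ : Euc m → Euc m, ContinuousOn θ D →
      (∀ u ∈ D, ‖θ u - u‖ ≤ ε) → ∀ c : PolyIdx m k → ℝ,
      κ * ∑ i, c i ^ 2 ≤ ∫ u in D, (∑ i, c i * polyBasis m k i (θ u)) ^ 2 := by
  classical
  obtain ⟨κ, hκ, hlow⟩ := exists_polyBasis_lower (k := k) hD hne hR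
  have hDv : volume D ≠ ⊤ := ne_top_of_le_ne_top
    (measure_closedBall_lt_top (x := (0 : Euc m)) (r := R)).ne
    (measure_mono fun u hu => mem_closedBall_zero_iff.2 (hR u hu))
  have : IsFiniteMeasure (volume.restrict D) := isFiniteMeasure_restrict.2 hDv
  obtain ⟨N, hNdef⟩ : ∃ N : ℝ, N = ((Fintype.card (PolyIdx m k) : ℕ) : ℝ) := ⟨_, rfl⟩
  set V : ℝ := volume.real D
  have hV : 0 ≤ V := measureReal_nonneg
  have hN : 0 ≤ N := by rw [hNdef]; positivity
  -- `e` bounds the change of each basis function under the perturbation. Of the original `κ`, one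
  -- half survives the pointwise comparison and at most one quarter is lost to the error.
  obtain ⟨e, he, heκ⟩ : ∃ e : ℝ, 0 < e ∧ N * e ^ 2 * V ≤ κ / 4 := by
    have hc : Tendsto (fun e : ℝ => N * e ^ 2 * V) (𝓝[>] 0) (𝓝 0) := by
      have : Continuous fun e : ℝ => N * e ^ 2 * V := by fun_prop
      simpa using (this.tendsto 0).mono_left nhdsWithin_le_nhds
    obtain ⟨e, h1, h2⟩ := ((hc.eventually (gt_mem_nhds (by positivity : 0 < κ / 4))).and
      self_mem_nhdsWithin).exists
    exact ⟨e, h2, h1.le⟩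
  have huc : ∀ i, ∃ ε > 0, ∀ u ∈ Metric.closedBall (0 : Euc m) (R + 1),
      ∀ v ∈ Metric.closedBall (0 : Euc m) (R + 1), dist u v < ε →
      dist (polyBasis m k i u) (polyBasis m k i v) < e := fun i =>
    Metric.uniformContinuousOn_iff.1 ((isCompact_closedBall _ _).uniformContinuousOn_of_continuous
      (continuous_polyBasis i).continuousOn) e he
  choose ε hε huc using huc
  obtain ⟨ε', hε', hle⟩ : ∃ ε' > 0, ∀ i, ε' < ε i := by
    have h1 : ∀ᶠ x in 𝓝[>] (0 : ℝ), ∀ i, x < ε i := by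
      rw [eventually_all]
      exact fun i => nhdsWithin_le_nhds (gt_mem_nhds (hε i))
    obtain ⟨x, h1, h2⟩ := (h1.and self_mem_nhdsWithin).exists
    exact ⟨x, h2, h1⟩
  obtain ⟨K, hK0, hK⟩ := exists_polyBasis_bound (m := m) (k := k) (R + 1)
  refine ⟨κ / 4, by positivity, min ε' 1, by positivity, fun θ hθ hθe c => ?_⟩
  have hθR : ∀ u ∈ D, ‖θ u‖ ≤ R + 1 := fun u hu => by
    have h1 := norm_add_le (θ u - u) u
    rw [sub_add_cancel] at h1
    linarith [hR u hu, (hθe u hu).trans (min_le_right _ _)]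
  have hb : ∀ i, IsBdd (volume.restrict D) (polyBasis m k i) K := fun i =>
    ⟨(continuous_polyBasis i).aestronglyMeasurable, by
      filter_upwards [ae_restrict_mem hD.measurableSet] with u hu
      exact hK i u ((hR u hu).trans (by linarith))⟩
  have hb' : ∀ i, IsBdd (volume.restrict D) (fun u => polyBasis m k i (θ u)) K := fun i =>
    ⟨((continuous_polyBasis i).comp_continuousOn hθ).aestronglyMeasurable hD.measurableSet, by
      filter_upwards [ae_restrict_mem hD.measurableSet] with u hu using hK i _ (hθR u hu)⟩
  have hsq : ∀ φ : PolyIdx m k → Euc m → ℝ, (∀ i, IsBdd (volume.restrict D) (φ i) K) →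
      Integrable (fun u => (∑ i, c i * φ i u) ^ 2) (volume.restrict D) := by
    intro φ hφ
    have e1 : ∀ u, (∑ i, c i * φ i u) ^ 2 = ∑ i, ∑ j, c i * c j * (φ i u * φ j u) := fun u => by
      rw [sq, Finset.sum_mul_sum]
      exact Finset.sum_congr rfl fun i _ => Finset.sum_congr rfl fun j _ => by ring
    simp_rw [e1]
    exact integrable_finsetSum _ fun i _ => integrable_finsetSum _ fun j _ =>
      ((hφ i).mul (hφ j)).integrable.const_mul _
  have hc0 : 0 ≤ ∑ i, c i ^ 2 := Finset.sum_nonneg fun i _ => sq_nonneg _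
  -- From `a ^ 2 ≤ 2 b ^ 2 + 2 (a - b) ^ 2`, with `(a - b) ^ 2` bounded by Cauchy-Schwarz.
  have hpt : ∀ u ∈ D, (∑ i, c i * polyBasis m k i u) ^ 2 * (1 / 2) - N * e ^ 2 * ∑ i, c i ^ 2
      ≤ (∑ i, c i * polyBasis m k i (θ u)) ^ 2 := by
    intro u hu
    set a := ∑ i, c i * polyBasis m k i u
    set b := ∑ i, c i * polyBasis m k i (θ u)
    have h1 : |a - b| ≤ ∑ i, |c i| * e := by
      rw [← Finset.sum_sub_distrib]
      refine (Finset.abs_sum_le_sum_abs _ _).trans (Finset.sum_le_sum fun i _ => ?_)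
      rw [← mul_sub, abs_mul]
      refine mul_le_mul_of_nonneg_left ?_ (abs_nonneg _)
      refine (huc i u (mem_closedBall_zero_iff.2 ((hR u hu).trans (by linarith))) (θ u)
        (mem_closedBall_zero_iff.2 (hθR u hu)) ?_).le
      rw [dist_comm, dist_eq_norm]
      exact (((hθe u hu).trans (min_le_left _ _))).trans_lt (hle i)
    have h2 : (a - b) ^ 2 ≤ N * e ^ 2 * ∑ i, c i ^ 2 := by
      rw [← Finset.sum_mul] at h1
      have h3 : (∑ i, |c i|) ^ 2 ≤ N * ∑ i, c i ^ 2 := by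
        have := sq_sum_le_card_mul_sum_sq (s := (Finset.univ : Finset (PolyIdx m k)))
          (f := fun i => |c i|)
        simpa [hNdef] using this
      calc (a - b) ^ 2 = |a - b| ^ 2 := (sq_abs _).symm
        _ ≤ ((∑ i, |c i|) * e) ^ 2 := by gcongr
        _ = (∑ i, |c i|) ^ 2 * e ^ 2 := by ring
        _ ≤ N * (∑ i, c i ^ 2) * e ^ 2 := by gcongr
        _ = _ := by ring
    nlinarith [sq_nonneg (a - 2 * b)]
  have h5 : ∫ u in D, ((∑ i, c i * polyBasis m k i u) ^ 2 * (1 / 2) - N * e ^ 2 * ∑ i, c i ^ 2)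
      ≤ ∫ u in D, (∑ i, c i * polyBasis m k i (θ u)) ^ 2 :=
    setIntegral_mono_on (((hsq _ hb).mul_const _).sub (integrable_const _)) (hsq _ hb')
      hD.measurableSet hpt
  rw [integral_sub ((hsq _ hb).mul_const _) (integrable_const _), integral_mul_const,
    setIntegral_const, smul_eq_mul] at h5
  have h6 := hlow c
  have h7 := mul_le_mul_of_nonneg_right heκ hc0
  change _ - V * _ ≤ _ at h5
  nlinarith

end Basis

/-! ### Scaled normal coordinates on small neighborhoods -/

section Local

variable {m d : ℕ} [NeZero m] {M : Type*} [TopologicalSpace M]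
  [ChartedSpace (EuclideanHalfSpace m) M] {ι : M → Euc d} {x : M} {r : ℝ} {U : M → M → Euc d}

lemma continuousOn_normalCoordinates (hU : IsNormalCoordinates m ι r U) {h : ℝ} (hr : h ≤ r)
    (y : M) : ContinuousOn (U y) (nhd ι h y) := by
  have h1 := hU.smooth.continuousOn
  exact h1.comp (f := fun q => (y, q)) (by fun_prop) fun q hq => by
    have : dist (ι q) (ι y) < h := hq
    rw [dist_comm] at this
    exact this.trans_le hr

/-- The volume measure on `N_y`, scaled. -/
def scaledVol (m : ℕ) [NeZero m] {M : Type*} [TopologicalSpace M]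
    [ChartedSpace (EuclideanHalfSpace m) M] [MeasurableSpace M] {d : ℕ} (ι : M → Euc d) (h : ℝ)
    (y : M) : Measure M :=
  ENNReal.ofReal ((h ^ m)⁻¹) • (vol m ι).restrict (nhd ι h y)

lemma integral_scaledVol [MeasurableSpace M] {h : ℝ} (hh : 0 < h) (y : M) (g : M → ℝ) :
    ∫ q, g q ∂(scaledVol m ι h y) = (h ^ m)⁻¹ * ∫ q in nhd ι h y, g q ∂(vol m ι) := by
  rw [scaledVol, integral_smul_measure, ENNReal.toReal_ofReal (by positivity), smul_eq_mul]

namespace Patch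

variable (P : Patch m ι x)

/-- The normal coordinates, as vectors of `ℝᵐ`. -/
def w (U : M → M → Euc d) (y q : M) : Euc m := transposeL P.J.toContinuousLinearMap (U y q)

/-- The basis of polynomials, in scaled normal coordinates. -/
def scaledBasis (U : M → M → Euc d) (k : ℕ) (h : ℝ) (y : M) (i : PolyIdx m k) (q : M) : ℝ :=
  polyBasis m k i (h⁻¹ • P.w U y q)

variable {P}

lemma continuousOn_w (hU : IsNormalCoordinates m ι r U) {h : ℝ} (hr : h ≤ r) (y : M) :
    ContinuousOn (P.w U y) (nhd ι h y) :=
  (transposeL P.J.toContinuousLinearMap).continuous.comp_continuousOn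
    (continuousOn_normalCoordinates hU hr y)

lemma continuousOn_scaledBasis (hU : IsNormalCoordinates m ι r U) {h : ℝ} (hr : h ≤ r) (y : M)
    {k : ℕ} (i : PolyIdx m k) : ContinuousOn (P.scaledBasis U k h y i) (nhd ι h y) :=
  (continuous_polyBasis i).comp_continuousOn ((continuousOn_w hU hr y).const_smul h⁻¹)

variable [IsManifold (𝓡∂ m) ∞ M]

section Good

variable (hι : ContMDiff (𝓡∂ m) 𝓘(ℝ, Euc d) ∞ ι) (hG : P.IsGood r)
  (hU : IsNormalCoordinates m ι r U)
include hι hG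

/-- The projection `J` transposed, restricted to the tangent space at `y`, is within `1 / 2` of the
identity in coordinates and hence invertible. So polynomials in the `d` components of `U y` are
polynomials in the `m` components of `w`. -/
lemma exists_recover {y : Euc m} (hy : y ∈ P.B) : ∃ T : Euc m →L[ℝ] Euc d,
    ∀ u ∈ tangentSub m ι (P.Ψ y), T (transposeL P.J.toContinuousLinearMap u) = u := by
  set A : Euc m →L[ℝ] Euc m := transposeL P.J.toContinuousLinearMap ∘L fderivWithin ℝ P.F P.B y
  have hA : ∀ v, ‖A v - v‖ ≤ 1 / 2 * ‖v‖ := by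
    intro v
    have h1 : A v - v = transposeL P.J.toContinuousLinearMap
        (fderivWithin ℝ P.F P.B y v - P.J v) := by
      rw [map_sub, transposeL_isometry_apply]; rfl
    rw [h1]
    exact (norm_transposeL_isometry_le _ _).trans (hG.norm_fderivWithin_sub_le hι hy v)
  have hinj : Function.Injective A.toLinearMap := by
    rw [injective_iff_map_eq_zero]
    intro v hv
    have hv' : A v = 0 := hv
    have h1 := hA v
    rw [hv', zero_sub, norm_neg] at h1
    exact norm_eq_zero.1 (le_antisymm (by linarith) (norm_nonneg _))
  let e : Euc m ≃L[ℝ] Euc m := (LinearEquiv.ofInjectiveEndo _ hinj).toContinuousLinearEquiv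
  have he : ∀ v, e v = A v := fun v => rfl
  refine ⟨fderivWithin ℝ P.F P.B y ∘L (e.symm : Euc m →L[ℝ] Euc m), fun u hu => ?_⟩
  rw [P.tangentSub_eq hy hι] at hu
  obtain ⟨v, rfl⟩ := hu
  change fderivWithin ℝ P.F P.B y (e.symm (A v)) = fderivWithin ℝ P.F P.B y v
  rw [← he, e.symm_apply_apply]

include hU

lemma exists_w_approx {ε : ℝ} (hε : 0 < ε) : ∃ δ > 0, ∀ y ∈ P.B, ∀ z ∈ P.B, ‖y‖ < δ → ‖z‖ < δ →
    ‖P.w U (P.Ψ y) (P.Ψ z) - (z - y)‖ ≤ ε * ‖z - y‖ := by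
  obtain ⟨C, hC, δ1, hδ1, h1⟩ := exists_normalCoordinates_sub_le hG hι hU
  obtain ⟨δ2, hδ2, h2⟩ := P.exists_fderivWithin_approx hι (half_pos hε)
  -- This radius gives `C * ‖z - y‖ ≤ ε / 2`, which absorbs the quadratic error of the normal
  -- coordinates into a linear one.
  refine ⟨min (min δ1 δ2) (ε / (4 * C)), by positivity, fun y hy z hz hyd hzd => ?_⟩
  have hy1 : ‖y‖ < δ1 := hyd.trans_le ((min_le_left _ _).trans (min_le_left _ _))
  have hz1 : ‖z‖ < δ1 := hzd.trans_le ((min_le_left _ _).trans (min_le_left _ _))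
  have hy2 : ‖y‖ < δ2 := hyd.trans_le ((min_le_left _ _).trans (min_le_right _ _))
  have hzy : ‖z - y‖ ≤ ε / (2 * C) := by
    have e1 := norm_sub_le z y
    have e2 := hyd.trans_le (min_le_right _ _)
    have e3 := hzd.trans_le (min_le_right _ _)
    have e4 : ε / (2 * C) = ε / (4 * C) + ε / (4 * C) := by field_simp; norm_num
    linarith
  have e1 : P.w U (P.Ψ y) (P.Ψ z) - (z - y) = transposeL P.J.toContinuousLinearMap
      (U (P.Ψ y) (P.Ψ z) - P.J (z - y)) := by
    rw [map_sub, transposeL_isometry_apply]; rfl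
  rw [e1]
  refine (norm_transposeL_isometry_le _ _).trans ?_
  have e2 := norm_add_le (U (P.Ψ y) (P.Ψ z) - fderivWithin ℝ P.F P.B y (z - y))
    (fderivWithin ℝ P.F P.B y (z - y) - P.J (z - y))
  rw [sub_add_sub_cancel] at e2
  have e3 := h1 y hy z hz hy1 hz1
  have e4 : ‖fderivWithin ℝ P.F P.B y (z - y) - P.J (z - y)‖ ≤ ε / 2 * ‖z - y‖ :=
    ContinuousLinearMap.le_of_opNorm_le _ (h2 y hy hy2).le _
  have e5 : C * ‖z - y‖ ^ 2 ≤ ε / 2 * ‖z - y‖ := by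
    have : C * ‖z - y‖ ≤ ε / 2 := by
      calc C * ‖z - y‖ ≤ C * (ε / (2 * C)) := by gcongr
        _ = ε / 2 := by field_simp
    calc C * ‖z - y‖ ^ 2 = (C * ‖z - y‖) * ‖z - y‖ := by ring
      _ ≤ _ := by gcongr
  linarith

end Good

section Nhd

variable (hι : Manifold.IsSmoothEmbedding (𝓡∂ m) 𝓘(ℝ, Euc d) ∞ ι) (hG : P.IsGood r)
  (hU : IsNormalCoordinates m ι r U)
include hι hG

lemma IsGood.norm_sub_le {y z : Euc m} (hy : y ∈ P.B) (hz : z ∈ P.B) :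
    ‖P.F z - P.F y‖ ≤ 3 / 2 * ‖z - y‖ := by
  have := norm_add_le (P.F z - P.F y - P.J (z - y)) (P.J (z - y))
  rw [sub_add_cancel, P.J.norm_map] at this
  linarith [hG.approx y hy z hz]

lemma IsGood.le_norm_sub {y z : Euc m} (hy : y ∈ P.B) (hz : z ∈ P.B) :
    1 / 2 * ‖z - y‖ ≤ ‖P.F z - P.F y‖ := by
  have := norm_sub_norm_le (P.J (z - y)) (P.J (z - y) - (P.F z - P.F y))
  rw [sub_sub_cancel, P.J.norm_map, norm_sub_rev (P.J (z - y))] at this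
  linarith [hG.approx y hy z hz]

/-- Small neighborhoods are contained in the patch. -/
lemma exists_nhd_subset {ρ' : ℝ} (hρ' : 0 < ρ') : ∃ ρ > 0, ∃ h0 > 0, ∀ y ∈ P.B, ‖y‖ < ρ →
    ∀ h < h0, ∀ q ∈ nhd ι h (P.Ψ y), q ∈ P.Ψ '' P.B ∧ ‖P.ξ q‖ < ρ' ∧ ‖P.ξ q - y‖ ≤ 2 * h := by
  have h1 := P.image_ball_mem_nhds hρ'
  rw [hι.isEmbedding.nhds_eq_comap] at h1
  obtain ⟨ε, hε, h2⟩ := (Metric.nhds_basis_ball.comap ι).mem_iff.1 h1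
  -- The ambient distance to `x` is at most `3 / 2 * ‖y‖ + h`, which is below `ε`.
  refine ⟨ε / 3, by positivity, ε / 2, by positivity, fun y hy hyρ h hh q hq => ?_⟩
  have hq' : dist (ι q) (ι (P.Ψ y)) < h := hq
  have e1 : dist (ι (P.Ψ y)) (ι x) ≤ 3 / 2 * ‖y‖ := by
    have := hG.norm_sub_le hι P.zero_mem hy
    rw [F, F, P.Ψ_zero, sub_zero] at this
    rwa [dist_eq_norm]
  have e2 : ι q ∈ Metric.ball (ι x) ε := by
    rw [Metric.mem_ball]
    linarith [dist_triangle (ι q) (ι (P.Ψ y)) (ι x)]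
  obtain ⟨z, ⟨hz, hzρ⟩, rfl⟩ := h2 e2
  refine ⟨⟨z, hz, rfl⟩, by rw [P.ξ_Ψ hz]; exact hzρ, ?_⟩
  rw [P.ξ_Ψ hz]
  have := hG.le_norm_sub hι hy hz
  rw [dist_eq_norm] at hq'
  change ‖P.F z - P.F y‖ < h at hq'
  linarith

include hU

/-- Normal coordinates of the points of small neighborhoods. -/
lemma exists_norm_w_le {ρ' : ℝ} (hρ' : 0 < ρ') : ∃ ρ > 0, ∃ h0 > 0, h0 ≤ r ∧ ∀ y ∈ P.B, ‖y‖ < ρ →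
    ∀ h < h0, ∀ q ∈ nhd ι h (P.Ψ y), q ∈ P.Ψ '' P.B ∧ ‖P.ξ q‖ < ρ' ∧ ‖P.ξ q - y‖ ≤ 2 * h ∧
      ‖P.w U (P.Ψ y) q‖ ≤ 4 * h := by
  obtain ⟨δ, hδ, h1⟩ := exists_w_approx hι.contMDiff hG hU one_pos
  obtain ⟨ρ, hρ, h0, hh0, h2⟩ := exists_nhd_subset hι hG (lt_min hδ hρ')
  refine ⟨min ρ δ, by positivity, min h0 r, lt_min hh0 hU.pos, min_le_right _ _,
    fun y hy hyρ h hh q hq => ?_⟩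
  obtain ⟨⟨z, hz, rfl⟩, e1, e2⟩ := h2 y hy (hyρ.trans_le (min_le_left _ _)) h
    (hh.trans_le (min_le_left _ _)) q hq
  rw [P.ξ_Ψ hz] at e1 e2 ⊢
  refine ⟨⟨z, hz, rfl⟩, e1.trans_le (min_le_right _ _), e2, ?_⟩
  have e3 := h1 y hy z hz (hyρ.trans_le (min_le_right _ _)) (e1.trans_le (min_le_left _ _))
  have e4 := norm_add_le (P.w U (P.Ψ y) (P.Ψ z) - (z - y)) (z - y)
  rw [sub_add_cancel] at e4
  linarith

end Nhd

end Patch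

end Local

/-! ### Uniform stability of the local fits -/

section FitSystem

variable {m d : ℕ} [NeZero m] {M : Type*} [TopologicalSpace M]
  [ChartedSpace (EuclideanHalfSpace m) M] {ι : M → Euc d} {x : M} {r : ℝ} {U : M → M → Euc d}
  [IsManifold (𝓡∂ m) ∞ M] [CompactSpace M] [MeasurableSpace M] [BorelSpace M]

lemma setIntegral_ball_comp {m : ℕ} (G : Euc m → ℝ) (y v : Euc m) {h : ℝ} (hh : 0 < h) (ρ : ℝ) :
    ∫ z in Metric.ball (y + h • v) (h * ρ), G z
      = h ^ m * ∫ u in Metric.ball v ρ, G (y + h • u) := by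
  rw [← integral_indicator Metric.isOpen_ball.measurableSet,
    ← integral_indicator Metric.isOpen_ball.measurableSet]
  set F := (Metric.ball (y + h • v) (h * ρ)).indicator G
  have h1 : ∀ u, (Metric.ball v ρ).indicator (fun u => G (y + h • u)) u = F (y + h • u) := by
    intro u
    have : u ∈ Metric.ball v ρ ↔ y + h • u ∈ Metric.ball (y + h • v) (h * ρ) := by
      rw [Metric.mem_ball, Metric.mem_ball, dist_add_left, dist_smul₀, Real.norm_of_nonneg hh.le,
        mul_lt_mul_iff_right₀ hh]
    by_cases hu : u ∈ Metric.ball v ρ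
    · rw [Set.indicator_of_mem hu]; exact (Set.indicator_of_mem (this.1 hu) G).symm
    · rw [Set.indicator_of_notMem hu]; exact (Set.indicator_of_notMem (mt this.2 hu) G).symm
  simp_rw [h1]
  have h2 := Measure.integral_comp_smul volume (fun z => F (y + z)) h
  rw [integral_add_left_eq_self (fun z => F z) y, finrank_euclideanSpace_fin,
    abs_of_pos (by positivity), smul_eq_mul] at h2
  rw [h2, ← mul_assoc, mul_inv_cancel₀ (by positivity), one_mul]

namespace Patch

variable {P : Patch m ι x} (hι : Manifold.IsSmoothEmbedding (𝓡∂ m) 𝓘(ℝ, Euc d) ∞ ι)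
  (hG : P.IsGood r) (hU : IsNormalCoordinates m ι r U)
include hι hG

lemma vol_nhd_le {y : Euc m} {h : ℝ} (hh : 0 ≤ h)
    (hsub : ∀ q ∈ nhd ι h (P.Ψ y), q ∈ P.Ψ '' P.B ∧ ‖P.ξ q - y‖ ≤ 2 * h) :
    vol m ι (nhd ι h (P.Ψ y))
      ≤ ENNReal.ofReal (h ^ m) * (2 ^ m * volume (Metric.closedBall (0 : Euc m) 2)) := by
  have hA : MeasurableSet (P.B ∩ Metric.closedBall y (h * 2)) :=
    P.measurableSet_B.inter Metric.isClosed_closedBall.measurableSet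
  calc vol m ι (nhd ι h (P.Ψ y)) ≤ vol m ι (P.Ψ '' (P.B ∩ Metric.closedBall y (h * 2))) := by
        refine measure_mono fun q hq => ?_
        obtain ⟨e1, e2⟩ := hsub q hq
        refine ⟨P.ξ q, ⟨P.ξ_mem e1, ?_⟩, P.Ψ_ξ e1⟩
        rw [Metric.mem_closedBall, dist_eq_norm, mul_comm]; exact e2
    _ ≤ 2 ^ m * volume (P.B ∩ Metric.closedBall y (h * 2)) := by
        rw [← ν_apply hA inter_subset_left]; exact hG.ν_le hι hA inter_subset_left
    _ ≤ 2 ^ m * volume (Metric.closedBall y (h * 2)) := by gcongr; exact inter_subset_right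
    _ = _ := by
        rw [Measure.addHaar_closedBall_mul volume y hh (by norm_num), finrank_euclideanSpace_fin]
        ring

include hU

/-- The polynomials in scaled normal coordinates are quantitatively linearly independent on small
neighborhoods. -/
lemma exists_isFitSystem (k : ℕ) {ρ' : ℝ} (hρ' : 0 < ρ') : ∃ κ K V : ℝ, ∃ ρ > 0, ∃ h0 > 0,
    h0 ≤ r ∧ ∀ y ∈ P.B, ‖y‖ < ρ → ∀ h, 0 < h → h < h0 →
      IsFitSystem (scaledVol m ι h (P.Ψ y)) (P.scaledBasis U k h (P.Ψ y)) κ K V ∧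
      (∀ q ∈ nhd ι h (P.Ψ y), ∀ i, |P.scaledBasis U k h (P.Ψ y) i q| ≤ K) ∧
      ∀ q ∈ nhd ι h (P.Ψ y), q ∈ P.Ψ '' P.B ∧ ‖P.ξ q‖ < ρ' ∧ ‖P.ξ q - y‖ ≤ 2 * h ∧
        ‖P.w U (P.Ψ y) q‖ ≤ 4 * h := by
  have hιc := hι.contMDiff
  -- A ball of directions pointing into the half space: `y + h u` stays in the patch for every base
  -- point, also on the boundary. The bound `1 / 2` keeps its image in `N_y`, since `F` expands by
  -- at most `3 / 2`.
  obtain ⟨v, σ, hσ, hD⟩ : ∃ v : Euc m, ∃ σ > 0, ∀ u ∈ Metric.ball v σ, 0 ≤ P.ell u ∧ ‖u‖ ≤ 1 / 2 := by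
    have hn := norm_pos_iff.2 P.inward_ne_zero
    have hO : IsOpen {u : Euc m | 0 < P.ell u ∧ ‖u‖ < 1 / 2} :=
      (isOpen_lt continuous_const P.ell.continuous).inter
        (isOpen_lt continuous_norm continuous_const)
    obtain ⟨σ, hσ, hsub⟩ := Metric.isOpen_iff.1 hO ((4 * ‖P.inward‖)⁻¹ • P.inward) (by
      refine ⟨?_, ?_⟩
      · rw [map_smul, P.ell_inward, smul_eq_mul, mul_one]; positivity
      · rw [norm_smul, Real.norm_of_nonneg (by positivity)]
        have : (4 * ‖P.inward‖)⁻¹ * ‖P.inward‖ = 1 / 4 := by field_simp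
        rw [this]; norm_num)
    exact ⟨_, σ, hσ, fun u hu => ⟨(hsub hu).1.le, (hsub hu).2.le⟩⟩
  obtain ⟨κ, hκ, ε, hε, hlow⟩ := exists_polyBasis_lower_perturb (m := m) (k := k)
    (Metric.isOpen_ball (x := v) (ε := σ)) ⟨v, Metric.mem_ball_self hσ⟩ (fun u hu => (hD u hu).2)
  obtain ⟨K, hK0, hK⟩ := exists_polyBasis_bound (m := m) (k := k) 4
  obtain ⟨δ, hδ, hw⟩ := exists_w_approx hιc hG hU hε
  obtain ⟨ρ, hρ, h0, hh0, hh0r, hn⟩ := exists_norm_w_le hι hG hU hρ'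
  have hδP := P.δ_pos
  -- The factors `2 ^ m` come from the two comparisons of `ν` with Lebesgue measure; `N_y` lies in
  -- the coordinate ball of radius `2 h`.
  refine ⟨κ / 2 ^ m, K, 2 ^ m * volume.real (Metric.closedBall (0 : Euc m) 2),
    min ρ (min (δ / 2) (P.δ / 2)), by positivity, min h0 (min δ P.δ), by positivity,
    (min_le_left _ _).trans hh0r, fun y hy hyρ h hh hhlt => ?_⟩
  have hyρ1 : ‖y‖ < ρ := hyρ.trans_le (min_le_left _ _)
  have hyδ : ‖y‖ < δ / 2 := hyρ.trans_le ((min_le_right _ _).trans (min_le_left _ _))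
  have hyP : ‖y‖ < P.δ / 2 := hyρ.trans_le ((min_le_right _ _).trans (min_le_right _ _))
  have hhh0 : h < h0 := hhlt.trans_le (min_le_left _ _)
  have hhδ : h < δ := hhlt.trans_le ((min_le_right _ _).trans (min_le_left _ _))
  have hhP : h < P.δ := hhlt.trans_le ((min_le_right _ _).trans (min_le_right _ _))
  have hhr : h ≤ r := hhh0.le.trans hh0r
  have hgeo := hn y hy hyρ1 h hhh0
  have hO := isOpen_nhd hι.isEmbedding.continuous h (P.Ψ y)
  have hbd : ∀ q ∈ nhd ι h (P.Ψ y), ∀ i, |P.scaledBasis U k h (P.Ψ y) i q| ≤ K := by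
    intro q hq i
    refine hK i _ ?_
    rw [norm_smul, norm_inv, Real.norm_of_nonneg hh.le, inv_mul_le_iff₀ hh, mul_comm]
    exact (hgeo q hq).2.2.2
  have hvol := vol_nhd_le hι hG hh.le (fun q hq => ⟨(hgeo q hq).1, (hgeo q hq).2.2.1⟩)
  have hvtop : (2 : ENNReal) ^ m * volume (Metric.closedBall (0 : Euc m) 2) < ⊤ :=
    ENNReal.mul_lt_top (by simp) measure_closedBall_lt_top
  have hmeas : ∀ i, AEStronglyMeasurable (P.scaledBasis U k h (P.Ψ y) i)
      ((vol m ι).restrict (nhd ι h (P.Ψ y))) := fun i =>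
    (continuousOn_scaledBasis hU hhr _ i).aestronglyMeasurable hO.measurableSet
  have hmass : scaledVol m ι h (P.Ψ y) univ
      ≤ 2 ^ m * volume (Metric.closedBall (0 : Euc m) 2) := by
    rw [scaledVol, Measure.smul_apply, Measure.restrict_apply_univ, smul_eq_mul]
    calc ENNReal.ofReal (h ^ m)⁻¹ * vol m ι (nhd ι h (P.Ψ y)) ≤ ENNReal.ofReal (h ^ m)⁻¹ *
          (ENNReal.ofReal (h ^ m) * (2 ^ m * volume (Metric.closedBall (0 : Euc m) 2))) := by gcongr
      _ = _ := by
          rw [← mul_assoc, ← ENNReal.ofReal_mul (by positivity), inv_mul_cancel₀ (by positivity),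
            ENNReal.ofReal_one, one_mul]
  refine ⟨⟨⟨hmass.trans_lt hvtop⟩, ?_, fun i => (hmeas i).mono_ac
    (Measure.smul_absolutelyContinuous), fun i => ?_, hK0.le, by positivity, fun c => ?_⟩, hbd, hgeo⟩
  · have := ENNReal.toReal_mono hvtop.ne hmass
    rw [ENNReal.toReal_mul, ENNReal.toReal_pow, ENNReal.toReal_ofNat] at this
    exact this
  · refine Measure.ae_smul_measure ?_ _
    filter_upwards [ae_restrict_mem hO.measurableSet] with q hq using hbd q hq i
  · rw [integral_scaledVol hh]
    set g : M → ℝ := fun q => (∑ i, c i * P.scaledBasis U k h (P.Ψ y) i q) ^ 2 with hg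
    have hgc : ContinuousOn g (nhd ι h (P.Ψ y)) := by
      have := fun i => continuousOn_scaledBasis hU hhr (P.Ψ y) (P := P) (k := k) i
      exact (continuousOn_finsetSum _ fun i _ => (this i).const_mul (c i) |>.congr
        fun _ _ => rfl).pow 2
    set L : ℝ := ((∑ i, |c i|) * K) ^ 2
    have hgb : ∀ q ∈ nhd ι h (P.Ψ y), |g q| ≤ L := by
      intro q hq
      simp only [hg]
      rw [abs_of_nonneg (sq_nonneg _), ← sq_abs]
      refine pow_le_pow_left₀ (abs_nonneg _) ((Finset.abs_sum_le_sum_abs _ _).trans ?_) 2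
      rw [Finset.sum_mul]
      refine Finset.sum_le_sum fun i _ => ?_
      rw [abs_mul]
      exact mul_le_mul_of_nonneg_left (hbd q hq i) (abs_nonneg _)
    set g' := (nhd ι h (P.Ψ y)).indicator g with hg'
    have hg'm : StronglyMeasurable g' :=
      stronglyMeasurable_indicator_of_continuousOn hO.measurableSet hgc
    have hg'b : ∀ q, |g' q| ≤ L := by
      intro q
      by_cases hq : q ∈ nhd ι h (P.Ψ y)
      · rw [hg', Set.indicator_of_mem hq]; exact hgb q hq
      · rw [hg', Set.indicator_of_notMem hq, abs_zero]; exact sq_nonneg _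
    have hg'0 : ∀ q, 0 ≤ g' q := fun q => Set.indicator_nonneg (fun _ _ => sq_nonneg _) q
    set A := Metric.ball (y + h • v) (h * σ) with hA
    have hAm : MeasurableSet A := Metric.isOpen_ball.measurableSet
    have hmemA : ∀ u ∈ Metric.ball v σ, y + h • u ∈ P.B ∧ ‖y + h • u‖ < δ ∧
        P.Ψ (y + h • u) ∈ nhd ι h (P.Ψ y) := by
      intro u hu
      obtain ⟨hu1, hu2⟩ := hD u hu
      have e1 : ‖h • u‖ ≤ h / 2 := by
        rw [norm_smul, Real.norm_of_nonneg hh.le]; nlinarith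
      have e2 : ‖y + h • u‖ ≤ ‖y‖ + h / 2 := (norm_add_le _ _).trans (by linarith)
      have e3 : y + h • u ∈ P.B := P.add_mem_B hy
        (by rw [map_smul, smul_eq_mul]; exact mul_nonneg hh.le hu1) (by linarith)
      refine ⟨e3, by linarith, ?_⟩
      have e4 := hG.norm_sub_le hι hy e3
      rw [add_sub_cancel_left] at e4
      change dist (P.F (y + h • u)) (P.F y) < h
      rw [dist_eq_norm]; linarith
    have hAim : ∀ z ∈ A, ∃ u ∈ Metric.ball v σ, y + h • u = z := by
      intro z hz
      refine ⟨h⁻¹ • (z - y), ?_, by rw [smul_inv_smul₀ hh.ne', add_sub_cancel]⟩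
      have e1 : z = y + h • (h⁻¹ • (z - y)) := by rw [smul_inv_smul₀ hh.ne', add_sub_cancel]
      rw [hA, e1, Metric.mem_ball, dist_add_left, dist_smul₀, Real.norm_of_nonneg hh.le,
        mul_lt_mul_iff_right₀ hh] at hz
      exact hz
    have hAB : A ⊆ P.B := fun z hz => by
      obtain ⟨u, hu, rfl⟩ := hAim z hz; exact (hmemA u hu).1
    have hAn : P.Ψ '' A ⊆ nhd ι h (P.Ψ y) := by
      rintro _ ⟨z, hz, rfl⟩
      obtain ⟨u, hu, rfl⟩ := hAim z hz; exact (hmemA u hu).2.2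
    have hfin : IsFiniteMeasure ((vol m ι).restrict (nhd ι h (P.Ψ y))) :=
      isFiniteMeasure_restrict.2 (ne_top_of_le_ne_top
        (ENNReal.mul_ne_top ENNReal.ofReal_ne_top hvtop.ne) hvol)
    have s1 : ∫ q in nhd ι h (P.Ψ y), g q ∂(vol m ι) = ∫ q in nhd ι h (P.Ψ y), g' q ∂(vol m ι) :=
      setIntegral_congr_fun hO.measurableSet fun q hq => by rw [hg', Set.indicator_of_mem hq]
    -- The integrand is a square, so the integral over `N_y` is at least that over the image of the
    -- small ball `A`.
    have s2 : ∫ q in P.Ψ '' A, g' q ∂(vol m ι) ≤ ∫ q in nhd ι h (P.Ψ y), g' q ∂(vol m ι) :=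
      setIntegral_mono_set (Integrable.of_bound hg'm.aestronglyMeasurable L
        (Eventually.of_forall hg'b)) (Eventually.of_forall hg'0) hAn.eventuallyLE
    rw [setIntegral_image_eq hg'm hAm hAB] at s2
    have s3 : ∫ z in A, g' (P.Ψ z) ≤ 2 ^ m * ∫ z in A, g' (P.Ψ z) ∂P.ν := by
      have hle : volume.restrict A ≤ ENNReal.ofReal (2 ^ m) • P.ν.restrict A := by
        refine Measure.le_iff.2 fun S hS => ?_
        rw [Measure.restrict_apply hS, Measure.smul_apply, Measure.restrict_apply hS,
          ENNReal.ofReal_pow (by norm_num), ENNReal.ofReal_ofNat, smul_eq_mul]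
        exact hG.le_ν hι (hS.inter hAm) (inter_subset_right.trans hAB)
      have hνA : P.ν A ≠ ⊤ := by
        refine ne_top_of_le_ne_top (ENNReal.mul_ne_top (by simp) ?_) (hG.ν_le hι hAm hAB)
        exact measure_ball_lt_top.ne
      have hfin' : IsFiniteMeasure (P.ν.restrict A) := isFiniteMeasure_restrict.2 hνA
      have hint : Integrable (fun z => g' (P.Ψ z)) (P.ν.restrict A) :=
        Integrable.of_bound ((hg'm.measurable.comp_aemeasurable
          (aemeasurable_Ψ (P := P))).aestronglyMeasurable.restrict) L
          (Eventually.of_forall fun z => hg'b _)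
      have := integral_mono_measure hle (Eventually.of_forall fun z => hg'0 (P.Ψ z))
        (hint.smul_measure ENNReal.ofReal_ne_top)
      rwa [integral_smul_measure, ENNReal.toReal_ofReal (by positivity), smul_eq_mul] at this
    have s4 : ∫ z in A, g' (P.Ψ z) = h ^ m * ∫ u in Metric.ball v σ,
        (∑ i, c i * polyBasis m k i (h⁻¹ • P.w U (P.Ψ y) (P.Ψ (y + h • u)))) ^ 2 := by
      rw [hA, setIntegral_ball_comp _ y v hh σ]
      congr 1
      refine setIntegral_congr_fun Metric.isOpen_ball.measurableSet fun u hu => ?_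
      simp only [hg', Set.indicator_of_mem (hmemA u hu).2.2, hg, scaledBasis]
    -- For `z = y + h u` the scaled normal coordinates differ from `u` by at most `ε`, so the
    -- perturbed lower bound applies.
    have s5 := hlow (fun u => h⁻¹ • P.w U (P.Ψ y) (P.Ψ (y + h • u))) (by
        refine ContinuousOn.fun_const_smul ?_ h⁻¹
        refine (continuousOn_w hU hhr (P.Ψ y)).comp (f := fun u => P.Ψ (y + h • u)) ?_
          fun u hu => (hmemA u hu).2.2
        exact P.continuousOn_Ψ.comp (by fun_prop) fun u hu => (hmemA u hu).1) (by
        intro u hu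
        obtain ⟨e1, e2, -⟩ := hmemA u hu
        have e3 := hw y hy _ e1 (by linarith) e2
        rw [add_sub_cancel_left] at e3
        have e4 : h⁻¹ • P.w U (P.Ψ y) (P.Ψ (y + h • u)) - u
            = h⁻¹ • (P.w U (P.Ψ y) (P.Ψ (y + h • u)) - h • u) := by
          rw [smul_sub, inv_smul_smul₀ hh.ne']
        rw [e4, norm_smul, norm_inv, Real.norm_of_nonneg hh.le, inv_mul_le_iff₀ hh]
        refine e3.trans ?_
        rw [norm_smul, Real.norm_of_nonneg hh.le]
        have : ‖u‖ ≤ 1 := by linarith [(hD u hu).2]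
        have e5 : 0 < ε * h := by positivity
        nlinarith) c
    rw [s1]
    have hpow : (0 : ℝ) < h ^ m := by positivity
    have h2m : (0 : ℝ) < 2 ^ m := by positivity
    calc κ / 2 ^ m * ∑ i, c i ^ 2 = (2 ^ m)⁻¹ * (κ * ∑ i, c i ^ 2) := by ring
      _ ≤ (2 ^ m)⁻¹ * ((h ^ m)⁻¹ * ∫ z in A, g' (P.Ψ z)) := by
          rw [s4, ← mul_assoc (h ^ m)⁻¹, inv_mul_cancel₀ hpow.ne', one_mul]
          gcongr
      _ ≤ (2 ^ m)⁻¹ * ((h ^ m)⁻¹ * (2 ^ m * ∫ z in A, g' (P.Ψ z) ∂P.ν)) := by gcongr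
      _ = (h ^ m)⁻¹ * ∫ z in A, g' (P.Ψ z) ∂P.ν := by field_simp
      _ ≤ _ := by gcongr

end Patch

end FitSystem

/-! ### Measurability, limits and linearity of the fit coefficients -/

section Fit

open scoped Matrix

variable {Ω : Type*} [MeasurableSpace Ω] {I : Type*} [Fintype I] [DecidableEq I]

lemma measurable_matrix_det {α : Type*} [MeasurableSpace α] {A : α → Matrix I I ℝ}
    (h : ∀ i j, Measurable fun a => A a i j) : Measurable fun a => (A a).det := by
  simp only [Matrix.det_apply]
  refine Finset.measurable_fun_sum _ fun σ _ => ?_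
  exact (Finset.measurable_fun_prod _ fun i _ => h _ _).const_smul _

/-- Cramer's rule: the entries are quotients of determinants, and `Matrix.inv` is given by the same
formula where the determinant vanishes. -/
lemma measurable_matrix_inv {α : Type*} [MeasurableSpace α] {A : α → Matrix I I ℝ}
    (h : ∀ i j, Measurable fun a => A a i j) (i j : I) : Measurable fun a => (A a)⁻¹ i j := by
  simp only [Matrix.inv_def, Matrix.smul_apply, Ring.inverse_eq_inv', smul_eq_mul]
  refine (measurable_matrix_det h).inv.mul ?_
  simp only [Matrix.adjugate_apply]
  refine measurable_matrix_det fun k l => ?_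
  by_cases hk : k = j
  · subst hk; simp
  · simp only [Matrix.updateRow_ne hk]; exact h k l

/-- Only Gram entries and moments have to converge, so the limit system may live on another space:
neighborhoods in `M` before the limit, caps in `ℝᵐ` after it. -/
lemma tendsto_fitCoeff {β : Type*} {l : Filter β} {μ : β → Measure Ω} {ψ : β → I → Ω → ℝ}
    {g : β → Ω → ℝ} {Ω' : Type*} [MeasurableSpace Ω'] {μ0 : Measure Ω'} {ψ0 : I → Ω' → ℝ}
    {g0 : Ω' → ℝ} (h0 : IsUnit (gram μ0 ψ0))
    (h1 : ∀ i j, Tendsto (fun b => gram (μ b) (ψ b) i j) l (𝓝 (gram μ0 ψ0 i j)))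
    (h2 : ∀ i, Tendsto (fun b => moments (μ b) (ψ b) (g b) i) l (𝓝 (moments μ0 ψ0 g0 i))) (i : I) :
    Tendsto (fun b => fitCoeff (μ b) (ψ b) (g b) i) l (𝓝 (fitCoeff μ0 ψ0 g0 i)) := by
  have hA : Tendsto (fun b => gram (μ b) (ψ b)) l (𝓝 (gram μ0 ψ0)) :=
    tendsto_pi_nhds.2 fun i => tendsto_pi_nhds.2 fun j => h1 i j
  have hdet : (gram μ0 ψ0).det ≠ 0 := ((Matrix.isUnit_iff_isUnit_det _).1 h0).ne_zero
  have hd : Tendsto (fun b => (gram (μ b) (ψ b)).det) l (𝓝 (gram μ0 ψ0).det) :=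
    ((continuous_id.matrix_det).tendsto _).comp hA
  have ha : ∀ j, Tendsto (fun b => (gram (μ b) (ψ b)).adjugate i j) l
      (𝓝 ((gram μ0 ψ0).adjugate i j)) := fun j =>
    (((continuous_apply_apply i j).comp continuous_id.matrix_adjugate).tendsto _).comp hA
  simp only [fitCoeff, Matrix.mulVec, dotProduct, Matrix.inv_def, Matrix.smul_apply,
    Ring.inverse_eq_inv', smul_eq_mul]
  exact tendsto_finsetSum _ fun j _ => ((hd.inv₀ hdet).mul (ha j)).mul (h2 j)

lemma IsFitSystem.orthogonal_sum {μ : Measure Ω} {ψ : I → Ω → ℝ} {κ K V : ℝ}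
    (hψ : IsFitSystem μ ψ κ K V) {g : Ω → ℝ} {L : ℝ} (hg : IsBdd μ g L) (c : I → ℝ) :
    ∫ z, (g z - ∑ i, fitCoeff μ ψ g i * ψ i z) * ∑ j, c j * ψ j z ∂μ = 0 := by
  have := hψ.finite
  have h1 := hg.sub (hψ.isBdd_sum (fitCoeff μ ψ g))
  simp_rw [Finset.mul_sum]
  have h2 : ∀ j, Integrable (fun z => (g z - ∑ i, fitCoeff μ ψ g i * ψ i z) * (c j * ψ j z)) μ :=
    fun j => ((h1.mul (hψ.isBdd j)).integrable.const_mul (c j)).congr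
      (Eventually.of_forall fun z => by ring)
  rw [integral_finsetSum _ fun j _ => h2 j]
  refine Finset.sum_eq_zero fun j _ => ?_
  have h3 : ∀ z, (g z - ∑ i, fitCoeff μ ψ g i * ψ i z) * (c j * ψ j z)
      = c j * ((g z - ∑ i, fitCoeff μ ψ g i * ψ i z) * ψ j z) := fun z => by ring
  simp_rw [h3]
  rw [integral_const_mul, hψ.orthogonal hg, mul_zero]

lemma fitCoeff_congr {μ : Measure Ω} {ψ : I → Ω → ℝ} {g g' : Ω → ℝ} (h : g =ᵐ[μ] g') :
    fitCoeff μ ψ g = fitCoeff μ ψ g' := by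
  have : moments μ ψ g = moments μ ψ g' := by
    ext i
    refine integral_congr_ae ?_
    filter_upwards [h] with z hz
    rw [hz]
  rw [fitCoeff, fitCoeff, this]

lemma fitCoeff_const_mul {μ : Measure Ω} {ψ : I → Ω → ℝ} {g : Ω → ℝ} (a : ℝ) :
    fitCoeff μ ψ (fun z => a * g z) = a • fitCoeff μ ψ g := by
  have : moments μ ψ (fun z => a * g z) = a • moments μ ψ g := by
    ext i
    simp only [moments, Pi.smul_apply, smul_eq_mul, ← integral_const_mul, mul_assoc]
  rw [fitCoeff, fitCoeff, this, Matrix.mulVec_smul]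

lemma IsFitSystem.fitCoeff_add {μ : Measure Ω} {ψ : I → Ω → ℝ} {κ K V : ℝ}
    (hψ : IsFitSystem μ ψ κ K V) {g g' : Ω → ℝ} {L L' : ℝ} (hg : IsBdd μ g L)
    (hg' : IsBdd μ g' L') :
    fitCoeff μ ψ (fun z => g z + g' z) = fitCoeff μ ψ g + fitCoeff μ ψ g' := by
  have := hψ.finite
  have : moments μ ψ (fun z => g z + g' z) = moments μ ψ g + moments μ ψ g' := by
    ext i
    simp only [moments, Pi.add_apply, add_mul]
    exact integral_add (hg.mul (hψ.isBdd i)).integrable (hg'.mul (hψ.isBdd i)).integrable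
  rw [fitCoeff, fitCoeff, fitCoeff, this, Matrix.mulVec_add]

end Fit

/-! ### Local fits on the manifold -/

section Hat

variable {m d : ℕ} [NeZero m] {M : Type*} [TopologicalSpace M]
  [ChartedSpace (EuclideanHalfSpace m) M] {ι : M → Euc d} {x : M} {r : ℝ} {U : M → M → Euc d}

lemma comp_mem_localPoly {k : ℕ} {f : Euc d → ℝ} (hf : f ∈ polyFun d k) (y : M) :
    (fun z => f (U y z)) ∈ localPoly U k y := by
  obtain ⟨Q, hQ, h⟩ := mem_polyFun.1 hf
  exact ⟨Q, hQ, fun z => h _⟩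

lemma exists_of_mem_localPoly {k : ℕ} {y : M} {p : M → ℝ} (hp : p ∈ localPoly U k y) :
    ∃ f ∈ polyFun d k, ∀ z, p z = f (U y z) := by
  obtain ⟨Q, hQ, h⟩ := hp
  exact ⟨_, mem_polyFun.2 ⟨Q, hQ, fun u => rfl⟩, h⟩

lemma localPoly_mono {k k' : ℕ} (h : k ≤ k') (y : M) : localPoly U k y ⊆ localPoly U k' y :=
  fun _ ⟨Q, hQ, e⟩ => ⟨Q, hQ.trans h, e⟩

lemma add_mem_localPoly {k : ℕ} {y : M} {p q : M → ℝ} (hp : p ∈ localPoly U k y)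
    (hq : q ∈ localPoly U k y) : (fun z => p z + q z) ∈ localPoly U k y := by
  obtain ⟨f, hf, h1⟩ := exists_of_mem_localPoly hp
  obtain ⟨g, hg, h2⟩ := exists_of_mem_localPoly hq
  have : (fun z => p z + q z) = fun z => (f + g) (U y z) := by ext z; simp [h1, h2]
  rw [this]
  exact comp_mem_localPoly (Submodule.add_mem _ hf hg) y

lemma sub_mem_localPoly {k : ℕ} {y : M} {p q : M → ℝ} (hp : p ∈ localPoly U k y)
    (hq : q ∈ localPoly U k y) : (fun z => p z - q z) ∈ localPoly U k y := by
  obtain ⟨f, hf, h1⟩ := exists_of_mem_localPoly hp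
  obtain ⟨g, hg, h2⟩ := exists_of_mem_localPoly hq
  have : (fun z => p z - q z) = fun z => (f - g) (U y z) := by ext z; simp [h1, h2]
  rw [this]
  exact comp_mem_localPoly (Submodule.sub_mem _ hf hg) y

namespace Patch

variable {P : Patch m ι x}

lemma polyFun_w_mem_localPoly {k : ℕ} {f : Euc m → ℝ} (hf : f ∈ polyFun m k) (a : ℝ) (y : M) :
    (fun z => f (a • P.w U y z)) ∈ localPoly U k y :=
  comp_mem_localPoly (comp_linear_mem_polyFun hf (a • transposeL P.J.toContinuousLinearMap)) y

variable [IsManifold (𝓡∂ m) ∞ M] (hι : ContMDiff (𝓡∂ m) 𝓘(ℝ, Euc d) ∞ ι) (hG : P.IsGood r)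
  (hU : IsNormalCoordinates m ι r U)
include hι hG hU

/-- The vectors `U y z` are tangent at `y`, so `exists_recover` rewrites a polynomial in them as one
in `w`; scaling preserves the degree. -/
lemma exists_coeff_of_mem_localPoly {k : ℕ} {y : Euc m} (hy : y ∈ P.B) {h : ℝ} (hh : 0 < h)
    (hr : h ≤ r) {p : M → ℝ} (hp : p ∈ localPoly U k (P.Ψ y)) : ∃ c : PolyIdx m k → ℝ,
      ∀ z ∈ nhd ι h (P.Ψ y), p z = ∑ i, c i * P.scaledBasis U k h (P.Ψ y) i z := by
  obtain ⟨f, hf, hp⟩ := exists_of_mem_localPoly hp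
  obtain ⟨T, hT⟩ := exists_recover hι hG hy
  obtain ⟨c, hc⟩ := exists_sum_polyBasis (comp_linear_mem_polyFun hf (h • T))
  refine ⟨c, fun z hz => ?_⟩
  have hz' : dist (ι (P.Ψ y)) (ι z) < r := by
    rw [dist_comm]; exact lt_of_lt_of_le hz hr
  have h1 := hT _ (hU.tangent _ _ hz')
  have h2 := hc (h⁻¹ • P.w U (P.Ψ y) z)
  rw [_root_.smul_apply, map_smul, smul_inv_smul₀ hh.ne', w, h1] at h2
  rw [hp, h2]
  rfl

variable [MeasurableSpace M] [BorelSpace M]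

lemma setIntegral_nhd {h : ℝ} (hh : 0 < h) (y : M) (g : M → ℝ) :
    ∫ q in nhd ι h y, g q ∂(vol m ι) = h ^ m * ∫ q, g q ∂(scaledVol m ι h y) := by
  rw [integral_scaledVol hh, ← mul_assoc, mul_inv_cancel₀ (by positivity), one_mul]

lemma ae_scaledVol {h : ℝ} {y : M} {p : M → Prop} (hp : ∀ z ∈ nhd ι h y, p z) :
    ∀ᵐ z ∂(scaledVol m ι h y), p z := by
  refine Measure.ae_smul_measure ?_ _
  filter_upwards [ae_restrict_mem (isOpen_nhd hι.continuous h y).measurableSet] with q hq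
    using hp q hq

/-- The local fit is given by the Gram matrix. -/
lemma hat_eq {k : ℕ} {y : Euc m} (hy : y ∈ P.B) {h : ℝ} (hh : 0 < h) (hr : h ≤ r) {κ K V L : ℝ}
    (hfs : IsFitSystem (scaledVol m ι h (P.Ψ y)) (P.scaledBasis U k h (P.Ψ y)) κ K V)
    {f : M → ℝ} (hf : IsBdd (scaledVol m ι h (P.Ψ y)) f L) {z : M} (hz : z ∈ nhd ι h (P.Ψ y)) :
    hat m ι U k h (P.Ψ y) f z = ∑ i, fitCoeff (scaledVol m ι h (P.Ψ y))
      (P.scaledBasis U k h (P.Ψ y)) f i * P.scaledBasis U k h (P.Ψ y) i z := by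
  -- `hat` is a choice, so nothing is known about it until some fit exists; the Gram formula
  -- provides one.
  have hex : ∃ p, IsLocalFit m ι U k h (P.Ψ y) f p := by
    refine ⟨fun z => ∑ i, fitCoeff (scaledVol m ι h (P.Ψ y)) (P.scaledBasis U k h (P.Ψ y)) f i
      * P.scaledBasis U k h (P.Ψ y) i z, polyFun_w_mem_localPoly (sum_polyBasis_mem _) h⁻¹ _, ?_⟩
    intro q hq
    obtain ⟨c, hc⟩ := exists_coeff_of_mem_localPoly hι hG hU hy hh hr hq
    rw [setIntegral_nhd hι hG hU hh, ← mul_zero (h ^ m), ← hfs.orthogonal_sum hf c]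
    congr 1
    refine integral_congr_ae ?_
    filter_upwards [ae_scaledVol hι hG hU hc] with z hz
    rw [hz]
  obtain ⟨hp1, hp2⟩ : IsLocalFit m ι U k h (P.Ψ y) f (hat m ι U k h (P.Ψ y) f) :=
    Classical.epsilon_spec hex
  obtain ⟨c, hc⟩ := exists_coeff_of_mem_localPoly hι hG hU hy hh hr hp1
  rw [hc z hz]
  -- The chosen fit satisfies the normal equations, which have only one solution.
  have : c = fitCoeff (scaledVol m ι h (P.Ψ y)) (P.scaledBasis U k h (P.Ψ y)) f := by
    refine hfs.eq_fitCoeff hf fun j => ?_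
    have h1 := hp2 _ (polyFun_w_mem_localPoly (P := P) (polyBasis_mem (m := m) (k := k) j) h⁻¹ _)
    rw [setIntegral_nhd hι hG hU hh] at h1
    have h2 := (mul_eq_zero.1 h1).resolve_left (by positivity)
    rw [← h2]
    refine integral_congr_ae ?_
    filter_upwards [ae_scaledVol hι hG hU hc] with z hz
    rw [hz]; rfl
  rw [this]

/-- The error of the local fit of a function that is close to a polynomial. -/
lemma abs_sub_hat_le {k : ℕ} {y : Euc m} (hy : y ∈ P.B) {h : ℝ} (hh : 0 < h) (hr : h ≤ r)
    {κ K V L : ℝ}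
    (hfs : IsFitSystem (scaledVol m ι h (P.Ψ y)) (P.scaledBasis U k h (P.Ψ y)) κ K V)
    (hK : ∀ q ∈ nhd ι h (P.Ψ y), ∀ i, |P.scaledBasis U k h (P.Ψ y) i q| ≤ K)
    {f p : M → ℝ} (hf : ContinuousOn f (nhd ι h (P.Ψ y))) (hp : p ∈ localPoly U k (P.Ψ y))
    (hfp : ∀ q ∈ nhd ι h (P.Ψ y), |f q - p q| ≤ L) {z : M} (hz : z ∈ nhd ι h (P.Ψ y)) :
    |f z - hat m ι U k h (P.Ψ y) f z|
      ≤ (1 + Fintype.card (PolyIdx m k) * K * V / κ * K) * L := by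
  have hO := isOpen_nhd hι.continuous h (P.Ψ y)
  obtain ⟨c, hc⟩ := exists_coeff_of_mem_localPoly hι hG hU hy hh hr hp
  have hpc : ContinuousOn p (nhd ι h (P.Ψ y)) := by
    have := fun i => continuousOn_scaledBasis hU hr (P.Ψ y) (P := P) (k := k) i
    exact (continuousOn_finsetSum _ fun i _ => (this i).const_mul (c i) |>.congr
      fun _ _ => rfl).congr hc
  have hL : 0 ≤ L := (abs_nonneg _).trans (hfp z hz)
  have hg : IsBdd (scaledVol m ι h (P.Ψ y)) (fun q => f q - p q) L :=
    ⟨((hf.sub hpc).aestronglyMeasurable hO.measurableSet).mono_ac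
      Measure.smul_absolutelyContinuous, ae_scaledVol hι hG hU hfp⟩
  have hfe : f =ᵐ[scaledVol m ι h (P.Ψ y)] fun q => (f q - p q)
      + ∑ i, c i * P.scaledBasis U k h (P.Ψ y) i q := by
    filter_upwards [ae_scaledVol hι hG hU hc] with q hq
    rw [← hq]; ring
  have hfb : IsBdd (scaledVol m ι h (P.Ψ y)) f (L + (∑ i, |c i|) * K) := by
    refine ⟨(hf.aestronglyMeasurable hO.measurableSet).mono_ac
      Measure.smul_absolutelyContinuous, ?_⟩
    filter_upwards [hfe, hg.bound, (hfs.isBdd_sum c).bound] with q h0 h1 h2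
    rw [h0]
    exact (abs_add_le _ _).trans (add_le_add h1 h2)
  -- The fit reproduces `p`, so the residual of `f` is that of `f - p`.
  rw [hat_eq hι hG hU hy hh hr hfs hfb hz, fitCoeff_congr hfe, hfs.fitCoeff_sum_add hg]
  have h1 : f z - ∑ i, (fitCoeff (scaledVol m ι h (P.Ψ y)) (P.scaledBasis U k h (P.Ψ y))
      (fun q => f q - p q) + c) i * P.scaledBasis U k h (P.Ψ y) i z
      = (f z - p z) - ∑ i, fitCoeff (scaledVol m ι h (P.Ψ y)) (P.scaledBasis U k h (P.Ψ y))
      (fun q => f q - p q) i * P.scaledBasis U k h (P.Ψ y) i z := by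
    simp only [Pi.add_apply, add_mul, Finset.sum_add_distrib]
    rw [hc z hz]; ring
  rw [h1]
  have h2 := hfs.sum_abs_fitCoeff_le hg hL
  have h3 : |∑ i, fitCoeff (scaledVol m ι h (P.Ψ y)) (P.scaledBasis U k h (P.Ψ y))
      (fun q => f q - p q) i * P.scaledBasis U k h (P.Ψ y) i z|
      ≤ (∑ i, |fitCoeff (scaledVol m ι h (P.Ψ y)) (P.scaledBasis U k h (P.Ψ y))
      (fun q => f q - p q) i|) * K := by
    refine (Finset.abs_sum_le_sum_abs _ _).trans ?_
    rw [Finset.sum_mul]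
    refine Finset.sum_le_sum fun i _ => ?_
    rw [abs_mul]
    exact mul_le_mul_of_nonneg_left (hK z hz i) (abs_nonneg _)
  have h4 := mul_le_mul_of_nonneg_right h2 hfs.K_nonneg
  refine (abs_sub _ _).trans ?_
  rw [add_mul, one_mul]
  have h5 := hfp z hz
  nlinarith

end Patch

end Hat

/-! ### Measurable dependence on the base point -/

section Measurability

variable {m d : ℕ} [NeZero m] {M : Type*} [TopologicalSpace M]
  [ChartedSpace (EuclideanHalfSpace m) M] {ι : M → Euc d} {x : M} {r : ℝ} {U : M → M → Euc d}
  [IsManifold (𝓡∂ m) ∞ M] [CompactSpace M] [MeasurableSpace M] [BorelSpace M]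
  (hι : Manifold.IsSmoothEmbedding (𝓡∂ m) 𝓘(ℝ, Euc d) ∞ ι) (hU : IsNormalCoordinates m ι r U)

include hι

/-- The pairs `(y, z)` with `z` in `N_y` form an open set of `M × M`, so this is Fubini
measurability for one jointly measurable integrand. -/
lemma measurable_integral_scaledVol {h : ℝ} (hh : 0 < h) {G : M → M → ℝ}
    (hG : ContinuousOn (fun p : M × M => G p.1 p.2) {p | dist (ι p.2) (ι p.1) < h}) :
    Measurable fun y => ∫ z, G y z ∂(scaledVol m ι h y) := by
  have := hι.isEmbedding.secondCountableTopology
  have := isFiniteMeasure_vol hι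
  have hO : IsOpen {p : M × M | dist (ι p.2) (ι p.1) < h} := by
    have := hι.isEmbedding.continuous
    exact isOpen_lt (by fun_prop) continuous_const
  have h1 := (stronglyMeasurable_indicator_of_continuousOn hO.measurableSet hG).integral_prod_right'
    (ν := vol m ι)
  have h2 : (fun y => ∫ z, G y z ∂(scaledVol m ι h y)) = fun y => (h ^ m)⁻¹ *
      ∫ z, ({p : M × M | dist (ι p.2) (ι p.1) < h}.indicator fun p => G p.1 p.2) (y, z)
        ∂(vol m ι) := by
    ext y
    rw [integral_scaledVol hh, ← integral_indicator
      (isOpen_nhd hι.isEmbedding.continuous h y).measurableSet]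
    rfl
  rw [h2]
  exact h1.measurable.const_mul _

include hU

lemma Patch.continuousOn_uncurry_scaledBasis {P : Patch m ι x} {k : ℕ} {h : ℝ} (hr : h ≤ r)
    (i : PolyIdx m k) : ContinuousOn (fun p : M × M => P.scaledBasis U k h p.1 i p.2)
      {p | dist (ι p.2) (ι p.1) < h} := by
  refine (continuous_polyBasis i).comp_continuousOn (ContinuousOn.fun_const_smul ?_ h⁻¹)
  refine (transposeL P.J.toContinuousLinearMap).continuous.comp_continuousOn ?_
  refine hU.smooth.continuousOn.mono fun p hp => ?_
  have hp' : dist (ι p.2) (ι p.1) < h := hp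
  rw [dist_comm] at hp'
  exact hp'.trans_le hr

/-- The local fits depend measurably on the base point. -/
lemma Patch.stronglyMeasurable_fit {P : Patch m ι x} {k : ℕ} {h : ℝ} (hh : 0 < h) (hr : h ≤ r)
    {f : M → ℝ} (hf : Continuous f) (q : M) :
    StronglyMeasurable ({y | dist (ι q) (ι y) < h}.indicator fun y =>
      ∑ i, fitCoeff (scaledVol m ι h y) (P.scaledBasis U k h y) f i
        * P.scaledBasis U k h y i q) := by
  classical
  have hb := fun i => Patch.continuousOn_uncurry_scaledBasis hι hU (P := P) (k := k) hr i
  have h1 : ∀ i j, Measurable fun y => gram (scaledVol m ι h y) (P.scaledBasis U k h y) i j :=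
    fun i j => measurable_integral_scaledVol hι hh ((hb i).mul (hb j))
  have h2 : ∀ i, Measurable fun y => moments (scaledVol m ι h y) (P.scaledBasis U k h y) f i :=
    fun i => measurable_integral_scaledVol hι hh
      ((hf.comp continuous_snd).continuousOn.mul (hb i))
  have h3 : ∀ i, Measurable fun y => fitCoeff (scaledVol m ι h y) (P.scaledBasis U k h y) f i := by
    intro i
    simp only [fitCoeff, Matrix.mulVec, dotProduct]
    exact Finset.measurable_fun_sum _ fun j _ => (measurable_matrix_inv h1 i j).mul (h2 j)
  have hO : IsOpen {y | dist (ι q) (ι y) < h} := by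
    have := hι.isEmbedding.continuous
    exact isOpen_lt (by fun_prop) continuous_const
  have h4 : ∀ i, Measurable ({y | dist (ι q) (ι y) < h}.indicator fun y =>
      P.scaledBasis U k h y i q) := fun i =>
    (stronglyMeasurable_indicator_of_continuousOn hO.measurableSet
      ((hb i).comp (f := fun y => (y, q)) (by fun_prop) fun y hy => hy)).measurable
  have h5 : ({y | dist (ι q) (ι y) < h}.indicator fun y =>
      ∑ i, fitCoeff (scaledVol m ι h y) (P.scaledBasis U k h y) f i
        * P.scaledBasis U k h y i q) = fun y => ∑ i, fitCoeff (scaledVol m ι h y)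
        (P.scaledBasis U k h y) f i * ({y | dist (ι q) (ι y) < h}.indicator fun y =>
      P.scaledBasis U k h y i q) y := by
    ext y
    by_cases hy : y ∈ {y | dist (ι q) (ι y) < h}
    · simp only [Set.indicator_of_mem hy]
    · simp only [Set.indicator_of_notMem hy, mul_zero, Finset.sum_const_zero]
  rw [h5]
  exact (Finset.measurable_fun_sum _ fun i _ => (h3 i).mul (h4 i)).stronglyMeasurable

end Measurability

/-! ### Caps of the unit ball and their affine fits -/

section Cap

variable {m : ℕ}

lemma integral_eq_zero_of_slices (b : Fin m) {g : Euc m → ℝ} (hg : Integrable g)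
    (h : ∀ u : Euc m, u b = 0 → ∫ s : ℝ, g (u + s • coordVec b) = 0) : ∫ u, g u = 0 := by
  cases m with
  | zero => exact b.elim0
  | succ n =>
    have e1 := PiLp.volume_preserving_toLp (Fin (n + 1))
    have e2 := (volume_preserving_piFinSuccAbove (fun _ : Fin (n + 1) => ℝ) b).symm
    have hm1 : MeasurableEmbedding (@WithLp.toLp 2 (Fin (n + 1) → ℝ)) :=
      (MeasurableEquiv.toLp 2 (Fin (n + 1) → ℝ)).measurableEmbedding
    have hm2 := (MeasurableEquiv.piFinSuccAbove (fun _ : Fin (n + 1) => ℝ) b).symm.measurableEmbedding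
    rw [← e1.integral_comp hm1, ← e2.integral_comp hm2]
    have hint := (e2.integrable_comp_emb hm2).2 ((e1.integrable_comp_emb hm1).2 hg)
    change Integrable _ (volume.prod volume) at hint
    rw [Measure.volume_eq_prod]
    refine (integral_prod_symm _ hint).trans ?_
    refine (integral_congr_ae (Eventually.of_forall fun y => ?_)).trans (integral_zero _ _)
    have h1 := h (WithLp.toLp 2 (b.insertNth 0 y)) (by simp)
    refine Eq.trans (integral_congr_ae (Eventually.of_forall fun s => ?_)) h1
    refine congrArg g ?_
    change WithLp.toLp 2 (b.insertNth (α := fun _ => ℝ) s y) = _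
    ext i
    refine Fin.succAboveCases b ?_ (fun j => ?_) i
    · simp [coordVec]
    · simp [coordVec]

/-- The antiderivative `c s - s ^ 3` vanishes at both endpoints `±√c`. -/
lemma integral_indicator_sq_lt (c : ℝ) :
    ∫ s : ℝ, {s : ℝ | s ^ 2 < c}.indicator (fun s => c - 3 * s ^ 2) s = 0 := by
  rcases le_or_gt c 0 with hc | hc
  · have : {s : ℝ | s ^ 2 < c} = ∅ := by
      ext s
      simp only [mem_ofPred_eq, mem_empty_iff_false, iff_false, not_lt]
      nlinarith [sq_nonneg s]
    simp [this]
  · have h1 : {s : ℝ | s ^ 2 < c} = Ioo (-√c) (√c) := by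
      ext s
      simp only [mem_ofPred_eq, mem_Ioo]
      rw [← abs_lt, Real.lt_sqrt (abs_nonneg s), sq_abs]
    have h0 : -√c ≤ √c := by have := Real.sqrt_nonneg c; linarith
    rw [h1, integral_indicator measurableSet_Ioo, ← integral_Ioc_eq_integral_Ioo,
      ← intervalIntegral.integral_of_le h0]
    have hd : ∀ s ∈ uIcc (-√c) (√c), HasDerivAt (fun s : ℝ => c * s - s ^ 3) (c - 3 * s ^ 2) s := by
      intro s _
      have := ((hasDerivAt_id s).const_mul c).sub (hasDerivAt_pow 3 s)
      refine (this.congr_deriv ?_).congr_of_eventuallyEq (Eventually.of_forall fun s => ?_)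
      · norm_num
      · rfl
    rw [intervalIntegral.integral_eq_sub_of_hasDerivAt hd
      ((by fun_prop : Continuous fun s : ℝ => c - 3 * s ^ 2).intervalIntegrable _ _)]
    have h2 : √c ^ 2 = c := Real.sq_sqrt hc.le
    have h3 : √c ^ 3 = c * √c := by rw [pow_succ, h2]
    have h4 : (-√c) ^ 3 = -(c * √c) := by rw [← h3]; ring
    rw [h3, h4]; ring

variable [NeZero m]

variable (m) in
/-- The part of the unit ball above the hyperplane at height `-t`. -/
def cap (t : ℝ) : Set (Euc m) := {u | ‖u‖ < 1 ∧ -t < u 0}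

lemma isOpen_cap (t : ℝ) : IsOpen (cap m t) :=
  (isOpen_lt continuous_norm continuous_const).inter
    (isOpen_lt continuous_const (by fun_prop : Continuous fun z : Euc m => z 0))

lemma cap_mono {s t : ℝ} (h : s ≤ t) : cap m s ⊆ cap m t := fun _ hu => ⟨hu.1, by linarith [hu.2]⟩

lemma cap_nonempty {t : ℝ} (ht : 0 ≤ t) : (cap m t).Nonempty := by
  refine ⟨(1 / 2 : ℝ) • coordVec 0, ?_, ?_⟩
  · rw [norm_smul]; simp [coordVec]; norm_num
  · simp [coordVec]; linarith

lemma volume_cap_lt_top (t : ℝ) : volume (cap m t) < ⊤ :=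
  (measure_mono fun _ hu => mem_closedBall_zero_iff.2 hu.1.le).trans_lt
    (measure_closedBall_lt_top (x := (0 : Euc m)) (r := 1))

lemma integrableOn_cap {f : Euc m → ℝ} (hf : Continuous f) (t : ℝ) : IntegrableOn f (cap m t) := by
  have : IntegrableOn f (Metric.closedBall 0 1) volume :=
    hf.continuousOn.integrableOn_compact (isCompact_closedBall _ _)
  exact this.mono_set fun u hu => mem_closedBall_zero_iff.2 hu.1.le

/-- On a line in a tangential direction `b` the height is constant and the cap is cut out by `s ^ 2
< 1 - ‖u‖ ^ 2`, taken at the point where `s = 0`; the integral over each line is then zero. -/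
lemma integral_cap_slice {b : Fin m} (hb : b ≠ 0) {g : ℝ → ℝ} (hg : Continuous g) (t : ℝ) :
    ∫ u in cap m t, (1 - ‖u‖ ^ 2 - 2 * u b ^ 2) * g (u 0) = 0 := by
  have hc : Continuous fun u : Euc m => (1 - ‖u‖ ^ 2 - 2 * u b ^ 2) * g (u 0) := by fun_prop
  rw [← integral_indicator (isOpen_cap t).measurableSet]
  refine integral_eq_zero_of_slices b
    ((integrable_indicator_iff (isOpen_cap t).measurableSet).2 (integrableOn_cap hc t)) fun u hu => ?_
  have hn : ∀ s : ℝ, ‖u + s • coordVec b‖ ^ 2 = ‖u‖ ^ 2 + s ^ 2 := by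
    intro s
    rw [norm_add_sq_real, norm_smul, inner_smul_right]
    have : inner ℝ u (coordVec b) = 0 := by
      rw [coordVec, EuclideanSpace.inner_single_right]; simp [hu]
    rw [this]
    simp [coordVec]
  have h0 : ∀ s : ℝ, (u + s • coordVec b) 0 = u 0 := fun s => by simp [coordVec, hb]
  have hb' : ∀ s : ℝ, (u + s • coordVec b) b = s := fun s => by simp [coordVec, hu]
  by_cases ht : -t < u 0
  · have h1 : ∀ s : ℝ, (cap m t).indicator (fun u => (1 - ‖u‖ ^ 2 - 2 * u b ^ 2) * g (u 0))
        (u + s • coordVec b) = {s : ℝ | s ^ 2 < 1 - ‖u‖ ^ 2}.indicator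
          (fun s => (1 - ‖u‖ ^ 2) - 3 * s ^ 2) s * g (u 0) := by
      intro s
      have hiff : u + s • coordVec b ∈ cap m t ↔ s ∈ {s : ℝ | s ^ 2 < 1 - ‖u‖ ^ 2} := by
        simp only [cap, mem_ofPred_eq, h0, ht, and_true]
        rw [← sq_lt_one_iff₀ (norm_nonneg _), hn]
        constructor <;> intro h <;> linarith
      by_cases hs : s ∈ {s : ℝ | s ^ 2 < 1 - ‖u‖ ^ 2}
      · rw [indicator_of_mem (hiff.2 hs), indicator_of_mem hs, hn, h0, hb']; ring
      · rw [indicator_of_notMem (fun h => hs (hiff.1 h)), indicator_of_notMem hs, zero_mul]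
    simp_rw [h1]
    rw [integral_mul_const, integral_indicator_sq_lt, zero_mul]
  · refine (integral_congr_ae (Eventually.of_forall fun s => ?_)).trans (integral_zero _ _)
    refine indicator_of_notMem (fun h => ht ?_) _
    have := h.2
    rwa [h0] at this

lemma norm_sq_eq_add_sum (u : Euc m) : ‖u‖ ^ 2 = u 0 ^ 2 + ∑ c ∈ Finset.univ.erase 0, u c ^ 2 := by
  rw [EuclideanSpace.norm_sq_eq, Finset.add_sum_erase _ (fun c => u c ^ 2) (Finset.mem_univ 0)]
  simp

/-- On each slice of constant height the mean of `u_b²` is `(1 - u₀²) / (m + 1)`. -/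
lemma integral_cap_sq {b : Fin m} (hb : b ≠ 0) {g : ℝ → ℝ} (hg : Continuous g) (t : ℝ) :
    ∫ u in cap m t, (u b ^ 2 - (1 - u 0 ^ 2) / (m + 1)) * g (u 0) = 0 := by
  have hI : ∀ {f : Euc m → ℝ}, Continuous f → Integrable f (volume.restrict (cap m t)) :=
    fun hf => integrableOn_cap hf t
  set W := ∫ u in cap m t, (1 - ‖u‖ ^ 2) * g (u 0) with hW
  -- Every tangential coordinate has the same weighted second moment `W / 2`.
  have h1 : ∀ c : Fin m, c ≠ 0 → ∫ u in cap m t, u c ^ 2 * g (u 0) = W / 2 := by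
    intro c hc
    have h2 := integral_cap_slice hc hg t
    have h3 : ∀ u : Euc m, (1 - ‖u‖ ^ 2 - 2 * u c ^ 2) * g (u 0)
        = (1 - ‖u‖ ^ 2) * g (u 0) - 2 * (u c ^ 2 * g (u 0)) := fun u => by ring
    simp_rw [h3] at h2
    rw [integral_sub (hI (by fun_prop)) (hI (by fun_prop)), integral_const_mul] at h2
    linarith
  -- Since `1 - u_0 ^ 2` is `1 - ‖u‖ ^ 2` plus the `m - 1` tangential squares, its moment is `(m +
  -- 1) / 2` times `W`; this is the source of the factor `m + 1`.
  have h4 : ∫ u in cap m t, (1 - u 0 ^ 2) * g (u 0) = W + (m - 1) * (W / 2) := by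
    have h5 : ∀ u : Euc m, (1 - u 0 ^ 2) * g (u 0) = (1 - ‖u‖ ^ 2) * g (u 0)
        + ∑ c ∈ Finset.univ.erase 0, u c ^ 2 * g (u 0) := fun u => by
      rw [norm_sq_eq_add_sum, ← Finset.sum_mul]; ring
    simp_rw [h5]
    rw [integral_add (hI (by fun_prop)) (hI (by fun_prop)),
      integral_finsetSum _ fun c _ => hI (by fun_prop),
      Finset.sum_congr rfl fun c hc => h1 c (Finset.ne_of_mem_erase hc), Finset.sum_const,
      Finset.card_erase_of_mem (Finset.mem_univ _), Finset.card_univ, Fintype.card_fin, nsmul_eq_mul,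
      Nat.cast_sub (NeZero.one_le), Nat.cast_one]
  have h6 : ∀ u : Euc m, (u b ^ 2 - (1 - u 0 ^ 2) / (m + 1)) * g (u 0)
      = u b ^ 2 * g (u 0) - (1 / ((m : ℝ) + 1)) * ((1 - u 0 ^ 2) * g (u 0)) := fun u => by ring
  simp_rw [h6]
  rw [integral_sub (hI (by fun_prop)) (hI (by fun_prop)), integral_const_mul, h1 b hb, h4]
  have : (m : ℝ) + 1 ≠ 0 := by positivity
  field_simp
  ring

/-- The reflection of a coordinate. -/
def coordReflection (c : Fin m) : Euc m ≃ₗᵢ[ℝ] Euc m :=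
  LinearIsometryEquiv.piLpCongrRight 2 fun i =>
    if i = c then LinearIsometryEquiv.neg ℝ else LinearIsometryEquiv.refl ℝ ℝ

omit [NeZero m] in
lemma coordReflection_apply (c : Fin m) (u : Euc m) (i : Fin m) :
    coordReflection c u i = if i = c then -u i else u i := by
  simp only [coordReflection, LinearIsometryEquiv.piLpCongrRight_apply]
  split_ifs <;> rfl

section Fit

/-- Caps grow with `t` inside the unit ball, so the lower bound on the half ball and the upper
bounds on the ball serve all `t ≥ 0`. -/
lemma exists_isFitSystem_cap (k : ℕ) : ∃ κ K V, ∀ t, 0 ≤ t →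
    IsFitSystem (volume.restrict (cap m t)) (polyBasis m k) κ K V := by
  classical
  obtain ⟨κ, hκ, hl⟩ := exists_polyBasis_lower (k := k) (isOpen_cap (m := m) 0)
    (cap_nonempty le_rfl) (R := 1) fun u hu => hu.1.le
  obtain ⟨K, hK0, hK⟩ := exists_polyBasis_bound (m := m) (k := k) 1
  refine ⟨κ, K, volume.real (Metric.closedBall (0 : Euc m) 1), fun t ht => ⟨?_, ?_, ?_, ?_, ?_, hκ, ?_⟩⟩
  · exact isFiniteMeasure_restrict.2 (volume_cap_lt_top t).ne
  · rw [measureReal_restrict_apply MeasurableSet.univ, univ_inter]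
    exact measureReal_mono (fun _ hu => mem_closedBall_zero_iff.2 hu.1.le)
      measure_closedBall_lt_top.ne
  · exact fun i => (continuous_polyBasis i).aestronglyMeasurable
  · intro i
    filter_upwards [ae_restrict_mem (isOpen_cap t).measurableSet] with u hu using hK i u hu.1.le
  · exact hK0.le
  · intro c
    refine (hl c).trans (setIntegral_mono_set ?_ (ae_of_all _ fun u => sq_nonneg _)
      (cap_mono ht).eventuallyLE)
    have := fun i => continuous_polyBasis (m := m) (k := k) i
    exact integrableOn_cap (by fun_prop) t

lemma exists_isBdd_cap {f : Euc m → ℝ} (hf : Continuous f) : ∃ L, 0 ≤ L ∧ (∀ u, ‖u‖ ≤ 1 → |f u| ≤ L) ∧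
    ∀ t, IsBdd (volume.restrict (cap m t)) f L := by
  obtain ⟨L, hL⟩ := (isCompact_closedBall (0 : Euc m) 1).exists_bound_of_continuousOn hf.continuousOn
  have h : ∀ u, ‖u‖ ≤ 1 → |f u| ≤ L := fun u hu => hL u (mem_closedBall_zero_iff.2 hu)
  refine ⟨L, (abs_nonneg _).trans (h 0 (by simp)), h, fun t => ⟨hf.aestronglyMeasurable, ?_⟩⟩
  filter_upwards [ae_restrict_mem (isOpen_cap t).measurableSet] with u hu using h u hu.1.le

/-- The affine fit of a function on a cap. -/
def capFit (t : ℝ) (f : Euc m → ℝ) (u : Euc m) : ℝ :=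
  ∑ i, fitCoeff (volume.restrict (cap m t)) (polyBasis m 1) f i * polyBasis m 1 i u

lemma capFit_mem (t : ℝ) (f : Euc m → ℝ) : capFit t f ∈ polyFun m 1 := sum_polyBasis_mem _

lemma integral_sub_capFit_mul {t : ℝ} (ht : 0 ≤ t) {f g : Euc m → ℝ} (hf : Continuous f)
    (hg : g ∈ polyFun m 1) : ∫ u in cap m t, (f u - capFit t f u) * g u = 0 := by
  obtain ⟨κ, K, V, hs⟩ := exists_isFitSystem_cap (m := m) 1
  obtain ⟨L, -, -, hL⟩ := exists_isBdd_cap hf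
  obtain ⟨c, hc⟩ := exists_sum_polyBasis hg
  simp_rw [hc]
  exact (hs t ht).orthogonal_sum (hL t) c

lemma capFit_unique {t : ℝ} (ht : 0 ≤ t) {f p : Euc m → ℝ} (hf : Continuous f)
    (hp : p ∈ polyFun m 1) (h : ∀ g ∈ polyFun m 1, ∫ u in cap m t, (f u - p u) * g u = 0) :
    capFit t f = p := by
  obtain ⟨κ, K, V, hs⟩ := exists_isFitSystem_cap (m := m) 1
  obtain ⟨L, -, -, hL⟩ := exists_isBdd_cap hf
  obtain ⟨c, hc⟩ := exists_sum_polyBasis hp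
  have := (hs t ht).eq_fitCoeff (hL t) (c := c) fun j => by
    simp_rw [← hc]; exact h _ (polyBasis_mem j)
  ext u
  rw [hc, this]; rfl

lemma capFit_add {t : ℝ} (ht : 0 ≤ t) {f g : Euc m → ℝ} (hf : Continuous f) (hg : Continuous g) :
    capFit t (fun u => f u + g u) = fun u => capFit t f u + capFit t g u := by
  obtain ⟨κ, K, V, hs⟩ := exists_isFitSystem_cap (m := m) 1
  obtain ⟨L, -, -, hL⟩ := exists_isBdd_cap hf
  obtain ⟨L', -, -, hL'⟩ := exists_isBdd_cap hg
  ext u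
  simp only [capFit, (hs t ht).fitCoeff_add (hL t) (hL' t), Pi.add_apply, add_mul,
    Finset.sum_add_distrib]

lemma capFit_const_mul (t : ℝ) (a : ℝ) (f : Euc m → ℝ) :
    capFit t (fun u => a * f u) = fun u => a * capFit t f u := by
  ext u
  simp only [capFit, fitCoeff_const_mul, Pi.smul_apply, smul_eq_mul, Finset.mul_sum, mul_assoc]

lemma cap_preimage {R : Euc m ≃ₗᵢ[ℝ] Euc m} (hR : ∀ u, R u 0 = u 0) (t : ℝ) :
    R ⁻¹' cap m t = cap m t := by
  ext u
  simp only [cap, mem_preimage, mem_ofPred_eq, R.norm_map, hR]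

lemma setIntegral_cap_comp {R : Euc m ≃ₗᵢ[ℝ] Euc m} (hR : ∀ u, R u 0 = u 0) (t : ℝ)
    (f : Euc m → ℝ) : ∫ u in cap m t, f (R u) = ∫ u in cap m t, f u := by
  have := (R.measurePreserving).setIntegral_preimage_emb
    R.toHomeomorph.measurableEmbedding f (cap m t)
  rwa [cap_preimage hR] at this

/-- An isometry that fixes heights preserves the cap, its volume and the affine functions, so it
commutes with the projection. -/
lemma capFit_comp {R : Euc m ≃ₗᵢ[ℝ] Euc m} (hR : ∀ u, R u 0 = u 0) {t : ℝ} (ht : 0 ≤ t)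
    {f : Euc m → ℝ} (hf : Continuous f) :
    capFit t (fun u => f (R u)) = fun u => capFit t f (R u) := by
  refine capFit_unique ht (hf.comp R.continuous)
    (comp_linear_mem_polyFun (capFit_mem t f) (R : Euc m ≃L[ℝ] Euc m).toContinuousLinearMap)
    fun g hg => ?_
  rw [← integral_sub_capFit_mul ht hf (comp_linear_mem_polyFun hg
    (R.symm : Euc m ≃L[ℝ] Euc m).toContinuousLinearMap), ← setIntegral_cap_comp hR t fun u => (f u - capFit t f u) * g _]
  refine integral_congr_ae (Eventually.of_forall fun u => ?_)
  simp

lemma exists_abs_capFit_le {f : Euc m → ℝ} (hf : Continuous f) : ∃ L, ∀ t, 0 ≤ t → ∀ u, ‖u‖ ≤ 1 →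
    |capFit t f u| ≤ L := by
  obtain ⟨κ, K, V, hs⟩ := exists_isFitSystem_cap (m := m) 1
  obtain ⟨L, hL0, -, hL⟩ := exists_isBdd_cap hf
  obtain ⟨K', hK0, hK⟩ := exists_polyBasis_bound (m := m) (k := 1) 1
  refine ⟨Fintype.card (PolyIdx m 1) * K * V / κ * L * K', fun t ht u hu => ?_⟩
  refine (Finset.abs_sum_le_sum_abs _ _).trans ?_
  have h1 := (hs t ht).sum_abs_fitCoeff_le (hL t) hL0
  refine le_trans ?_ (mul_le_mul_of_nonneg_right h1 hK0.le)
  rw [Finset.sum_mul]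
  refine Finset.sum_le_sum fun i _ => ?_
  rw [abs_mul]
  exact mul_le_mul_of_nonneg_left (hK i u hu) (abs_nonneg _)

lemma measurable_setIntegral_cap {g : Euc m → ℝ} (hg : Continuous g) :
    Measurable fun t => ∫ u in cap m t, g u := by
  have hO : IsOpen {p : ℝ × Euc m | p.2 ∈ cap m p.1} :=
    (isOpen_lt (by fun_prop : Continuous fun p : ℝ × Euc m => ‖p.2‖) continuous_const).inter
      (isOpen_lt (by fun_prop : Continuous fun p : ℝ × Euc m => -p.1)
        (by fun_prop : Continuous fun p : ℝ × Euc m => p.2 0))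
  have h1 := (stronglyMeasurable_indicator_of_continuousOn hO.measurableSet
    (hg.comp continuous_snd).continuousOn).integral_prod_right' (ν := (volume : Measure (Euc m)))
  have h2 : (fun t => ∫ u in cap m t, g u) = fun t => ∫ u,
      ({p : ℝ × Euc m | p.2 ∈ cap m p.1}.indicator (g ∘ Prod.snd)) (t, u) := by
    ext t
    rw [← integral_indicator (isOpen_cap t).measurableSet]
    rfl
  rw [h2]
  exact h1.measurable

lemma measurable_capFit {f : Euc m → ℝ} (hf : Continuous f) :
    Measurable fun z : Euc m => capFit (z 0) f (-z) := by
  classical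
  have hb := fun i => continuous_polyBasis (m := m) (k := 1) i
  have h1 : ∀ i j, Measurable fun t => gram (volume.restrict (cap m t)) (polyBasis m 1) i j :=
    fun i j => measurable_setIntegral_cap ((hb i).mul (hb j))
  have h2 : ∀ i, Measurable fun t => moments (volume.restrict (cap m t)) (polyBasis m 1) f i :=
    fun i => measurable_setIntegral_cap (hf.mul (hb i))
  have h3 : ∀ i, Measurable fun t => fitCoeff (volume.restrict (cap m t)) (polyBasis m 1) f i := by
    intro i
    simp only [fitCoeff, Matrix.mulVec, dotProduct]
    exact Finset.measurable_fun_sum _ fun j _ => (measurable_matrix_inv h1 i j).mul (h2 j)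
  have h4 : Measurable fun z : Euc m => z 0 := by fun_prop
  exact Finset.measurable_fun_sum _ fun i _ => ((h3 i).comp h4).mul
    ((hb i).comp continuous_neg).measurable

/-- The integral over a half ball of the residuals, at a fixed boundary point, of the affine fits
in the balls around the points of the half ball. -/
def capIntegral (f : Euc m → ℝ) : ℝ := ∫ z in cap m 0, (f (-z) - capFit (z 0) f (-z))

lemma integrable_capIntegral {f : Euc m → ℝ} (hf : Continuous f) :
    IntegrableOn (fun z => f (-z) - capFit (z 0) f (-z)) (cap m 0) := by
  refine (integrableOn_cap (hf.comp continuous_neg) 0).sub ?_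
  obtain ⟨L, hL⟩ := exists_abs_capFit_le hf
  refine IntegrableOn.of_bound (volume_cap_lt_top 0) (measurable_capFit hf).aestronglyMeasurable L ?_
  filter_upwards [ae_restrict_mem (isOpen_cap 0).measurableSet] with u hu
  exact hL _ (by have := hu.2; linarith) _ (by rw [norm_neg]; exact hu.1.le)

lemma capIntegral_add {f g : Euc m → ℝ} (hf : Continuous f) (hg : Continuous g) :
    capIntegral (fun u => f u + g u) = capIntegral f + capIntegral g := by
  rw [capIntegral, capIntegral, capIntegral,
    ← integral_add (integrable_capIntegral hf) (integrable_capIntegral hg)]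
  refine setIntegral_congr_fun (isOpen_cap 0).measurableSet fun z hz => ?_
  simp only [capFit_add (by have := hz.2; linarith : 0 ≤ z 0) hf hg]
  ring

lemma capIntegral_const_mul (a : ℝ) (f : Euc m → ℝ) :
    capIntegral (fun u => a * f u) = a * capIntegral f := by
  rw [capIntegral, capIntegral, ← integral_const_mul]
  refine integral_congr_ae (Eventually.of_forall fun z => ?_)
  simp only [capFit_const_mul]
  ring

lemma capIntegral_comp {R : Euc m ≃ₗᵢ[ℝ] Euc m} (hR : ∀ u, R u 0 = u 0) {f : Euc m → ℝ}
    (hf : Continuous f) : capIntegral (fun u => f (R u)) = capIntegral f := by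
  rw [capIntegral, capIntegral, ← setIntegral_cap_comp hR 0 fun z => f (-z) - capFit (z 0) f (-z)]
  refine setIntegral_congr_fun (isOpen_cap 0).measurableSet fun z hz => ?_
  simp only [capFit_comp hR (by have := hz.2; linarith : 0 ≤ z 0) hf, hR, map_neg]

lemma capIntegral_finsetSum {J : Type*} (s : Finset J) {f : J → Euc m → ℝ}
    (hf : ∀ j, Continuous (f j)) :
    capIntegral (fun u => ∑ j ∈ s, f j u) = ∑ j ∈ s, capIntegral (f j) := by
  classical
  induction s using Finset.induction_on with
  | empty =>
    have := capIntegral_const_mul (m := m) 0 fun _ => 0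
    simpa using this
  | insert j s hj ih =>
    simp only [Finset.sum_insert hj]
    rw [capIntegral_add (hf j) (by fun_prop), ih]

end Fit

end Cap

/-! ### The cap integral of a quadratic form -/

section CapIntegral

variable {m : ℕ} [NeZero m]

lemma coordReflection_apply_zero {c : Fin m} (hc : c ≠ 0) (u : Euc m) :
    coordReflection c u 0 = u 0 := by
  rw [coordReflection_apply, if_neg hc.symm]

lemma setIntegral_cap_eq_zero_of_odd {c : Fin m} (hc : c ≠ 0) (t : ℝ) {f : Euc m → ℝ}
    (h : ∀ u, f (coordReflection c u) = -f u) : ∫ u in cap m t, f u = 0 := by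
  have h1 := setIntegral_cap_comp (coordReflection_apply_zero hc) t f
  simp only [h, integral_neg] at h1
  linarith

lemma capIntegral_eq_zero_of_odd {c : Fin m} (hc : c ≠ 0) {f : Euc m → ℝ} (hf : Continuous f)
    (h : ∀ u, f (coordReflection c u) = -f u) : capIntegral f = 0 := by
  have h1 := capIntegral_comp (coordReflection_apply_zero hc) hf
  have h2 := capIntegral_const_mul (-1) f
  simp only [h] at h1
  simp only [neg_one_mul] at h2
  linarith

/-- One of the two indices is tangential, and reflecting that coordinate changes the sign of the
product. -/
lemma capIntegral_mul_of_ne {a b : Fin m} (h : a ≠ b) :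
    capIntegral (fun u : Euc m => u a * u b) = 0 := by
  obtain ⟨c, hc, hab⟩ : ∃ c : Fin m, c ≠ 0 ∧ (c = a ∨ c = b) := by
    by_cases ha : a = 0
    · exact ⟨b, fun hb => h (ha.trans hb.symm), Or.inr rfl⟩
    · exact ⟨a, ha, Or.inl rfl⟩
  refine capIntegral_eq_zero_of_odd hc (by fun_prop) fun u => ?_
  rw [coordReflection_apply, coordReflection_apply]
  rcases hab with rfl | rfl
  · rw [if_pos rfl, if_neg h.symm]; ring
  · rw [if_pos rfl, if_neg h]; ring

/-- `u_b ^ 2 + u_0 ^ 2 / (m + 1)` minus the constant `1 / (m + 1)` is orthogonal to functions of the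
height by `integral_cap_sq`, and to the tangential coordinates by reflection. So that constant is
the affine fit, and the residual integrates to zero over the half ball by the same slice identity.
-/
lemma capIntegral_sq_of_ne {b : Fin m} (hb : b ≠ 0) :
    capIntegral (fun u : Euc m => u b * u b)
      = -(1 / ((m : ℝ) + 1)) * capIntegral (fun u : Euc m => u 0 * u 0) := by
  have hfit : ∀ t, 0 ≤ t → capFit t (fun u : Euc m => u b * u b + (1 / ((m : ℝ) + 1)) * (u 0 * u 0))
      = fun _ => 1 / ((m : ℝ) + 1) := by
    intro t ht
    refine capFit_unique ht (by fun_prop) (const_mem_polyFun _) fun g hg => ?_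
    obtain ⟨α, β, hg⟩ := exists_affine_of_mem_polyFun hg
    have h1 : ∀ u : Euc m, (u b * u b + (1 / ((m : ℝ) + 1)) * (u 0 * u 0) - 1 / ((m : ℝ) + 1)) * g u
        = (u b ^ 2 - (1 - u 0 ^ 2) / (m + 1)) * (α + β 0 * u 0)
          + ∑ i ∈ Finset.univ.erase 0, β i * ((u b ^ 2 - (1 - u 0 ^ 2) / (m + 1)) * u i) := by
      intro u
      rw [hg, ← Finset.add_sum_erase _ (fun i => β i * u i) (Finset.mem_univ 0),
        ← Finset.sum_congr rfl fun i _ => mul_left_comm (u b ^ 2 - (1 - u 0 ^ 2) / ((m : ℝ) + 1))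
          (β i) (u i), ← Finset.mul_sum]
      ring
    simp_rw [h1]
    rw [integral_add (integrableOn_cap (by fun_prop) t) (integrableOn_cap (by fun_prop) t),
      integral_finsetSum _ fun i _ => integrableOn_cap (by fun_prop) t,
      integral_cap_sq hb (g := fun s => α + β 0 * s) (by fun_prop), zero_add]
    refine Finset.sum_eq_zero fun i hi => ?_
    have hi0 := Finset.ne_of_mem_erase hi
    rw [integral_const_mul, setIntegral_cap_eq_zero_of_odd hi0, mul_zero]
    intro u
    simp only [coordReflection_apply, if_neg hi0.symm, if_true]
    split_ifs <;> ring
  have h2 : capIntegral (fun u : Euc m => u b * u b + (1 / ((m : ℝ) + 1)) * (u 0 * u 0)) = 0 := by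
    rw [← integral_cap_sq hb (continuous_const (y := (1 : ℝ))) 0, capIntegral]
    refine setIntegral_congr_fun (isOpen_cap 0).measurableSet fun z hz => ?_
    simp only [hfit _ (by have := hz.2; linarith : 0 ≤ z 0), PiLp.neg_apply]
    ring
  rw [capIntegral_add (by fun_prop) (by fun_prop), capIntegral_const_mul] at h2
  linarith

/-- The fit inherits the invariance of `u_0 ^ 2` under tangential reflections, so its tangential
slopes vanish. -/
lemma exists_capFit_sq {t : ℝ} (ht : 0 ≤ t) : ∃ a b : ℝ, ∀ u : Euc m,
    capFit t (fun u : Euc m => u 0 * u 0) u = a + b * u 0 := by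
  obtain ⟨a, β, h⟩ := exists_affine_of_mem_polyFun (capFit_mem (m := m) t fun u => u 0 * u 0)
  refine ⟨a, β 0, fun u => ?_⟩
  rw [h, ← Finset.add_sum_erase _ (fun i => β i * u i) (Finset.mem_univ 0),
    Finset.sum_eq_zero, add_zero]
  intro c hc
  have hc0 := Finset.ne_of_mem_erase hc
  have h1 := congrFun (capFit_comp (coordReflection_apply_zero hc0) ht
    (by fun_prop : Continuous fun u : Euc m => u 0 * u 0)) (coordVec c)
  simp only [coordReflection_apply_zero hc0] at h1
  rw [h, h] at h1
  have h2 : ∀ i, β i * coordReflection c (coordVec c : Euc m) i = -(β i * (coordVec c : Euc m) i) := by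
    intro i
    rw [coordReflection_apply]
    by_cases hi : i = c
    · rw [if_pos hi]; ring
    · simp [coordVec, hi]
  simp only [h2, Finset.sum_neg_distrib] at h1
  have h3 : ∑ i, β i * (coordVec c : Euc m) i = β c := by simp [coordVec]
  rw [h3] at h1
  have : β c = 0 := by linarith
  rw [this, zero_mul]

/-- The residual of the affine fit of `u₀²` is positive at the bottom of the cap. -/
lemma capFit_sq_lt {t : ℝ} (ht : 0 ≤ t) {u : Euc m} (hu : u 0 = -t) :
    capFit t (fun u : Euc m => u 0 * u 0) u < u 0 * u 0 := by
  obtain ⟨a, b, hab⟩ := exists_capFit_sq (m := m) ht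
  rw [hab, hu]
  -- Otherwise `s ^ 2 - (a + b s)` is nonpositive at `s = -t`, hence has real roots `e' ≤ -t ≤ e`.
  by_contra hlt
  push Not at hlt
  set D := b ^ 2 + 4 * a
  have hD : (b + 2 * t) ^ 2 ≤ D := by simp only [D]; nlinarith
  have hD0 : 0 ≤ D := (sq_nonneg _).trans hD
  have hsq := Real.sq_sqrt hD0
  have hle : b + 2 * t ≤ √D := Real.le_sqrt_of_sq_le hD
  set e := (b + √D) / 2 with he
  set e' := (b - √D) / 2 with he'
  have hprod : ∀ s : ℝ, s * s - (a + b * s) = (s - e) * (s - e') := by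
    intro s
    have : D = b ^ 2 + 4 * a := rfl
    rw [he, he']; nlinarith
  have hg : (fun u : Euc m => u 0 - e) ∈ polyFun m 1 :=
    Submodule.sub_mem _ (apply_mem_polyFun 0) (const_mem_polyFun e)
  -- Tested against the affine function `u_0 - e`, the residual gives `(u_0 - e) ^ 2 (u_0 - e')`,
  -- which is nonnegative on the cap and not identically zero; this contradicts orthogonality.
  have h0 := integral_sub_capFit_mul ht (by fun_prop : Continuous fun u : Euc m => u 0 * u 0) hg
  simp only [hab, hprod] at h0
  have hc : Continuous fun u : Euc m => (u 0 - e) * (u 0 - e') * (u 0 - e) := by fun_prop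
  have hnn : 0 ≤ᵐ[volume.restrict (cap m t)] fun u => (u 0 - e) * (u 0 - e') * (u 0 - e) := by
    filter_upwards [ae_restrict_mem (isOpen_cap t).measurableSet] with u hu
    have h1 : 0 ≤ u 0 - e' := by have := hu.2; linarith
    have h2 : (u 0 - e) * (u 0 - e') * (u 0 - e) = (u 0 - e) ^ 2 * (u 0 - e') := by ring
    rw [h2]
    positivity
  have h1 := (integral_eq_zero_iff_of_nonneg_ae hnn (integrableOn_cap hc t)).1 h0
  have h2 := Measure.eqOn_open_of_ae_eq h1 (isOpen_cap t) hc.continuousOn continuousOn_const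
  have h3 : ∀ s ∈ Ioo (0 : ℝ) 1, s = e := by
    intro s hs
    have hmem : s • (coordVec 0 : Euc m) ∈ cap m t := by
      refine ⟨?_, ?_⟩
      · rw [norm_smul]; simp [coordVec, abs_of_pos hs.1, hs.2]
      · simp [coordVec]; linarith [hs.1]
    have h4 := h2 hmem
    have h5 : (s • (coordVec 0 : Euc m)) 0 = s := by simp [coordVec]
    simp only [h5, Pi.zero_apply] at h4
    have h6 : s - e' ≠ 0 := by have := hs.1; intro h; linarith
    rcases mul_eq_zero.1 h4 with h7 | h7
    · exact sub_eq_zero.1 ((mul_eq_zero.1 h7).resolve_right h6)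
    · exact sub_eq_zero.1 h7
  have h4 := h3 (1 / 2) (by norm_num)
  have h5 := h3 (1 / 3) (by norm_num)
  norm_num [← h4] at h5

lemma capIntegral_sq_zero_pos : 0 < capIntegral (fun u : Euc m => u 0 * u 0) := by
  rw [capIntegral, setIntegral_pos_iff_support_of_nonneg_ae]
  · refine lt_of_lt_of_le ((isOpen_cap (m := m) 0).measure_pos volume (cap_nonempty le_rfl))
      (measure_mono fun z hz => ⟨?_, hz⟩)
    have h0 : (0 : ℝ) ≤ z 0 := by have := hz.2; linarith
    have := capFit_sq_lt (m := m) h0 (u := -z) (by simp)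
    exact (sub_pos.2 this).ne'
  · filter_upwards [ae_restrict_mem (isOpen_cap 0).measurableSet] with z hz
    have h0 : (0 : ℝ) ≤ z 0 := by have := hz.2; linarith
    have := capFit_sq_lt (m := m) h0 (u := -z) (by simp)
    exact (sub_pos.2 this).le
  · exact integrable_capIntegral (by fun_prop : Continuous fun u : Euc m => u 0 * u 0)

/-- The diagonal terms sum to `T_00 - (∑_{b ≠ 0} T_bb) / (m + 1)`, which is where the constant `m +
2` of the boundary condition arises. -/
lemma capIntegral_bilinear (T : Euc m →L[ℝ] Euc m →L[ℝ] ℝ) :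
    capIntegral (fun u : Euc m => T u u)
      = (((m : ℝ) + 2) * T (coordVec 0) (coordVec 0) - ∑ a, T (coordVec a) (coordVec a)) / (m + 1)
        * capIntegral (fun u : Euc m => u 0 * u 0) := by
  set I0 := capIntegral (fun u : Euc m => u 0 * u 0)
  have h1 : (fun u : Euc m => T u u)
      = fun u => ∑ a, ∑ b, T (coordVec a) (coordVec b) * (u a * u b) := by
    ext u
    conv_lhs => rw [euc_eq_sum u]
    simp only [map_sum, map_smul, _root_.sum_apply, _root_.smul_apply, smul_eq_mul, Finset.mul_sum]
    rw [Finset.sum_comm]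
    exact Finset.sum_congr rfl fun a _ => Finset.sum_congr rfl fun b _ => by ring
  have h2 : ∀ a, ∑ b, T (coordVec a) (coordVec b) * capIntegral (fun u : Euc m => u a * u b)
      = T (coordVec a) (coordVec a) * capIntegral (fun u : Euc m => u a * u a) := fun a =>
    Finset.sum_eq_single a (fun b _ hb => by rw [capIntegral_mul_of_ne hb.symm, mul_zero])
      fun h => absurd (Finset.mem_univ a) h
  have h3 : ∀ a ∈ Finset.univ.erase (0 : Fin m),
      T (coordVec a) (coordVec a) * capIntegral (fun u : Euc m => u a * u a)
      = T (coordVec a) (coordVec a) * (-(1 / ((m : ℝ) + 1)) * I0) := fun a ha => by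
    rw [capIntegral_sq_of_ne (Finset.ne_of_mem_erase ha)]
  have h4 : ∀ a b : Fin m, Continuous fun u : Euc m =>
    T (coordVec a) (coordVec b) * (u a * u b) := fun a b => by fun_prop
  have h5 : ∀ a, capIntegral (fun u : Euc m => ∑ b, T (coordVec a) (coordVec b) * (u a * u b))
      = T (coordVec a) (coordVec a) * capIntegral (fun u : Euc m => u a * u a) := fun a => by
    rw [capIntegral_finsetSum _ fun b => h4 a b, ← h2]
    exact Finset.sum_congr rfl fun b _ => capIntegral_const_mul _ _
  rw [h1, capIntegral_finsetSum _ fun a => continuous_finsetSum _ fun b _ => h4 a b,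
    Finset.sum_congr rfl fun a _ => h5 a, ← Finset.add_sum_erase _ _ (Finset.mem_univ 0), Finset.sum_congr rfl h3, ← Finset.sum_mul,
    ← Finset.add_sum_erase _ (fun a => T (coordVec a) (coordVec a)) (Finset.mem_univ 0)]
  rw [show capIntegral (fun u : Euc m => u 0 * u 0) = I0 from rfl]
  have : (m : ℝ) + 1 ≠ 0 := by positivity
  field_simp
  ring

end CapIntegral

/-- The relation `x ∈ N_y` is symmetric, so the integrand is supported in `N_x`. -/
lemma abs_integral_nhd_le {m d : ℕ} {M : Type*} [MeasurableSpace M] {ι : M → Euc d} {h K : ℝ} (x : M) {g : M → ℝ} (hg : ∀ y, |g y| ≤ K)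
    [IsFiniteMeasure (vol m ι)] (h0 : ∀ y, x ∉ nhd ι h y → g y = 0) :
    |∫ y, g y ∂(vol m ι)| ≤ K * (vol m ι).real (nhd ι h x) := by
  rw [← setIntegral_eq_integral_of_forall_compl_eq_zero (s := nhd ι h x) fun y hy => h0 y ?_]
  · rw [← Real.norm_eq_abs]
    exact norm_setIntegral_le_of_norm_le_const (measure_lt_top _ _) fun y _ => hg y
  · intro hx
    refine hy ?_
    have : dist (ι x) (ι y) < h := hx
    rwa [dist_comm] at this

/-! ### Affine functions of an isometric chart -/

section AffineChart

open Patch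

variable {m d : ℕ} [NeZero m] {M : Type*} [TopologicalSpace M]
  [ChartedSpace (EuclideanHalfSpace m) M] {ι : M → Euc d} {r : ℝ} {U : M → M → Euc d}

lemma affine_mem_localPoly {k : ℕ} (hk : 1 ≤ k) (c : ℝ) (T : Euc d →L[ℝ] ℝ) (y : M) :
    (fun q => c + T (U y q)) ∈ localPoly U k y :=
  localPoly_mono hk y (comp_mem_localPoly (f := fun u => c + T u)
    (Submodule.add_mem _ (const_mem_polyFun c) (linear_mem_polyFun T)) y)

lemma ballVol_eq (m : ℕ) {h : ℝ} (hh : 0 < h) : ballVol m h = h ^ m * ballVol m 1 := by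
  rw [ballVol, Measure.addHaar_ball_of_pos _ _ hh, ENNReal.toReal_mul,
    ENNReal.toReal_ofReal (by positivity), finrank_euclideanSpace_fin]
  rfl

lemma ballVol_one_pos (m : ℕ) : 0 < ballVol m 1 :=
  ENNReal.toReal_pos (Metric.measure_ball_pos volume _ one_pos).ne' measure_ball_lt_top.ne

variable [IsManifold (𝓡∂ m) ∞ M] [CompactSpace M] [MeasurableSpace M] [BorelSpace M]
  (hι : Manifold.IsSmoothEmbedding (𝓡∂ m) 𝓘(ℝ, Euc d) ∞ ι) (hU : IsNormalCoordinates m ι r U)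

include hι hU

/-- A function that is a polynomial of the local coordinates on `N_y` is its own local fit. -/
lemma eqOn_hat_of_eqOn_localPoly {k : ℕ} {y : M} {h : ℝ} (hr : h < r) {f p : M → ℝ}
    (hp : p ∈ localPoly U k y) (hfp : EqOn f p (nhd ι h y)) :
    EqOn f (hat m ι U k h y f) (nhd ι h y) := by
  have := isFiniteMeasure_vol hι
  have := isOpenPosMeasure_vol hι
  have := hι.isEmbedding.t2Space
  have hO := isOpen_nhd hι.isEmbedding.continuous h y
  -- `p` itself is a fit, so the chosen one satisfies the normal equations.
  have hex : ∃ p, IsLocalFit m ι U k h y f p := by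
    refine ⟨p, hp, fun q _ => ?_⟩
    rw [setIntegral_congr_fun (g := fun _ => 0) hO.measurableSet fun z hz => ?_, integral_zero]
    simp only [hfp hz, sub_self, zero_mul]
  obtain ⟨h1, h2⟩ : IsLocalFit m ι U k h y f (hat m ι U k h y f) := Classical.epsilon_spec hex
  set p' := hat m ι U k h y f
  have h3 := sub_mem_localPoly hp h1
  obtain ⟨g, hg, hpg⟩ := exists_of_mem_localPoly h3
  have hK : IsCompact {z | dist (ι z) (ι y) ≤ h} := by
    refine IsClosed.isCompact (isClosed_le ?_ continuous_const)
    exact hι.isEmbedding.continuous.dist continuous_const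
  have hc : ContinuousOn (fun z => (p z - p' z) ^ 2) {z | dist (ι z) (ι y) ≤ h} := by
    have : ContinuousOn (fun z => g (U y z) ^ 2) {z | dist (ι z) (ι y) ≤ h} :=
      ((continuous_of_mem_polyFun hg).comp_continuousOn
        ((continuousOn_normalCoordinates hU le_rfl y).mono fun z hz => lt_of_le_of_lt hz hr)).pow 2
    exact this.congr fun z _ => by simp only [hpg]
  have hsub : nhd ι h y ⊆ {z | dist (ι z) (ι y) ≤ h} := fun z (hz : _ < h) => hz.le
  -- The difference of the two polynomials is an admissible test function. Its square integrates to
  -- zero, and open sets have positive volume, so it vanishes on `N_y`.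
  have h4 : ∫ z in nhd ι h y, (p z - p' z) ^ 2 ∂(vol m ι) = 0 := by
    rw [← h2 _ h3]
    refine setIntegral_congr_fun hO.measurableSet fun z hz => ?_
    simp only [hfp hz]; ring
  have h5 := (integral_eq_zero_iff_of_nonneg (fun z => sq_nonneg _)
    ((hc.integrableOn_compact hK).mono_set hsub)).1 h4
  have h6 := Measure.eqOn_open_of_ae_eq h5 hO (hc.mono hsub) continuousOn_const
  intro z hz
  have h7 : (p z - p' z) ^ 2 = 0 := h6 hz
  rw [hfp hz]
  exact sub_eq_zero.1 (pow_eq_zero_iff two_ne_zero |>.1 h7)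

variable {φ : M → Euc m} (hφ : IsIsometricChart ι φ) {a : Euc m} {c : ℝ} {f : M → ℝ}
  (hf : ∀ z, f z = c + inner ℝ a (φ z))
include hφ hf

/-- Along the geodesic from `y` to `z` the chart is affine, with initial velocity `U y z`. So `f` is
a polynomial of degree one on `N_y`, and both fits reproduce it. -/
lemma op_affine_chart_eq_zero {h : ℝ} (hr : h < r)
    (hgeo : ∀ y z : M, dist (ι y) (ι z) < h → ∃ γ : ℝ → M, IsGeodesic m ι γ ∧
      γ 0 = y ∧ γ 1 = z ∧ ‖initialVelocity ι γ‖ < r) (α : ℝ → ℝ) (x : M) :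
    opLTSA m ι U α h f x = 0 ∧ opHLLE m ι U α h f x = 0 := by
  have key : ∀ y k, 1 ≤ k → EqOn f (hat m ι U k h y f) (nhd ι h y) := by
    intro y k hk
    obtain ⟨Q, hQ⟩ := exists_isGood_patch hι hU.pos y
    refine eqOn_hat_of_eqOn_localPoly hι hU hr (affine_mem_localPoly hk (f y)
      ((innerSL ℝ a) ∘L fderivWithin ℝ (fun z => φ (Q.Ψ z)) Q.B 0 ∘L Q.Λ 0) y) fun z hz => ?_
    have hz' : dist (ι y) (ι z) < h := by rw [dist_comm]; exact hz
    obtain ⟨γ, hγ, rfl, rfl, hv⟩ := hgeo y z hz'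
    have h1 := Patch.chart_geodesic hι hφ hγ hQ hU.pos
    rw [hU.geodesic γ hγ hv, hf, hf, h1, inner_add_right]
    simp only [ContinuousLinearMap.comp_apply, innerSL_apply_apply]
    ring
  have h1 : ∀ y, localLTSA m ι U h y f x = 0 := fun y => by
    rw [localLTSA, indicator_apply_eq_zero]
    intro hx
    rw [← key y 1 le_rfl hx, sub_self]
  have h2 : ∀ y, localHLLE m ι U h y f x = 0 := fun y => by
    rw [localHLLE, indicator_apply_eq_zero]
    intro hx
    rw [← key y 1 le_rfl hx, ← key y 2 one_le_two hx, sub_self]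
  simp only [opLTSA, opHLLE, h1, h2, integral_zero, mul_zero, and_self]

lemma exists_local_affine_chart_le (x : M) : ∃ s ∈ 𝓝 x, ∃ C ≥ 0, ∃ h0 > 0, ∀ y ∈ s, ∀ h, 0 < h →
    h < h0 → (vol m ι).real (nhd ι h y) ≤ C * h ^ m ∧ ∀ q ∈ nhd ι h y, ∀ k ∈ ({1, 2} : Set ℕ),
      |f q - hat m ι U k h y f q| ≤ C * h ^ 5 := by
  obtain ⟨P, hG⟩ := exists_isGood_patch hι hU.pos x
  -- Order `4` makes the error `O(h ^ 5)`, one power better than the normalization of order `h ^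
  -- (-4)` requires.
  obtain ⟨C, hC, δ, hδ, hexp⟩ := Patch.exists_chart_expansion_le hι.contMDiff hG hφ hU 4
  have hfc : Continuous f := (contMDiff_affine_chart hφ hf).continuous
  have hk : ∀ k, 1 ≤ k → ∃ C' ≥ 0, ∃ ρ > 0, ∃ h0 > 0, ∀ y ∈ P.B, ‖y‖ < ρ → ∀ h, 0 < h → h < h0 →
      (vol m ι).real (nhd ι h (P.Ψ y)) ≤ C' * h ^ m ∧
      ∀ q ∈ nhd ι h (P.Ψ y), |f q - hat m ι U k h (P.Ψ y) f q| ≤ C' * h ^ 5 := by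
    intro k hk
    obtain ⟨κ, K, V, ρ, hρ, h0, hh0, h0r, hsys⟩ := Patch.exists_isFitSystem hι hG hU k hδ
    set A := ENNReal.toReal (2 ^ m * volume (Metric.closedBall (0 : Euc m) 2))
    set A' := (1 + Fintype.card (PolyIdx m k) * K * V / κ * K) * (‖a‖ * (C * 2 ^ 5))
    refine ⟨max A |A'|, (abs_nonneg _).trans (le_max_right _ _), min ρ δ, lt_min hρ hδ, h0, hh0,
      fun y hy hyρ h hh hhh => ?_⟩
    obtain ⟨hfs, hK, hn⟩ := hsys y hy (hyρ.trans_le (min_le_left _ _)) h hh hhh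
    constructor
    · have h1 := Patch.vol_nhd_le hι hG hh.le fun q hq => ⟨(hn q hq).1, (hn q hq).2.2.1⟩
      have hfin : 2 ^ m * volume (Metric.closedBall (0 : Euc m) 2) ≠ ⊤ :=
        ENNReal.mul_ne_top (by finiteness) measure_closedBall_lt_top.ne
      have h2 := ENNReal.toReal_mono (ENNReal.mul_ne_top ENNReal.ofReal_ne_top hfin) h1
      rw [ENNReal.toReal_mul, ENNReal.toReal_ofReal (by positivity)] at h2
      refine h2.trans ?_
      rw [mul_comm]
      exact mul_le_mul_of_nonneg_right (le_max_left _ _) (by positivity)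
    · intro q hq
      have h1 := Patch.abs_sub_hat_le hι.contMDiff hG hU hy hh (hhh.le.trans h0r) hfs hK
        hfc.continuousOn (affine_mem_localPoly hk (f (P.Ψ y))
          ((innerSL ℝ a) ∘L fderivWithin ℝ (fun z => φ (P.Ψ z)) P.B y ∘L P.Λ y) (P.Ψ y))
        (L := ‖a‖ * (C * 2 ^ 5) * h ^ 5) (fun q hq => ?_) hq
      · refine h1.trans ?_
        rw [← mul_assoc]
        exact mul_le_mul_of_nonneg_right ((le_abs_self _).trans (le_max_right _ _)) (by positivity)
      · obtain ⟨hq1, hq2, hq3, -⟩ := hn q hq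
        have h2 := hexp y hy _ (P.ξ_mem hq1) (hyρ.trans_le (min_le_right _ _)) hq2
        rw [P.Ψ_ξ hq1] at h2
        have h3 : f q - (f (P.Ψ y) + ((innerSL ℝ a) ∘L
            fderivWithin ℝ (fun z => φ (P.Ψ z)) P.B y ∘L P.Λ y) (U (P.Ψ y) q))
            = inner ℝ a (φ q - φ (P.Ψ y) - fderivWithin ℝ (fun z => φ (P.Ψ z)) P.B y
              (P.Λ y (U (P.Ψ y) q))) := by
          simp only [ContinuousLinearMap.comp_apply, innerSL_apply_apply, hf, inner_sub_right]
          ring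
        rw [h3]
        refine (abs_real_inner_le_norm _ _).trans ?_
        rw [mul_assoc]
        refine mul_le_mul_of_nonneg_left (h2.trans ?_) (norm_nonneg _)
        rw [mul_assoc, ← mul_pow]
        gcongr
  obtain ⟨C1, hC1, ρ1, hρ1, h1, hh1, H1⟩ := hk 1 le_rfl
  obtain ⟨C2, hC2, ρ2, hρ2, h2, hh2, H2⟩ := hk 2 one_le_two
  refine ⟨_, P.image_ball_mem_nhds (lt_min hρ1 hρ2), max C1 C2, hC1.trans (le_max_left _ _),
    min h1 h2, lt_min hh1 hh2, ?_⟩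
  rintro _ ⟨y, ⟨hy, hyρ⟩, rfl⟩ h hh hhh
  have e1 := H1 y hy (lt_of_lt_of_le hyρ (min_le_left _ _)) h hh (hhh.trans_le (min_le_left _ _))
  have e2 := H2 y hy (lt_of_lt_of_le hyρ (min_le_right _ _)) h hh (hhh.trans_le (min_le_right _ _))
  refine ⟨e1.1.trans (mul_le_mul_of_nonneg_right (le_max_left _ _) (by positivity)),
    fun q hq k hk => ?_⟩
  rcases hk with rfl | rfl
  · exact (e1.2 q hq).trans (mul_le_mul_of_nonneg_right (le_max_left _ _) (by positivity))
  · exact (e2.2 q hq).trans (mul_le_mul_of_nonneg_right (le_max_right _ _) (by positivity))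

lemma exists_affine_chart_le : ∃ C ≥ 0, ∃ h0 > 0, ∀ y : M, ∀ h, 0 < h →
    h < h0 → (vol m ι).real (nhd ι h y) ≤ C * h ^ m ∧ ∀ q ∈ nhd ι h y, ∀ k ∈ ({1, 2} : Set ℕ),
      |f q - hat m ι U k h y f q| ≤ C * h ^ 5 := by
  have := isCompact_univ (X := M) |>.induction_on
    (p := fun s => ∃ C ≥ 0, ∃ h0 > 0, ∀ y ∈ s, ∀ h, 0 < h →
    h < h0 → (vol m ι).real (nhd ι h y) ≤ C * h ^ m ∧ ∀ q ∈ nhd ι h y, ∀ k ∈ ({1, 2} : Set ℕ),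
      |f q - hat m ι U k h y f q| ≤ C * h ^ 5)
    ⟨0, le_rfl, 1, one_pos, fun y hy => absurd hy (Set.notMem_empty y)⟩
    (fun s t hst ⟨C, hC, h0, hh0, H⟩ => ⟨C, hC, h0, hh0, fun y hy => H y (hst hy)⟩)
    (fun s t ⟨C1, hC1, h1, hh1, H1⟩ ⟨C2, hC2, h2, hh2, H2⟩ => by
      refine ⟨max C1 C2, hC1.trans (le_max_left _ _), min h1 h2, lt_min hh1 hh2,
        fun y hy h hh hhh => ?_⟩
      rcases hy with hy | hy
      · obtain ⟨e1, e2⟩ := H1 y hy h hh (hhh.trans_le (min_le_left _ _))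
        exact ⟨e1.trans (mul_le_mul_of_nonneg_right (le_max_left _ _) (by positivity)),
          fun q hq k hk => (e2 q hq k hk).trans
            (mul_le_mul_of_nonneg_right (le_max_left _ _) (by positivity))⟩
      · obtain ⟨e1, e2⟩ := H2 y hy h hh (hhh.trans_le (min_le_right _ _))
        exact ⟨e1.trans (mul_le_mul_of_nonneg_right (le_max_right _ _) (by positivity)),
          fun q hq k hk => (e2 q hq k hk).trans
            (mul_le_mul_of_nonneg_right (le_max_right _ _) (by positivity))⟩)
    (fun x _ => by
      obtain ⟨s, hs, H⟩ := exists_local_affine_chart_le hι hU hφ hf x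
      exact ⟨s, mem_nhdsWithin_of_mem_nhds hs, H⟩)
  obtain ⟨C, hC, h0, hh0, H⟩ := this
  exact ⟨C, hC, h0, hh0, fun y => H y (mem_univ y)⟩

lemma tendstoUniformly_op_affine_chart {α : ℝ → ℝ} (hα : α =O[𝓝[>] 0] fun h : ℝ => h ^ (-4 : ℤ)) :
    TendstoUniformly (fun h x => opLTSA m ι U α h f x) (fun _ => 0) (𝓝[>] 0) ∧
    TendstoUniformly (fun h x => opHLLE m ι U α h f x) (fun _ => 0) (𝓝[>] 0) := by
  have := isFiniteMeasure_vol hι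
  obtain ⟨C, hC, h0, hh0, H⟩ := exists_affine_chart_le hι hU hφ hf
  obtain ⟨c', hc', hαc⟩ := hα.exists_pos
  rw [IsBigOWith] at hαc
  have hv := ballVol_one_pos m
  set v := ballVol m 1
  -- The powers `h ^ (-4)`, `h ^ (-m)`, `h ^ 5` and `h ^ m` combine to `h`. The factor `2` leaves
  -- room for HLLE, a difference of two residuals.
  have hbound : ∀ᶠ h in 𝓝[>] (0 : ℝ), ∀ I : ℝ, |I| ≤ 2 * C * h ^ 5 * (C * h ^ m) →
      |α h / ballVol m h * I| ≤ c' * (2 * C * C) / v * h := by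
    filter_upwards [hαc, self_mem_nhdsWithin] with h h1 hh I hI
    have hh' : 0 < h := hh
    rw [Real.norm_eq_abs, Real.norm_eq_abs, abs_of_pos (zpow_pos hh' _)] at h1
    rw [abs_mul, abs_div, ballVol_eq m hh', abs_of_pos (mul_pos (pow_pos hh' m) hv)]
    calc |α h| / (h ^ m * v) * |I|
        ≤ c' * h ^ (-4 : ℤ) / (h ^ m * v) * (2 * C * h ^ 5 * (C * h ^ m)) := by gcongr
      _ = c' * (2 * C * C) / v * h := by
        rw [zpow_neg]; norm_cast; field_simp
  have hlim : Tendsto (fun h : ℝ => c' * (2 * C * C) / v * h) (𝓝[>] 0) (𝓝 0) := by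
    have : Continuous fun h : ℝ => c' * (2 * C * C) / v * h := by fun_prop
    simpa using (this.tendsto 0).mono_left nhdsWithin_le_nhds
  have hh0' : ∀ᶠ h in 𝓝[>] (0 : ℝ), h < h0 := nhdsWithin_le_nhds (gt_mem_nhds hh0)
  have key : ∀ Q : ℝ → M → M → ℝ, (∀ h, 0 < h → h < h0 → ∀ y x, |Q h y x| ≤ 2 * C * h ^ 5) →
      (∀ h y x, x ∉ nhd ι h y → Q h y x = 0) →
      TendstoUniformly (fun h x => α h / ballVol m h * ∫ y, Q h y x ∂(vol m ι)) (fun _ => 0)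
        (𝓝[>] 0) := by
    intro Q h1 h2
    rw [Metric.tendstoUniformly_iff]
    intro ε hε
    filter_upwards [hbound, hlim.eventually (gt_mem_nhds hε), hh0', self_mem_nhdsWithin]
      with h e1 e2 e3 e4 x
    rw [dist_comm, Real.dist_0_eq_abs]
    refine (e1 _ ?_).trans_lt e2
    have hh : 0 < h := e4
    refine (abs_integral_nhd_le x (fun y => h1 h e4 e3 y x) fun y => h2 h y x).trans ?_
    exact mul_le_mul_of_nonneg_left (H x h e4 e3).1 (by positivity)
  constructor
  · refine key (fun h y x => localLTSA m ι U h y f x) (fun h hh hh' y x => ?_)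
      fun h y x hx => indicator_of_notMem hx _
    by_cases hx : x ∈ nhd ι h y
    · have := (H y h hh hh').2 x hx 1 (by simp)
      have h5 : 0 ≤ C * h ^ 5 := by positivity
      rw [localLTSA, indicator_of_mem hx]
      linarith
    · rw [localLTSA, indicator_of_notMem hx, abs_zero]; positivity
  · refine key (fun h y x => localHLLE m ι U h y f x) (fun h hh hh' y x => ?_)
      fun h y x hx => indicator_of_notMem hx _
    by_cases hx : x ∈ nhd ι h y
    · have h1 := (H y h hh hh').2 x hx 1 (by simp)
      have h2 := (H y h hh hh').2 x hx 2 (by simp)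
      rw [localHLLE, indicator_of_mem hx]
      rw [abs_le] at h1 h2 ⊢
      constructor <;> linarith
    · rw [localHLLE, indicator_of_notMem hx, abs_zero]; positivity

end AffineChart

/-! ### The zoom at a boundary point -/

namespace Patch

variable {m d : ℕ} [NeZero m] {M : Type*} [TopologicalSpace M]
  [ChartedSpace (EuclideanHalfSpace m) M] {ι : M → Euc d} {x : M} {r : ℝ} {U : M → M → Euc d}
  {P : Patch m ι x} [IsManifold (𝓡∂ m) ∞ M]

section Pointwise

variable (hι : ContMDiff (𝓡∂ m) 𝓘(ℝ, Euc d) ∞ ι) (hG : P.IsGood r)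
  (hU : IsNormalCoordinates m ι r U) (hB : ∀ z, z ∈ P.B ↔ 0 ≤ z 0 ∧ ‖z‖ < P.δ)

lemma eventually_norm_smul_lt {ρ : ℝ} (hρ : 0 < ρ) (z : Euc m) :
    ∀ᶠ h : ℝ in 𝓝[>] 0, ‖h • z‖ < ρ := by
  have : Continuous fun h : ℝ => ‖h • z‖ := by fun_prop
  refine ((this.tendsto 0).mono_left nhdsWithin_le_nhds).eventually (gt_mem_nhds ?_)
  simpa using hρ

include hB in
omit [IsManifold (𝓡∂ m) ∞ M] in
lemma eventually_smul_mem {z : Euc m} (hz : 0 ≤ z 0) : ∀ᶠ h : ℝ in 𝓝[>] 0, h • z ∈ P.B := by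
  filter_upwards [eventually_norm_smul_lt P.δ_pos z, self_mem_nhdsWithin] with h h1 h2
  refine (hB _).2 ⟨?_, h1⟩
  have : 0 < h := h2
  simp only [PiLp.smul_apply, smul_eq_mul]; positivity

lemma tendsto_of_norm_sub_le {E : Type*} [NormedAddCommGroup E] {g : ℝ → E} {a : E} {C : ℝ}
    (h : ∀ ε > 0, ∀ᶠ t in 𝓝[>] (0 : ℝ), ‖g t - a‖ ≤ ε * C) : Tendsto g (𝓝[>] 0) (𝓝 a) := by
  rw [tendsto_iff_norm_sub_tendsto_zero, Metric.tendsto_nhds]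
  intro ε hε
  have hC : 0 < |C| + 1 := by positivity
  filter_upwards [h (ε / (|C| + 1)) (by positivity)] with t ht
  rw [dist_zero_right, norm_norm]
  refine ht.trans_lt ?_
  rw [div_mul_eq_mul_div, div_lt_iff₀ hC]
  exact mul_lt_mul_of_pos_left ((le_abs_self C).trans_lt (lt_add_one _)) hε

include hι hB

lemma tendsto_inv_smul_sub {y z : Euc m} (hy : 0 ≤ y 0) (hz : 0 ≤ z 0) :
    Tendsto (fun h : ℝ => h⁻¹ • (P.F (h • z) - P.F (h • y))) (𝓝[>] 0) (𝓝 (P.J (z - y))) := by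
  refine tendsto_of_norm_sub_le (C := ‖z - y‖) fun ε hε => ?_
  obtain ⟨ρ, hρ, h1⟩ := P.exists_approx hι hε
  filter_upwards [eventually_norm_smul_lt hρ y, eventually_norm_smul_lt hρ z,
    eventually_smul_mem hB hy, eventually_smul_mem hB hz, self_mem_nhdsWithin] with h e1 e2 e3 e4 e5
  have hh : 0 < h := e5
  have h2 := h1 _ e3 _ e4 e1 e2
  have h3 : h⁻¹ • (P.F (h • z) - P.F (h • y)) - P.J (z - y)
      = h⁻¹ • (P.F (h • z) - P.F (h • y) - P.J (h • z - h • y)) := by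
    rw [← smul_sub h, map_smul, smul_sub h⁻¹ _ (h • _), inv_smul_smul₀ hh.ne']
  rw [h3, norm_smul, Real.norm_of_nonneg (by positivity)]
  rw [← smul_sub h, norm_smul, Real.norm_of_nonneg hh.le] at h2
  rw [inv_mul_le_iff₀ hh, ← smul_sub h]
  linarith

lemma tendsto_inv_mul_dist {y z : Euc m} (hy : 0 ≤ y 0) (hz : 0 ≤ z 0) :
    Tendsto (fun h : ℝ => h⁻¹ * dist (ι (P.Ψ (h • z))) (ι (P.Ψ (h • y)))) (𝓝[>] 0)
      (𝓝 ‖z - y‖) := by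
  have h1 := (tendsto_inv_smul_sub hι hB hy hz).norm
  rw [P.J.norm_map] at h1
  refine h1.congr' ?_
  filter_upwards [self_mem_nhdsWithin] with h hh
  have hh : 0 < h := hh
  rw [norm_smul, Real.norm_of_nonneg (by positivity), dist_eq_norm]
  rfl

/-- After rescaling, ambient distances become Euclidean, and `‖z - y‖` is compared with `1`. The
undecided case of equality is a null set. -/
lemma eventually_mem_nhd {y z : Euc m} (hy : 0 ≤ y 0) (hz : 0 ≤ z 0) (h1 : ‖z - y‖ < 1) :
    ∀ᶠ h : ℝ in 𝓝[>] 0, P.Ψ (h • z) ∈ nhd ι h (P.Ψ (h • y)) := by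
  filter_upwards [(tendsto_inv_mul_dist hι hB hy hz).eventually (gt_mem_nhds h1),
    self_mem_nhdsWithin] with h e1 e2
  have hh : 0 < h := e2
  rw [inv_mul_lt_iff₀ hh, mul_one] at e1
  exact e1

lemma eventually_notMem_nhd {y z : Euc m} (hy : 0 ≤ y 0) (hz : 0 ≤ z 0) (h1 : 1 < ‖z - y‖) :
    ∀ᶠ h : ℝ in 𝓝[>] 0, P.Ψ (h • z) ∉ nhd ι h (P.Ψ (h • y)) := by
  filter_upwards [(tendsto_inv_mul_dist hι hB hy hz).eventually (lt_mem_nhds h1),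
    self_mem_nhdsWithin] with h e1 e2
  have hh : 0 < h := e2
  rw [lt_inv_mul_iff₀ hh, mul_one] at e1
  exact not_lt.2 e1.le

include hG hU

lemma tendsto_inv_smul_w {y z : Euc m} (hy : 0 ≤ y 0) (hz : 0 ≤ z 0) :
    Tendsto (fun h : ℝ => h⁻¹ • P.w U (P.Ψ (h • y)) (P.Ψ (h • z))) (𝓝[>] 0) (𝓝 (z - y)) := by
  refine tendsto_of_norm_sub_le (C := ‖z - y‖) fun ε hε => ?_
  obtain ⟨ρ, hρ, h1⟩ := exists_w_approx hι hG hU hε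
  filter_upwards [eventually_norm_smul_lt hρ y, eventually_norm_smul_lt hρ z,
    eventually_smul_mem hB hy, eventually_smul_mem hB hz, self_mem_nhdsWithin] with h e1 e2 e3 e4 e5
  have hh : 0 < h := e5
  have h2 := h1 _ e3 _ e4 e1 e2
  have h3 : h⁻¹ • P.w U (P.Ψ (h • y)) (P.Ψ (h • z)) - (z - y)
      = h⁻¹ • (P.w U (P.Ψ (h • y)) (P.Ψ (h • z)) - (h • z - h • y)) := by
    rw [← smul_sub h, smul_sub h⁻¹ _ (h • _), inv_smul_smul₀ hh.ne']
  rw [h3, norm_smul, Real.norm_of_nonneg (by positivity)]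
  rw [← smul_sub h, norm_smul, Real.norm_of_nonneg hh.le] at h2
  rw [inv_mul_le_iff₀ hh, ← smul_sub h]
  linarith

end Pointwise

section Integrals

variable [CompactSpace M] [MeasurableSpace M] [BorelSpace M]
  (hι : Manifold.IsSmoothEmbedding (𝓡∂ m) 𝓘(ℝ, Euc d) ∞ ι) (hG : P.IsGood r)
  (hU : IsNormalCoordinates m ι r U) (hB : ∀ z, z ∈ P.B ↔ 0 ≤ z 0 ∧ ‖z‖ < P.δ)

lemma _root_.ManifoldLearning.ae_norm_sub_ne (y : Euc m) : ∀ᵐ z : Euc m, ‖z - y‖ ≠ 1 := by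
  have : Nontrivial (Euc m) := ⟨⟨coordVec 0, 0, fun h => by
    have := congrArg (fun v : Euc m => v 0) h
    simp [coordVec] at this⟩⟩
  have h := Measure.addHaar_sphere volume y 1
  rw [ae_iff]
  refine measure_mono_null (fun z hz => ?_) h
  simpa [dist_eq_norm] using hz

include hι hG hU hB

/-- Integrals over the neighborhood of a point near the boundary, rescaled, tend to integrals over
a cap. -/
lemma tendsto_integral_scaledVol {y : Euc m} (hy : 0 ≤ y 0) {G : Euc m → ℝ} (hGc : Continuous G) :
    Tendsto (fun h : ℝ => ∫ q, G (h⁻¹ • P.w U (P.Ψ (h • y)) q) ∂(scaledVol m ι h (P.Ψ (h • y))))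
      (𝓝[>] 0) (𝓝 (∫ u in cap m (y 0), G u)) := by
  classical
  obtain ⟨K, hK⟩ := (isCompact_closedBall (0 : Euc m) 4).exists_bound_of_continuousOn
    hGc.continuousOn
  have hK0 : 0 ≤ K := (norm_nonneg _).trans (hK 0 (by simp))
  obtain ⟨ρ, hρ, h0, hh0, h0r, hn⟩ := exists_norm_w_le hι hG hU P.δ_pos
  set Φ : ℝ → M → ℝ := fun h => (nhd ι h (P.Ψ (h • y))).indicator
    fun q => G (h⁻¹ • P.w U (P.Ψ (h • y)) q) with hΦ
  have hsmall : ∀ᶠ h : ℝ in 𝓝[>] 0, h < h0 := nhdsWithin_le_nhds (gt_mem_nhds hh0)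
  have hev := (eventually_norm_smul_lt hρ y).and ((eventually_smul_mem hB hy).and
    (hsmall.and self_mem_nhdsWithin))
  have hlim := tendsto_scaled_integral hι hB (Φ := Φ) (C := ‖y‖ + 2) (K := K)
    (Φ0 := fun z => (Metric.ball (0 : Euc m) 1).indicator G (z - y)) ?_ ?_ ?_ ?_
  -- Translation by `y` carries the part of the unit ball around `y` inside the half space to the
  -- cap of height `y 0`.
  · have e1 : ∫ z in halfSpace m, (Metric.ball (0 : Euc m) 1).indicator G (z - y)
        = ∫ u in cap m (y 0), G u := by
      have hmh : MeasurableSet (halfSpace m) :=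
        (isOpen_lt continuous_const (by fun_prop : Continuous fun z : Euc m => z 0)).measurableSet
      rw [← integral_indicator hmh, ← integral_indicator (isOpen_cap _).measurableSet,
        ← integral_sub_right_eq_self ((cap m (y 0)).indicator fun u => G u) y]
      refine integral_congr_ae (Eventually.of_forall fun z => ?_)
      have hiff : z - y ∈ cap m (y 0) ↔ z ∈ halfSpace m ∧ z - y ∈ Metric.ball (0 : Euc m) 1 := by
        simp only [cap, halfSpace, mem_ofPred_eq, PiLp.sub_apply, mem_ball_zero_iff]
        constructor
        · rintro ⟨h1, h2⟩; exact ⟨by linarith, h1⟩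
        · rintro ⟨h1, h2⟩; exact ⟨h2, by linarith⟩
      by_cases h : z - y ∈ cap m (y 0)
      · obtain ⟨h1, h2⟩ := hiff.1 h
        simp only [indicator_of_mem h, indicator_of_mem h1, indicator_of_mem h2]
      · by_cases h1 : z ∈ halfSpace m
        · have h2 := fun h2 => h (hiff.2 ⟨h1, h2⟩)
          simp only [indicator_of_notMem h, indicator_of_mem h1, indicator_of_notMem h2]
        · simp only [indicator_of_notMem h, indicator_of_notMem h1]
    rw [e1] at hlim
    refine hlim.congr' ?_
    filter_upwards [self_mem_nhdsWithin] with h hh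
    rw [integral_scaledVol hh, ← integral_indicator
      (isOpen_nhd hι.isEmbedding.continuous h _).measurableSet]
  · filter_upwards [hsmall] with h hh
    exact stronglyMeasurable_indicator_of_continuousOn
      (isOpen_nhd hι.isEmbedding.continuous h _).measurableSet
      (hGc.comp_continuousOn ((continuousOn_w hU (hh.le.trans h0r) _).const_smul h⁻¹))
  · filter_upwards [hev] with h ⟨h1, h2, h3, h4⟩ q
    have hh : 0 < h := h4
    by_cases hq : q ∈ nhd ι h (P.Ψ (h • y))
    · simp only [hΦ, indicator_of_mem hq]
      refine hK _ (mem_closedBall_zero_iff.2 ?_)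
      rw [norm_smul, Real.norm_of_nonneg (by positivity), inv_mul_le_iff₀ hh, mul_comm]
      exact (hn _ h2 h1 h h3 q hq).2.2.2
    · simp only [hΦ, indicator_of_notMem hq, abs_zero, hK0]
  · filter_upwards [hev] with h ⟨h1, h2, h3, h4⟩ q hq
    have hh : 0 < h := h4
    obtain ⟨e1, -, e2, -⟩ := hn _ h2 h1 h h3 q (mem_of_indicator_ne_zero hq)
    refine ⟨e1, ?_⟩
    have e3 := norm_add_le (P.ξ q - h • y) (h • y)
    rw [sub_add_cancel, norm_smul h y, Real.norm_of_nonneg hh.le] at e3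
    linarith
  · filter_upwards [ae_norm_sub_ne y] with z hz hz0
    rcases lt_or_gt_of_ne hz with h1 | h1
    · rw [indicator_of_mem (mem_ball_zero_iff.2 h1)]
      refine ((hGc.tendsto _).comp (tendsto_inv_smul_w hι.contMDiff hG hU hB hy hz0.le)).congr' ?_
      filter_upwards [eventually_mem_nhd hι.contMDiff hB hy hz0.le h1] with h hh
      simp only [hΦ, indicator_of_mem hh, Function.comp_apply]
    · rw [indicator_of_notMem (fun h => not_lt.2 h1.le (mem_ball_zero_iff.1 h))]
      refine tendsto_const_nhds.congr' ?_
      filter_upwards [eventually_notMem_nhd hι.contMDiff hB hy hz0.le h1] with h hh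
      simp only [hΦ, indicator_of_notMem hh]

/-- Gram matrices and moments on the neighborhoods tend to those of the cap, where the Gram matrix
is invertible. -/
lemma tendsto_fit {y z : Euc m} (hy : 0 ≤ y 0) (hz : 0 ≤ z 0) {G : Euc m → ℝ}
    (hGc : Continuous G) : Tendsto (fun h : ℝ => G (h⁻¹ • P.w U (P.Ψ (h • y)) (P.Ψ (h • z)))
      - ∑ i, fitCoeff (scaledVol m ι h (P.Ψ (h • y))) (P.scaledBasis U 1 h (P.Ψ (h • y)))
        (fun q => G (h⁻¹ • P.w U (P.Ψ (h • y)) q)) i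
        * P.scaledBasis U 1 h (P.Ψ (h • y)) i (P.Ψ (h • z)))
      (𝓝[>] 0) (𝓝 (G (z - y) - capFit (y 0) G (z - y))) := by
  have hw := tendsto_inv_smul_w hι.contMDiff hG hU hB hy hz
  obtain ⟨κ, K, V, hs⟩ := exists_isFitSystem_cap (m := m) 1
  have hb := fun i => continuous_polyBasis (m := m) (k := 1) i
  refine ((hGc.tendsto _).comp hw).sub (tendsto_finsetSum _ fun i _ => Tendsto.mul ?_
    (((hb i).tendsto _).comp hw))
  exact tendsto_fitCoeff (hs _ hy).isUnit_gram
    (fun i j => tendsto_integral_scaledVol hι hG hU hB hy ((hb i).mul (hb j)))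
    (fun i => tendsto_integral_scaledVol hι hG hU hB hy (hGc.mul (hb i))) i

end Integrals

end Patch

/-! ### Residuals of smooth functions near the boundary -/

namespace Patch

variable {m d : ℕ} [NeZero m] {M : Type*} [TopologicalSpace M]
  [ChartedSpace (EuclideanHalfSpace m) M] {ι : M → Euc d} {x : M} {r : ℝ} {U : M → M → Euc d}
  {P : Patch m ι x} [IsManifold (𝓡∂ m) ∞ M]
  (hι : Manifold.IsSmoothEmbedding (𝓡∂ m) 𝓘(ℝ, Euc d) ∞ ι) (hG : P.IsGood r)
  (hU : IsNormalCoordinates m ι r U) {f : M → ℝ} (hf : ContMDiff (𝓡∂ m) 𝓘(ℝ, ℝ) ∞ f)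

variable (P) in
/-- Half of the Hessian of a function at the base point. -/
def halfHess (f : M → ℝ) : Euc m →L[ℝ] Euc m →L[ℝ] ℝ :=
  (1 / 2 : ℝ) • P.Hess (fun z => f (P.Ψ z)) 0

include hι hG hf

lemma exists_Hess_approx {ε : ℝ} (hε : 0 < ε) : ∃ ρ > 0, ∀ y ∈ P.B, ‖y‖ < ρ →
    ‖P.Hess (fun z => f (P.Ψ z)) y - P.Hess (fun z => f (P.Ψ z)) 0‖ < ε := by
  have hc := (hG.contDiffOn_Hess hι.contMDiff (P.contDiffOn_comp hf)).continuousOn 0 P.zero_mem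
  obtain ⟨ρ, hρ, h⟩ := Metric.continuousWithinAt_iff.1 hc ε hε
  refine ⟨ρ, hρ, fun z hz hzρ => ?_⟩
  have := h hz (by simpa using hzρ)
  rwa [dist_eq_norm] at this

include hU

/-- Near the base point a smooth function is a quadratic function of the normal coordinates, with a
constant quadratic part, up to a small error. -/
lemma exists_expansion_localPoly {ε : ℝ} (hε : 0 < ε) : ∃ ρ > 0, ∃ h0 > 0, ∀ y ∈ P.B, ‖y‖ < ρ →
    ∀ h, 0 < h → h < h0 → ∃ p ∈ localPoly U 1 (P.Ψ y), ∀ q ∈ nhd ι h (P.Ψ y),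
      |f q - h ^ 2 * P.halfHess f (h⁻¹ • P.w U (P.Ψ y) q) (h⁻¹ • P.w U (P.Ψ y) q) - p q|
        ≤ ε * h ^ 2 := by
  set T := P.halfHess f with hT
  -- Half of `ε` pays for the cubic remainder. The other half pays for the variation of the Hessian,
  -- with weight `2`, and for replacing `z - y` by `w` in each slot of `T`, with weights `8 ‖T‖` and
  -- `4 ‖T‖`.
  obtain ⟨ε1, hε1, hε1e⟩ : ∃ ε1 > 0, (2 + 12 * ‖T‖) * ε1 = ε / 2 :=
    ⟨ε / (2 * (2 + 12 * ‖T‖)), by positivity, by field_simp⟩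
  obtain ⟨C, hC, δ1, hδ1, h1⟩ := exists_expansion_le hG hι.contMDiff hU (P.contDiffOn_comp hf)
  obtain ⟨δ2, hδ2, h2⟩ := exists_w_approx hι.contMDiff hG hU hε1
  obtain ⟨δ3, hδ3, h3⟩ := exists_Hess_approx hι hG hf hε1
  obtain ⟨ρ, hρ, h0, hh0, -, hn⟩ := exists_norm_w_le hι hG hU (lt_min hδ1 hδ2)
  refine ⟨min ρ (min δ1 (min δ2 δ3)), by positivity, min h0 (ε / (16 * C)), by positivity,
    fun y hy hyρ h hh hhh => ?_⟩
  have hyρ' := hyρ.trans_le (min_le_left _ _)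
  have hy' := hyρ.trans_le (min_le_right _ _)
  have hy1 := hy'.trans_le (min_le_left _ _)
  have hy23 := hy'.trans_le (min_le_right _ _)
  have hy2 := hy23.trans_le (min_le_left _ _)
  have hy3 := hy23.trans_le (min_le_right _ _)
  refine ⟨fun q => f (P.Ψ y) + (fderivWithin ℝ (fun z => f (P.Ψ z)) P.B y ∘L P.Λ y) (U (P.Ψ y) q),
    affine_mem_localPoly le_rfl _ _ _, fun q hq => ?_⟩
  obtain ⟨hq1, hq2, hq3, hq4⟩ := hn y hy hyρ' h (hhh.trans_le (min_le_left _ _)) q hq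
  set z := P.ξ q
  have hqz : q = P.Ψ z := (P.Ψ_ξ hq1).symm
  have hz := P.ξ_mem hq1
  have e1 := h1 y hy z hz hy1 (hq2.trans_le (min_le_left _ _))
  have e2 := h2 y hy z hz hy2 (hq2.trans_le (min_le_right _ _))
  have e3 := (h3 y hy hy3).le
  rw [← hqz] at e1 e2
  set w := P.w U (P.Ψ y) q
  set v := z - y
  have e4 : h ^ 2 * T (h⁻¹ • w) (h⁻¹ • w) = T w w := by
    rw [map_smul, map_smul, _root_.smul_apply, smul_eq_mul, smul_eq_mul]; field_simp
  rw [e4]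
  have e5 : f q - T w w - (f (P.Ψ y) + (fderivWithin ℝ (fun z => f (P.Ψ z)) P.B y ∘L P.Λ y)
      (U (P.Ψ y) q)) = (f q - f (P.Ψ y) - fderivWithin ℝ (fun z => f (P.Ψ z)) P.B y
        (P.Λ y (U (P.Ψ y) q)) - (1 / 2 : ℝ) • P.Hess (fun z => f (P.Ψ z)) y v v)
      + (1 / 2 : ℝ) * (P.Hess (fun z => f (P.Ψ z)) y - P.Hess (fun z => f (P.Ψ z)) 0) v v
      - (T (w - v) w + T v (w - v)) := by
    simp only [ContinuousLinearMap.comp_apply, hT, halfHess, _root_.smul_apply, _root_.sub_apply,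
      map_sub, smul_eq_mul]
    ring
  rw [e5]
  have b1 : C * ‖v‖ ^ 3 ≤ ε / 2 * h ^ 2 := by
    have hC2 : 16 * C * h ≤ ε := by
      have := (hhh.trans_le (min_le_right _ _)).le
      rwa [le_div_iff₀ (by positivity), mul_comm] at this
    calc C * ‖v‖ ^ 3 ≤ C * (2 * h) ^ 3 := by gcongr
      _ = (16 * C * h) / 2 * h ^ 2 := by ring
      _ ≤ ε / 2 * h ^ 2 := by gcongr
  have b2 : |(1 / 2 : ℝ) * (P.Hess (fun z => f (P.Ψ z)) y - P.Hess (fun z => f (P.Ψ z)) 0) v v|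
      ≤ 2 * ε1 * h ^ 2 := by
    have := ContinuousLinearMap.le_opNorm₂
      (P.Hess (fun z => f (P.Ψ z)) y - P.Hess (fun z => f (P.Ψ z)) 0) v v
    rw [Real.norm_eq_abs] at this
    rw [abs_mul, abs_of_pos (by norm_num : (0 : ℝ) < 1 / 2)]
    calc _ ≤ 1 / 2 * (ε1 * (2 * h) * (2 * h)) := by
          gcongr
          refine this.trans ?_
          gcongr
      _ = 2 * ε1 * h ^ 2 := by ring
  have hwv : ‖w - v‖ ≤ ε1 * (2 * h) := e2.trans (by gcongr)
  have b3 : |T (w - v) w| ≤ 8 * ‖T‖ * ε1 * h ^ 2 := by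
    have := ContinuousLinearMap.le_opNorm₂ T (w - v) w
    rw [Real.norm_eq_abs] at this
    calc _ ≤ ‖T‖ * ‖w - v‖ * ‖w‖ := this
      _ ≤ ‖T‖ * (ε1 * (2 * h)) * (4 * h) := by gcongr
      _ = _ := by ring
  have b4 : |T v (w - v)| ≤ 4 * ‖T‖ * ε1 * h ^ 2 := by
    have := ContinuousLinearMap.le_opNorm₂ T v (w - v)
    rw [Real.norm_eq_abs] at this
    calc _ ≤ ‖T‖ * ‖v‖ * ‖w - v‖ := this
      _ ≤ ‖T‖ * (2 * h) * (ε1 * (2 * h)) := by gcongr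
      _ = _ := by ring
  have b5 : ε * h ^ 2 = ε / 2 * h ^ 2 + 2 * ε1 * h ^ 2 + (8 * ‖T‖ * ε1 * h ^ 2
      + 4 * ‖T‖ * ε1 * h ^ 2) := by
    linear_combination (-h ^ 2) * hε1e
  rw [b5]
  refine (abs_sub _ _).trans (add_le_add ((abs_add_le _ _).trans (add_le_add ?_ b2))
    ((abs_add_le _ _).trans (add_le_add b3 b4)))
  exact e1.trans b1

variable [CompactSpace M] [MeasurableSpace M] [BorelSpace M]

omit hG hU hf [CompactSpace M] [IsManifold (𝓡∂ m) ∞ M] in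
lemma isBdd_scaledVol {h : ℝ} {y : M} {g : M → ℝ} {L : ℝ} (hg : ContinuousOn g (nhd ι h y))
    (hL : ∀ q ∈ nhd ι h y, |g q| ≤ L) : IsBdd (scaledVol m ι h y) g L := by
  have hO := isOpen_nhd hι.isEmbedding.continuous h y
  refine ⟨(hg.aestronglyMeasurable hO.measurableSet).mono_ac
    Measure.smul_absolutelyContinuous, Measure.ae_smul_measure ?_ _⟩
  filter_upwards [ae_restrict_mem hO.measurableSet] with q hq using hL q hq

omit hι hG hU [MeasurableSpace M] [BorelSpace M] [IsManifold (𝓡∂ m) ∞ M] in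
lemma exists_abs_le : ∃ L, ∀ q, |f q| ≤ L := by
  obtain ⟨L, hL⟩ := isCompact_univ.exists_bound_of_continuousOn hf.continuous.continuousOn
  exact ⟨L, fun q => hL q (mem_univ q)⟩

lemma exists_hat_eq (k : ℕ) : ∃ ρ > 0, ∃ h0 > 0, h0 ≤ r ∧ ∀ y ∈ P.B, ‖y‖ < ρ →
    ∀ h, 0 < h → h < h0 → ∀ q ∈ nhd ι h (P.Ψ y), hat m ι U k h (P.Ψ y) f q =
      ∑ i, fitCoeff (scaledVol m ι h (P.Ψ y)) (P.scaledBasis U k h (P.Ψ y)) f i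
        * P.scaledBasis U k h (P.Ψ y) i q := by
  obtain ⟨κ, K, V, ρ, hρ, h0, hh0, h0r, hsys⟩ := exists_isFitSystem hι hG hU k one_pos
  obtain ⟨L, hL⟩ := exists_abs_le hf
  refine ⟨ρ, hρ, h0, hh0, h0r, fun y hy hyρ h hh hhh q hq => ?_⟩
  exact hat_eq hι.contMDiff hG hU hy hh (hhh.le.trans h0r) (hsys y hy hyρ h hh hhh).1
    (isBdd_scaledVol hι hf.continuous.continuousOn fun q _ => hL q) hq

/-- Both fits reproduce the affine part. The affine fit leaves the residual of the quadratic form,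
while the quadratic fit absorbs the form as well; hence LTSA and HLLE share their leading term. -/
lemma exists_residual_approx {ε : ℝ} (hε : 0 < ε) : ∃ ρ > 0, ∃ h0 > 0, ∀ y ∈ P.B, ‖y‖ < ρ →
    ∀ h, 0 < h → h < h0 → ∀ q ∈ nhd ι h (P.Ψ y),
      |f q - hat m ι U 1 h (P.Ψ y) f q
        - h ^ 2 * (P.halfHess f (h⁻¹ • P.w U (P.Ψ y) q) (h⁻¹ • P.w U (P.Ψ y) q)
        - ∑ i, fitCoeff (scaledVol m ι h (P.Ψ y)) (P.scaledBasis U 1 h (P.Ψ y))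
          (fun q => P.halfHess f (h⁻¹ • P.w U (P.Ψ y) q) (h⁻¹ • P.w U (P.Ψ y) q)) i
          * P.scaledBasis U 1 h (P.Ψ y) i q)| ≤ ε * h ^ 2 ∧
      |f q - hat m ι U 2 h (P.Ψ y) f q| ≤ ε * h ^ 2 := by
  obtain ⟨κ, K, V, ρ1, hρ1, h1, hh1, h1r, hsys⟩ := exists_isFitSystem hι hG hU 1 one_pos
  obtain ⟨κ', K', V', ρ2, hρ2, h2, hh2, h2r, hsys'⟩ := exists_isFitSystem hι hG hU 2 one_pos
  set c1 := 1 + Fintype.card (PolyIdx m 1) * K * V / κ * K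
  set c2 := 1 + Fintype.card (PolyIdx m 2) * K' * V' / κ' * K'
  set c := max |c1| |c2| + 1
  have hc : 0 < c := by positivity
  have hc1 : c1 ≤ c := by
    have := (le_abs_self c1).trans (le_max_left |c1| |c2|); simp only [c]; linarith
  have hc2 : c2 ≤ c := by
    have := (le_abs_self c2).trans (le_max_right |c1| |c2|); simp only [c]; linarith
  obtain ⟨ρ3, hρ3, h3, hh3, hexp⟩ := exists_expansion_localPoly hι hG hU hf (div_pos hε hc)
  obtain ⟨L, hL⟩ := exists_abs_le hf
  refine ⟨min ρ1 (min ρ2 ρ3), by positivity, min h1 (min h2 h3), by positivity,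
    fun y hy hyρ h hh hhh q hq => ?_⟩
  have hyρ' := hyρ.trans_le (min_le_right _ _)
  have hhh' := hhh.trans_le (min_le_right _ _)
  have hhr : h ≤ r := (hhh.trans_le (min_le_left _ _)).le.trans h1r
  obtain ⟨hfs, hK, hn⟩ := hsys y hy (hyρ.trans_le (min_le_left _ _)) h hh
    (hhh.trans_le (min_le_left _ _))
  obtain ⟨hfs', hK', -⟩ := hsys' y hy (hyρ'.trans_le (min_le_left _ _)) h hh
    (hhh'.trans_le (min_le_left _ _))
  obtain ⟨p, hp, hpf⟩ := hexp y hy (hyρ'.trans_le (min_le_right _ _)) h hh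
    (hhh'.trans_le (min_le_right _ _))
  set T := P.halfHess f with hT
  have hGc : Continuous fun u => T u u := by fun_prop
  obtain ⟨LT, hLT⟩ := (isCompact_closedBall (0 : Euc m) 4).exists_bound_of_continuousOn
    hGc.continuousOn
  set g : M → ℝ := fun q => T (h⁻¹ • P.w U (P.Ψ y) q) (h⁻¹ • P.w U (P.Ψ y) q) with hg
  have hgc : ContinuousOn g (nhd ι h (P.Ψ y)) :=
    hGc.comp_continuousOn ((continuousOn_w hU hhr _).const_smul h⁻¹)
  have hgL : ∀ q ∈ nhd ι h (P.Ψ y), |g q| ≤ LT := fun q hq => by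
    refine hLT _ (mem_closedBall_zero_iff.2 ?_)
    rw [norm_smul, Real.norm_of_nonneg (by positivity), inv_mul_le_iff₀ hh, mul_comm]
    exact (hn q hq).2.2.2
  have hfc := hf.continuous.continuousOn (s := nhd ι h (P.Ψ y))
  have hgc2 : ContinuousOn (fun q => h ^ 2 * g q) (nhd ι h (P.Ψ y)) := continuousOn_const.mul hgc
  have hg2L : ∀ q ∈ nhd ι h (P.Ψ y), |h ^ 2 * g q| ≤ h ^ 2 * LT := fun q hq => by
    rw [abs_mul, abs_of_pos (by positivity : 0 < h ^ 2)]
    exact mul_le_mul_of_nonneg_left (hgL q hq) (by positivity)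
  have hfb := isBdd_scaledVol hι hfc fun q _ => hL q
  have hgb := isBdd_scaledVol hι hgc2 hg2L
  have hFb := hfb.sub hgb
  have hle : ∀ c' ≤ c, c' * (ε / c * h ^ 2) ≤ ε * h ^ 2 := fun c' hc' => by
    calc c' * (ε / c * h ^ 2) ≤ c * (ε / c * h ^ 2) := by gcongr
      _ = ε * h ^ 2 := by field_simp
  constructor
  · have e1 := abs_sub_hat_le (f := fun z => f z - h ^ 2 * g z) hι.contMDiff hG hU hy hh hhr hfs hK
      (hfc.sub hgc2) hp hpf hq
    refine le_trans (le_of_eq ?_) (e1.trans (hle _ hc1))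
    rw [hat_eq hι.contMDiff hG hU hy hh hhr hfs hFb hq,
      hat_eq hι.contMDiff hG hU hy hh hhr hfs hfb hq]
    have e2 := hfs.fitCoeff_add hFb hgb
    simp only [sub_add_cancel] at e2
    rw [fitCoeff_const_mul] at e2
    simp only [e2, Pi.add_apply, Pi.smul_apply, smul_eq_mul, add_mul, Finset.sum_add_distrib,
      mul_sub, Finset.mul_sum, mul_assoc]
    congr 1
    ring
  · have hp2 : (fun q => p q + h ^ 2 * g q) ∈ localPoly U 2 (P.Ψ y) :=
      add_mem_localPoly (localPoly_mono one_le_two _ hp) (polyFun_w_mem_localPoly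
        (f := fun u => h ^ 2 * T u u)
        (Submodule.smul_mem _ (h ^ 2) (bilinear_mem_polyFun T)) h⁻¹ _)
    exact (abs_sub_hat_le hι.contMDiff hG hU hy hh hhr hfs' hK' hfc hp2 (fun q hq => by
      rw [add_comm, ← sub_sub]; exact hpf q hq) hq).trans (hle _ hc2)

lemma exists_residual_le : ∃ A ≥ 0, ∃ ρ > 0, ∃ h0 > 0, ∀ y ∈ P.B, ‖y‖ < ρ →
    ∀ h, 0 < h → h < h0 → ∀ q ∈ nhd ι h (P.Ψ y),
      |f q - hat m ι U 1 h (P.Ψ y) f q| ≤ A * h ^ 2 := by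
  obtain ⟨κ, K, V, ρ1, hρ1, h1, hh1, h1r, hsys⟩ := exists_isFitSystem hι hG hU 1 one_pos
  obtain ⟨ρ3, hρ3, h3, hh3, hexp⟩ := exists_expansion_localPoly hι hG hU hf one_pos
  set T := P.halfHess f with hT
  set c1 := 1 + Fintype.card (PolyIdx m 1) * K * V / κ * K
  refine ⟨|c1| * (1 + ‖T‖ * 4 * 4), by positivity, min ρ1 ρ3, by positivity, min h1 h3,
    by positivity, fun y hy hyρ h hh hhh q hq => ?_⟩
  have hhr : h ≤ r := (hhh.trans_le (min_le_left _ _)).le.trans h1r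
  obtain ⟨hfs, hK, hn⟩ := hsys y hy (hyρ.trans_le (min_le_left _ _)) h hh
    (hhh.trans_le (min_le_left _ _))
  obtain ⟨p, hp, hpf⟩ := hexp y hy (hyρ.trans_le (min_le_right _ _)) h hh
    (hhh.trans_le (min_le_right _ _))
  have e1 := abs_sub_hat_le hι.contMDiff hG hU hy hh hhr hfs hK hf.continuous.continuousOn hp
    (L := (1 + ‖T‖ * 4 * 4) * h ^ 2) (fun q hq => ?_) hq
  · refine e1.trans ?_
    rw [mul_assoc |c1|]
    exact mul_le_mul_of_nonneg_right (le_abs_self c1) (by positivity)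
  · have e2 := hpf q hq
    have e3 : ‖h⁻¹ • P.w U (P.Ψ y) q‖ ≤ 4 := by
      rw [norm_smul, Real.norm_of_nonneg (by positivity), inv_mul_le_iff₀ hh, mul_comm]
      exact (hn q hq).2.2.2
    have e4 := ContinuousLinearMap.le_opNorm₂ T (h⁻¹ • P.w U (P.Ψ y) q) (h⁻¹ • P.w U (P.Ψ y) q)
    rw [Real.norm_eq_abs] at e4
    have e5 : |h ^ 2 * T (h⁻¹ • P.w U (P.Ψ y) q) (h⁻¹ • P.w U (P.Ψ y) q)|
        ≤ h ^ 2 * (‖T‖ * 4 * 4) := by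
      rw [abs_mul, abs_of_pos (by positivity : 0 < h ^ 2)]
      refine mul_le_mul_of_nonneg_left (e4.trans ?_) (by positivity)
      gcongr
    have e6 := abs_add_le (f q - h ^ 2 * T (h⁻¹ • P.w U (P.Ψ y) q) (h⁻¹ • P.w U (P.Ψ y) q) - p q)
      (h ^ 2 * T (h⁻¹ • P.w U (P.Ψ y) q) (h⁻¹ • P.w U (P.Ψ y) q))
    have e7 : f q - h ^ 2 * T (h⁻¹ • P.w U (P.Ψ y) q) (h⁻¹ • P.w U (P.Ψ y) q) - p q
      + h ^ 2 * T (h⁻¹ • P.w U (P.Ψ y) q) (h⁻¹ • P.w U (P.Ψ y) q) = f q - p q := by ring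
    rw [e7] at e6
    linarith

end Patch

/-! ### Limits at a boundary point -/

namespace Patch

variable {m d : ℕ} [NeZero m] {M : Type*} [TopologicalSpace M]
  [ChartedSpace (EuclideanHalfSpace m) M] {ι : M → Euc d} {x : M} {r : ℝ} {U : M → M → Euc d}
  {P : Patch m ι x} [IsManifold (𝓡∂ m) ∞ M]
  (hι : Manifold.IsSmoothEmbedding (𝓡∂ m) 𝓘(ℝ, Euc d) ∞ ι)

include hι in
/-- At a boundary point there are coordinates on a half ball, whose first coordinate direction is
the inward unit normal. -/
lemma exists_boundary_patch (hr : 0 < r) (hx : x ∈ (𝓡∂ m).boundary M) {η : Euc m}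
    (hη : IsInwardUnitNormal ι x η) : ∃ P : Patch m ι x, P.IsGood r ∧ P.L (coordVec 0) = η ∧
      ∀ z, z ∈ P.B ↔ 0 ≤ z 0 ∧ ‖z‖ < P.δ := by
  obtain ⟨hη0, hη1, hη2⟩ := hη
  have hinj := diffAt_injective hι x
  obtain ⟨P0, hP0⟩ := exists_patch hinj (u := diffAt ι x η) ⟨η, rfl⟩ hη1
  obtain ⟨P, hJ, -, hG⟩ := P0.exists_isGood hι.contMDiff hr
  have hL : P.L (coordVec 0) = η := hinj (by rw [P.diff_comp, hJ, hP0])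
  refine ⟨P, hG, hL, fun z => ?_⟩
  have hb : (extChartAt (𝓡∂ m) x x : Euc m) 0 = 0 := by
    have h : extChartAt (𝓡∂ m) x x ∈ frontier (range (𝓡∂ m)) := hx
    rw [frontier_range_modelWithCornersEuclideanHalfSpace] at h
    exact Eq.symm h
  -- Subtracting the multiple of `η` with the same first coordinate leaves a vector tangent to the
  -- boundary, hence orthogonal to `η`. As `L` is orthonormal at `x`, this computes `z 0`, and the
  -- half space becomes `0 ≤ z 0`.
  have hell : P.L z 0 = η 0 * z 0 := by
    have h1 := hη2 (P.L z - (P.L z 0 / η 0) • η) (by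
      simp only [PiLp.sub_apply, PiLp.smul_apply, smul_eq_mul]; field_simp; ring)
    rw [← hL, map_sub, map_smul, P.diff_comp, P.diff_comp, inner_sub_left, inner_smul_left,
      P.J.inner_map_map, P.J.inner_map_map, hL] at h1
    have h2 : inner ℝ z (coordVec 0) = z 0 := by
      rw [coordVec, EuclideanSpace.inner_single_right]; simp
    have h3 : inner ℝ (coordVec 0 : Euc m) (coordVec 0) = 1 := by
      rw [coordVec, EuclideanSpace.inner_single_right]; simp
    rw [h2, h3] at h1
    simp only [RCLike.conj_to_real] at h1
    field_simp at h1
    linarith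
  have haff : P.aff z 0 = η 0 * z 0 := by
    rw [← hell, P.aff_apply_zero, hb, zero_add]
    rfl
  change 0 ≤ P.aff z 0 ∧ ‖z‖ < P.δ ↔ _
  rw [haff, mul_nonneg_iff_of_pos_left hη0]

variable (hG : P.IsGood r) (hU : IsNormalCoordinates m ι r U)
  {f : M → ℝ} (hf : ContMDiff (𝓡∂ m) 𝓘(ℝ, ℝ) ∞ f)
  (hB : ∀ z, z ∈ P.B ↔ 0 ≤ z 0 ∧ ‖z‖ < P.δ)
  [CompactSpace M] [MeasurableSpace M] [BorelSpace M]

include hι hG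

lemma eventually_mem_nhd_base {ρ : ℝ} (hρ : 0 < ρ) : ∀ᶠ h : ℝ in 𝓝[>] 0, ∀ q, x ∈ nhd ι h q →
    ∃ y ∈ P.B, ‖y‖ < ρ ∧ ‖y‖ ≤ 2 * h ∧ P.Ψ y = q := by
  obtain ⟨ρ', hρ', h0, hh0, hn⟩ := exists_nhd_subset hι hG hρ
  filter_upwards [nhdsWithin_le_nhds (gt_mem_nhds hh0)] with h hh q hq
  have hq' : q ∈ nhd ι h (P.Ψ 0) := by
    have : dist (ι x) (ι q) < h := hq
    rw [P.Ψ_zero]; rwa [dist_comm] at this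
  obtain ⟨e1, e2, e3⟩ := hn 0 P.zero_mem (by simpa using hρ') h hh q hq'
  rw [sub_zero] at e3
  exact ⟨P.ξ q, P.ξ_mem e1, e2, e3, P.Ψ_ξ e1⟩

include hU hf

/-- `hat` is a pointwise choice; measurability in `y` holds because for small `h` it equals the Gram
formula wherever `x` lies in `N_y`. -/
lemma eventually_stronglyMeasurable_hat (k : ℕ) : ∀ᶠ h : ℝ in 𝓝[>] 0, StronglyMeasurable
    ({y | dist (ι x) (ι y) < h}.indicator fun y => hat m ι U k h y f x) := by
  obtain ⟨ρ, hρ, h0, hh0, h0r, H⟩ := exists_hat_eq hι hG hU hf k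
  filter_upwards [eventually_mem_nhd_base hι hG hρ, nhdsWithin_le_nhds (gt_mem_nhds hh0),
    self_mem_nhdsWithin] with h h1 h2 h3
  have := stronglyMeasurable_fit (P := P) (k := k) hι hU h3 (h2.le.trans h0r) hf.continuous x
  convert this using 1
  ext y
  by_cases hy : y ∈ {y | dist (ι x) (ι y) < h}
  · obtain ⟨z, hz, hzρ, -, rfl⟩ := h1 y hy
    rw [indicator_of_mem hy, indicator_of_mem hy, H z hz hzρ h h3 h2 x hy]
  · rw [indicator_of_notMem hy, indicator_of_notMem hy]

include hB

/-- Averages, over the points near a boundary point, of functions that are asymptotically given by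
the residuals of the local affine fits. -/
lemma tendsto_scaled_of_residual {R : ℝ → M → ℝ}
    (hm : ∀ᶠ h in 𝓝[>] (0 : ℝ), StronglyMeasurable (R h))
    (hR0 : ∀ h y, x ∉ nhd ι h y → R h y = 0)
    (hA : ∃ A ≥ 0, ∃ ρ > 0, ∃ h0 > 0, ∀ y ∈ P.B, ‖y‖ < ρ → ∀ h, 0 < h → h < h0 →
      x ∈ nhd ι h (P.Ψ y) → |R h (P.Ψ y)| ≤ A * h ^ 2)
    (happ : ∀ ε > 0, ∃ ρ > 0, ∃ h0 > 0, ∀ y ∈ P.B, ‖y‖ < ρ → ∀ h, 0 < h → h < h0 →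
      x ∈ nhd ι h (P.Ψ y) → |R h (P.Ψ y)
        - h ^ 2 * (P.halfHess f (h⁻¹ • P.w U (P.Ψ y) x) (h⁻¹ • P.w U (P.Ψ y) x)
        - ∑ i, fitCoeff (scaledVol m ι h (P.Ψ y)) (P.scaledBasis U 1 h (P.Ψ y))
          (fun q => P.halfHess f (h⁻¹ • P.w U (P.Ψ y) q) (h⁻¹ • P.w U (P.Ψ y) q)) i
          * P.scaledBasis U 1 h (P.Ψ y) i x)| ≤ ε * h ^ 2) :
    Tendsto (fun h => (h ^ m)⁻¹ * ∫ y, (h ^ 2)⁻¹ * R h y ∂(vol m ι)) (𝓝[>] 0)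
      (𝓝 (capIntegral fun u => P.halfHess f u u)) := by
  obtain ⟨A, hA0, ρ, hρ, h0, hh0, hA⟩ := hA
  set T := P.halfHess f
  have hT : Continuous fun u => T u u := by fun_prop
  have hmh : MeasurableSet (halfSpace m) :=
    (isOpen_lt continuous_const (by fun_prop : Continuous fun z : Euc m => z 0)).measurableSet
  have e1 : ∫ z in halfSpace m, (Metric.ball (0 : Euc m) 1).indicator
      (fun z => T (-z) (-z) - capFit (z 0) (fun u => T u u) (-z)) z
      = capIntegral fun u => T u u := by
    rw [setIntegral_indicator Metric.isOpen_ball.measurableSet, capIntegral]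
    congr 2
    ext z
    simp only [halfSpace, cap, mem_inter_iff, mem_ofPred_eq, mem_ball_zero_iff, neg_zero]
    exact and_comm
  rw [← e1]
  refine tendsto_scaled_integral hι hB (C := 2) (K := A) ?_ ?_ ?_ ?_
  · filter_upwards [hm] with h hh using hh.const_mul _
  · filter_upwards [eventually_mem_nhd_base hι hG hρ, nhdsWithin_le_nhds (gt_mem_nhds hh0),
      self_mem_nhdsWithin] with h h1 h2 h3 q
    have hh : 0 < h := h3
    by_cases hq : x ∈ nhd ι h q
    · obtain ⟨y, hy, hyρ, -, rfl⟩ := h1 q hq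
      rw [abs_mul, abs_of_pos (by positivity), inv_mul_le_iff₀ (by positivity), mul_comm]
      exact hA y hy hyρ h hh h2 hq
    · rw [hR0 h q hq, mul_zero, abs_zero]; exact hA0
  · filter_upwards [eventually_mem_nhd_base hι hG hρ] with h h1 q hq
    obtain ⟨y, hy, -, hyh, rfl⟩ := h1 q (by
      by_contra hq'
      exact hq (by rw [hR0 h q hq', mul_zero]))
    exact ⟨⟨y, hy, rfl⟩, by rwa [P.ξ_Ψ hy]⟩
  · filter_upwards [ae_norm_sub_ne (0 : Euc m)] with z hz hz0
    rw [sub_zero] at hz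
    rcases lt_or_gt_of_ne hz with h1 | h1
    · rw [indicator_of_mem (mem_ball_zero_iff.2 h1)]
      -- The residual is evaluated at `x`, which in the cap around `y = h z` sits at `-z`.
      have h2 := tendsto_fit hι hG hU hB hz0.le (z := 0) (by simp) hT
      have h3 := eventually_mem_nhd (z := 0) hι.contMDiff hB hz0.le (by simp) (by simpa using h1)
      simp only [smul_zero, P.Ψ_zero, zero_sub] at h2 h3
      have h4 : Tendsto (fun h : ℝ => (h ^ 2)⁻¹ * R h (P.Ψ (h • z))
          - (T (h⁻¹ • P.w U (P.Ψ (h • z)) x) (h⁻¹ • P.w U (P.Ψ (h • z)) x)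
        - ∑ i, fitCoeff (scaledVol m ι h (P.Ψ (h • z))) (P.scaledBasis U 1 h (P.Ψ (h • z)))
          (fun q => T (h⁻¹ • P.w U (P.Ψ (h • z)) q) (h⁻¹ • P.w U (P.Ψ (h • z)) q)) i
          * P.scaledBasis U 1 h (P.Ψ (h • z)) i x)) (𝓝[>] 0) (𝓝 0) := by
        refine tendsto_of_norm_sub_le (C := 1) fun ε hε => ?_
        obtain ⟨ρ', hρ', h0', hh0', H⟩ := happ ε hε
        filter_upwards [eventually_norm_smul_lt hρ' z, eventually_smul_mem hB hz0.le, h3,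
          nhdsWithin_le_nhds (gt_mem_nhds hh0'), self_mem_nhdsWithin] with h e2 e3 e4 e5 e6
        have hh : 0 < h := e6
        have e7 := H _ e3 e2 h hh e5 e4
        rw [sub_zero, Real.norm_eq_abs, mul_one]
        rw [← mul_le_mul_iff_left₀ (by positivity : 0 < h ^ 2)]
        refine le_trans (le_of_eq ?_) e7
        have e8 : ∀ X : ℝ, |X| * h ^ 2 = |X * h ^ 2| := fun X => by
          rw [abs_mul, abs_of_pos (by positivity : 0 < h ^ 2)]
        rw [e8]
        rw [sub_mul, mul_right_comm, inv_mul_cancel₀ (by positivity), one_mul]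
        exact congrArg (fun t => |R h (P.Ψ (h • z)) - t|) (mul_comm _ _)
      have h5 := h4.add h2
      simp only [sub_add_cancel, zero_add] at h5
      exact h5
    · rw [indicator_of_notMem (fun h => not_lt.2 h1.le (mem_ball_zero_iff.1 h))]
      have h3 := eventually_notMem_nhd (z := 0) hι.contMDiff hB hz0.le (by simp)
        (by simpa using h1)
      simp only [smul_zero, P.Ψ_zero] at h3
      refine tendsto_const_nhds.congr' ?_
      filter_upwards [h3] with h hh
      rw [hR0 _ _ hh, mul_zero]

lemma tendsto_scaled_localLTSA :
    Tendsto (fun h => (h ^ m)⁻¹ * ∫ y, (h ^ 2)⁻¹ * localLTSA m ι U h y f x ∂(vol m ι)) (𝓝[>] 0)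
      (𝓝 (capIntegral fun u => P.halfHess f u u)) := by
  refine tendsto_scaled_of_residual hι hG hU hf hB ?_ (fun h y hy => indicator_of_notMem hy _) ?_ ?_
  · filter_upwards [eventually_stronglyMeasurable_hat hι hG hU hf 1] with h hh
    have hO : IsOpen {y | dist (ι x) (ι y) < h} := by
      have := hι.isEmbedding.continuous
      exact isOpen_lt (by fun_prop) continuous_const
    have h1 : StronglyMeasurable ({y | dist (ι x) (ι y) < h}.indicator fun _ => f x) :=
      stronglyMeasurable_const.indicator hO.measurableSet
    convert h1.sub hh using 1
    ext y
    by_cases hy : y ∈ {y | dist (ι x) (ι y) < h}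
    · rw [Pi.sub_apply, indicator_of_mem hy, indicator_of_mem hy]
      exact indicator_of_mem (s := nhd ι h y) hy _
    · rw [Pi.sub_apply, indicator_of_notMem hy, indicator_of_notMem hy, sub_zero]
      exact indicator_of_notMem (s := nhd ι h y) hy _
  · obtain ⟨A, hA, ρ, hρ, h0, hh0, H⟩ := exists_residual_le hι hG hU hf
    refine ⟨A, hA, ρ, hρ, h0, hh0, fun y hy hyρ h hh hhh hx => ?_⟩
    rw [localLTSA, indicator_of_mem hx]
    exact H y hy hyρ h hh hhh x hx
  · intro ε hε
    obtain ⟨ρ, hρ, h0, hh0, H⟩ := exists_residual_approx hι hG hU hf hε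
    refine ⟨ρ, hρ, h0, hh0, fun y hy hyρ h hh hhh hx => ?_⟩
    rw [localLTSA, indicator_of_mem hx]
    exact (H y hy hyρ h hh hhh x hx).1

/-- The quadratic fit differs from `f` by `o(h ^ 2)`, so replacing `f` by it in the LTSA residual
does not change the limit. -/
lemma tendsto_scaled_localHLLE :
    Tendsto (fun h => (h ^ m)⁻¹ * ∫ y, (h ^ 2)⁻¹ * localHLLE m ι U h y f x ∂(vol m ι)) (𝓝[>] 0)
      (𝓝 (capIntegral fun u => P.halfHess f u u)) := by
  refine tendsto_scaled_of_residual hι hG hU hf hB ?_ (fun h y hy => indicator_of_notMem hy _) ?_ ?_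
  · filter_upwards [eventually_stronglyMeasurable_hat hι hG hU hf 1,
      eventually_stronglyMeasurable_hat hι hG hU hf 2] with h h1 h2
    convert h2.sub h1 using 1
    ext y
    by_cases hy : y ∈ {y | dist (ι x) (ι y) < h}
    · rw [Pi.sub_apply, indicator_of_mem hy, indicator_of_mem hy]
      exact indicator_of_mem (s := nhd ι h y) hy _
    · rw [Pi.sub_apply, indicator_of_notMem hy, indicator_of_notMem hy, sub_zero]
      exact indicator_of_notMem (s := nhd ι h y) hy _
  · obtain ⟨A, hA, ρ, hρ, h0, hh0, H⟩ := exists_residual_le hι hG hU hf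
    obtain ⟨ρ', hρ', h0', hh0', H'⟩ := exists_residual_approx hι hG hU hf one_pos
    refine ⟨A + 1, by positivity, min ρ ρ', lt_min hρ hρ', min h0 h0', lt_min hh0 hh0',
      fun y hy hyρ h hh hhh hx => ?_⟩
    have e1 := H y hy (hyρ.trans_le (min_le_left _ _)) h hh (hhh.trans_le (min_le_left _ _)) x hx
    have e2 := (H' y hy (hyρ.trans_le (min_le_right _ _)) h hh (hhh.trans_le (min_le_right _ _))
      x hx).2
    rw [localHLLE, indicator_of_mem hx]
    rw [abs_le] at e1 e2 ⊢
    constructor <;> linarith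
  · intro ε hε
    obtain ⟨ρ, hρ, h0, hh0, H⟩ := exists_residual_approx hι hG hU hf (half_pos hε)
    refine ⟨ρ, hρ, h0, hh0, fun y hy hyρ h hh hhh hx => ?_⟩
    rw [localHLLE, indicator_of_mem hx]
    obtain ⟨e1, e2⟩ := H y hy hyρ h hh hhh x hx
    rw [abs_le] at e1 e2 ⊢
    constructor <;> linarith

omit hι hG hU hB [MeasurableSpace M] [BorelSpace M] [CompactSpace M] in
-- The factor in `capIntegral_bilinear` is a nonzero multiple of the defect in the boundary
-- condition, and the other factor is positive.
lemma capIntegral_halfHess_ne_zero (hιc : ContMDiff (𝓡∂ m) 𝓘(ℝ, Euc d) ∞ ι) {η : Euc m}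
    (hη : P.L (coordVec 0) = η)
    (hne : secondDeriv ι f x η ≠ 1 / ((m : ℝ) + 2) * laplaceBeltrami m ι f x) :
    capIntegral (fun u => P.halfHess f u u) ≠ 0 := by
  rw [← hη, P.secondDeriv_eq hιc hf, P.laplaceBeltrami_eq hιc hf] at hne
  rw [capIntegral_bilinear]
  refine mul_ne_zero (div_ne_zero (fun h0 => hne ?_) (by positivity)) capIntegral_sq_zero_pos.ne'
  simp only [halfHess, _root_.smul_apply, smul_eq_mul, ← Finset.mul_sum] at h0
  have : (m : ℝ) + 2 ≠ 0 := by positivity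
  field_simp
  linarith

end Patch

/-! ### Blow-up of the operators -/

section Blowup

variable {m : ℕ} [NeZero m]

omit [NeZero m] in
-- `J` has size `|c| h ^ (m + 2)`, and `α / ballVol` is at least a constant times `h ^ (-4 - m)`, so
-- the product dominates a positive multiple of `h ^ (-2)`.
lemma tendsto_abs_mul_atTop {α J : ℝ → ℝ} {c : ℝ} (hc : c ≠ 0)
    (hα : (fun h : ℝ => h ^ (-4 : ℤ)) =O[𝓝[>] 0] α)
    (hJ : Tendsto (fun h => (h ^ m)⁻¹ * ((h ^ 2)⁻¹ * J h)) (𝓝[>] 0) (𝓝 c)) :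
    Tendsto (fun h => |α h / ballVol m h * J h|) (𝓝[>] 0) atTop := by
  obtain ⟨K, hK, hα⟩ := hα.exists_pos
  rw [IsBigOWith] at hα
  have hv := ballVol_one_pos m
  have h1 : Tendsto (fun h : ℝ => (h ^ 2)⁻¹) (𝓝[>] 0) atTop :=
    (tendsto_inv_nhdsGT_zero (𝕜 := ℝ)).comp (tendsto_nhdsWithin_iff.2
      ⟨by simpa using ((continuous_pow 2).tendsto (0 : ℝ)).mono_left nhdsWithin_le_nhds, by
        filter_upwards [self_mem_nhdsWithin] with h hh
        exact pow_pos (show 0 < h from hh) 2⟩)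
  have h2 := (h1.atTop_mul_pos (abs_pos.2 hc) hJ.abs).const_mul_atTop
    (by positivity : 0 < (K * ballVol m 1)⁻¹)
  refine tendsto_atTop_mono' _ ?_ h2
  filter_upwards [hα, self_mem_nhdsWithin] with h e1 e2
  have hh : 0 < h := e2
  rw [Real.norm_eq_abs, Real.norm_eq_abs, abs_of_pos (zpow_pos hh _), zpow_neg] at e1
  rw [ballVol_eq m hh, abs_mul, abs_mul, abs_mul, abs_div,
    abs_of_pos (by positivity : 0 < (h ^ m)⁻¹), abs_of_pos (by positivity : 0 < (h ^ 2)⁻¹),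
    abs_of_pos (by positivity : 0 < h ^ m * ballVol m 1)]
  have e3 : (h ^ 4)⁻¹ ≤ K * |α h| := by exact_mod_cast e1
  calc (K * ballVol m 1)⁻¹ * ((h ^ 2)⁻¹ * ((h ^ m)⁻¹ * ((h ^ 2)⁻¹ * |J h|)))
      = (K * ballVol m 1)⁻¹ * (h ^ m)⁻¹ * |J h| * (h ^ 4)⁻¹ := by field_simp
    _ ≤ (K * ballVol m 1)⁻¹ * (h ^ m)⁻¹ * |J h| * (K * |α h|) := by gcongr
    _ = |α h| / (h ^ m * ballVol m 1) * |J h| := by field_simp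

variable {d : ℕ} {M : Type*} [TopologicalSpace M]
  [ChartedSpace (EuclideanHalfSpace m) M] {ι : M → Euc d} {x : M} {r : ℝ} {U : M → M → Euc d}
  [IsManifold (𝓡∂ m) ∞ M] [CompactSpace M] [MeasurableSpace M] [BorelSpace M]

/-- The operators blow up at the boundary points where the boundary condition fails. -/
lemma tendsto_abs_op_atTop (hι : Manifold.IsSmoothEmbedding (𝓡∂ m) 𝓘(ℝ, Euc d) ∞ ι)
    (hU : IsNormalCoordinates m ι r U) {α : ℝ → ℝ}
    (hα : (fun h : ℝ => h ^ (-4 : ℤ)) =O[𝓝[>] 0] α) (hx : x ∈ (𝓡∂ m).boundary M) {η : Euc m}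
    (hη : IsInwardUnitNormal ι x η) {f : M → ℝ} (hf : ContMDiff (𝓡∂ m) 𝓘(ℝ, ℝ) ∞ f)
    (hne : secondDeriv ι f x η ≠ 1 / ((m : ℝ) + 2) * laplaceBeltrami m ι f x) :
    Tendsto (fun h => |opLTSA m ι U α h f x|) (𝓝[>] 0) atTop ∧
      Tendsto (fun h => |opHLLE m ι U α h f x|) (𝓝[>] 0) atTop := by
  obtain ⟨P, hG, hL, hB⟩ := Patch.exists_boundary_patch hι hU.pos hx hη
  have hc := Patch.capIntegral_halfHess_ne_zero hf hι.contMDiff hL hne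
  have h1 := Patch.tendsto_scaled_localLTSA hι hG hU hf hB
  have h2 := Patch.tendsto_scaled_localHLLE hι hG hU hf hB
  simp only [integral_const_mul] at h1 h2
  exact ⟨tendsto_abs_mul_atTop hc hα h1, tendsto_abs_mul_atTop hc hα h2⟩

end Blowup

end ManifoldLearning

end

theorem theorem4 {m d : ℕ} [NeZero m] {M : Type*} [TopologicalSpace M]
    [ChartedSpace (EuclideanHalfSpace m) M] [IsManifold (𝓡∂ m) ∞ M] [CompactSpace M]
    [MeasurableSpace M] [BorelSpace M]
    (ι : M → EuclideanSpace ℝ (Fin d))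
    (hι : Manifold.IsSmoothEmbedding (𝓡∂ m) 𝓘(ℝ, EuclideanSpace ℝ (Fin d)) ∞ ι)
    (r : ℝ) (U : M → M → EuclideanSpace ℝ (Fin d))
    (hU : ManifoldLearning.IsNormalCoordinates m ι r U)
    (α : ℝ → ℝ) (hα : α =Θ[𝓝[>] 0] fun h : ℝ => h ^ (-4 : ℤ)) :
    (∀ x ∈ (𝓡∂ m).boundary M, ∀ η : EuclideanSpace ℝ (Fin m),
      ManifoldLearning.IsInwardUnitNormal ι x η →
      ∀ f : M → ℝ, ContMDiff (𝓡∂ m) 𝓘(ℝ, ℝ) ∞ f →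
        ManifoldLearning.secondDeriv ι f x η
          ≠ 1 / ((m : ℝ) + 2) * ManifoldLearning.laplaceBeltrami m ι f x →
        Tendsto (fun h => |ManifoldLearning.opLTSA m ι U α h f x|) (𝓝[>] 0) atTop ∧
        Tendsto (fun h => |ManifoldLearning.opHLLE m ι U α h f x|) (𝓝[>] 0) atTop) ∧
    (∀ φ : M → EuclideanSpace ℝ (Fin m), ManifoldLearning.IsIsometricChart ι φ →
      ∀ (a : EuclideanSpace ℝ (Fin m)) (c : ℝ) (f : M → ℝ), (∀ z, f z = c + inner ℝ a (φ z)) →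
        (∀ x ∈ (𝓡∂ m).boundary M, ∀ η : EuclideanSpace ℝ (Fin m),
          ManifoldLearning.IsInwardUnitNormal ι x η →
          ManifoldLearning.secondDeriv ι f x η
            = 1 / ((m : ℝ) + 2) * ManifoldLearning.laplaceBeltrami m ι f x) ∧
        TendstoUniformly (fun h x => ManifoldLearning.opLTSA m ι U α h f x) (fun _ => 0)
          (𝓝[>] 0) ∧
        TendstoUniformly (fun h x => ManifoldLearning.opHLLE m ι U α h f x) (fun _ => 0)
          (𝓝[>] 0) ∧
        ∀ h : ℝ, 0 < h → h < r →
          (∀ y z : M, dist (ι y) (ι z) < h → ∃ γ : ℝ → M, ManifoldLearning.IsGeodesic m ι γ ∧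
            γ 0 = y ∧ γ 1 = z ∧ ‖ManifoldLearning.initialVelocity ι γ‖ < r) →
          ∀ x, ManifoldLearning.opLTSA m ι U α h f x = 0 ∧
            ManifoldLearning.opHLLE m ι U α h f x = 0) := by
  refine ⟨fun x hx η hη f hf hne => ManifoldLearning.tendsto_abs_op_atTop hι hU hα.2 hx hη hf hne,
    fun φ hφ a c f hf => ?_⟩
  have hunif := ManifoldLearning.tendstoUniformly_op_affine_chart hι hU hφ hf hα.1
  refine ⟨fun x _ η _ => ?_, hunif.1, hunif.2, fun h _ hr hgeo x =>
    ManifoldLearning.op_affine_chart_eq_zero hι hU hφ hf hr hgeo α x⟩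
  rw [ManifoldLearning.Patch.secondDeriv_affine_chart hι hφ hf hU.pos,
    ManifoldLearning.Patch.laplaceBeltrami_affine_chart hι hφ hf hU.pos, mul_zero]
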